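/- **Effect structures.** A *partial commutative monoid* is a set $M$ with $0\in M$ and a partial binary operation $\oplus$ which, in the sense of Kleene equality, is commutative and associative and satisfies $x\oplus 0=x$. An *effect algebra* is a partial commutative monoid with a total map $(-)^\bot$ such that $x\oplus y=0^\bot$ iff $y=x^\bot$, and $x=0$ whenever $x\oplus 0^\bot$ is defined; put $1=0^\bot$, and $x\le y$ iff $x\oplus z=y$ for some $z$. An *effect monoid* is an effect algebra $E$ with an associative multiplication with unit $1$ such that, whenever $x\oplus y$ is defined, $(x\oplus y)z=xz\oplus yz$ and $z(x\oplus y)=zx\oplus zy$. An *effect module* over $E$ is an effect algebra $A$ with $\cdot:E\times A\to A$ that distributes in the same sense over $\oplus$ in both arguments, with $(rs)\cdot x=r\cdot(s\cdot x)$ and $1\cdot x=x$. Homomorphisms preserve existing sums, $(-)^\bot$ and scalar multiplication; this gives the category $\mathbf{EMod}_E$. $\mathcal D_E$ is the distribution monad, $\mathcal D_EX=\{\varphi:X\to E \text{ of finite support with } \sum_x\varphi(x)=1\}$, and $\mathbf{Conv}_E$ (convex sets and affine maps) is its category of Eilenberg–Moore algebras. **Triangles.** A *state-and-effect triangle* consists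 of: a symmetric monoidal category $\mathcal V$ with binary coproducts that distribute over $\otimes$ and with terminal tensor unit $I$; a commutative effect monoid $E$; a functor $P:\mathcal V\to\mathbf{EMod}_E^{\mathrm{op}}$ that preserves finite coproducts and the terminal object; a (lax) symmetric monoidal functor $S:\mathcal V\to\mathbf{Conv}_E$; natural transformations $\alpha:P\to\mathbf{Conv}_E[S-,E]$ and $\beta:S\to\mathbf{EMod}_E[P-,E]$ with $\alpha_A(p)(x)=\beta_A(x)(p)$; and, for $n\ge1$ and $r_1,\dots,r_n\in PA$ with $r_1\oplus\dots\oplus r_n=1$, an arrow $\operatorname{meas}_A(r_1,\dots,r_n):A\to n\cdot I$, such that, with $\kappa_i$ the coprojections, 1. $\operatorname{meas}_A(r_{p(1)},\dots,r_{p(n)})=\pi_p\circ\operatorname{meas}_A(r_1,\dots,r_n)$ for every permutation $p$, where $\pi_p\circ\kappa_{p(i)}=\kappa_i$; 2. $\operatorname{meas}_A(r_1,\dots,r_n,0)=\kappa_1\circ\operatorname{meas}_A(r_1,\dots,r_n)$, where $\kappa_1:n\cdot I\to n\cdot I+I$; 3. $\operatorname{meas}_A(p\oplus q,r_1,\dots,r_n)=[\kappa_1,\kappa_1,\kappa_2,\dots,\kappa_{n+1}]\circ\operatorname{meas}_A(p,q,r_1,\dots,r_n)$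 ($n\ge0$); 4. $\operatorname{meas}_B(r_1,\dots,r_n)\circ f=\operatorname{meas}_A(Pf(r_1),\dots,Pf(r_n))$ for $f:A\to B$. **QPEL.** Types are $A::=A\otimes A\mid I\mid A+A$. Terms are $M::=x\mid M\otimes M\mid \mathsf{let}\ x\otimes y=M\ \mathsf{in}\ M\mid\langle\rangle\mid\mathsf{inl}\,M\mid\mathsf{inr}\,M\mid(\mathsf{case}\ M\ \mathsf{of}\ \mathsf{inl}\,x\mapsto M\mid\mathsf{inr}\,y\mapsto M)\mid(\mathsf{measure}\ \phi_1\mapsto M_1\mid\cdots\mid\phi_n\mapsto M_n)$ with $n\ge1$. Effects are $\phi::=0\mid\phi\oplus\phi\mid\phi^\bot\mid\phi\cdot\phi\mid(\mathsf{case}\ M\ \mathsf{of}\ \mathsf{inl}\,x\mapsto\phi\mid\mathsf{inr}\,y\mapsto\phi)$. Expressions are taken up to renaming of bound variables. Contexts $\Gamma$ are finite lists of declarations $x:A$ of distinct variables; whenever contexts are concatenated they are disjoint, and bound variables are chosen to avoid capture. Judgements are $\Gamma\vdash M:A$, $\Gamma\vdash M=N:A$, $\Gamma\vdash\phi\ \mathrm{eff}$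 and $\Gamma\vdash\phi\le\psi$. Write $1=0^\bot$, $\phi\perp\psi$ for $\phi\le\psi^\bot$, $\phi\equiv\psi$ for the two judgements $\phi\le\psi$ and $\psi\le\phi$, $\bigoplus_i\phi_i$ for the sum bracketed to the left, and $C_M(N,P)$ for $\mathsf{case}\ M\ \mathsf{of}\ \mathsf{inl}\,x\mapsto N\mid\mathsf{inr}\,y\mapsto P$ ($N,P$ terms or effects). Derivability is generated by the following rules. *Exchange:* two adjacent declarations in the context of any judgement may be swapped. *Terms:* $\Gamma\vdash x:A$ if $x:A\in\Gamma$; $\Gamma\vdash\langle\rangle:I$; from $\Gamma\vdash M:A$ and $\Delta\vdash N:B$ infer $\Gamma,\Delta\vdash M\otimes N:A\otimes B$; from $\Gamma\vdash M:A\otimes B$ and $\Delta,x:A,y:B\vdash N:C$ infer $\Gamma,\Delta\vdash\mathsf{let}\ x\otimes y=M\ \mathsf{in}\ N:C$; $\mathsf{inl}\,M:A+B$ from $M:A$ and $\mathsf{inr}\,M:A+B$ from $M:B$, in the same context; from $\Gamma\vdash M:A+B$, $\Delta,x:A\vdash N:C$ and $\Delta,y:B\vdash P:C$ infer $\Gamma,\Delta\vdash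 C_M(N,P):C$; from $\Gamma\vdash1\le\bigoplus_i\phi_i$ and $\Delta\vdash M_i:A$ for all $i$ infer $\Gamma,\Delta\vdash\mathsf{measure}_i\,\phi_i\mapsto M_i:A$. *Term equality:* reflexivity (for derivable terms), symmetry, transitivity; congruence for $\otimes$, $\mathsf{let}$, $\mathsf{inl}$, $\mathsf{inr}$, $\mathsf{case}$, and for $\mathsf{measure}$ (from $\Gamma\vdash1\le\bigoplus_i\phi_i$, $\Gamma\vdash\phi_i\equiv\psi_i$, $\Delta\vdash M_i=N_i:A$); and the following equations, each in the concatenation of the disjoint contexts of its (well-typed) constituents, where the two branches of a $\mathsf{case}$, resp. all branches of a $\mathsf{measure}$, share a context: - $(\beta)$ $\mathsf{let}\ x\otimes y=M\otimes N\ \mathsf{in}\ P=[M/x,N/y]P$; $C_{\mathsf{inl}M}(N,P)=[M/x]N$; $C_{\mathsf{inr}M}(N,P)=[M/y]P$. - $(\eta)$ $M=\mathsf{let}\ x\otimes y=M\ \mathsf{in}\ x\otimes y$; $M=\langle\rangle$ for $M:I$; $M=C_M(\mathsf{inl}\,x,\mathsf{inr}\,y)$. - (commuting conversions) $\mathsf{let}\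 x\otimes y=M\ \mathsf{in}\ \mathsf{let}\ t\otimes u=N\ \mathsf{in}\ P=\mathsf{let}\ t\otimes u=(\mathsf{let}\ x\otimes y=M\ \mathsf{in}\ N)\ \mathsf{in}\ P$; $\mathsf{let}\ z\otimes t=C_M(N,P)\ \mathsf{in}\ Q=C_M(\mathsf{let}\ z\otimes t=N\ \mathsf{in}\ Q,\ \mathsf{let}\ z\otimes t=P\ \mathsf{in}\ Q)$; $(\mathsf{let}\ x\otimes y=M\ \mathsf{in}\ N)\otimes P=\mathsf{let}\ x\otimes y=M\ \mathsf{in}\ (N\otimes P)$; $C_M(C_N(Q,R),C_P(Q,R))=C_{C_M(N,P)}(Q,R)$; $C_Q(M,N)\otimes P=C_Q(M\otimes P,N\otimes P)$. - (measurement; in each case the sum of the effects of the measurement is derivably $\ge1$ in its context) invariance of $\mathsf{measure}_i\,\phi_i\mapsto M_i$ under permuting the branches; a branch $0\mapsto N$ may be added at the end of a measurement; $(\mathsf{measure}\ 1\mapsto M)=M$; $(\mathsf{measure}\ \phi\oplus\psi\mapsto M\mid\vec\chi\mapsto\vec P)=(\mathsf{measure}\ \phi\mapsto M\mid\psi\mapsto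 M\mid\vec\chi\mapsto\vec P)$; and, if $\Gamma,x:A\vdash1\le\bigoplus_i\phi_i$, $\Gamma,y:B\vdash1\le\bigoplus_i\psi_i$, $\Delta\vdash M:A+B$ and $\Theta\vdash N_i:C$, then $\Gamma,\Delta,\Theta\vdash\mathsf{measure}_i\,C_M(\phi_i,\psi_i)\mapsto N_i=C_M(\mathsf{measure}_i\,\phi_i\mapsto N_i,\ \mathsf{measure}_i\,\psi_i\mapsto N_i):C$. *Effects:* $0$ is an effect in any context; $\phi^\bot$ if $\phi$ is; $\phi\oplus\psi$ if $\Gamma\vdash\phi\perp\psi$; $\Gamma\vdash\phi\cdot\psi\ \mathrm{eff}$ if $\vdash\phi\ \mathrm{eff}$ and $\Gamma\vdash\psi\ \mathrm{eff}$; from $\Gamma,x:A\vdash\phi\ \mathrm{eff}$, $\Gamma,y:B\vdash\psi\ \mathrm{eff}$ and $\Delta\vdash M:A+B$ infer $\Gamma,\Delta\vdash C_M(\phi,\psi)\ \mathrm{eff}$. *Entailment:* (for effects derivable in the context $\Gamma$) $\phi\le\phi$; transitivity; $0\le\phi$; $\phi\le\psi$ gives $\psi^\bot\le\phi^\bot$;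 $\phi\le\phi^{\bot\bot}$; $\phi\perp\psi$ gives $\phi\le\phi\oplus\psi$ and $\phi\oplus\psi\le\psi\oplus\phi$; $\phi\le\psi$ and $\psi\le\chi^\bot$ give $\phi\oplus\chi\le\psi\oplus\chi$; $\phi\oplus\psi\perp\chi$ gives $\psi\oplus\chi\perp\phi$ and $\phi\oplus(\psi\oplus\chi)\le(\phi\oplus\psi)\oplus\chi$; $\phi\oplus0\le\phi$; $1\le\phi\oplus\psi$ gives $\psi^\bot\le\phi$; $1\le\phi\oplus\phi^\bot$. For products (left factors being effects in the empty context): $\vdash\phi\perp\psi$ gives $\phi\cdot\chi\perp\psi\cdot\chi$ and $(\phi\oplus\psi)\cdot\chi\equiv\phi\cdot\chi\oplus\psi\cdot\chi$; $\Gamma\vdash\psi\perp\chi$ gives $\phi\cdot\psi\perp\phi\cdot\chi$ and $\phi\cdot(\psi\oplus\chi)\equiv\phi\cdot\psi\oplus\phi\cdot\chi$; $1\cdot\phi\equiv\phi$; $\Gamma\vdash\phi\cdot1\equiv\phi$ if $\vdash\phi\ \mathrm{eff}$; $\phi\cdot(\psi\cdot\chi)\equiv(\phi\cdot\psi)\cdot\chi$;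 $\vdash\phi\cdot\psi\equiv\psi\cdot\phi$. For $\mathsf{case}$ (in contexts as in the formation rule): $C_M(\phi,\psi)\equiv C_N(\phi,\psi)$ if $\Delta\vdash M=N:A+B$; $C_M(\phi,\psi)\le C_M(\phi',\psi')$ if $\phi\le\phi'$ and $\psi\le\psi'$; $C_{\mathsf{inl}M}(\phi,\psi)\equiv[M/x]\phi$ and $C_{\mathsf{inr}M}(\phi,\psi)\equiv[M/y]\psi$; $\Gamma,z:A+B\vdash\phi\equiv C_z([\mathsf{inl}\,x/z]\phi,[\mathsf{inr}\,y/z]\phi)$; $C_M(\phi\oplus\phi',\psi\oplus\psi')\equiv C_M(\phi,\psi)\oplus C_M(\phi',\psi')$ if $\phi\perp\phi'$ and $\psi\perp\psi'$; $C_M(\phi^\bot,\psi^\bot)\equiv C_M(\phi,\psi)^\bot$; if $\Gamma\vdash M:A+B$, $\Delta,x:A\vdash\phi\le\chi$ and $\Delta,y:B\vdash\psi\le\chi$ with $x,y$ not free in $\chi$, then $\Gamma,\Delta\vdash C_M(\phi,\psi)\le\chi$; $C_M(\chi\cdot\phi,\chi\cdot\psi)\equiv\chi\cdot C_M(\phi,\psi)$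 if $\vdash\chi\ \mathrm{eff}$. **Interpretation.** In a triangle, $[\![I]\!]=I$, $[\![A\otimes B]\!]=[\![A]\!]\otimes[\![B]\!]$, $[\![A+B]\!]=[\![A]\!]+[\![B]\!]$, $[\![\langle\rangle]\!]=I$, $[\![\Gamma,x:A]\!]=[\![\Gamma]\!]\otimes[\![A]\!]$. A derivable $\Gamma\vdash M:A$ is interpreted as an arrow $[\![\Gamma]\!]\to[\![A]\!]$ and a derivable $\Gamma\vdash\phi\ \mathrm{eff}$ as an element of $P[\![\Gamma]\!]$, by recursion on the formation rules; up to the symmetric monoidal isomorphisms (in particular $[\![\Gamma,\Delta]\!]\cong[\![\Gamma]\!]\otimes[\![\Delta]\!]$; exchange is interpreted by the symmetry): a variable is the projection that discards the other factors along $!$ to $I$; $[\![M\otimes N]\!]=[\![M]\!]\otimes[\![N]\!]$; $[\![\mathsf{let}\ x\otimes y=M\ \mathsf{in}\ N]\!]=[\![N]\!]\circ([\![M]\!]\otimes1_{[\![\Delta]\!]})$; $[\![\langle\rangle]\!]={!}$; $[\![\mathsf{inl}\,M]\!]=\kappa_1\circ[\![M]\!]$, $[\![\mathsf{inr}\,M]\!]=\kappa_2\circ[\![M]\!]$;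 $[\![C_M(N,P)]\!]$ is $[\![M]\!]\otimes1_{[\![\Delta]\!]}$ followed by distributivity and $[[\![N]\!],[\![P]\!]]$; $[\![\mathsf{measure}_i\,\phi_i\mapsto M_i]\!]$ is $\operatorname{meas}([\![\phi_1]\!],\dots,[\![\phi_n]\!])\otimes1_{[\![\Delta]\!]}$ followed by $(n\cdot I)\otimes[\![\Delta]\!]\cong n\cdot[\![\Delta]\!]$ and $[[\![M_1]\!],\dots,[\![M_n]\!]]$; $0,{}^\bot,\oplus$ are interpreted by those of $P[\![\Gamma]\!]$; $[\![\phi\cdot\psi]\!]=[\![\phi]\!]\cdot[\![\psi]\!]$ with $[\![\phi]\!]\in PI\cong E$; and $[\![C_M(\phi,\psi)]\!]=P(1_{[\![\Gamma]\!]}\otimes[\![M]\!])([\![\phi]\!],[\![\psi]\!])$, where $P([\![\Gamma]\!]\otimes([\![A]\!]+[\![B]\!]))\cong P([\![\Gamma]\!]\otimes[\![A]\!])\times P([\![\Gamma]\!]\otimes[\![B]\!])$. **Theorem (Soundness).** In every state-and-effect triangle every derivable judgement is true: 1. if $\Gamma\vdash M:A$ is derivable, then $[\![\Gamma\vdash M:A]\!]$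 is defined and does not depend on the derivation, and likewise $[\![\Gamma\vdash\phi\ \mathrm{eff}]\!]$ if $\Gamma\vdash\phi\ \mathrm{eff}$ is derivable; 2. if $\Gamma\vdash M=N:A$ is derivable, then both sides have well-defined interpretations and $[\![\Gamma\vdash M:A]\!]=[\![\Gamma\vdash N:A]\!]$; 3. if $\Gamma\vdash\phi\le\psi$ is derivable, then both sides have well-defined interpretations and $[\![\Gamma\vdash\phi\ \mathrm{eff}]\!]\le[\![\Gamma\vdash\psi\ \mathrm{eff}]\!]$ in the effect module $P[\![\Gamma]\!]$. -/

import Mathlib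

open CategoryTheory MonoidalCategory Limits

universe u v w

namespace QPEL


/-! ## Effect algebras, effect monoids, effect modules -/

/-- A partial commutative monoid. The partial sum `x ⩒ y` is `ovee x y : Option M`, with `none`
for "undefined", so that equality in `Option M` is Kleene equality. -/
class PartialCommMonoid (M : Type w) extends Zero M where
  ovee : M → M → Option M
  ovee_comm : ∀ x y, ovee x y = ovee y x
  ovee_assoc : ∀ x y z, ((ovee y z).bind fun s => ovee x s) = (ovee x y).bind fun s => ovee s z
  ovee_zero : ∀ x, ovee x 0 = some x


/-- An effect algebra: a partial commutative monoid with orthosupplement. -/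
class EffectAlgebra (M : Type w) extends PartialCommMonoid M where
  orth : M → M
  ovee_eq_top_iff : ∀ x y, ovee x y = some (orth 0) ↔ y = orth x
  eq_zero_of_perp_top : ∀ x, (ovee x (orth 0)).isSome → x = 0

open PartialCommMonoid EffectAlgebra

/-- `1 = 0^⊥`. -/
instance EffectAlgebra.instOne (M : Type w) [EffectAlgebra M] : One M := ⟨orth 0⟩

/-- The order of an effect algebra: `x ≤ y` iff `x ⩒ z = y` for some `z`. -/
instance EffectAlgebra.instLE (M : Type w) [EffectAlgebra M] : LE M :=
  ⟨fun x y => ∃ z, ovee x z = some y⟩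

/-- An effect monoid. -/
class EffectMonoid (E : Type w) extends EffectAlgebra E, Mul E where
  ovee_mul : ∀ x y z s : E, ovee x y = some s → ovee (x * z) (y * z) = some (s * z)
  mul_ovee : ∀ x y z s : E, ovee y z = some s → ovee (x * y) (x * z) = some (x * s)
  top_mul : ∀ x : E, orth 0 * x = x
  mul_top : ∀ x : E, x * orth 0 = x
  mul_assoc' : ∀ x y z : E, x * (y * z) = (x * y) * z

/-- A commutative effect monoid. -/
class CommEffectMonoid (E : Type w) extends EffectMonoid E where
  mul_comm' : ∀ x y : E, x * y = y * x

/-- An effect module over the effect monoid `E`. -/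
class EffectModule (E : Type w) [EffectMonoid E] (A : Type w) [EffectAlgebra A]
    extends SMul E A where
  smul_ovee : ∀ (r : E) (x y s : A), ovee x y = some s → ovee (r • x) (r • y) = some (r • s)
  ovee_smul : ∀ (r s t : E) (x : A), ovee r s = some t → ovee (r • x) (s • x) = some (t • x)
  mul_smul' : ∀ (r s : E) (x : A), (r * s) • x = r • (s • x)
  one_smul' : ∀ x : A, (1 : E) • x = x

/-- The category `EMod_E` of effect modules over `E`: objects. -/
structure EModCat (E : Type w) [EffectMonoid E] : Type (w + 1) where
  carrier : Type w
  [effectAlgebra : EffectAlgebra carrier]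
  [effectModule : EffectModule E carrier]

attribute [instance] EModCat.effectAlgebra EModCat.effectModule

/-- Effect module homomorphisms. -/
@[ext]
structure EModHom {E : Type w} [EffectMonoid E] (A B : EModCat E) : Type w where
  toFun : A.carrier → B.carrier
  map_ovee : ∀ x y z, ovee x y = some z → ovee (toFun x) (toFun y) = some (toFun z)
  map_orth : ∀ x, toFun (orth x) = orth (toFun x)
  map_smul : ∀ (r : E) x, toFun (r • x) = r • toFun x

instance EModCat.category (E : Type w) [EffectMonoid E] : Category.{w} (EModCat.{w} E) where
  Hom A B := EModHom A B
  id A := ⟨id, fun _ _ _ h => h, fun _ => rfl, fun _ _ => rfl⟩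
  comp f g := ⟨g.toFun ∘ f.toFun, fun _ _ _ h => g.map_ovee _ _ _ (f.map_ovee _ _ _ h),
    fun x => by simp [f.map_orth, g.map_orth], fun r x => by simp [f.map_smul, g.map_smul]⟩

/-- `E` as an effect module over itself. -/
instance EffectMonoid.selfModule (E : Type w) [EffectMonoid E] : EffectModule E E where
  smul r x := r * x
  smul_ovee r x y s h := EffectMonoid.mul_ovee r x y s h
  ovee_smul r s t x h := EffectMonoid.ovee_mul r s x t h
  mul_smul' r s x := (EffectMonoid.mul_assoc' r s x).symm
  one_smul' x := EffectMonoid.top_mul x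

/-- The object `E` of `EMod_E`. -/
def EModCat.self (E : Type w) [EffectMonoid E] : EModCat.{w} E := ⟨E⟩

@[ext]
theorem EModCat.hom_ext {E : Type w} [EffectMonoid E] {A B : EModCat.{w} E} {f g : A ⟶ B}
    (h : ∀ x, f.toFun x = g.toFun x) : f = g := EModHom.ext (funext h)

/-- `E` is the initial effect module: the unique homomorphism `E → A` is `r ↦ r · 1`. -/
def EModCat.selfIsInitial (E : Type w) [EffectMonoid E] : IsInitial (EModCat.self E) :=
  IsInitial.ofUniqueHom
    (fun A => { toFun := fun r => (show E from r) • (1 : A.carrier)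
                map_ovee := fun r s t h => EffectModule.ovee_smul (E := E) r s t 1 h
                map_orth := fun r => by
                  refine (ovee_eq_top_iff _ _).1 ?_
                  have h := EffectModule.ovee_smul (A := A.carrier) (show E from r)
                    (orth (M := E) r) _ 1 ((ovee_eq_top_iff _ _).2 rfl)
                  exact h.trans (congrArg some (EffectModule.one_smul' (1 : A.carrier)))
                map_smul := fun r s => EffectModule.mul_smul' (E := E) r s 1 })
    (fun A f => by
      have h0 : f.toFun (0 : E) = 0 := by
        have h := f.map_ovee (0 : E) (0 : E) (0 : E) (ovee_zero (0 : E))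
        have h1 := (ovee_eq_top_iff (f.toFun (0 : E)) _).2 rfl
        have h2 := ovee_assoc (f.toFun (0 : E)) (f.toFun (0 : E)) (orth (f.toFun (0 : E)))
        rw [h1, h] at h2
        apply eq_zero_of_perp_top
        rw [show ovee (f.toFun (0 : E)) (orth 0) = some (orth 0) from h2.trans h1]
        rfl
      refine EModCat.hom_ext fun r => ?_
      have h1 : f.toFun (1 : E) = 1 := (f.map_orth (0 : E)).trans (congrArg orth h0)
      have h2 := f.map_smul (show E from r) (1 : E)
      rw [h1] at h2
      rw [show r = (show E from r) • (1 : E) from (EffectMonoid.mul_top (show E from r)).symm]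
      exact h2.trans (congrArg (· • (1 : A.carrier))
        (EffectMonoid.mul_top (show E from r)).symm))

/-! ## Finite partial sums -/

/-- Possibly undefined elements of a partial commutative monoid `M`; finite sums in this
commutative monoid are the finite partial sums in `M`. -/
def PSum (M : Type w) : Type w := Option M

namespace PSum

variable {M : Type w}

/-- A defined element. -/
def of (x : M) : PSum M := some x

theorem of_injective : Function.Injective (of : M → PSum M) := fun _ _ h => Option.some.inj h

instance [PartialCommMonoid M] : Add (PSum M) :=
  ⟨fun s t => Option.bind s fun x => Option.bind t fun y => ovee x y⟩

theorem of_add_of [PartialCommMonoid M] (x y : M) : of x + of y = (ovee x y : Option M) := rfl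

instance [PartialCommMonoid M] : Zero (PSum M) := ⟨of 0⟩

theorem of_zero [PartialCommMonoid M] : of (0 : M) = 0 := rfl

/-- The undefined element. -/
def undef : PSum M := none

theorem undef_add [PartialCommMonoid M] (s : PSum M) : undef + s = undef := rfl

theorem add_undef [PartialCommMonoid M] (s : PSum M) : s + undef = undef := by
  cases s <;> rfl

instance [PartialCommMonoid M] : AddCommMonoid (PSum M) where
  add_assoc s t r := by
    rcases s with _ | x
    · rfl
    rcases t with _ | y
    · rfl
    rcases r with _ | z
    · exact (add_undef _).trans ((congrArg (of x + ·) (add_undef (of y))).trans (add_undef _)).symm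
    change (Option.bind (ovee x y) fun s => ovee s z) = Option.bind (ovee y z) fun s => ovee x s
    exact (ovee_assoc x y z).symm
  zero_add s := by
    rcases s with _ | x
    · rfl
    · change ovee 0 x = some x
      rw [ovee_comm, ovee_zero]
  add_zero s := by
    rcases s with _ | x
    · rfl
    · exact ovee_zero x
  add_comm s t := by
    rcases s with _ | x <;> rcases t with _ | y <;> first | rfl | exact ovee_comm x y
  nsmul := nsmulRec

/-- The element is defined. -/
def Defined (s : PSum M) : Prop := ∃ x, s = of x

/-- The value of a defined element (and `0` otherwise). -/
def val [PartialCommMonoid M] (s : PSum M) : M := Option.getD s 0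

theorem val_of [PartialCommMonoid M] (x : M) : (of x).val = x := rfl

theorem val_zero [PartialCommMonoid M] : (0 : PSum M).val = 0 := rfl

theorem Defined.of_val [PartialCommMonoid M] {s : PSum M} (h : s.Defined) : of s.val = s := by
  obtain ⟨x, rfl⟩ := h; rfl

theorem Defined.left [PartialCommMonoid M] {s t : PSum M} (h : (s + t).Defined) : s.Defined := by
  rcases s with _ | x
  · obtain ⟨x, hx⟩ := h
    cases hx
  · exact ⟨x, rfl⟩

theorem Defined.sum_subset [PartialCommMonoid M] {ι : Type*} {s t : Finset ι} (hst : s ⊆ t)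
    {f : ι → PSum M} (h : (∑ i ∈ t, f i).Defined) : (∑ i ∈ s, f i).Defined := by
  classical
  rw [← Finset.sum_sdiff hst, add_comm] at h
  exact h.left

end PSum

section Scalars

variable {E : Type w}

theorem eq_zero_of_ovee_self {M : Type w} [EffectAlgebra M] {x a : M}
    (h : ovee x a = some x) : a = 0 := by
  have h1 : ovee x (orth x) = some (orth 0) := (ovee_eq_top_iff x (orth x)).2 rfl
  have h2 := ovee_assoc a x (orth x)
  rw [h1, ovee_comm a x, h] at h2
  apply eq_zero_of_perp_top
  rw [show ovee a (orth 0) = some (orth 0) from h2.trans h1]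
  rfl

theorem mul_zero' [EffectMonoid E] (r : E) : r * 0 = 0 :=
  eq_zero_of_ovee_self (x := r * 0) (EffectMonoid.mul_ovee r 0 0 0 (ovee_zero 0))

theorem zero_mul' [EffectMonoid E] (r : E) : 0 * r = 0 :=
  eq_zero_of_ovee_self (x := 0 * r) (EffectMonoid.ovee_mul 0 0 r 0 (ovee_zero 0))

theorem PSum.mul_sum [EffectMonoid E] {ι : Type*} (s : Finset ι) (r : E) (g : ι → E) {z : E}
    (h : ∑ i ∈ s, of (g i) = of z) : ∑ i ∈ s, of (r * g i) = of (r * z) := by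
  classical
  induction s using Finset.induction_on generalizing z with
  | empty =>
    rw [Finset.sum_empty] at h ⊢
    rw [← of_injective (show of (0 : E) = of z from h), mul_zero']
    rfl
  | insert a s ha ih =>
    rw [Finset.sum_insert ha] at h ⊢
    obtain ⟨y, hy⟩ : (∑ i ∈ s, of (g i)).Defined := by
      apply Defined.left (t := of (g a)); rw [add_comm, h]; exact ⟨z, rfl⟩
    rw [ih hy]
    rw [hy] at h
    exact EffectMonoid.mul_ovee r _ _ _ h

theorem PSum.sum_mul [EffectMonoid E] {ι : Type*} (s : Finset ι) (r : E) (g : ι → E) {z : E}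
    (h : ∑ i ∈ s, of (g i) = of z) : ∑ i ∈ s, of (g i * r) = of (z * r) := by
  classical
  induction s using Finset.induction_on generalizing z with
  | empty =>
    rw [Finset.sum_empty] at h ⊢
    rw [← of_injective (show of (0 : E) = of z from h), zero_mul']
    rfl
  | insert a s ha ih =>
    rw [Finset.sum_insert ha] at h ⊢
    obtain ⟨y, hy⟩ : (∑ i ∈ s, of (g i)).Defined := by
      apply Defined.left (t := of (g a)); rw [add_comm, h]; exact ⟨z, rfl⟩
    rw [ih hy]
    rw [hy] at h
    exact EffectMonoid.ovee_mul _ _ r _ h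

theorem PSum.Defined.sum_mul_of [EffectMonoid E] {ι : Type*} {s : Finset ι} {g h : ι → E}
    (hg : (∑ i ∈ s, of (g i)).Defined) : (∑ i ∈ s, of (g i * h i)).Defined := by
  have key : ∀ i, of (g i) = of (g i * h i) + of (g i * orth (h i)) := fun i => by
    have h1 := EffectMonoid.mul_ovee (g i) (h i) (orth (h i)) _
      ((ovee_eq_top_iff (h i) _).2 rfl)
    rw [EffectMonoid.mul_top] at h1
    exact h1.symm
  rw [Finset.sum_congr rfl fun i _ => key i, Finset.sum_add_distrib] at hg
  exact hg.left

end Scalars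

/-! ## The distribution monad and convex sets -/

section Distributions

variable (E : Type w) [EffectMonoid E]

/-- `𝒟_E X`: finitely supported functions `φ : X → E` whose sum exists and is `1`. -/
structure Dist (X : Type w) : Type w where
  toFinsupp : X →₀ E
  sum_eq_one : ∑ x ∈ toFinsupp.support, PSum.of (toFinsupp x) = PSum.of 1

variable {E}

namespace Dist

variable {X Y Z : Type w}

instance : CoeFun (Dist E X) fun _ => X → E := ⟨fun φ => φ.toFinsupp⟩

theorem ext {φ ψ : Dist E X} (h : ∀ x, φ x = ψ x) : φ = ψ := by
  obtain ⟨φ, _⟩ := φ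
  obtain ⟨ψ, _⟩ := ψ
  obtain rfl : φ = ψ := Finsupp.ext h
  rfl

theorem sum_of_subset (φ : Dist E X) {s : Finset X} (hs : φ.toFinsupp.support ⊆ s) :
    ∑ x ∈ s, PSum.of (φ x) = PSum.of 1 := by
  refine Eq.trans (Eq.symm (Finset.sum_subset hs ?_)) φ.sum_eq_one
  intro x _ hx
  rw [Finsupp.notMem_support_iff.1 hx]
  rfl

theorem sum_defined (φ : Dist E X) (s : Finset X) : (∑ x ∈ s, PSum.of (φ x)).Defined := by
  classical
  refine PSum.Defined.sum_subset (Finset.subset_union_left (s₂ := φ.toFinsupp.support)) ?_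
  rw [sum_of_subset φ Finset.subset_union_right]
  exact ⟨1, rfl⟩

open Classical in
/-- The action of `𝒟_E` on functions: `𝒟_E f(φ)(y) = ∑_{f(x) = y} φ(x)`. -/
noncomputable def map (f : X → Y) (φ : Dist E X) : Dist E Y :=
  ⟨Finsupp.onFinset (φ.toFinsupp.support.image f)
    (fun y => (∑ x ∈ φ.toFinsupp.support with f x = y, PSum.of (φ x)).val) (fun y hy => by
      by_contra h
      apply hy
      rw [Finset.filter_eq_empty_iff.2, Finset.sum_empty, PSum.val_zero]
      intro x hx hxy
      exact h (Finset.mem_image.2 ⟨x, hx, hxy⟩)), by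
    rw [Finset.sum_subset Finsupp.support_onFinset_subset (fun y _ hy => by
      rw [Finsupp.notMem_support_iff.1 hy]; rfl)]
    simp only [Finsupp.onFinset_apply]
    rw [Finset.sum_congr rfl fun y _ => (sum_defined φ _).of_val]
    rw [Finset.sum_fiberwise_of_maps_to (fun x hx => Finset.mem_image_of_mem f hx)]
    exact φ.sum_eq_one⟩

open Classical in
/-- The unit `η` of `𝒟_E`: `η(a)(a') = 1` if `a = a'`, and `0` otherwise. -/
noncomputable def pure (a : X) : Dist E X :=
  ⟨Finsupp.onFinset {a} (fun a' => if a = a' then 1 else 0) (fun a' h => by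
      by_contra h'
      exact h (if_neg fun e => h' (Finset.mem_singleton.2 e.symm))), by
    rw [Finset.sum_subset Finsupp.support_onFinset_subset (fun y _ hy => by
      rw [Finsupp.notMem_support_iff.1 hy]; rfl)]
    simp⟩

theorem sum_join_defined (Φ : Dist E (Dist E X)) (s : Finset X) (t : Finset (Dist E X)) :
    (∑ a ∈ s, ∑ φ ∈ t, PSum.of (Φ φ * φ a)).Defined := by
  classical
  rw [Finset.sum_comm]
  have h : (∑ φ ∈ t, PSum.of (Φ φ * (∑ a ∈ s, PSum.of (φ a)).val)).Defined :=
    PSum.Defined.sum_mul_of (sum_defined Φ t)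
  rwa [Finset.sum_congr rfl fun φ _ => (PSum.mul_sum s (Φ φ) φ (sum_defined φ s).of_val.symm).symm]
    at h

open Classical in
/-- The multiplication `μ` of `𝒟_E`: `μ(Φ)(a) = ∑_φ Φ(φ) · φ(a)`. -/
noncomputable def join (Φ : Dist E (Dist E X)) : Dist E X :=
  ⟨Finsupp.onFinset (Φ.toFinsupp.support.biUnion fun φ => φ.toFinsupp.support)
    (fun a => (∑ φ ∈ Φ.toFinsupp.support, PSum.of (Φ φ * φ a)).val) (fun a ha => by
      by_contra h
      apply ha
      rw [Finset.sum_eq_zero, PSum.val_zero]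
      intro φ hφ
      have : φ a = 0 := by
        by_contra h'
        exact h (Finset.mem_biUnion.2 ⟨φ, hφ, Finsupp.mem_support_iff.2 h'⟩)
      rw [this, mul_zero']
      rfl), by
    rw [Finset.sum_subset Finsupp.support_onFinset_subset (fun y _ hy => by
      rw [Finsupp.notMem_support_iff.1 hy]; rfl)]
    simp only [Finsupp.onFinset_apply]
    rw [Finset.sum_congr rfl fun a _ => PSum.Defined.of_val (by
      simpa using sum_join_defined Φ {a} Φ.toFinsupp.support)]
    rw [Finset.sum_comm]
    rw [Finset.sum_congr rfl fun φ hφ => PSum.mul_sum _ (Φ φ) φ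
      (sum_of_subset φ (Finset.subset_biUnion_of_mem (fun φ : Dist E X => φ.toFinsupp.support) hφ))]
    rw [Finset.sum_congr rfl fun φ _ =>
      (congrArg PSum.of (EffectMonoid.mul_top (Φ φ)) : PSum.of (Φ φ * 1) = PSum.of (Φ φ))]
    exact Φ.sum_eq_one⟩

theorem of_map_apply (f : X → Y) (φ : Dist E X) (y : Y) [DecidableEq Y] :
    PSum.of (map f φ y) = ∑ x ∈ φ.toFinsupp.support with f x = y, PSum.of (φ x) := by
  classical
  refine ((sum_defined φ _).of_val.symm.trans ?_).symm
  refine congrArg (fun s : Finset X => PSum.of (∑ x ∈ s, PSum.of (φ x)).val) ?_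
  ext x
  simp

theorem of_join_apply (Φ : Dist E (Dist E X)) (a : X) :
    PSum.of (join Φ a) = ∑ φ ∈ Φ.toFinsupp.support, PSum.of (Φ φ * φ a) :=
  PSum.Defined.of_val (by simpa using sum_join_defined Φ {a} Φ.toFinsupp.support)

/-- Sums against a pushed-forward distribution. -/
theorem sum_map (f : X → Y) (φ : Dist E X) (g : Y → E) {s : Finset Y}
    (hs' : ∀ x ∈ φ.toFinsupp.support, f x ∈ s) :
    ∑ y ∈ s, PSum.of (map f φ y * g y) =
      ∑ x ∈ φ.toFinsupp.support, PSum.of (φ x * g (f x)) := by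
  classical
  rw [← Finset.sum_fiberwise_of_maps_to hs']
  refine Finset.sum_congr rfl fun y _ => ?_
  rw [← PSum.sum_mul _ (g y) φ (of_map_apply f φ y).symm]
  refine Finset.sum_congr rfl fun x hx => ?_
  rw [(Finset.mem_filter.1 hx).2]

theorem support_map_subset [DecidableEq Y] (f : X → Y) (φ : Dist E X) :
    (map f φ).toFinsupp.support ⊆ φ.toFinsupp.support.image f := by
  classical
  intro y hy
  by_contra h
  refine Finsupp.mem_support_iff.1 hy (PSum.of_injective ?_)
  rw [of_map_apply, Finset.filter_eq_empty_iff.2, Finset.sum_empty]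
  · rfl
  · intro x hx hxy
    exact h (Finset.mem_image.2 ⟨x, hx, hxy⟩)

theorem map_comp (g : Y → Z) (f : X → Y) (φ : Dist E X) : map (g ∘ f) φ = map g (map f φ) := by
  classical
  refine ext fun z => PSum.of_injective ?_
  rw [of_map_apply, of_map_apply]
  have hs : ((map f φ).toFinsupp.support.filter fun y => g y = z) ⊆
      (φ.toFinsupp.support.image f).filter fun y => g y = z :=
    Finset.filter_subset_filter _ (support_map_subset f φ)
  rw [Finset.sum_subset hs]
  · rw [Finset.sum_congr rfl fun y _ => of_map_apply f φ y]
    rw [← Finset.sum_fiberwise_of_maps_to (g := f)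
      (t := (φ.toFinsupp.support.image f).filter fun y => g y = z)]
    · refine Finset.sum_congr rfl fun y hy => Finset.sum_congr ?_ fun _ _ => rfl
      ext x
      simp only [Finset.mem_filter, Function.comp]
      constructor
      · rintro ⟨⟨h1, _⟩, h3⟩
        exact ⟨h1, h3⟩
      · rintro ⟨h1, h3⟩
        exact ⟨⟨h1, by rw [h3]; exact (Finset.mem_filter.1 hy).2⟩, h3⟩
    · intro x hx
      rw [Finset.mem_filter] at hx ⊢
      exact ⟨Finset.mem_image_of_mem f hx.1, hx.2⟩
  · intro y hy hy'
    have : map f φ y = 0 := by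
      by_contra h
      exact hy' (Finset.mem_filter.2 ⟨Finsupp.mem_support_iff.2 h, (Finset.mem_filter.1 hy).2⟩)
    rw [this]
    rfl

theorem map_id (φ : Dist E X) : map id φ = φ := by
  classical
  refine ext fun x => PSum.of_injective ?_
  rw [of_map_apply, Finset.sum_filter]
  simp only [id_eq, Finset.sum_ite_eq', Finsupp.mem_support_iff]
  split_ifs with h
  · rfl
  · rw [not_not.1 h]; rfl

end Dist

variable (E)

/-- Convex sets over `E`: Eilenberg--Moore algebras of the monad `𝒟_E`. -/
structure ConvCat : Type (w + 1) where
  carrier : Type w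
  act : Dist E carrier → carrier
  act_pure : ∀ x, act (Dist.pure x) = x
  act_join : ∀ Φ : Dist E (Dist E carrier), act (Dist.join Φ) = act (Dist.map act Φ)

variable {E}

/-- A function between convex sets is affine if it is a morphism of algebras. -/
def IsAffine (X Y : ConvCat E) (f : X.carrier → Y.carrier) : Prop :=
  ∀ φ : Dist E X.carrier, f (X.act φ) = Y.act (Dist.map f φ)

/-- Affine functions. -/
@[ext]
structure AffineHom (X Y : ConvCat E) : Type w where
  toFun : X.carrier → Y.carrier
  isAffine : IsAffine X Y toFun

/-- The category `Conv_E` of convex sets and affine functions. -/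
instance ConvCat.category : Category.{w} (ConvCat.{w} E) where
  Hom X Y := AffineHom X Y
  id X := ⟨id, fun φ => by rw [Dist.map_id]; rfl⟩
  comp {X Y Z} f g := ⟨g.toFun ∘ f.toFun, fun φ => by
    rw [Dist.map_comp, ← g.isAffine, ← f.isAffine]; rfl⟩

/-- The convex combination `∑_x φ(x) · g(x)` of scalars. -/
noncomputable def Dist.expect {X : Type w} (φ : Dist E X) (g : X → E) : E :=
  (∑ x ∈ φ.toFinsupp.support, PSum.of (φ x * g x)).val

theorem Dist.of_expect {X : Type w} (φ : Dist E X) (g : X → E) :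
    PSum.of (φ.expect g) = ∑ x ∈ φ.toFinsupp.support, PSum.of (φ x * g x) :=
  (PSum.Defined.sum_mul_of (φ.sum_defined _)).of_val

theorem Dist.of_expect_of_subset {X : Type w} (φ : Dist E X) (g : X → E) {s : Finset X}
    (hs : φ.toFinsupp.support ⊆ s) :
    PSum.of (φ.expect g) = ∑ x ∈ s, PSum.of (φ x * g x) := by
  rw [φ.of_expect]
  refine Finset.sum_subset hs fun x _ hx => ?_
  rw [Finsupp.notMem_support_iff.1 hx, zero_mul']
  rfl

variable (E) in
/-- `E` as a convex set, with its own convex combinations. -/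
noncomputable def ConvCat.self : ConvCat.{w} E where
  carrier := E
  act φ := φ.expect fun x => x
  act_pure x := by
    classical
    refine PSum.of_injective ?_
    have hs : (Dist.pure x : Dist E E).toFinsupp.support ⊆ {x} := by
      intro a ha
      by_contra h
      exact Finsupp.mem_support_iff.1 ha (if_neg fun e => h (Finset.mem_singleton.2 e.symm))
    rw [Dist.of_expect_of_subset _ _ hs, Finset.sum_singleton]
    have : (Dist.pure x : Dist E E) x = 1 := if_pos rfl
    rw [this]
    exact congrArg PSum.of (EffectMonoid.top_mul x)
  act_join Φ := by
    classical
    refine PSum.of_injective ?_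
    have hs : (Dist.join Φ).toFinsupp.support ⊆
        Φ.toFinsupp.support.biUnion fun φ => φ.toFinsupp.support := by
      unfold Dist.join
      convert Finsupp.support_onFinset_subset
    rw [Dist.of_expect_of_subset _ _ hs,
      Dist.of_expect_of_subset _ _ (Dist.support_map_subset _ Φ),
      Dist.sum_map _ Φ (fun y => y)
        fun x hx => Finset.mem_image_of_mem _ hx]
    rw [Finset.sum_congr rfl fun x _ =>
      (PSum.sum_mul _ x _ (Dist.of_join_apply Φ x).symm).symm, Finset.sum_comm]
    refine Finset.sum_congr rfl fun φ hφ => ?_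
    rw [← PSum.mul_sum _ (Φ φ) _ (φ.of_expect_of_subset (fun x => x)
      (Finset.subset_biUnion_of_mem (fun φ : Dist E E => φ.toFinsupp.support) hφ)).symm]
    exact Finset.sum_congr rfl fun x _ =>
      congrArg PSum.of (EffectMonoid.mul_assoc' (Φ φ) (φ x) x).symm

end Distributions

/-! ## State-and-effect triangles -/

/-- A test: a nonempty finite family of elements of an effect algebra with sum `1`. -/
def IsTest {M : Type w} [EffectAlgebra M] {n : ℕ} (r : Fin (n + 1) → M) : Prop :=
  ∑ i, PSum.of (r i) = PSum.of 1

section Copowers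

variable (V : Type u) [Category.{v} V] [MonoidalCategory V] [HasBinaryCoproducts V]

/-- `copower V n` is the `(n+1)`-fold coproduct `(n+1) · I` of the tensor unit. -/
noncomputable def copower : ℕ → V
  | 0 => 𝟙_ V
  | n + 1 => copower n ⨿ 𝟙_ V

/-- The coprojections `κ_i : I ⟶ (n+1) · I`. -/
noncomputable def copower.ι : (n : ℕ) → Fin (n + 1) → (𝟙_ V ⟶ copower V n)
  | 0 => fun _ => 𝟙 _
  | n + 1 => Fin.snoc (α := fun _ => 𝟙_ V ⟶ copower V (n + 1))
      (fun i => copower.ι n i ≫ coprod.inl) coprod.inr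

variable {V}

/-- The mediating arrow `[f_0, …, f_n] : (n+1) · I ⟶ X`. -/
noncomputable def copower.desc {X : V} : (n : ℕ) → (Fin (n + 1) → (𝟙_ V ⟶ X)) → (copower V n ⟶ X)
  | 0 => fun f => f 0
  | n + 1 => fun f => coprod.desc (copower.desc n fun i => f i.castSucc) (f (Fin.last (n + 1)))

/-- The arrow `Δ ⊗ (n+1) · I ≅ (n+1) · Δ ⟶ X` given by `f_0, …, f_n : Δ ⟶ X`. -/
noncomputable def copower.branch [IsMonoidalDistrib V] {D X : V} :
    (n : ℕ) → (Fin (n + 1) → (D ⟶ X)) → (D ⊗ copower V n ⟶ X)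
  | 0 => fun f => (ρ_ D).hom ≫ f 0
  | n + 1 => fun f => (leftDistrib D (copower V n) (𝟙_ V)).inv ≫
      coprod.desc (copower.branch n fun i => f i.castSucc)
        ((ρ_ D).hom ≫ f (Fin.last (n + 1)))

end Copowers

/-- The effect module `P A`, for `P : V ⥤ EMod_Eᵒᵖ`. -/
abbrev predObj {V : Type u} [Category.{v} V] {E : Type w} [CommEffectMonoid E]
    (P : V ⥤ (EModCat.{w} E)ᵒᵖ) (A : V) : Type w :=
  (P.obj A).unop.carrier

/-- The map `P f : P B → P A`, for `f : A ⟶ B`. -/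
abbrev predMap {V : Type u} [Category.{v} V] {E : Type w} [CommEffectMonoid E]
    (P : V ⥤ (EModCat.{w} E)ᵒᵖ) {A B : V} (f : A ⟶ B) : predObj P B → predObj P A :=
  (P.map f).unop.toFun

/-- The convex set `S A`, for `S : V ⥤ Conv_E`. -/
abbrev stateObj {V : Type u} [Category.{v} V] {E : Type w} [CommEffectMonoid E]
    (S : V ⥤ ConvCat.{w} E) (A : V) : Type w :=
  (S.obj A).carrier

/-- The affine map `S f : S A → S B`, for `f : A ⟶ B`. -/
abbrev stateMap {V : Type u} [Category.{v} V] {E : Type w} [CommEffectMonoid E]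
    (S : V ⥤ ConvCat.{w} E) {A B : V} (f : A ⟶ B) : stateObj S A → stateObj S B :=
  (S.map f).toFun

/-- A (lax) symmetric monoidal structure on `S : V ⥤ Conv_E`. Affine maps `S A ⊗ S B ⟶ S (A ⊗ B)`
out of the tensor product of convex sets are the functions `S A × S B → S (A ⊗ B)` that are affine
in each variable, and the tensor unit of `Conv_E` is the one-point convex set. -/
structure SymmetricMonoidalStructure {V : Type u} [Category.{v} V] [MonoidalCategory V]
    [SymmetricCategory V] {E : Type w} [CommEffectMonoid E] (S : V ⥤ ConvCat.{w} E) where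
  unit : stateObj S (𝟙_ V)
  tensor : ∀ A B : V, stateObj S A → stateObj S B → stateObj S (A ⊗ B)
  affine_left : ∀ (A B : V) (b : stateObj S B),
    IsAffine (S.obj A) (S.obj (A ⊗ B)) fun a => tensor A B a b
  affine_right : ∀ (A B : V) (a : stateObj S A),
    IsAffine (S.obj B) (S.obj (A ⊗ B)) fun b => tensor A B a b
  natural : ∀ {A A' B B' : V} (f : A ⟶ A') (g : B ⟶ B') (a : stateObj S A) (b : stateObj S B),
    stateMap S (f ⊗ₘ g) (tensor A B a b) = tensor A' B' (stateMap S f a) (stateMap S g b)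
  associativity : ∀ (A B C : V) (a : stateObj S A) (b : stateObj S B) (c : stateObj S C),
    stateMap S (α_ A B C).hom (tensor (A ⊗ B) C (tensor A B a b) c) =
      tensor A (B ⊗ C) a (tensor B C b c)
  left_unit : ∀ (A : V) (a : stateObj S A),
    stateMap S (λ_ A).hom (tensor (𝟙_ V) A unit a) = a
  right_unit : ∀ (A : V) (a : stateObj S A),
    stateMap S (ρ_ A).hom (tensor A (𝟙_ V) a unit) = a
  symmetry : ∀ (A B : V) (a : stateObj S A) (b : stateObj S B),
    stateMap S (β_ A B).hom (tensor A B a b) = tensor B A b a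

/-- A state-and-effect triangle over a symmetric monoidal category `V`, with binary coproducts
that distribute over the tensor, and a commutative effect monoid `E`. -/
structure Triangle (V : Type u) [Category.{v} V] [MonoidalCategory V] [SymmetricCategory V]
    [HasBinaryCoproducts V] [IsMonoidalDistrib V] (E : Type w) [CommEffectMonoid E] where
  /-- The tensor unit is terminal. -/
  unitTerminal : IsTerminal (𝟙_ V)
  /-- The predicate functor. -/
  P : V ⥤ (EModCat.{w} E)ᵒᵖ
  preservesCoproducts : PreservesFiniteCoproducts P
  preservesTerminal : PreservesLimit (Functor.empty.{0} V) P
  /-- The state functor. -/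
  S : V ⥤ ConvCat.{w} E
  monoidal : SymmetricMonoidalStructure S
  /-- The measurement arrows. -/
  meas : ∀ {A : V} {n : ℕ} (r : Fin (n + 1) → predObj P A), IsTest r → (A ⟶ copower V n)
  meas_perm : ∀ {A : V} {n : ℕ} (r : Fin (n + 1) → predObj P A) (p : Equiv.Perm (Fin (n + 1)))
    (h : IsTest r) (h' : IsTest fun i => r (p i)),
    meas (fun i => r (p i)) h' = meas r h ≫ copower.desc n fun i => copower.ι V n (p.symm i)
  meas_zero : ∀ {A : V} {n : ℕ} (r : Fin (n + 1) → predObj P A)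
    (h : IsTest r) (h' : IsTest (Fin.snoc (α := fun _ => predObj P A) r 0)),
    meas (Fin.snoc (α := fun _ => predObj P A) r 0) h' = meas r h ≫ coprod.inl
  meas_ovee : ∀ {A : V} {n : ℕ} (p q s : predObj P A) (r : Fin n → predObj P A),
    ovee p q = some s →
    ∀ (h : IsTest (Fin.cons (α := fun _ => predObj P A) s r))
      (h' : IsTest (Fin.cons (α := fun _ => predObj P A) p
        (Fin.cons (α := fun _ => predObj P A) q r))),
    meas (Fin.cons (α := fun _ => predObj P A) s r) h =
      meas (Fin.cons (α := fun _ => predObj P A) p (Fin.cons (α := fun _ => predObj P A) q r)) h' ≫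
        copower.desc (n + 1) (Fin.cons (α := fun _ => 𝟙_ V ⟶ copower V n)
          (copower.ι V n 0) (copower.ι V n))
  meas_natural : ∀ {A B : V} (f : A ⟶ B) {n : ℕ} (r : Fin (n + 1) → predObj P B)
    (h : IsTest r) (h' : IsTest fun i => predMap P f (r i)),
    f ≫ meas r h = meas (fun i => predMap P f (r i)) h'
  /-- The validity transformation `α_A : P A → Conv_E[S A, E]`; the target carries the pointwise
  effect module structure. -/
  alpha : ∀ A : V, predObj P A → (S.obj A ⟶ ConvCat.self E)
  alpha_ovee : ∀ (A : V) (p q s : predObj P A), ovee p q = some s →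
    ∀ x : stateObj S A,
      ovee (M := E) ((alpha A p).toFun x) ((alpha A q).toFun x) = some ((alpha A s).toFun x)
  alpha_orth : ∀ (A : V) (p : predObj P A) (x : stateObj S A),
    (alpha A (orth p)).toFun x = orth (M := E) ((alpha A p).toFun x)
  alpha_smul : ∀ (A : V) (r : E) (p : predObj P A) (x : stateObj S A),
    (alpha A (r • p)).toFun x = r * (show E from (alpha A p).toFun x)
  alpha_natural : ∀ {A B : V} (f : A ⟶ B) (p : predObj P B),
    alpha A (predMap P f p) = S.map f ≫ alpha B p
  /-- The validity transformation `β_A : S A → EMod_E[P A, E]`; the target carries the pointwise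
  convex structure. -/
  beta : ∀ A : V, stateObj S A → ((P.obj A).unop ⟶ EModCat.self E)
  beta_affine : ∀ (A : V) (φ : Dist E (stateObj S A)) (p : predObj P A),
    (beta A ((S.obj A).act φ)).toFun p = φ.expect fun x => (beta A x).toFun p
  beta_natural : ∀ {A B : V} (f : A ⟶ B) (x : stateObj S A),
    beta B (stateMap S f x) = (P.map f).unop ≫ beta A x
  alpha_eq_beta : ∀ (A : V) (p : predObj P A) (x : stateObj S A),
    (alpha A p).toFun x = (beta A x).toFun p

end QPEL

/-! ## Syntax of QPEL -/

namespace QPEL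


/-- Types `A ::= A ⊗ A | I | A + A`. -/
inductive Ty : Type
  | tensor (A B : Ty)
  | unit
  | sum (A B : Ty)

/-- The two sorts of expressions. -/
inductive Kind : Type
  | tm
  | eff

/-- Expressions (terms and effects) up to renaming of bound variables: free variables are names
`x : ℕ`, bound variables are de Bruijn indices. `letE M N` binds two variables in `N` (index `1` is
the first and index `0` the second); `caseT` and `caseE` bind one variable in each branch. -/
inductive Expr : Kind → Type
  | bvar (i : ℕ) : Expr .tm
  | fvar (x : ℕ) : Expr .tm
  | pair (M N : Expr .tm) : Expr .tm
  | letE (M N : Expr .tm) : Expr .tm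
  | unit : Expr .tm
  | inl (M : Expr .tm) : Expr .tm
  | inr (M : Expr .tm) : Expr .tm
  | caseT (M N P : Expr .tm) : Expr .tm
  | measure {n : ℕ} (φ : Fin (n + 1) → Expr .eff) (M : Fin (n + 1) → Expr .tm) : Expr .tm
  | zero : Expr .eff
  | ovee (φ ψ : Expr .eff) : Expr .eff
  | orth (φ : Expr .eff) : Expr .eff
  | mul (φ ψ : Expr .eff) : Expr .eff
  | caseE (M : Expr .tm) (φ ψ : Expr .eff) : Expr .eff

/-- Terms. -/
abbrev Tm : Type := Expr .tm

/-- Effects. -/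
abbrev Eff : Type := Expr .eff

namespace Expr

/-- Turn the free variable `x` into the bound variable that has index `k` at the top level. -/
def close (x : ℕ) : ℕ → {s : Kind} → Expr s → Expr s
  | _, _, bvar i => bvar i
  | k, _, fvar y => if y = x then bvar k else fvar y
  | k, _, pair M N => pair (close x k M) (close x k N)
  | k, _, letE M N => letE (close x k M) (close x (k + 2) N)
  | _, _, unit => unit
  | k, _, inl M => inl (close x k M)
  | k, _, inr M => inr (close x k M)
  | k, _, caseT M N P => caseT (close x k M) (close x (k + 1) N) (close x (k + 1) P)
  | k, _, measure φ M => measure (fun i => close x k (φ i)) (fun i => close x k (M i))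
  | _, _, zero => zero
  | k, _, ovee φ ψ => ovee (close x k φ) (close x k ψ)
  | k, _, orth φ => orth (close x k φ)
  | k, _, mul φ ψ => mul (close x k φ) (close x k ψ)
  | k, _, caseE M φ ψ => caseE (close x k M) (close x (k + 1) φ) (close x (k + 1) ψ)

/-- Simultaneous substitution of terms for the free variables. It is used for terms without
dangling indices, so that no variable can be captured. -/
def subst (σ : ℕ → Tm) : {s : Kind} → Expr s → Expr s
  | _, bvar i => bvar i
  | _, fvar y => σ y
  | _, pair M N => pair (subst σ M) (subst σ N)
  | _, letE M N => letE (subst σ M) (subst σ N)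
  | _, unit => unit
  | _, inl M => inl (subst σ M)
  | _, inr M => inr (subst σ M)
  | _, caseT M N P => caseT (subst σ M) (subst σ N) (subst σ P)
  | _, measure φ M => measure (fun i => subst σ (φ i)) (fun i => subst σ (M i))
  | _, zero => zero
  | _, ovee φ ψ => ovee (subst σ φ) (subst σ ψ)
  | _, orth φ => orth (subst σ φ)
  | _, mul φ ψ => mul (subst σ φ) (subst σ ψ)
  | _, caseE M φ ψ => caseE (subst σ M) (subst σ φ) (subst σ ψ)

/-- The variable `x` occurs free in an expression. -/
def Occurs (x : ℕ) : {s : Kind} → Expr s → Prop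
  | _, bvar _ => False
  | _, fvar y => y = x
  | _, pair M N => Occurs x M ∨ Occurs x N
  | _, letE M N => Occurs x M ∨ Occurs x N
  | _, unit => False
  | _, inl M => Occurs x M
  | _, inr M => Occurs x M
  | _, caseT M N P => Occurs x M ∨ Occurs x N ∨ Occurs x P
  | _, measure φ M => (∃ i, Occurs x (φ i)) ∨ ∃ i, Occurs x (M i)
  | _, zero => False
  | _, ovee φ ψ => Occurs x φ ∨ Occurs x ψ
  | _, orth φ => Occurs x φ
  | _, mul φ ψ => Occurs x φ ∨ Occurs x ψ
  | _, caseE M φ ψ => Occurs x M ∨ Occurs x φ ∨ Occurs x ψ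

/-- `[M/x]e`. -/
def subst1 (M : Tm) (x : ℕ) {s : Kind} (e : Expr s) : Expr s :=
  subst (Function.update fvar x M) e

/-- `[M/x, N/y]e`. -/
def subst2 (M : Tm) (x : ℕ) (N : Tm) (y : ℕ) {s : Kind} (e : Expr s) : Expr s :=
  subst (Function.update (Function.update fvar x M) y N) e

/-- `let x ⊗ y = M in N`. -/
def letIn (x y : ℕ) (M N : Tm) : Tm := letE M (close y 0 (close x 1 N))

/-- `case M of inl x ↦ N | inr y ↦ P`, for terms. -/
def caseOf (M : Tm) (x : ℕ) (N : Tm) (y : ℕ) (P : Tm) : Tm := caseT M (close x 0 N) (close y 0 P)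

/-- `case M of inl x ↦ φ | inr y ↦ ψ`, for effects. -/
def caseEff (M : Tm) (x : ℕ) (φ : Eff) (y : ℕ) (ψ : Eff) : Eff :=
  caseE M (close x 0 φ) (close y 0 ψ)

/-- The effect `1 = 0^⊥`. -/
def one : Eff := orth zero

/-- `⩒_i φ_i = (⋯ (φ_0 ⩒ φ_1) ⩒ ⋯) ⩒ φ_n`. -/
def bigOvee : {n : ℕ} → (Fin (n + 1) → Eff) → Eff
  | 0, φ => φ 0
  | n + 1, φ => ovee (bigOvee fun i : Fin (n + 1) => φ i.castSucc) (φ (Fin.last (n + 1)))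

/-- Adding a first element to a family. -/
abbrev cons {s : Kind} {n : ℕ} (e : Expr s) (f : Fin n → Expr s) : Fin (n + 1) → Expr s :=
  Fin.cons (α := fun _ => Expr s) e f

/-- Adding a last element to a family. -/
abbrev snoc {s : Kind} {n : ℕ} (f : Fin n → Expr s) (e : Expr s) : Fin (n + 1) → Expr s :=
  Fin.snoc (α := fun _ => Expr s) f e

end Expr

/-- Contexts `Γ ::= ⟨⟩ | Γ, x : A`. -/
inductive Ctx : Type
  | nil
  | ext (Γ : Ctx) (x : ℕ) (A : Ty)

namespace Ctx

/-- The context `Γ, Δ`. -/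
def append (Γ : Ctx) : Ctx → Ctx
  | nil => Γ
  | ext Δ x A => ext (append Γ Δ) x A

instance : Append Ctx := ⟨append⟩

/-- The list of the names declared in a context. -/
def names : Ctx → List ℕ
  | nil => []
  | ext Γ x _ => x :: names Γ

/-- No variable is declared twice. -/
def Valid (Γ : Ctx) : Prop := Γ.names.Nodup

/-- Occurrences `x : A ∈ Γ`. -/
inductive Has : Ctx → ℕ → Ty → Type
  | here {Γ : Ctx} {x : ℕ} {A : Ty} : Has (ext Γ x A) x A
  | there {Γ : Ctx} {x y : ℕ} {A B : Ty} (h : Has Γ x A) : Has (ext Γ y B) x A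

end Ctx

/-- Judgements over a context. -/
inductive Jdg : Type
  /-- `⊢ M : A` -/
  | tm (M : Tm) (A : Ty)
  /-- `⊢ M = N : A` -/
  | eq (M N : Tm) (A : Ty)
  /-- `⊢ φ eff` -/
  | eff (φ : Eff)
  /-- `⊢ φ ≤ ψ` -/
  | le (φ ψ : Eff)

/-- `φ ⊥ ψ` is `φ ≤ ψ^⊥`. -/
abbrev Jdg.perp (φ ψ : Eff) : Jdg := .le φ (.orth ψ)

/-- `φ ≡ ψ` stands for the two judgements `φ ≤ ψ` and `ψ ≤ φ`. -/
def Jdg.equiv (φ ψ : Eff) : Set Jdg := {.le φ ψ, .le ψ φ}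

open QPEL.Expr

/-- Derivability of `Γ ⊢ J` in QPEL. Contexts declare each variable once, and bound variables are
chosen distinct from the free ones where they would capture them. -/
inductive Derives : Ctx → Jdg → Prop
  -- Structural rule
  | exch {Γ Δ : Ctx} {x y : ℕ} {A B : Ty} {J : Jdg} :
      Derives ((Γ.ext x A).ext y B ++ Δ) J → Derives ((Γ.ext y B).ext x A ++ Δ) J
  -- Term formation
  | var {Γ : Ctx} {x : ℕ} {A : Ty} : Γ.Valid → Γ.Has x A → Derives Γ (.tm (fvar x) A)
  | pair {Γ Δ : Ctx} {M N : Tm} {A B : Ty} : (Γ ++ Δ).Valid →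
      Derives Γ (.tm M A) → Derives Δ (.tm N B) → Derives (Γ ++ Δ) (.tm (pair M N) (.tensor A B))
  | letIn {Γ Δ : Ctx} {x y : ℕ} {M N : Tm} {A B C : Ty} : (Γ ++ Δ).Valid →
      Derives Γ (.tm M (.tensor A B)) → Derives ((Δ.ext x A).ext y B) (.tm N C) →
      Derives (Γ ++ Δ) (.tm (letIn x y M N) C)
  | unit {Γ : Ctx} : Γ.Valid → Derives Γ (.tm unit .unit)
  | inl {Γ : Ctx} {M : Tm} {A B : Ty} : Derives Γ (.tm M A) → Derives Γ (.tm (inl M) (.sum A B))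
  | inr {Γ : Ctx} {M : Tm} {A B : Ty} : Derives Γ (.tm M B) → Derives Γ (.tm (inr M) (.sum A B))
  | caseOf {Γ Δ : Ctx} {x y : ℕ} {M N P : Tm} {A B C : Ty} : (Γ ++ Δ).Valid →
      Derives Γ (.tm M (.sum A B)) → Derives (Δ.ext x A) (.tm N C) →
      Derives (Δ.ext y B) (.tm P C) → Derives (Γ ++ Δ) (.tm (caseOf M x N y P) C)
  | measure {Γ Δ : Ctx} {n : ℕ} {φ : Fin (n + 1) → Eff} {M : Fin (n + 1) → Tm} {A : Ty} :
      (Γ ++ Δ).Valid → Derives Γ (.le one (bigOvee φ)) → (∀ i, Derives Δ (.tm (M i) A)) →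
      Derives (Γ ++ Δ) (.tm (measure φ M) A)
  -- Equality of terms
  | refl {Γ : Ctx} {M : Tm} {A : Ty} : Derives Γ (.tm M A) → Derives Γ (.eq M M A)
  | symm {Γ : Ctx} {M N : Tm} {A : Ty} : Derives Γ (.eq M N A) → Derives Γ (.eq N M A)
  | trans {Γ : Ctx} {M N P : Tm} {A : Ty} :
      Derives Γ (.eq M N A) → Derives Γ (.eq N P A) → Derives Γ (.eq M P A)
  -- Congruences
  | pair_eq {Γ Δ : Ctx} {M M' N N' : Tm} {A B : Ty} : (Γ ++ Δ).Valid →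
      Derives Γ (.eq M M' A) → Derives Δ (.eq N N' B) →
      Derives (Γ ++ Δ) (.eq (pair M N) (pair M' N') (.tensor A B))
  | let_eq {Γ Δ : Ctx} {x y : ℕ} {M M' N N' : Tm} {A B C : Ty} : (Γ ++ Δ).Valid →
      Derives Γ (.eq M M' (.tensor A B)) → Derives ((Δ.ext x A).ext y B) (.eq N N' C) →
      Derives (Γ ++ Δ) (.eq (letIn x y M N) (letIn x y M' N') C)
  | inl_eq {Γ : Ctx} {M N : Tm} {A B : Ty} :
      Derives Γ (.eq M N A) → Derives Γ (.eq (inl M) (inl N) (.sum A B))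
  | inr_eq {Γ : Ctx} {M N : Tm} {A B : Ty} :
      Derives Γ (.eq M N B) → Derives Γ (.eq (inr M) (inr N) (.sum A B))
  | case_eq {Γ Δ : Ctx} {x y : ℕ} {M M' N N' P P' : Tm} {A B C : Ty} : (Γ ++ Δ).Valid →
      Derives Γ (.eq M M' (.sum A B)) → Derives (Δ.ext x A) (.eq N N' C) →
      Derives (Δ.ext y B) (.eq P P' C) →
      Derives (Γ ++ Δ) (.eq (caseOf M x N y P) (caseOf M' x N' y P') C)
  | measure_eq {Γ Δ : Ctx} {n : ℕ} {φ ψ : Fin (n + 1) → Eff} {M N : Fin (n + 1) → Tm} {A : Ty} :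
      (Γ ++ Δ).Valid → Derives Γ (.le one (bigOvee φ)) →
      (∀ i, Derives Γ (.le (φ i) (ψ i))) → (∀ i, Derives Γ (.le (ψ i) (φ i))) →
      (∀ i, Derives Δ (.eq (M i) (N i) A)) →
      Derives (Γ ++ Δ) (.eq (measure φ M) (measure ψ N) A)
  -- β-conversions
  | beta_tensor {Γ Δ Θ : Ctx} {x y : ℕ} {M N P : Tm} {A B C : Ty} : (Γ ++ Δ ++ Θ).Valid →
      Derives Γ (.tm M A) → Derives Δ (.tm N B) → Derives ((Θ.ext x A).ext y B) (.tm P C) →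
      Derives (Γ ++ Δ ++ Θ) (.eq (letIn x y (pair M N) P) (subst2 M x N y P) C)
  | beta_inl {Γ Δ : Ctx} {x y : ℕ} {M N P : Tm} {A B C : Ty} : (Γ ++ Δ).Valid →
      Derives Γ (.tm M A) → Derives (Δ.ext x A) (.tm N C) → Derives (Δ.ext y B) (.tm P C) →
      Derives (Γ ++ Δ) (.eq (caseOf (inl M) x N y P) (subst1 M x N) C)
  | beta_inr {Γ Δ : Ctx} {x y : ℕ} {M N P : Tm} {A B C : Ty} : (Γ ++ Δ).Valid →
      Derives Γ (.tm M B) → Derives (Δ.ext x A) (.tm N C) → Derives (Δ.ext y B) (.tm P C) →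
      Derives (Γ ++ Δ) (.eq (caseOf (inr M) x N y P) (subst1 M y P) C)
  -- η-conversions
  | eta_tensor {Γ : Ctx} {x y : ℕ} {M : Tm} {A B : Ty} : x ≠ y →
      Derives Γ (.tm M (.tensor A B)) →
      Derives Γ (.eq M (letIn x y M (pair (fvar x) (fvar y))) (.tensor A B))
  | eta_unit {Γ : Ctx} {M : Tm} : Derives Γ (.tm M .unit) → Derives Γ (.eq M unit .unit)
  | eta_sum {Γ : Ctx} {x y : ℕ} {M : Tm} {A B : Ty} : Derives Γ (.tm M (.sum A B)) →
      Derives Γ (.eq M (caseOf M x (inl (fvar x)) y (inr (fvar y))) (.sum A B))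
  -- Commuting conversions
  | let_commute {Γ Δ Θ : Ctx} {x y t u : ℕ} {M N P : Tm} {A B C D E : Ty} :
      (((Γ ++ Δ ++ Θ).ext x A).ext y B).Valid →
      Derives Γ (.tm M (.tensor A B)) → Derives ((Δ.ext x A).ext y B) (.tm N (.tensor C D)) →
      Derives ((Θ.ext t C).ext u D) (.tm P E) →
      Derives (Γ ++ Δ ++ Θ)
        (.eq (letIn x y M (letIn t u N P)) (letIn t u (letIn x y M N) P) E)
  | let_case {Γ Δ Θ : Ctx} {x y z t : ℕ} {M N P Q : Tm} {A B C D E : Ty} :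
      ((Γ ++ Δ ++ Θ).ext x A).Valid → ((Γ ++ Δ ++ Θ).ext y B).Valid →
      Derives Γ (.tm M (.sum A B)) → Derives (Δ.ext x A) (.tm N (.tensor C D)) →
      Derives (Δ.ext y B) (.tm P (.tensor C D)) → Derives ((Θ.ext z C).ext t D) (.tm Q E) →
      Derives (Γ ++ Δ ++ Θ)
        (.eq (letIn z t (caseOf M x N y P) Q) (caseOf M x (letIn z t N Q) y (letIn z t P Q)) E)
  | let_tensor {Γ Δ Θ : Ctx} {x y : ℕ} {M N P : Tm} {A B C D : Ty} :
      (((Γ ++ Δ ++ Θ).ext x A).ext y B).Valid →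
      Derives Γ (.tm M (.tensor A B)) → Derives ((Δ.ext x A).ext y B) (.tm N C) →
      Derives Θ (.tm P D) →
      Derives (Γ ++ Δ ++ Θ)
        (.eq (pair (letIn x y M N) P) (letIn x y M (pair N P)) (.tensor C D))
  | case_commute {Γ Δ Θ : Ctx} {x y z t : ℕ} {M N P Q R : Tm} {A B C D E : Ty} :
      ((Γ ++ Δ ++ Θ).ext x A).Valid → ((Γ ++ Δ ++ Θ).ext y B).Valid →
      Derives Γ (.tm M (.sum A B)) → Derives (Δ.ext x A) (.tm N (.sum C D)) →
      Derives (Δ.ext y B) (.tm P (.sum C D)) →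
      Derives (Θ.ext z C) (.tm Q E) → Derives (Θ.ext t D) (.tm R E) →
      Derives (Γ ++ Δ ++ Θ)
        (.eq (caseOf M x (caseOf N z Q t R) y (caseOf P z Q t R))
          (caseOf (caseOf M x N y P) z Q t R) E)
  | case_tensor {Γ Δ Θ : Ctx} {a b : ℕ} {Q M N P : Tm} {A B C D : Ty} :
      ((Γ ++ Δ ++ Θ).ext a A).Valid → ((Γ ++ Δ ++ Θ).ext b B).Valid →
      Derives Γ (.tm Q (.sum A B)) → Derives (Δ.ext a A) (.tm M C) →
      Derives (Δ.ext b B) (.tm N C) → Derives Θ (.tm P D) →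
      Derives (Γ ++ Δ ++ Θ)
        (.eq (pair (caseOf Q a M b N) P) (caseOf Q a (pair M P) b (pair N P)) (.tensor C D))
  -- Rules for measurement
  | measure_perm {Γ Δ : Ctx} {n : ℕ} {φ : Fin (n + 1) → Eff} {M : Fin (n + 1) → Tm} {A : Ty}
      (p : Equiv.Perm (Fin (n + 1))) :
      (Γ ++ Δ).Valid → Derives Γ (.le one (bigOvee φ)) → (∀ i, Derives Δ (.tm (M i) A)) →
      Derives (Γ ++ Δ) (.eq (measure φ M) (measure (fun i => φ (p i)) fun i => M (p i)) A)
  | measure_zero {Γ Δ : Ctx} {n : ℕ} {φ : Fin (n + 1) → Eff} {M : Fin (n + 1) → Tm} {N : Tm}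
      {A : Ty} :
      (Γ ++ Δ).Valid → Derives Γ (.le one (bigOvee φ)) → (∀ i, Derives Δ (.tm (M i) A)) →
      Derives Δ (.tm N A) →
      Derives (Γ ++ Δ) (.eq (measure (snoc φ zero) (snoc M N)) (measure φ M) A)
  | measure_one {Γ : Ctx} {M : Tm} {A : Ty} : Derives Γ (.tm M A) →
      Derives Γ (.eq (measure (n := 0) (fun _ => one) fun _ => M) M A)
  | measure_plus {Γ Δ : Ctx} {n : ℕ} {φ ψ : Eff} {χ : Fin n → Eff} {M : Tm} {P : Fin n → Tm}
      {A : Ty} :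
      (Γ ++ Δ).Valid → Derives Γ (.le one (bigOvee (cons φ (cons ψ χ)))) →
      Derives Δ (.tm M A) → (∀ i, Derives Δ (.tm (P i) A)) →
      Derives (Γ ++ Δ) (.eq (measure (cons (ovee φ ψ) χ) (cons M P))
        (measure (cons φ (cons ψ χ)) (cons M (cons M P))) A)
  | measure_case {Γ Δ Θ : Ctx} {n : ℕ} {x y : ℕ} {φ ψ : Fin (n + 1) → Eff} {M : Tm}
      {N : Fin (n + 1) → Tm} {A B C : Ty} :
      ((Γ ++ Δ ++ Θ).ext x A).Valid → ((Γ ++ Δ ++ Θ).ext y B).Valid →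
      Derives (Γ.ext x A) (.le one (bigOvee φ)) → Derives (Γ.ext y B) (.le one (bigOvee ψ)) →
      Derives Δ (.tm M (.sum A B)) → (∀ i, Derives Θ (.tm (N i) C)) →
      Derives (Γ ++ Δ ++ Θ) (.eq (measure (fun i => caseEff M x (φ i) y (ψ i)) N)
        (caseOf M x (measure φ N) y (measure ψ N)) C)
  -- Effect formation
  | zero {Γ : Ctx} : Γ.Valid → Derives Γ (.eff zero)
  | orth {Γ : Ctx} {φ : Eff} : Derives Γ (.eff φ) → Derives Γ (.eff (orth φ))
  | ovee {Γ : Ctx} {φ ψ : Eff} : Derives Γ (.perp φ ψ) → Derives Γ (.eff (ovee φ ψ))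
  | mul {Γ : Ctx} {φ ψ : Eff} : Derives .nil (.eff φ) → Derives Γ (.eff ψ) →
      Derives Γ (.eff (mul φ ψ))
  | caseEff {Γ Δ : Ctx} {x y : ℕ} {φ ψ : Eff} {M : Tm} {A B : Ty} : (Γ ++ Δ).Valid →
      Derives (Γ.ext x A) (.eff φ) → Derives (Γ.ext y B) (.eff ψ) →
      Derives Δ (.tm M (.sum A B)) → Derives (Γ ++ Δ) (.eff (caseEff M x φ y ψ))
  -- Derivability of effects
  | le_refl {Γ : Ctx} {φ : Eff} : Derives Γ (.eff φ) → Derives Γ (.le φ φ)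
  | le_trans {Γ : Ctx} {φ ψ χ : Eff} :
      Derives Γ (.le φ ψ) → Derives Γ (.le ψ χ) → Derives Γ (.le φ χ)
  | zero_le {Γ : Ctx} {φ : Eff} : Derives Γ (.eff φ) → Derives Γ (.le zero φ)
  | orth_antitone {Γ : Ctx} {φ ψ : Eff} :
      Derives Γ (.le φ ψ) → Derives Γ (.le (orth ψ) (orth φ))
  | orth_orth {Γ : Ctx} {φ : Eff} : Derives Γ (.eff φ) → Derives Γ (.le φ (orth (orth φ)))
  | le_ovee {Γ : Ctx} {φ ψ : Eff} : Derives Γ (.perp φ ψ) → Derives Γ (.le φ (ovee φ ψ))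
  | ovee_mono {Γ : Ctx} {φ ψ χ : Eff} : Derives Γ (.le φ ψ) → Derives Γ (.le ψ (orth χ)) →
      Derives Γ (.le (ovee φ χ) (ovee ψ χ))
  | ovee_comm {Γ : Ctx} {φ ψ : Eff} : Derives Γ (.perp φ ψ) →
      Derives Γ (.le (ovee φ ψ) (ovee ψ φ))
  | perp_rotate {Γ : Ctx} {φ ψ χ : Eff} : Derives Γ (.perp (ovee φ ψ) χ) →
      Derives Γ (.perp (ovee ψ χ) φ)
  | ovee_assoc {Γ : Ctx} {φ ψ χ : Eff} : Derives Γ (.perp (ovee φ ψ) χ) →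
      Derives Γ (.le (ovee φ (ovee ψ χ)) (ovee (ovee φ ψ) χ))
  | ovee_zero {Γ : Ctx} {φ : Eff} : Derives Γ (.eff φ) → Derives Γ (.le (ovee φ zero) φ)
  | ortho₁ {Γ : Ctx} {φ ψ : Eff} : Derives Γ (.le one (ovee φ ψ)) → Derives Γ (.le (orth ψ) φ)
  | ortho₂ {Γ : Ctx} {φ : Eff} : Derives Γ (.eff φ) → Derives Γ (.le one (ovee φ (orth φ)))
  | dist_left_perp {Γ : Ctx} {φ ψ χ : Eff} : Derives .nil (.perp φ ψ) → Derives Γ (.eff χ) →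
      Derives Γ (.perp (mul φ χ) (mul ψ χ))
  | dist_left {Γ : Ctx} {φ ψ χ : Eff} {J : Jdg} : Derives .nil (.perp φ ψ) → Derives Γ (.eff χ) →
      J ∈ Jdg.equiv (mul (ovee φ ψ) χ) (ovee (mul φ χ) (mul ψ χ)) → Derives Γ J
  | dist_right_perp {Γ : Ctx} {φ ψ χ : Eff} : Derives .nil (.eff φ) → Derives Γ (.perp ψ χ) →
      Derives Γ (.perp (mul φ ψ) (mul φ χ))
  | dist_right {Γ : Ctx} {φ ψ χ : Eff} {J : Jdg} : Derives .nil (.eff φ) →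
      Derives Γ (.perp ψ χ) →
      J ∈ Jdg.equiv (mul φ (ovee ψ χ)) (ovee (mul φ ψ) (mul φ χ)) → Derives Γ J
  | unit_left {Γ : Ctx} {φ : Eff} {J : Jdg} : Derives Γ (.eff φ) →
      J ∈ Jdg.equiv (mul one φ) φ → Derives Γ J
  | unit_right {Γ : Ctx} {φ : Eff} {J : Jdg} : Γ.Valid → Derives .nil (.eff φ) →
      J ∈ Jdg.equiv (mul φ one) φ → Derives Γ J
  | assoc {Γ : Ctx} {φ ψ χ : Eff} {J : Jdg} : Derives .nil (.eff φ) → Derives .nil (.eff ψ) →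
      Derives Γ (.eff χ) → J ∈ Jdg.equiv (mul φ (mul ψ χ)) (mul (mul φ ψ) χ) → Derives Γ J
  | comm {φ ψ : Eff} {J : Jdg} : Derives .nil (.eff φ) → Derives .nil (.eff ψ) →
      J ∈ Jdg.equiv (mul φ ψ) (mul ψ φ) → Derives .nil J
  | case_cong {Γ Δ : Ctx} {x y : ℕ} {φ ψ : Eff} {M N : Tm} {A B : Ty} {J : Jdg} :
      (Γ ++ Δ).Valid → Derives (Γ.ext x A) (.eff φ) → Derives (Γ.ext y B) (.eff ψ) →
      Derives Δ (.eq M N (.sum A B)) →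
      J ∈ Jdg.equiv (caseEff M x φ y ψ) (caseEff N x φ y ψ) → Derives (Γ ++ Δ) J
  | case_mono {Γ Δ : Ctx} {x y : ℕ} {φ φ' ψ ψ' : Eff} {M : Tm} {A B : Ty} :
      (Γ ++ Δ).Valid → Derives (Γ.ext x A) (.le φ φ') → Derives (Γ.ext y B) (.le ψ ψ') →
      Derives Δ (.tm M (.sum A B)) →
      Derives (Γ ++ Δ) (.le (caseEff M x φ y ψ) (caseEff M x φ' y ψ'))
  | beta_inl_eff {Γ Δ : Ctx} {x y : ℕ} {φ ψ : Eff} {M : Tm} {A B : Ty} {J : Jdg} :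
      (Γ ++ Δ).Valid → Derives (Γ.ext x A) (.eff φ) → Derives (Γ.ext y B) (.eff ψ) →
      Derives Δ (.tm M A) →
      J ∈ Jdg.equiv (caseEff (inl M) x φ y ψ) (subst1 M x φ) → Derives (Γ ++ Δ) J
  | beta_inr_eff {Γ Δ : Ctx} {x y : ℕ} {φ ψ : Eff} {M : Tm} {A B : Ty} {J : Jdg} :
      (Γ ++ Δ).Valid → Derives (Γ.ext x A) (.eff φ) → Derives (Γ.ext y B) (.eff ψ) →
      Derives Δ (.tm M B) →
      J ∈ Jdg.equiv (caseEff (inr M) x φ y ψ) (subst1 M y ψ) → Derives (Γ ++ Δ) J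
  | eta_sum_eff {Γ : Ctx} {x y z : ℕ} {φ : Eff} {A B : Ty} {J : Jdg} :
      ((Γ.ext z (.sum A B)).ext x A).Valid → ((Γ.ext z (.sum A B)).ext y B).Valid →
      Derives (Γ.ext z (.sum A B)) (.eff φ) →
      J ∈ Jdg.equiv φ (caseEff (fvar z) x (subst1 (inl (fvar x)) z φ)
        y (subst1 (inr (fvar y)) z φ)) →
      Derives (Γ.ext z (.sum A B)) J
  | case_ovee {Γ Δ : Ctx} {x y : ℕ} {φ φ' ψ ψ' : Eff} {M : Tm} {A B : Ty} {J : Jdg} :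
      (Γ ++ Δ).Valid → Derives (Γ.ext x A) (.perp φ φ') → Derives (Γ.ext y B) (.perp ψ ψ') →
      Derives Δ (.tm M (.sum A B)) →
      J ∈ Jdg.equiv (caseEff M x (ovee φ φ') y (ovee ψ ψ'))
        (ovee (caseEff M x φ y ψ) (caseEff M x φ' y ψ')) →
      Derives (Γ ++ Δ) J
  | case_orth {Γ Δ : Ctx} {x y : ℕ} {φ ψ : Eff} {M : Tm} {A B : Ty} {J : Jdg} :
      (Γ ++ Δ).Valid → Derives (Γ.ext x A) (.eff φ) → Derives (Γ.ext y B) (.eff ψ) →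
      Derives Δ (.tm M (.sum A B)) →
      J ∈ Jdg.equiv (caseEff M x (orth φ) y (orth ψ)) (orth (caseEff M x φ y ψ)) →
      Derives (Γ ++ Δ) J
  | case_le {Γ Δ : Ctx} {x y : ℕ} {φ ψ χ : Eff} {M : Tm} {A B : Ty} :
      (Γ ++ Δ).Valid → ¬ Occurs x χ → ¬ Occurs y χ →
      Derives Γ (.tm M (.sum A B)) → Derives (Δ.ext x A) (.le φ χ) →
      Derives (Δ.ext y B) (.le ψ χ) → Derives (Γ ++ Δ) (.le (caseEff M x φ y ψ) χ)
  | case_mul {Γ Δ : Ctx} {x y : ℕ} {φ ψ χ : Eff} {M : Tm} {A B : Ty} {J : Jdg} :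
      (Γ ++ Δ).Valid → Derives (Γ.ext x A) (.eff φ) → Derives (Γ.ext y B) (.eff ψ) →
      Derives Δ (.tm M (.sum A B)) → Derives .nil (.eff χ) →
      J ∈ Jdg.equiv (caseEff M x (mul χ φ) y (mul χ ψ)) (mul χ (caseEff M x φ y ψ)) →
      Derives (Γ ++ Δ) J

end QPEL

/-! ## Interpretation of QPEL in a state-and-effect triangle -/

namespace QPEL


section Objects

variable (V : Type u) [Category.{v} V] [MonoidalCategory V] [HasBinaryCoproducts V]

/-- The object `⟦A⟧`. -/
noncomputable def Ty.obj : Ty → V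
  | .tensor A B => Ty.obj A ⊗ Ty.obj B
  | .unit => 𝟙_ V
  | .sum A B => Ty.obj A ⨿ Ty.obj B

/-- The object `⟦Γ⟧`. -/
noncomputable def Ctx.obj : Ctx → V
  | .nil => 𝟙_ V
  | .ext Γ _ A => Ctx.obj Γ ⊗ A.obj V

/-- The canonical isomorphism `⟦Γ, Δ⟧ ≅ ⟦Γ⟧ ⊗ ⟦Δ⟧`. -/
noncomputable def Ctx.split (Γ : Ctx) : (Δ : Ctx) → ((Γ ++ Δ).obj V ≅ Γ.obj V ⊗ Δ.obj V)
  | .nil => (ρ_ (Γ.obj V)).symm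
  | .ext Δ _ A => whiskerRightIso (Ctx.split Γ Δ) (A.obj V) ≪≫
      α_ (Γ.obj V) (Δ.obj V) (A.obj V)

/-- The isomorphism `⟦Γ, y : B, x : A, Δ⟧ ≅ ⟦Γ, x : A, y : B, Δ⟧`. -/
noncomputable def Ctx.swap [SymmetricCategory V] (Γ : Ctx) (x y : ℕ) (A B : Ty) : (Δ : Ctx) →
    (((Γ.ext y B).ext x A ++ Δ).obj V ≅ ((Γ.ext x A).ext y B ++ Δ).obj V)
  | .nil => α_ (Γ.obj V) (B.obj V) (A.obj V) ≪≫
      whiskerLeftIso (Γ.obj V) (β_ (B.obj V) (A.obj V)) ≪≫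
      (α_ (Γ.obj V) (A.obj V) (B.obj V)).symm
  | .ext Δ _ C => whiskerRightIso (Ctx.swap Γ x y A B Δ) (C.obj V)

end Objects

namespace Triangle

variable {V : Type u} [Category.{v} V] [MonoidalCategory V] [SymmetricCategory V]
  [HasBinaryCoproducts V] [IsMonoidalDistrib V] {E : Type w} [CommEffectMonoid E]
  (T : Triangle V E)

/-- The effect module of predicates on `A`. -/
abbrev Pred (A : V) : Type w := predObj T.P A

/-- The predicate transformer `P f : P B → P A`. -/
abbrev pull {A B : V} (f : A ⟶ B) : T.Pred B → T.Pred A := predMap T.P f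

/-- The unique arrow `! : A ⟶ I`. -/
def bang (A : V) : A ⟶ 𝟙_ V := T.unitTerminal.from A

/-- `P I` is initial in `EMod_E`, because `P` preserves the terminal object. -/
noncomputable def predUnitIsInitial : IsInitial (T.P.obj (𝟙_ V)).unop :=
  haveI := T.preservesTerminal
  initialUnopOfTerminal (IsTerminal.isTerminalObj T.P (𝟙_ V) T.unitTerminal)

/-- The isomorphism `P I ≅ E`. -/
noncomputable def predUnitIso : (T.P.obj (𝟙_ V)).unop ≅ EModCat.self E :=
  T.predUnitIsInitial.uniqueUpToIso (EModCat.selfIsInitial E)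

/-- The scalar that corresponds to a predicate on `I`. -/
noncomputable def scalar (p : T.Pred (𝟙_ V)) : E := T.predUnitIso.hom.toFun p

/-- The projection `⟦Γ⟧ ⟶ ⟦A⟧` onto a variable `x : A ∈ Γ`, which discards the other variables. -/
noncomputable def proj {x : ℕ} {A : Ty} : {Γ : Ctx} → Γ.Has x A → (Γ.obj V ⟶ A.obj V)
  | .ext Γ _ _, .here => T.bang (Γ.obj V) ▷ A.obj V ≫ (λ_ (A.obj V)).hom
  | .ext Γ _ B, .there h => Γ.obj V ◁ T.bang (B.obj V) ≫ (ρ_ (Γ.obj V)).hom ≫ proj h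

mutual

/-- `T.TmDen Γ M A f`: by the clauses of the interpretation, `⟦Γ ⊢ M : A⟧` is the arrow
`f : ⟦Γ⟧ ⟶ ⟦A⟧`. There is one clause for each rule of term formation and one for exchange. That the
clauses assign exactly one arrow to a derivable term is not assumed; see `TmInterp`. -/
inductive TmDen : (Γ : Ctx) → Tm → (A : Ty) → (Γ.obj V ⟶ A.obj V) → Prop
  | exch {Γ Δ : Ctx} {x y : ℕ} {A B C : Ty} {M : Tm}
      {f : ((Γ.ext x A).ext y B ++ Δ).obj V ⟶ C.obj V} :
      TmDen ((Γ.ext x A).ext y B ++ Δ) M C f →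
      TmDen ((Γ.ext y B).ext x A ++ Δ) M C ((Ctx.swap V Γ x y A B Δ).hom ≫ f)
  | var {Γ : Ctx} {x : ℕ} {A : Ty} (hΓ : Γ.Valid) (h : Γ.Has x A) :
      TmDen Γ (.fvar x) A (T.proj h)
  | pair {Γ Δ : Ctx} {M N : Tm} {A B : Ty} {f : Γ.obj V ⟶ A.obj V} {g : Δ.obj V ⟶ B.obj V} :
      (Γ ++ Δ).Valid → TmDen Γ M A f → TmDen Δ N B g →
      TmDen (Γ ++ Δ) (.pair M N) (.tensor A B) ((Ctx.split V Γ Δ).hom ≫ (f ⊗ₘ g))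
  | letIn {Γ Δ : Ctx} {x y : ℕ} {M N : Tm} {A B C : Ty} {f : Γ.obj V ⟶ (Ty.tensor A B).obj V}
      {g : ((Δ.ext x A).ext y B).obj V ⟶ C.obj V} :
      (Γ ++ Δ).Valid → TmDen Γ M (.tensor A B) f → TmDen ((Δ.ext x A).ext y B) N C g →
      TmDen (Γ ++ Δ) (.letIn x y M N) C
        ((Ctx.split V Γ Δ).hom ≫ f ▷ Δ.obj V ≫ (β_ (A.obj V ⊗ B.obj V) (Δ.obj V)).hom ≫
          (α_ (Δ.obj V) (A.obj V) (B.obj V)).inv ≫ g)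
  | unit {Γ : Ctx} : Γ.Valid → TmDen Γ .unit .unit (T.bang (Γ.obj V))
  | inl {Γ : Ctx} {M : Tm} {A B : Ty} {f : Γ.obj V ⟶ A.obj V} :
      TmDen Γ M A f → TmDen Γ (.inl M) (.sum A B) (f ≫ coprod.inl)
  | inr {Γ : Ctx} {M : Tm} {A B : Ty} {f : Γ.obj V ⟶ B.obj V} :
      TmDen Γ M B f → TmDen Γ (.inr M) (.sum A B) (f ≫ coprod.inr)
  | caseOf {Γ Δ : Ctx} {x y : ℕ} {M N P : Tm} {A B C : Ty} {f : Γ.obj V ⟶ (Ty.sum A B).obj V}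
      {g : (Δ.ext x A).obj V ⟶ C.obj V} {h : (Δ.ext y B).obj V ⟶ C.obj V} :
      (Γ ++ Δ).Valid → TmDen Γ M (.sum A B) f → TmDen (Δ.ext x A) N C g →
      TmDen (Δ.ext y B) P C h →
      TmDen (Γ ++ Δ) (.caseOf M x N y P) C
        ((Ctx.split V Γ Δ).hom ≫ f ▷ Δ.obj V ≫ (β_ (A.obj V ⨿ B.obj V) (Δ.obj V)).hom ≫
          (leftDistrib (Δ.obj V) (A.obj V) (B.obj V)).inv ≫ coprod.desc g h)
  | measure {Γ Δ : Ctx} {n : ℕ} {φ : Fin (n + 1) → Eff} {M : Fin (n + 1) → Tm} {A : Ty}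
      {p : Fin (n + 1) → T.Pred (Γ.obj V)} {f : Fin (n + 1) → (Δ.obj V ⟶ A.obj V)} :
      (Γ ++ Δ).Valid → (∀ i, EffDen Γ (φ i) (p i)) → (hp : IsTest p) →
      (∀ i, TmDen Δ (M i) A (f i)) →
      TmDen (Γ ++ Δ) (.measure φ M) A
        ((Ctx.split V Γ Δ).hom ≫ T.meas p hp ▷ Δ.obj V ≫
          (β_ (copower V n) (Δ.obj V)).hom ≫ copower.branch n f)

/-- `T.EffDen Γ φ p`: by the clauses of the interpretation, `⟦Γ ⊢ φ eff⟧` is the element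
`p ∈ P⟦Γ⟧`. -/
inductive EffDen : (Γ : Ctx) → Eff → T.Pred (Γ.obj V) → Prop
  | exch {Γ Δ : Ctx} {x y : ℕ} {A B : Ty} {φ : Eff}
      {p : T.Pred (((Γ.ext x A).ext y B ++ Δ).obj V)} :
      EffDen ((Γ.ext x A).ext y B ++ Δ) φ p →
      EffDen ((Γ.ext y B).ext x A ++ Δ) φ (T.pull (Ctx.swap V Γ x y A B Δ).hom p)
  | zero {Γ : Ctx} : Γ.Valid → EffDen Γ .zero 0
  | orth {Γ : Ctx} {φ : Eff} {p : T.Pred (Γ.obj V)} :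
      EffDen Γ φ p → EffDen Γ (.orth φ) (EffectAlgebra.orth p)
  | ovee {Γ : Ctx} {φ ψ : Eff} {p q s : T.Pred (Γ.obj V)} :
      EffDen Γ φ p → EffDen Γ ψ q → PartialCommMonoid.ovee p q = some s →
      EffDen Γ (.ovee φ ψ) s
  | mul {Γ : Ctx} {φ ψ : Eff} {p : T.Pred (Ctx.nil.obj V)} {q : T.Pred (Γ.obj V)} :
      EffDen .nil φ p → EffDen Γ ψ q → EffDen Γ (.mul φ ψ) (T.scalar p • q)
  /-- The pair `(p, q) ∈ P(⟦Γ⟧ ⊗ ⟦A⟧) × P(⟦Γ⟧ ⊗ ⟦B⟧)` is the element `r` of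
  `P(⟦Γ⟧ ⊗ (⟦A⟧ + ⟦B⟧))` that has `p` and `q` as components. -/
  | caseEff {Γ Δ : Ctx} {x y : ℕ} {φ ψ : Eff} {M : Tm} {A B : Ty}
      {p : T.Pred ((Γ.ext x A).obj V)} {q : T.Pred ((Γ.ext y B).obj V)}
      {f : Δ.obj V ⟶ (Ty.sum A B).obj V} {r : T.Pred (Γ.obj V ⊗ (A.obj V ⨿ B.obj V))} :
      (Γ ++ Δ).Valid → EffDen (Γ.ext x A) φ p → EffDen (Γ.ext y B) ψ q →
      TmDen Δ M (.sum A B) f →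
      T.pull (Γ.obj V ◁ coprod.inl) r = p → T.pull (Γ.obj V ◁ coprod.inr) r = q →
      EffDen (Γ ++ Δ) (.caseEff M x φ y ψ)
        (T.pull ((Ctx.split V Γ Δ).hom ≫ Γ.obj V ◁ f) r)

end

/-- `⟦Γ ⊢ M : A⟧ = f`: the interpretation is defined, uniquely determined, and equal to `f`. -/
def TmInterp (Γ : Ctx) (M : Tm) (A : Ty) (f : Γ.obj V ⟶ A.obj V) : Prop :=
  ∀ g, T.TmDen Γ M A g ↔ g = f

/-- `⟦Γ ⊢ φ eff⟧ = p`: the interpretation is defined, uniquely determined, and equal to `p`. -/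
def EffInterp (Γ : Ctx) (φ : Eff) (p : T.Pred (Γ.obj V)) : Prop :=
  ∀ q, T.EffDen Γ φ q ↔ q = p

end Triangle

end QPEL

set_option linter.unusedSectionVars false

namespace QPEL

/-! ## Structural maps between contexts -/

/-- Variables of expressions under binders: free variables, and the levels of bound variables. -/
inductive Key : Type
  | free (x : ℕ)
  | level (j : ℕ)

/-- Contexts that also declare bound variables; the last declaration comes first. -/
abbrev Scope : Type := List (Key × Ty)

section Swap

variable {V : Type u} [Category.{v} V] [MonoidalCategory V] [SymmetricCategory V]

/-- Exchange of the last two factors. -/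
def swapRight (X A B : V) : (X ⊗ A) ⊗ B ⟶ (X ⊗ B) ⊗ A :=
  (α_ X A B).hom ≫ X ◁ (β_ A B).hom ≫ (α_ X B A).inv

@[simp]
theorem swapRight_swapRight (X A B : V) : swapRight X A B ≫ swapRight X B A = 𝟙 _ := by
  simp only [swapRight, Category.assoc, Iso.inv_hom_id_assoc]
  rw [← MonoidalCategory.whiskerLeft_comp_assoc]
  simp

theorem swapRight_naturality {X X' A A' B B' : V} (f : X ⟶ X') (g : A ⟶ A') (h : B ⟶ B') :
    ((f ⊗ₘ g) ⊗ₘ h) ≫ swapRight X' A' B' = swapRight X A B ≫ ((f ⊗ₘ h) ⊗ₘ g) := by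
  simp only [swapRight, Category.assoc]
  rw [associator_naturality_assoc, ← MonoidalCategory.id_tensorHom,
    ← MonoidalCategory.id_tensorHom, tensorHom_comp_tensorHom_assoc,
    BraidedCategory.braiding_naturality, ← associator_inv_naturality,
    tensorHom_comp_tensorHom_assoc, Category.id_comp, Category.comp_id]

theorem swapRight_whisker_left {X X' : V} (f : X ⟶ X') (A B : V) :
    f ▷ A ▷ B ≫ swapRight X' A B = swapRight X A B ≫ f ▷ B ▷ A := by
  simpa using swapRight_naturality f (𝟙 A) (𝟙 B)

theorem swapRight_yang_baxter (X A B C : V) :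
    swapRight (X ⊗ A) B C ≫ swapRight X A C ▷ B ≫ swapRight (X ⊗ C) A B =
      swapRight X A B ▷ C ≫ swapRight (X ⊗ B) A C ≫ swapRight X B C ▷ A := by
  have h := congrArg (fun k : A ⊗ B ⊗ C ⟶ C ⊗ B ⊗ A => (α_ (X ⊗ A) B C).hom ≫
    (α_ X A (B ⊗ C)).hom ≫ X ◁ k ≫ (α_ X C (B ⊗ A)).inv ≫ (α_ (X ⊗ C) B A).inv)
    (BraidedCategory.yang_baxter A B C)
  simp only [swapRight]
  refine Eq.trans ?_ (h.symm.trans ?_)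
  · monoidal
  · monoidal

theorem swapRight_assoc_left (D X A B : V) :
    (α_ D X A).inv ▷ B ≫ swapRight (D ⊗ X) A B ≫ (α_ D X B).hom ▷ A =
      (α_ D (X ⊗ A) B).hom ≫ D ◁ swapRight X A B ≫ (α_ D (X ⊗ B) A).inv := by
  simp only [swapRight]
  monoidal

theorem swapRight_unit (X A : V) :
    (ρ_ (X ⊗ A)).inv ≫ swapRight X A (𝟙_ V) = (ρ_ X).inv ▷ A := by
  simp [swapRight]

theorem swapRight_tensor (X A B C : V) :
    (α_ (X ⊗ A) B C).inv ≫ swapRight X A B ▷ C ≫ swapRight (X ⊗ B) A C ≫ (α_ X B C).hom ▷ A =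
      swapRight X A (B ⊗ C) := by
  have h := BraidedCategory.hexagon_forward A B C
  have h' : (β_ A (B ⊗ C)).hom = (α_ A B C).inv ≫ (β_ A B).hom ▷ C ≫ (α_ B A C).hom ≫
      B ◁ (β_ A C).hom ≫ (α_ B C A).inv := by
    rw [← cancel_epi (α_ A B C).hom, ← cancel_mono (α_ B C A).hom]; simp
  simp only [swapRight]
  rw [h']
  monoidal

end Swap

end QPEL

namespace QPEL

section Objects

variable (V : Type u) [Category.{v} V] [MonoidalCategory V] [HasBinaryCoproducts V]

/-- The object of a scope. -/
@[reducible]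
noncomputable def Scope.obj : Scope → V
  | [] => 𝟙_ V
  | a :: Γ => Scope.obj Γ ⊗ a.2.obj V

/-- The object of a concatenation is the tensor product of the objects. -/
noncomputable def Scope.split : (Δ Γ : Scope) →
    (Scope.obj V (Δ ++ Γ) ≅ Scope.obj V Γ ⊗ Scope.obj V Δ)
  | [], Γ => (ρ_ (Scope.obj V Γ)).symm
  | a :: Δ, Γ => whiskerRightIso (Scope.split Δ Γ) (a.2.obj V) ≪≫
      α_ (Scope.obj V Γ) (Scope.obj V Δ) (a.2.obj V)

/-- `Extract V Ξ a Ξ' e`: the arrow `e` moves the declaration `a` of `Ξ` to the end and leaves `Ξ'`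
in front of it. -/
inductive Extract [SymmetricCategory V] : (Ξ : Scope) → (a : Key × Ty) → (Ξ' : Scope) →
    (Scope.obj V Ξ ⟶ Scope.obj V Ξ' ⊗ a.2.obj V) → Prop
  | here {Ξ : Scope} {a : Key × Ty} : Extract (a :: Ξ) a Ξ (𝟙 (Scope.obj V Ξ ⊗ a.2.obj V))
  | there {Ξ Ξ' : Scope} {a b : Key × Ty} {e : Scope.obj V Ξ ⟶ Scope.obj V Ξ' ⊗ a.2.obj V} :
      Extract Ξ a Ξ' e →
      Extract (b :: Ξ) a (b :: Ξ') (e ▷ b.2.obj V ≫ swapRight _ (a.2.obj V) (b.2.obj V))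

end Objects

section Auxiliary

variable {V : Type u} [Category.{v} V] [MonoidalCategory V]

theorem split_assoc_aux {P A B C R S U : V} {π : P ⟶ R} {s : R ⟶ A ⊗ S} {t : S ⟶ B ⊗ C}
    {r : P ⟶ U ⊗ C} {q : U ⟶ A ⊗ B} (h : π ≫ s ≫ A ◁ t = r ≫ q ▷ C ≫ (α_ A B C).hom) (D : V) :
    π ▷ D ≫ (s ▷ D ≫ (α_ A S D).hom) ≫ A ◁ (t ▷ D ≫ (α_ B C D).hom) =
      (r ▷ D ≫ (α_ U C D).hom) ≫ q ▷ (C ⊗ D) ≫ (α_ A B (C ⊗ D)).hom := by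
  have h' := congrArg (fun k => k ▷ D ≫ (α_ A (B ⊗ C) D).hom ≫ A ◁ (α_ B C D).hom) h
  simp only [comp_whiskerRight, Category.assoc] at h' ⊢
  refine Eq.trans ?_ (h'.trans ?_) <;> monoidal

theorem str_append_aux {Y Y' Z X X' D D' W A : V} {e' : Y ⟶ Y' ⊗ A} {s : Y ⟶ D ⊗ X}
    {s' : Y' ⟶ D ⊗ X'} {e : X ⟶ X' ⊗ A} (h : e' ≫ s' ▷ A = s ≫ D ◁ e ≫ (α_ D X' A).inv)
    {π : Y' ⟶ Z} {t : Z ⟶ D' ⊗ W} {π₁ : D ⟶ D'} {π₂ : X' ⟶ W} (h₂ : π ≫ t = s' ≫ (π₁ ⊗ₘ π₂)) :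
    (e' ≫ π ▷ A) ≫ t ▷ A ≫ (α_ D' W A).hom = s ≫ (π₁ ⊗ₘ (e ≫ π₂ ▷ A)) := by
  rw [Category.assoc, ← comp_whiskerRight_assoc, h₂, comp_whiskerRight_assoc, reassoc_of% h,
    MonoidalCategory.tensorHom_def, MonoidalCategory.tensorHom_def]
  simp only [MonoidalCategory.whiskerLeft_comp, comp_whiskerRight, Category.assoc,
    associator_naturality_middle, associator_naturality_left_assoc, Iso.inv_hom_id_assoc,
    MonoidalCategory.whisker_exchange_assoc]

theorem discard_aux {Y D X G A : V} (s : Y ⟶ D ⊗ X) (π : D ⟶ G) (k : X ⟶ 𝟙_ V) (l : A ⟶ 𝟙_ V) :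
    Y ◁ l ≫ (ρ_ _).hom ≫ s ≫ (π ⊗ₘ k) ≫ (ρ_ _).hom =
      (s ▷ A ≫ (α_ _ _ _).hom) ≫ (π ⊗ₘ (k ▷ A ≫ 𝟙_ V ◁ l ≫ (ρ_ _).hom)) ≫ (ρ_ _).hom := by
  have h : Y ◁ l ≫ (ρ_ _).hom ≫ s ≫ (π ⊗ₘ k) ≫ (ρ_ _).hom =
      (s ≫ (π ⊗ₘ k) ≫ (ρ_ _).hom) ▷ A ≫ G ◁ l ≫ (ρ_ _).hom := by
    rw [← MonoidalCategory.whisker_exchange_assoc, rightUnitor_naturality]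
  rw [h]
  simp only [MonoidalCategory.tensorHom_def]
  monoidal

end Auxiliary

section Extract

variable {V : Type u} [Category.{v} V] [MonoidalCategory V] [SymmetricCategory V]

theorem extract_exchange_aux {X X₁ X₂ X₃ A B : V} {eb : X ⟶ X₁ ⊗ B} {ea : X₁ ⟶ X₂ ⊗ A}
    {e₁ : X ⟶ X₃ ⊗ A} {e₂ : X₃ ⟶ X₂ ⊗ B}
    (h : eb ≫ ea ▷ B ≫ swapRight X₂ A B = e₁ ≫ e₂ ▷ A) (C : V) :
    (eb ▷ C ≫ swapRight X₁ B C) ≫ (ea ▷ C ≫ swapRight X₂ A C) ▷ B ≫ swapRight (X₂ ⊗ C) A B =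
      (e₁ ▷ C ≫ swapRight X₃ A C) ≫ (e₂ ▷ C ≫ swapRight X₂ B C) ▷ A := by
  have h' := congrArg (fun k => k ▷ C ≫ swapRight (X₂ ⊗ B) A C ≫ swapRight X₂ B C ▷ A) h
  simp only [comp_whiskerRight, Category.assoc] at h' ⊢
  rw [← reassoc_of% swapRight_whisker_left, ← reassoc_of% swapRight_whisker_left, swapRight_yang_baxter, h']

theorem extract_append_left_aux {Y Y' D X X' A : V} {e' : Y ⟶ Y' ⊗ A} {s : Y ⟶ D ⊗ X}
    {s' : Y' ⟶ D ⊗ X'} {e : X ⟶ X' ⊗ A} (h : e' ≫ s' ▷ A = s ≫ D ◁ e ≫ (α_ D X' A).inv) (B : V) :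
    (e' ▷ B ≫ swapRight Y' A B) ≫ (s' ▷ B ≫ (α_ D X' B).hom) ▷ A =
      (s ▷ B ≫ (α_ D X B).hom) ≫ D ◁ (e ▷ B ≫ swapRight X' A B) ≫ (α_ D (X' ⊗ B) A).inv := by
  have h' := congrArg (fun k => k ▷ B ≫ swapRight (D ⊗ X') A B ≫ (α_ D X' B).hom ▷ A) h
  simp only [comp_whiskerRight, Category.assoc] at h' ⊢
  rw [← reassoc_of% swapRight_whisker_left, h', swapRight_assoc_left]
  monoidal

theorem extract_append_right_aux {Y Y' D X X' A : V} {e' : Y ⟶ Y' ⊗ A} {s : Y ⟶ X ⊗ D}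
    {s' : Y' ⟶ X' ⊗ D} {e : X ⟶ X' ⊗ A} (h : e' ≫ s' ▷ A = s ≫ e ▷ D ≫ swapRight X' A D) (B : V) :
    (e' ▷ B ≫ swapRight Y' A B) ≫ (s' ▷ B ≫ (α_ X' D B).hom) ▷ A =
      (s ▷ B ≫ (α_ X D B).hom) ≫ e ▷ (D ⊗ B) ≫ swapRight X' A (D ⊗ B) := by
  have h' := congrArg (fun k => k ▷ B ≫ swapRight (X' ⊗ D) A B ≫ (α_ X' D B).hom ▷ A) h
  simp only [comp_whiskerRight, Category.assoc] at h' ⊢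
  rw [← reassoc_of% swapRight_whisker_left, h', ← swapRight_tensor]
  monoidal

theorem swapRight_braiding (X A Y : V) :
    swapRight X A Y ≫ (β_ X Y).hom ▷ A ≫ (α_ Y X A).hom = (β_ (X ⊗ A) Y).hom := by
  have h' : (β_ (X ⊗ A) Y).hom = (α_ X A Y).hom ≫ X ◁ (β_ A Y).hom ≫ (α_ X Y A).inv ≫
      (β_ X Y).hom ▷ A ≫ (α_ Y X A).hom := by
    rw [← cancel_epi (α_ X A Y).inv, ← cancel_mono (α_ Y X A).inv]; simp
  rw [h', swapRight]
  simp

theorem swapRight_unit_hom (X A : V) :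
    swapRight X A (𝟙_ V) ≫ (ρ_ X).hom ▷ A = (ρ_ (X ⊗ A)).hom := by
  rw [← cancel_epi (ρ_ (X ⊗ A)).inv, ← Category.assoc, swapRight_unit, ← comp_whiskerRight]
  simp

theorem swapRight_whiskerLeft (X A : V) {B : V} (k : B ⟶ 𝟙_ V) :
    swapRight X A B ≫ (X ◁ k) ▷ A ≫ (ρ_ X).hom ▷ A = (X ⊗ A) ◁ k ≫ (ρ_ (X ⊗ A)).hom := by
  have := swapRight_naturality (𝟙 X) (𝟙 A) k
  simp only [id_whiskerRight, id_tensorHom, tensorHom_id] at this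
  rw [← reassoc_of% this, swapRight_unit_hom]

variable [HasBinaryCoproducts V]

theorem Extract.perm {Ξ Ξ' : Scope} {a : Key × Ty} {e} (h : Extract V Ξ a Ξ' e) :
    Ξ.Perm (a :: Ξ') := by
  induction h with
  | here => exact List.Perm.refl _
  | there _ ih => exact (ih.cons _).trans (List.Perm.swap _ _ _)

theorem Extract.functional {Ξ Ξ₁ Ξ₂ : Scope} {a : Key × Ty} {e₁ e₂} (hΞ : Ξ.Nodup)
    (h₁ : Extract V Ξ a Ξ₁ e₁) (h₂ : Extract V Ξ a Ξ₂ e₂) :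
    (⟨Ξ₁, e₁⟩ : Σ Ξ', Scope.obj V Ξ ⟶ Scope.obj V Ξ' ⊗ a.2.obj V) = ⟨Ξ₂, e₂⟩ := by
  induction h₁ generalizing Ξ₂ with
  | here =>
    cases h₂ with
    | here => rfl
    | there h =>
      exact absurd (h.perm.mem_iff.2 List.mem_cons_self) (List.nodup_cons.1 hΞ).1
  | there h ih =>
    cases h₂ with
    | here => exact absurd (h.perm.mem_iff.2 List.mem_cons_self) (List.nodup_cons.1 hΞ).1
    | there h' =>
      have := ih (List.nodup_cons.1 hΞ).2 h'
      cases this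
      rfl

theorem Extract.exists_of_mem {Ξ : Scope} {a : Key × Ty} (h : a ∈ Ξ) :
    ∃ Ξ' e, Extract V Ξ a Ξ' e := by
  induction Ξ with
  | nil => cases h
  | cons b Ξ ih =>
    by_cases hab : a = b
    · subst hab
      exact ⟨_, _, .here⟩
    · obtain ⟨_, _, h⟩ := ih (List.mem_of_ne_of_mem hab h)
      exact ⟨_, _, h.there⟩

theorem Extract.exchange {Ξ Ξ₁ : Scope} {b : Key × Ty} {eb} (hb : Extract V Ξ b Ξ₁ eb)
    {Ξ₂ : Scope} {a : Key × Ty} {ea} (ha : Extract V Ξ₁ a Ξ₂ ea) :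
    ∃ Ξ₃ e₁ e₂, Extract V Ξ a Ξ₃ e₁ ∧ Extract V Ξ₃ b Ξ₂ e₂ ∧
      eb ≫ ea ▷ b.2.obj V ≫ swapRight _ (a.2.obj V) (b.2.obj V) = e₁ ≫ e₂ ▷ a.2.obj V := by
  induction hb generalizing Ξ₂ with
  | here =>
    refine ⟨_, _, _, ha.there, .here, ?_⟩
    exact (Category.id_comp _).trans
      ((congrArg _ (id_whiskerRight _ _)).trans (Category.comp_id _)).symm
  | @there Ξ Ξ₁ b c eb hb ih =>
    cases ha with
    | here =>
      refine ⟨_, _, _, .here, hb, ?_⟩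
      refine Eq.trans ?_ (Category.id_comp _).symm
      refine (Category.assoc _ _ _).trans ?_
      refine (congrArg (fun k => eb ▷ _ ≫ swapRight _ _ _ ≫ k)
        (congrArg (fun k => k ≫ swapRight _ _ _) (id_whiskerRight _ _))).trans ?_
      rw [Category.id_comp, swapRight_swapRight, Category.comp_id]
    | there ha =>
      obtain ⟨Ξ₃, e₁, e₂, h₁, h₂, h⟩ := ih ha
      exact ⟨_, _, _, h₁.there, h₂.there, extract_exchange_aux h _⟩

theorem Extract.append_left {Ξ Ξ' : Scope} {a : Key × Ty} {e} (h : Extract V Ξ a Ξ' e)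
    (Θ : Scope) : ∃ e', Extract V (Ξ ++ Θ) a (Ξ' ++ Θ) e' ∧
      e' ≫ (Scope.split V Ξ' Θ).hom ▷ a.2.obj V =
        (Scope.split V Ξ Θ).hom ≫ Scope.obj V Θ ◁ e ≫ (α_ _ _ _).inv := by
  induction h with
  | here =>
    refine ⟨_, .here, ?_⟩
    refine (Category.id_comp _).trans ?_
    refine Eq.trans ?_ (Category.assoc (_ ▷ _) (α_ _ _ _).hom _).symm
    exact Eq.trans (by simp) (congrArg (fun k => _ ≫ (α_ _ _ _).hom ≫ k ≫ _)
      (MonoidalCategory.whiskerLeft_id _ _).symm)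
  | there _ ih =>
    obtain ⟨e', he', h⟩ := ih
    exact ⟨_, he'.there, extract_append_left_aux h _⟩

theorem Extract.append_right {Ξ Ξ' : Scope} {a : Key × Ty} {e} (h : Extract V Ξ a Ξ' e)
    (Θ : Scope) : ∃ e', Extract V (Θ ++ Ξ) a (Θ ++ Ξ') e' ∧
      e' ≫ (Scope.split V Θ Ξ').hom ▷ a.2.obj V =
        (Scope.split V Θ Ξ).hom ≫ e ▷ Scope.obj V Θ ≫ swapRight _ (a.2.obj V) _ := by
  induction Θ with
  | nil =>
    refine ⟨e, h, ?_⟩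
    change e ≫ (ρ_ (Scope.obj V Ξ')).inv ▷ a.2.obj V =
      (ρ_ (Scope.obj V Ξ)).inv ≫ e ▷ 𝟙_ V ≫ swapRight (Scope.obj V Ξ') (a.2.obj V) (𝟙_ V)
    rw [← swapRight_unit]
    simp
  | cons b Θ ih =>
    obtain ⟨e', he', h⟩ := ih
    exact ⟨_, he'.there, extract_append_right_aux h _⟩

end Extract

section Str

variable {V : Type u} [Category.{v} V] [MonoidalCategory V] [SymmetricCategory V]
  [HasBinaryCoproducts V] [IsMonoidalDistrib V] {E : Type w} [CommEffectMonoid E]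

theorem Triangle.bang_unique (T : Triangle V E) {A : V} (f g : A ⟶ 𝟙_ V) : f = g :=
  T.unitTerminal.hom_ext f g

variable (T : Triangle V E)

/-- `Str T Ξ Γ π`: the arrow `π` permutes and discards declarations of `Ξ` so that `Γ` is left. -/
inductive Str : (Ξ Γ : Scope) → (Scope.obj V Ξ ⟶ Scope.obj V Γ) → Prop
  | nil {Ξ : Scope} : Str Ξ [] (T.bang (Scope.obj V Ξ))
  | cons {Ξ Ξ' Γ : Scope} {a : Key × Ty} {e : Scope.obj V Ξ ⟶ Scope.obj V Ξ' ⊗ a.2.obj V}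
      {π : Scope.obj V Ξ' ⟶ Scope.obj V Γ} :
      Extract V Ξ a Ξ' e → Str Ξ' Γ π → Str Ξ (a :: Γ) (e ≫ π ▷ a.2.obj V)

variable {T}

namespace Str

theorem of_eq {Ξ Γ : Scope} {π₁ π₂} (h : Str T Ξ Γ π₁) (he : π₁ = π₂) : Str T Ξ Γ π₂ := he ▸ h

theorem functional {Ξ Γ : Scope} {π₁ π₂} (hΞ : Ξ.Nodup) (h₁ : Str T Ξ Γ π₁)
    (h₂ : Str T Ξ Γ π₂) : π₁ = π₂ := by
  induction h₁ with
  | nil => cases h₂; rfl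
  | cons he _ ih =>
    cases h₂ with
    | cons he' h' =>
      have := he.functional hΞ he'
      cases this
      rw [ih (List.nodup_cons.1 (he.perm.nodup_iff.1 hΞ)).2 h']

theorem exists_of_subset {Ξ Γ : Scope} (hΓ : Γ.Nodup) (h : Γ ⊆ Ξ) : ∃ π, Str T Ξ Γ π := by
  induction Γ generalizing Ξ with
  | nil => exact ⟨_, .nil⟩
  | cons a Γ ih =>
    obtain ⟨Ξ', e, he⟩ := Extract.exists_of_mem (V := V) (h List.mem_cons_self)
    obtain ⟨π, hπ⟩ := ih (Ξ := Ξ') (List.nodup_cons.1 hΓ).2 fun b hb => by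
      refine List.mem_of_ne_of_mem ?_ (he.perm.mem_iff.1 (h (List.mem_cons_of_mem _ hb)))
      rintro rfl
      exact (List.nodup_cons.1 hΓ).1 hb
    exact ⟨_, .cons he hπ⟩

theorem extract {Ξ Γ Γ' : Scope} {a : Key × Ty} {π e} (h : Str T Ξ Γ π)
    (he : Extract V Γ a Γ' e) : ∃ Ξ' e' π', Extract V Ξ a Ξ' e' ∧ Str T Ξ' Γ' π' ∧
      π ≫ e = e' ≫ π' ▷ a.2.obj V := by
  induction he generalizing Ξ with
  | here =>
    cases h with
    | cons he h => exact ⟨_, _, _, he, h, Category.comp_id _⟩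
  | @there Γ Γ' a b e he ih =>
    cases h with
    | @cons _ Ξ₁ _ _ eb π₁ heb h =>
      obtain ⟨Ξ₂, ea, π', hea, h', hc⟩ := ih h
      obtain ⟨Ξ₃, e₁, e₂, he₁, he₂, hc'⟩ := heb.exchange hea
      refine ⟨_, _, _, he₁, .cons he₂ h', ?_⟩
      refine (Category.assoc _ _ _).trans ?_
      rw [← comp_whiskerRight_assoc, hc, comp_whiskerRight_assoc, swapRight_whisker_left,
        comp_whiskerRight, ← reassoc_of% hc']

theorem trans {Ξ Γ Θ : Scope} {π τ} (h : Str T Ξ Γ π) (h' : Str T Γ Θ τ) :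
    Str T Ξ Θ (π ≫ τ) := by
  induction h' generalizing Ξ with
  | nil => rw [T.bang_unique (π ≫ _) (T.bang _)]; exact .nil
  | cons he _ ih =>
    obtain ⟨_, e', π', he', hπ', hc⟩ := h.extract he
    rw [reassoc_of% hc, ← comp_whiskerRight]
    exact .cons he' (ih hπ')

theorem lift {Ξ Γ : Scope} {π} (h : Str T Ξ Γ π) (a : Key × Ty) :
    Str T (a :: Ξ) (a :: Γ) (π ▷ a.2.obj V) := by
  have := Str.cons .here h (a := a)
  rwa [Category.id_comp] at this

theorem refl (Γ : Scope) : Str T Γ Γ (𝟙 _) := by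
  induction Γ with
  | nil => rw [T.bang_unique (𝟙 _) (T.bang _)]; exact .nil
  | cons a Γ ih =>
    have := ih.lift a
    rwa [id_whiskerRight] at this

theorem weaken {Ξ Γ : Scope} {π} (h : Str T Ξ Γ π) (a : Key × Ty) :
    Str T (a :: Ξ) Γ (Scope.obj V Ξ ◁ T.bang (a.2.obj V) ≫ (ρ_ _).hom ≫ π) := by
  induction h with
  | nil => rw [T.bang_unique (_ ≫ _) (T.bang _)]; exact .nil
  | @cons Ξ Ξ' Γ b e π he h ih =>
    have := Str.cons (he.there (b := a)) ih
    refine Str.of_eq (this) ?_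
    simp only [comp_whiskerRight, Category.assoc]
    rw [reassoc_of% swapRight_whiskerLeft, ← MonoidalCategory.whisker_exchange_assoc,
      rightUnitor_naturality_assoc]

theorem weaken_append {Ξ Γ : Scope} {π} (h : Str T Ξ Γ π) (Θ : Scope) :
    Str T (Θ ++ Ξ) Γ ((Scope.split V Θ Ξ).hom ≫ (π ⊗ₘ T.bang (Scope.obj V Θ)) ≫ (ρ_ _).hom) := by
  induction Θ with
  | nil =>
    refine Str.of_eq (h) ?_
    rw [T.bang_unique (T.bang (Scope.obj V [])) (𝟙 _)]
    simp [Scope.split]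
  | cons a Θ ih =>
    refine Str.of_eq (ih.weaken a) ?_
    have h₁ : T.bang (Scope.obj V Θ ⊗ a.2.obj V) =
        T.bang (Scope.obj V Θ) ▷ a.2.obj V ≫ 𝟙_ V ◁ T.bang (a.2.obj V) ≫ (ρ_ _).hom :=
      T.bang_unique _ _
    exact (discard_aux _ _ _ _).trans (by rw [← h₁]; rfl)

theorem append {Ξ₁ Ξ₂ Γ₁ Γ₂ : Scope} {π₁ π₂} (h₁ : Str T Ξ₁ Γ₁ π₁) (h₂ : Str T Ξ₂ Γ₂ π₂) :
    ∃ π, Str T (Ξ₂ ++ Ξ₁) (Γ₂ ++ Γ₁) π ∧ π ≫ (Scope.split V Γ₂ Γ₁).hom =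
      (Scope.split V Ξ₂ Ξ₁).hom ≫ (π₁ ⊗ₘ π₂) := by
  induction h₂ with
  | nil => exact ⟨_, h₁.weaken_append _, by simp [Scope.split]⟩
  | cons he _ ih =>
    obtain ⟨e', he', hc⟩ := he.append_left Ξ₁
    obtain ⟨π, hπ, hc'⟩ := ih
    exact ⟨_, .cons he' hπ, str_append_aux hc hc'⟩

theorem append_nil (Γ : Scope) :
    Str T (Γ ++ []) Γ ((Scope.split V Γ []).hom ≫ (λ_ (Scope.obj V Γ)).hom) := by
  induction Γ with
  | nil =>
    refine Str.of_eq (Str.refl (T := T) []) ?_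
    exact T.bang_unique _ _
  | cons a Γ ih =>
    refine Str.of_eq (ih.lift a) ?_
    simp [Scope.split]

theorem braid (Γ Δ : Scope) : ∃ π, Str T (Γ ++ Δ) (Δ ++ Γ) π ∧
    π ≫ (Scope.split V Δ Γ).hom = (Scope.split V Γ Δ).hom ≫ (β_ _ _).hom := by
  induction Δ with
  | nil => exact ⟨_, append_nil Γ, by simp [Scope.split]⟩
  | cons a Δ ih =>
    obtain ⟨π, hπ, hc⟩ := ih
    obtain ⟨e', he', hc'⟩ := Extract.append_right (V := V) (.here (Ξ := Δ) (a := a)) Γ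
    refine ⟨_, .cons he' hπ, ?_⟩
    simp only [Scope.split, Iso.trans_hom, whiskerRightIso_hom, Category.assoc] at hc' ⊢
    rw [← comp_whiskerRight_assoc, hc, comp_whiskerRight_assoc, reassoc_of% hc',
      id_whiskerRight, Category.id_comp, swapRight_braiding]

theorem assoc (A B C : Scope) : ∃ π, Str T (C ++ (B ++ A)) ((C ++ B) ++ A) π ∧
    π ≫ (Scope.split V (C ++ B) A).hom ≫ Scope.obj V A ◁ (Scope.split V C B).hom =
      (Scope.split V C (B ++ A)).hom ≫ (Scope.split V B A).hom ▷ Scope.obj V C ≫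
        (α_ _ _ _).hom := by
  induction C with
  | nil => exact ⟨_, refl _, by simp [Scope.split]⟩
  | cons c C ih =>
    obtain ⟨π, hπ, hc⟩ := ih
    exact ⟨_, hπ.lift c, split_assoc_aux hc _⟩

end Str

end Str
end QPEL

namespace QPEL

/-- `Γ` consists of declarations of `Ξ`, each at most once. -/
@[grind =]
def Sub (Γ Ξ : Scope) : Prop := Ξ.Nodup ∧ Γ.Nodup ∧ Γ ⊆ Ξ

/-- `A` and `B` consist of different declarations of `Ξ`. -/
@[grind =]
def Split (Ξ A B : Scope) : Prop := Sub (B ++ A) Ξ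

attribute [grind =] List.nodup_append List.nodup_cons List.subset_def

namespace Triangle

variable {V : Type u} [Category.{v} V] [MonoidalCategory V] [SymmetricCategory V]
  [HasBinaryCoproducts V] [IsMonoidalDistrib V] {E : Type w} [CommEffectMonoid E]
  (T : Triangle V E)

/-- The structural arrow from a scope to a part of it. -/
noncomputable def str {Γ Ξ : Scope} (h : Sub Γ Ξ) : Scope.obj V Ξ ⟶ Scope.obj V Γ :=
  (Str.exists_of_subset (T := T) h.2.1 h.2.2).choose

theorem str_spec {Γ Ξ : Scope} (h : Sub Γ Ξ) : Str T Ξ Γ (T.str h) :=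
  (Str.exists_of_subset (T := T) h.2.1 h.2.2).choose_spec

variable {T} in
theorem _root_.QPEL.Str.eq {Γ Ξ : Scope} {π} (h : Str T Ξ Γ π) (hs : Sub Γ Ξ) : π = T.str hs :=
  h.functional hs.1 (T.str_spec hs)

theorem str_self {Γ : Scope} (h : Sub Γ Γ) : T.str h = 𝟙 _ := ((Str.refl Γ).eq h).symm

theorem str_nil {Γ : Scope} (h : Sub [] Γ) : T.str h = T.bang _ := T.bang_unique _ _

theorem str_comp {Γ Δ Ξ : Scope} (h : Sub Γ Ξ) (h' : Sub Δ Γ) (h'' : Sub Δ Ξ) :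
    T.str h ≫ T.str h' = T.str h'' :=
  ((T.str_spec h).trans (T.str_spec h')).eq h''

theorem str_cons {Γ Ξ : Scope} {a : Key × Ty} (h : Sub (a :: Γ) (a :: Ξ)) (h' : Sub Γ Ξ) :
    T.str h = T.str h' ▷ a.2.obj V :=
  (((T.str_spec h').lift a).eq h).symm

/-- The structural arrow from a scope to a pair of disjoint parts of it. -/
noncomputable def str₂ {Ξ A B : Scope} (h : Split Ξ A B) :
    Scope.obj V Ξ ⟶ Scope.obj V A ⊗ Scope.obj V B :=
  T.str h ≫ (Scope.split V B A).hom

theorem str_str₂ {Ξ Γ A B : Scope} (h : Sub Γ Ξ) (h' : Split Γ A B) (h'' : Split Ξ A B) :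
    T.str h ≫ T.str₂ h' = T.str₂ h'' := by
  rw [str₂, ← Category.assoc, T.str_comp h h' h'']; rfl

theorem str₂_str {Ξ A B A' B' : Scope} (h : Split Ξ A B) (hA : Sub A' A) (hB : Sub B' B)
    (h' : Split Ξ A' B') : T.str₂ h ≫ (T.str hA ⊗ₘ T.str hB) = T.str₂ h' := by
  obtain ⟨π, hπ, hc⟩ := (T.str_spec hA).append (T.str_spec hB)
  rw [str₂, Category.assoc, ← hc, ← Category.assoc, ((T.str_spec h).trans hπ).eq h']
  rfl

theorem str₂_braid {Ξ A B : Scope} (h : Split Ξ A B) (h' : Split Ξ B A) :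
    T.str₂ h ≫ (β_ _ _).hom = T.str₂ h' := by
  obtain ⟨π, hπ, hc⟩ := Str.braid (T := T) B A
  rw [str₂, Category.assoc, ← hc, ← Category.assoc, ((T.str_spec h).trans hπ).eq h']
  rfl

theorem str₂_assoc {Ξ P Q A B C : Scope} (h₁ : Split Ξ P C) (h₂ : Split P A B) (h₃ : Split Ξ A Q)
    (h₄ : Split Q B C) :
    T.str₂ h₁ ≫ T.str₂ h₂ ▷ Scope.obj V C ≫ (α_ _ _ _).hom =
      T.str₂ h₃ ≫ Scope.obj V A ◁ T.str₂ h₄ := by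
  obtain ⟨π, hπ, hc⟩ := Str.assoc (T := T) A B C
  have hC : Sub C C := by grind
  have hA : Sub A A := by grind
  have hP : Split Ξ (B ++ A) C := by grind
  have hQ : Split Ξ A (C ++ B) := by grind
  have e₁ := T.str₂_str h₁ h₂ hC hP
  have e₂ := T.str₂_str h₃ hA h₄ hQ
  rw [T.str_self, tensorHom_id] at e₁
  rw [T.str_self, id_tensorHom] at e₂
  rw [show T.str₂ h₂ = T.str h₂ ≫ _ from rfl, show T.str₂ h₄ = T.str h₄ ≫ _ from rfl, comp_whiskerRight, MonoidalCategory.whiskerLeft_comp,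
    Category.assoc, reassoc_of% e₁, reassoc_of% e₂]
  rw [str₂, str₂, Category.assoc, Category.assoc, ← hc, ← Category.assoc,
    ((T.str_spec hP).trans hπ).eq hQ]

theorem str₂_nil_right {Ξ A : Scope} (h : Split Ξ A []) (h' : Sub A Ξ) :
    T.str₂ h = T.str h' ≫ (ρ_ _).inv := rfl

theorem str₂_nil_left {Ξ A : Scope} (h : Split Ξ [] A) (h' : Sub A Ξ) :
    T.str₂ h ≫ (λ_ _).hom = T.str h' := by
  have h'' : Split Ξ A [] := h'
  rw [← T.str₂_braid h'' h, T.str₂_nil_right h'' h']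
  simp

theorem str₂_discard_right {Ξ A B : Scope} (h : Split Ξ A B) (h' : Sub A Ξ)
    (k : Scope.obj V B ⟶ 𝟙_ V) :
    T.str₂ h ≫ Scope.obj V A ◁ k ≫ (ρ_ _).hom = T.str h' := by
  have hB : Sub [] B := by grind
  have hA : Sub A A := by grind
  have h'' : Split Ξ A [] := h'
  rw [T.bang_unique k (T.str hB), ← id_tensorHom, ← T.str_self hA, ← Category.assoc,
    T.str₂_str h hA hB h'', T.str₂_nil_right h'' h']
  simp

theorem str₂_discard_left {Ξ A B : Scope} (h : Split Ξ A B) (h' : Sub B Ξ)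
    (k : Scope.obj V A ⟶ 𝟙_ V) :
    T.str₂ h ≫ k ▷ Scope.obj V B ≫ (λ_ _).hom = T.str h' := by
  have hB : Split Ξ B A := by grind
  rw [← T.str₂_braid hB h, Category.assoc, ← BraidedCategory.braiding_naturality_right_assoc,
    braiding_leftUnitor, T.str₂_discard_right hB h']

theorem str₂_cons_right {Ξ A B : Scope} {a : Key × Ty} (h : Split (a :: Ξ) A (a :: B))
    (h' : Split Ξ A B) : T.str₂ h = T.str₂ h' ▷ a.2.obj V ≫ (α_ _ _ _).hom := by
  have : T.str h = T.str h' ▷ a.2.obj V := T.str_cons h h'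
  rw [str₂, this, str₂]
  simp [Scope.split]

theorem str₂_single {Ξ : Scope} {a : Key × Ty} (h : Split (a :: Ξ) Ξ [a]) :
    T.str₂ h ≫ Scope.obj V Ξ ◁ (λ_ _).hom = 𝟙 _ := by
  have h₁ : Split Ξ Ξ [] := by grind
  have h₂ : Sub Ξ Ξ := by grind
  rw [T.str₂_cons_right h h₁, T.str₂_nil_right h₁ h₂, T.str_self]
  simp

end Triangle
end QPEL

namespace QPEL

open PartialCommMonoid QPEL.PSum

/-! ## Effect algebras and effect modules -/

namespace EffectAlgebra

variable {M : Type w} [EffectAlgebra M]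

theorem of_add_orth (x : M) : of x + of (orth x) = of 1 := (ovee_eq_top_iff x _).2 rfl

theorem eq_orth {x y : M} (h : of x + of y = of 1) : y = orth x := (ovee_eq_top_iff x y).1 h

theorem orth_orth (x : M) : orth (orth x) = x := by
  refine (eq_orth ?_).symm
  rw [add_comm, of_add_orth]

theorem le_iff {x y : M} : x ≤ y ↔ ∃ z, of x + of z = of y := Iff.rfl

theorem le_refl (x : M) : x ≤ x := ⟨0, ovee_zero x⟩

theorem zero_le (x : M) : 0 ≤ x := ⟨x, (ovee_comm _ _).trans (ovee_zero x)⟩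

theorem le_one (x : M) : x ≤ 1 := ⟨_, of_add_orth x⟩

theorem exists_of_left {s t : PSum M} {z : M} (h : s + t = of z) : ∃ x, s = of x :=
  Defined.left (t := t) ⟨z, h⟩

theorem le_trans {x y z : M} (h : x ≤ y) (h' : y ≤ z) : x ≤ z := by
  obtain ⟨a, h⟩ := le_iff.1 h
  obtain ⟨b, h'⟩ := le_iff.1 h'
  rw [← h] at h'
  obtain ⟨c, hc⟩ : ∃ c, of b + of a = of c := exists_of_left (t := of x) (by rw [← h']; abel)
  exact ⟨c, show of x + of c = of z by rw [← hc, ← h']; abel⟩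

theorem eq_zero_of_add_eq_zero {x y : M} (h : of x + of y = of 0) : x = 0 := by
  apply eq_zero_of_perp_top
  obtain ⟨c, hc⟩ : ∃ c, of x + of (1 : M) = of c := by
    refine exists_of_left (t := of y) (z := 1) ?_
    rw [add_right_comm, h, of_zero, zero_add]
  rw [show ovee x (orth 0) = some c from hc]
  rfl

theorem le_antisymm {x y : M} (h : x ≤ y) (h' : y ≤ x) : x = y := by
  obtain ⟨a, h⟩ := le_iff.1 h
  obtain ⟨b, h'⟩ := le_iff.1 h'
  rw [← h, add_assoc] at h'
  obtain ⟨c, hc⟩ := exists_of_left ((add_comm _ _).trans h')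
  rw [hc] at h'
  rw [eq_zero_of_ovee_self h'] at hc
  rw [eq_zero_of_add_eq_zero hc] at h
  exact of_injective ((add_zero _).symm.trans h)

theorem eq_one_of_one_le {x : M} (h : 1 ≤ x) : x = 1 := le_antisymm (le_one x) h

theorem orth_le_orth {x y : M} (h : x ≤ y) : orth y ≤ orth x := by
  obtain ⟨a, h⟩ := le_iff.1 h
  have h' := of_add_orth y
  rw [← h, add_assoc] at h'
  obtain ⟨c, hc⟩ := exists_of_left ((add_comm _ _).trans h')
  rw [hc] at h'
  rw [← eq_orth h']
  exact ⟨a, show of (orth y) + of a = of c by rw [← hc, add_comm]⟩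

theorem perp_iff {x y : M} : x ≤ orth y ↔ ∃ z, of x + of y = of z := by
  constructor
  · intro h
    obtain ⟨a, h⟩ := le_iff.1 h
    have h' := of_add_orth y
    rw [← h] at h'
    exact exists_of_left (t := of a) (z := 1) (by rw [← h']; abel)
  · rintro ⟨z, h⟩
    have h' := of_add_orth z
    rw [← h] at h'
    obtain ⟨c, hc⟩ : ∃ c, of x + of (orth z) = of c :=
      exists_of_left (t := of y) (z := 1) (by rw [← h']; abel)
    refine ⟨orth z, show of x + of (orth z) = of (orth y) from ?_⟩
    rw [hc, eq_orth (x := y) (y := c)]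
    rw [← hc, ← h']
    abel

theorem add_mono_left {x y z s : M} (h : x ≤ y) (hs : of y + of z = of s) :
    ∃ r, of x + of z = of r ∧ r ≤ s := by
  obtain ⟨a, h⟩ := le_iff.1 h
  rw [← h, add_right_comm] at hs
  obtain ⟨r, hr⟩ := exists_of_left hs
  exact ⟨r, hr, a, show of r + of a = of s by rw [← hr, hs]⟩

end EffectAlgebra

open EffectAlgebra

section Tests

variable {M : Type w} [EffectAlgebra M] {n : ℕ}

theorem IsTest.perm {r : Fin (n + 1) → M} (h : IsTest r) (p : Equiv.Perm (Fin (n + 1))) :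
    IsTest fun i => r (p i) :=
  (Equiv.sum_comp p fun i => of (r i)).trans h

theorem IsTest.snoc_zero {r : Fin (n + 1) → M} (h : IsTest r) :
    IsTest (Fin.snoc (α := fun _ => M) r 0) := by
  unfold IsTest
  rw [Fin.sum_univ_castSucc]
  simp only [Fin.snoc_castSucc, Fin.snoc_last]
  rw [of_zero, add_zero]
  exact h

theorem isTest_cons_iff {p q s : M} {r : Fin n → M} (h : ovee p q = some s) :
    IsTest (Fin.cons (α := fun _ => M) s r) ↔
      IsTest (Fin.cons (α := fun _ => M) p (Fin.cons (α := fun _ => M) q r)) := by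
  unfold IsTest
  rw [Fin.sum_univ_succ, Fin.sum_univ_succ, Fin.sum_univ_succ (n := n)]
  simp only [Fin.cons_zero, Fin.cons_succ]
  rw [← add_assoc, show of p + of q = of s from h]

end Tests

namespace EModHom

variable {E : Type w} [EffectMonoid E] {A B : EModCat.{w} E} (f : A ⟶ B)

theorem map_zero : f.toFun 0 = 0 :=
  eq_zero_of_ovee_self (f.map_ovee 0 0 0 (ovee_zero _))

theorem map_one : f.toFun 1 = 1 := (f.map_orth 0).trans (congrArg orth (map_zero f))

theorem map_le {x y : A.carrier} (h : x ≤ y) : f.toFun x ≤ f.toFun y := by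
  obtain ⟨z, h⟩ := h
  exact ⟨_, f.map_ovee _ _ _ h⟩

theorem map_sum {ι : Type*} (s : Finset ι) (r : ι → A.carrier) {z : A.carrier}
    (h : ∑ i ∈ s, of (r i) = of z) : ∑ i ∈ s, of (f.toFun (r i)) = of (f.toFun z) := by
  classical
  induction s using Finset.induction_on generalizing z with
  | empty =>
    rw [Finset.sum_empty] at h ⊢
    rw [← of_injective (show of (0 : A.carrier) = of z from h), map_zero]
    rfl
  | insert a s ha ih =>
    rw [Finset.sum_insert ha] at h ⊢
    obtain ⟨y, hy⟩ := exists_of_left ((add_comm _ _).trans h)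
    rw [ih hy]
    rw [hy] at h
    exact f.map_ovee _ _ _ h

theorem map_isTest {n : ℕ} {r : Fin (n + 1) → A.carrier} (h : IsTest r) :
    IsTest fun i => f.toFun (r i) := by
  have := map_sum f _ r h
  rwa [map_one] at this

end EModHom

section Product

variable {E : Type w}

/-- The componentwise sum of pairs. -/
def prodOvee {M N : Type w} [PartialCommMonoid M] [PartialCommMonoid N] (x y : M × N) :
    Option (M × N) :=
  (ovee x.1 y.1).bind fun a => (ovee x.2 y.2).map fun b => (a, b)

theorem prodOvee_eq_some {M N : Type w} [PartialCommMonoid M] [PartialCommMonoid N]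
    {x y z : M × N} :
    prodOvee x y = some z ↔ ovee x.1 y.1 = some z.1 ∧ ovee x.2 y.2 = some z.2 := by
  obtain ⟨z₁, z₂⟩ := z
  simp [prodOvee, Option.bind_eq_some_iff]

instance prodEffectAlgebra (M N : Type w) [EffectAlgebra M] [EffectAlgebra N] :
    EffectAlgebra (M × N) where
  zero := (0, 0)
  ovee := prodOvee
  ovee_comm x y := by simp [prodOvee, ovee_comm]
  ovee_assoc x y z := by
    have h₁ := fun r => iff_of_eq (congrArg (· = some r) (ovee_assoc x.1 y.1 z.1))
    have h₂ := fun r => iff_of_eq (congrArg (· = some r) (ovee_assoc x.2 y.2 z.2))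
    simp only [Option.bind_eq_some_iff] at h₁ h₂
    ext r
    simp only [Option.bind_eq_some_iff, prodOvee_eq_some, Prod.exists]
    constructor
    · rintro ⟨a, b, ⟨ha, hb⟩, ha', hb'⟩
      obtain ⟨a', h, h'⟩ := (h₁ r.1).1 ⟨a, ha, ha'⟩
      obtain ⟨b', k, k'⟩ := (h₂ r.2).1 ⟨b, hb, hb'⟩
      exact ⟨a', b', ⟨h, k⟩, h', k'⟩
    · rintro ⟨a, b, ⟨ha, hb⟩, ha', hb'⟩
      obtain ⟨a', h, h'⟩ := (h₁ r.1).2 ⟨a, ha, ha'⟩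
      obtain ⟨b', k, k'⟩ := (h₂ r.2).2 ⟨b, hb, hb'⟩
      exact ⟨a', b', ⟨h, k⟩, h', k'⟩
  ovee_zero x := prodOvee_eq_some.2 ⟨ovee_zero x.1, ovee_zero x.2⟩
  orth x := (orth x.1, orth x.2)
  ovee_eq_top_iff x y := by
    refine prodOvee_eq_some.trans ?_
    rw [Prod.ext_iff]
    exact and_congr (ovee_eq_top_iff _ _) (ovee_eq_top_iff _ _)
  eq_zero_of_perp_top x h := by
    obtain ⟨z, hz⟩ := Option.isSome_iff_exists.1 h
    obtain ⟨h₁, h₂⟩ := prodOvee_eq_some.1 hz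
    exact Prod.ext (eq_zero_of_perp_top _ (Option.isSome_iff_exists.2 ⟨_, h₁⟩))
      (eq_zero_of_perp_top _ (Option.isSome_iff_exists.2 ⟨_, h₂⟩))

variable [EffectMonoid E]

instance prodEffectModule (M N : Type w) [EffectAlgebra M] [EffectAlgebra N] [EffectModule E M]
    [EffectModule E N] : EffectModule E (M × N) where
  smul r x := (r • x.1, r • x.2)
  smul_ovee r x y s h := by
    obtain ⟨h₁, h₂⟩ := prodOvee_eq_some.1 h
    exact prodOvee_eq_some.2
      ⟨EffectModule.smul_ovee r _ _ _ h₁, EffectModule.smul_ovee r _ _ _ h₂⟩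
  ovee_smul r s t x h := prodOvee_eq_some.2
    ⟨EffectModule.ovee_smul r s t _ h, EffectModule.ovee_smul r s t _ h⟩
  mul_smul' r s x := Prod.ext (EffectModule.mul_smul' r s _) (EffectModule.mul_smul' r s _)
  one_smul' x := Prod.ext (EffectModule.one_smul' _) (EffectModule.one_smul' _)

/-- The product of two effect modules. -/
def EModCat.prod (A B : EModCat.{w} E) : EModCat.{w} E := ⟨A.carrier × B.carrier⟩

/-- The first projection. -/
def EModCat.fst (A B : EModCat.{w} E) : EModCat.prod A B ⟶ A where
  toFun x := x.1
  map_ovee _ _ _ h := (prodOvee_eq_some.1 h).1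
  map_orth _ := rfl
  map_smul _ _ := rfl

/-- The second projection. -/
def EModCat.snd (A B : EModCat.{w} E) : EModCat.prod A B ⟶ B where
  toFun x := x.2
  map_ovee _ _ _ h := (prodOvee_eq_some.1 h).2
  map_orth _ := rfl
  map_smul _ _ := rfl

/-- The pairing of two homomorphisms. -/
def EModCat.lift {A B C : EModCat.{w} E} (f : C ⟶ A) (g : C ⟶ B) : C ⟶ EModCat.prod A B where
  toFun x := (f.toFun x, g.toFun x)
  map_ovee _ _ _ h := prodOvee_eq_some.2 ⟨f.map_ovee _ _ _ h, g.map_ovee _ _ _ h⟩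
  map_orth x := Prod.ext (f.map_orth x) (g.map_orth x)
  map_smul r x := Prod.ext (f.map_smul r x) (g.map_smul r x)

theorem prod_sum {M N : Type w} [EffectAlgebra M] [EffectAlgebra N] {ι : Type*} (s : Finset ι)
    {f : ι → M} {g : ι → N} {x : M} {y : N} (hf : ∑ i ∈ s, of (f i) = of x)
    (hg : ∑ i ∈ s, of (g i) = of y) : ∑ i ∈ s, of (f i, g i) = of (x, y) := by
  classical
  induction s using Finset.induction_on generalizing x y with
  | empty =>
    rw [Finset.sum_empty] at hf hg ⊢
    rw [← of_injective (show of (0 : M) = of x from hf), ← of_injective (show of (0 : N) = of y from hg)]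
    rfl
  | insert a s ha ih =>
    rw [Finset.sum_insert ha] at hf hg ⊢
    obtain ⟨x', hx⟩ := exists_of_left ((add_comm _ _).trans hf)
    obtain ⟨y', hy⟩ := exists_of_left ((add_comm _ _).trans hg)
    rw [ih hx hy]
    rw [hx] at hf
    rw [hy] at hg
    exact prodOvee_eq_some.2 ⟨hf, hg⟩

end Product

end QPEL

namespace QPEL

open PartialCommMonoid QPEL.PSum EffectAlgebra

section Copowers

variable {V : Type u} [Category.{v} V] [MonoidalCategory V] [HasBinaryCoproducts V]

theorem ι_castSucc {n : ℕ} (i : Fin (n + 1)) :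
    copower.ι V (n + 1) i.castSucc = copower.ι V n i ≫ coprod.inl :=
  Fin.snoc_castSucc (α := fun _ => 𝟙_ V ⟶ copower V (n + 1)) _ _ i

theorem ι_last {n : ℕ} : copower.ι V (n + 1) (Fin.last (n + 1)) = coprod.inr :=
  Fin.snoc_last (α := fun _ => 𝟙_ V ⟶ copower V (n + 1)) _ _

theorem ι_desc {X : V} : ∀ {n : ℕ} (f : Fin (n + 1) → (𝟙_ V ⟶ X)) (i : Fin (n + 1)),
    copower.ι V n i ≫ copower.desc n f = f i
  | 0, f, i => by
    obtain rfl : i = 0 := Fin.fin_one_eq_zero i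
    exact Category.id_comp _
  | n + 1, f, i => by
    refine Fin.lastCases ?_ (fun i => ?_) i
    · rw [ι_last]
      exact coprod.inr_desc _ _
    · rw [ι_castSucc]
      exact (Category.assoc _ _ _).trans ((congrArg _ (coprod.inl_desc _ _)).trans (ι_desc _ i))

end Copowers

section Distributivity

variable {V : Type u} [Category.{v} V] [MonoidalCategory V] [HasBinaryCoproducts V]
  [IsMonoidalDistrib V]

/-- Definition by cases on an arrow out of `D ⊗ (A + B)`. -/
noncomputable def tensorDesc {D A B C : V} (g : D ⊗ A ⟶ C) (h : D ⊗ B ⟶ C) :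
    D ⊗ (A ⨿ B) ⟶ C :=
  (leftDistrib D A B).inv ≫ coprod.desc g h

@[simp]
theorem inl_tensorDesc {D A B C : V} (g : D ⊗ A ⟶ C) (h : D ⊗ B ⟶ C) :
    D ◁ coprod.inl ≫ tensorDesc g h = g := by
  rw [tensorDesc, CategoryTheory.whiskerLeft_coprod_inl_leftDistrib_inv_assoc, coprod.inl_desc]

@[simp]
theorem inr_tensorDesc {D A B C : V} (g : D ⊗ A ⟶ C) (h : D ⊗ B ⟶ C) :
    D ◁ coprod.inr ≫ tensorDesc g h = h := by
  rw [tensorDesc, CategoryTheory.whiskerLeft_coprod_inr_leftDistrib_inv_assoc, coprod.inr_desc]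

theorem tensor_coprod_hom_ext {D A B C : V} {f g : D ⊗ (A ⨿ B) ⟶ C}
    (h₁ : D ◁ coprod.inl ≫ f = D ◁ coprod.inl ≫ g)
    (h₂ : D ◁ coprod.inr ≫ f = D ◁ coprod.inr ≫ g) : f = g := by
  rw [← cancel_epi (leftDistrib D A B).hom]
  apply coprod.hom_ext
  · rw [CategoryTheory.coprod_inl_leftDistrib_hom_assoc, h₁,
      CategoryTheory.coprod_inl_leftDistrib_hom_assoc]
  · rw [CategoryTheory.coprod_inr_leftDistrib_hom_assoc, h₂,
      CategoryTheory.coprod_inr_leftDistrib_hom_assoc]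

theorem tensorDesc_comp {D A B C C' : V} (g : D ⊗ A ⟶ C) (h : D ⊗ B ⟶ C) (k : C ⟶ C') :
    tensorDesc g h ≫ k = tensorDesc (g ≫ k) (h ≫ k) := by
  apply tensor_coprod_hom_ext <;> rw [← Category.assoc] <;> simp

theorem map_tensorDesc {D D' A A' B B' C : V} (d : D ⟶ D') (a : A ⟶ A') (b : B ⟶ B')
    (g : D' ⊗ A' ⟶ C) (h : D' ⊗ B' ⟶ C) :
    (d ⊗ₘ coprod.map a b) ≫ tensorDesc g h = tensorDesc ((d ⊗ₘ a) ≫ g) ((d ⊗ₘ b) ≫ h) := by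
  have h₁ : D ◁ coprod.inl ≫ (d ⊗ₘ coprod.map a b) = (d ⊗ₘ a) ≫ D' ◁ coprod.inl := by
    simp only [← id_tensorHom, tensorHom_comp_tensorHom, coprod.inl_map, Category.id_comp,
      Category.comp_id]
  have h₂ : D ◁ coprod.inr ≫ (d ⊗ₘ coprod.map a b) = (d ⊗ₘ b) ≫ D' ◁ coprod.inr := by
    simp only [← id_tensorHom, tensorHom_comp_tensorHom, coprod.inr_map, Category.id_comp,
      Category.comp_id]
  apply tensor_coprod_hom_ext
  · rw [reassoc_of% h₁, inl_tensorDesc, inl_tensorDesc]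
  · rw [reassoc_of% h₂, inr_tensorDesc, inr_tensorDesc]

theorem ι_branch {D X : V} : ∀ {n : ℕ} (f : Fin (n + 1) → (D ⟶ X)) (i : Fin (n + 1)),
    D ◁ copower.ι V n i ≫ copower.branch n f = (ρ_ D).hom ≫ f i
  | 0, f, i => by
    obtain rfl : i = 0 := Fin.fin_one_eq_zero i
    exact (congrArg (· ≫ _) (MonoidalCategory.whiskerLeft_id _ _)).trans (Category.id_comp _)
  | n + 1, f, i => by
    change D ◁ _ ≫ tensorDesc _ _ = _
    refine Fin.lastCases ?_ (fun i => ?_) i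
    · simp [ι_last]
    · simp [ι_castSucc, ι_branch]

theorem tensor_copower_hom_ext {D X : V} : ∀ {n : ℕ} {f g : D ⊗ copower V n ⟶ X},
    (∀ i, D ◁ copower.ι V n i ≫ f = D ◁ copower.ι V n i ≫ g) → f = g
  | 0, f, g, h => by
    have key : ∀ k : D ⊗ 𝟙_ V ⟶ X, D ◁ 𝟙 (𝟙_ V) ≫ k = k := fun k => by simp
    exact (key f).symm.trans ((h 0).trans (key g))
  | n + 1, f, g, h => by
    apply tensor_coprod_hom_ext
    · refine tensor_copower_hom_ext fun i => ?_
      have := h i.castSucc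
      rw [ι_castSucc] at this
      exact (whiskerLeft_comp_assoc D _ _ _).symm.trans
        (this.trans (whiskerLeft_comp_assoc D _ _ _))
    · have := h (Fin.last (n + 1))
      rw [ι_last] at this
      exact this

theorem map_branch {D D' X X' : V} {n : ℕ} (d : D' ⟶ D) (f : Fin (n + 1) → (D ⟶ X)) (k : X ⟶ X') :
    d ▷ copower V n ≫ copower.branch n f ≫ k = copower.branch n fun i => d ≫ f i ≫ k := by
  refine tensor_copower_hom_ext fun i => ?_
  rw [MonoidalCategory.whisker_exchange_assoc, ← Category.assoc (D ◁ _), ι_branch, ι_branch]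
  simp

theorem desc_branch {D X : V} {m n : ℕ} (g : Fin (m + 1) → Fin (n + 1))
    (f : Fin (n + 1) → (D ⟶ X)) :
    D ◁ copower.desc m (fun i => copower.ι V n (g i)) ≫ copower.branch n f =
      copower.branch m fun i => f (g i) := by
  refine tensor_copower_hom_ext fun i => ?_
  rw [← MonoidalCategory.whiskerLeft_comp_assoc, ι_desc, ι_branch, ι_branch]

end Distributivity

namespace Triangle

variable {V : Type u} [Category.{v} V] [MonoidalCategory V] [SymmetricCategory V]
  [HasBinaryCoproducts V] [IsMonoidalDistrib V] {E : Type w} [CommEffectMonoid E]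
  (T : Triangle V E)

theorem pull_id {A : V} (p : T.Pred A) : T.pull (𝟙 A) p = p := by
  change (T.P.map (𝟙 A)).unop.toFun p = p
  rw [T.P.map_id]; rfl

theorem pull_comp {A B C : V} (f : A ⟶ B) (g : B ⟶ C) (p : T.Pred C) :
    T.pull (f ≫ g) p = T.pull f (T.pull g p) := by
  change (T.P.map (f ≫ g)).unop.toFun p = _
  rw [T.P.map_comp]; rfl

/-- The predicates `P (D ⊗ (A + B))` are the pairs of predicates. -/
noncomputable def coproductIsColimit (D A B : V) :
    IsColimit (BinaryCofan.mk (T.P.map (D ◁ (coprod.inl : A ⟶ A ⨿ B)))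
      (T.P.map (D ◁ (coprod.inr : B ⟶ A ⨿ B)))) :=
  haveI := T.preservesCoproducts
  mapIsColimitOfPreservesOfIsColimit T.P _ _
    (mapIsColimitOfPreservesOfIsColimit (tensorLeft D) _ _ (coprodIsCoprod A B))

/-- The homomorphism from pairs of predicates to predicates on `D ⊗ (A + B)`. -/
noncomputable def copairHom (D A B : V) :
    EModCat.prod (T.P.obj (D ⊗ A)).unop (T.P.obj (D ⊗ B)).unop ⟶ (T.P.obj (D ⊗ (A ⨿ B))).unop :=
  ((T.coproductIsColimit D A B).desc
    (BinaryCofan.mk (P := Opposite.op (EModCat.prod (T.P.obj (D ⊗ A)).unop (T.P.obj (D ⊗ B)).unop))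
      (EModCat.fst _ _).op (EModCat.snd _ _).op)).unop

theorem copairHom_inl (D A B : V) :
    T.copairHom D A B ≫ (T.P.map (D ◁ (coprod.inl : A ⟶ A ⨿ B))).unop = EModCat.fst _ _ :=
  Quiver.Hom.op_inj ((T.coproductIsColimit D A B).fac _ ⟨WalkingPair.left⟩)

theorem copairHom_inr (D A B : V) :
    T.copairHom D A B ≫ (T.P.map (D ◁ (coprod.inr : B ⟶ A ⨿ B))).unop = EModCat.snd _ _ :=
  Quiver.Hom.op_inj ((T.coproductIsColimit D A B).fac _ ⟨WalkingPair.right⟩)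

theorem lift_copairHom (D A B : V) :
    EModCat.lift (T.P.map (D ◁ (coprod.inl : A ⟶ A ⨿ B))).unop
      (T.P.map (D ◁ (coprod.inr : B ⟶ A ⨿ B))).unop ≫ T.copairHom D A B = 𝟙 _ := by
  refine Quiver.Hom.op_inj ?_
  refine BinaryCofan.IsColimit.hom_ext (T.coproductIsColimit D A B) ?_ ?_
  · refine Quiver.Hom.unop_inj ?_
    change (_ ≫ T.copairHom D A B) ≫ (T.P.map (D ◁ coprod.inl)).unop =
      𝟙 _ ≫ (T.P.map (D ◁ coprod.inl)).unop
    rw [Category.assoc, copairHom_inl, Category.id_comp]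
    rfl
  · refine Quiver.Hom.unop_inj ?_
    change (_ ≫ T.copairHom D A B) ≫ (T.P.map (D ◁ coprod.inr)).unop =
      𝟙 _ ≫ (T.P.map (D ◁ coprod.inr)).unop
    rw [Category.assoc, copairHom_inr, Category.id_comp]
    rfl

/-- The predicate on `D ⊗ (A + B)` with components `p` and `q`. -/
noncomputable def copair {D A B : V} (p : T.Pred (D ⊗ A)) (q : T.Pred (D ⊗ B)) :
    T.Pred (D ⊗ (A ⨿ B)) :=
  (T.copairHom D A B).toFun (p, q)

@[simp]
theorem pull_inl_copair {D A B : V} (p : T.Pred (D ⊗ A)) (q : T.Pred (D ⊗ B)) :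
    T.pull (D ◁ coprod.inl) (T.copair p q) = p :=
  congrFun (congrArg EModHom.toFun ((T.copairHom_inl D A B))) (p, q)

@[simp]
theorem pull_inr_copair {D A B : V} (p : T.Pred (D ⊗ A)) (q : T.Pred (D ⊗ B)) :
    T.pull (D ◁ coprod.inr) (T.copair p q) = q :=
  congrFun (congrArg EModHom.toFun ((T.copairHom_inr D A B))) (p, q)

theorem copair_pull {D A B : V} (r : T.Pred (D ⊗ (A ⨿ B))) :
    T.copair (T.pull (D ◁ coprod.inl) r) (T.pull (D ◁ coprod.inr) r) = r :=
  congrFun (congrArg EModHom.toFun ((T.lift_copairHom D A B))) r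

theorem eq_copair {D A B : V} {r : T.Pred (D ⊗ (A ⨿ B))} {p q}
    (hp : T.pull (D ◁ coprod.inl) r = p) (hq : T.pull (D ◁ coprod.inr) r = q) :
    r = T.copair p q := by
  rw [← hp, ← hq, copair_pull]

theorem copair_le {D A B : V} {p p' : T.Pred (D ⊗ A)} {q q' : T.Pred (D ⊗ B)} (hp : p ≤ p')
    (hq : q ≤ q') : T.copair p q ≤ T.copair p' q' := by
  obtain ⟨a, ha⟩ := hp
  obtain ⟨b, hb⟩ := hq
  exact EModHom.map_le _ ⟨(a, b), prodOvee_eq_some.2 ⟨ha, hb⟩⟩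

theorem ovee_copair {D A B : V} {p p' a : T.Pred (D ⊗ A)} {q q' b : T.Pred (D ⊗ B)}
    (hp : ovee p p' = some a) (hq : ovee q q' = some b) :
    ovee (T.copair p q) (T.copair p' q') = some (T.copair a b) :=
  EModHom.map_ovee _ _ _ _ (prodOvee_eq_some.2 ⟨hp, hq⟩)

theorem copair_orth {D A B : V} (p : T.Pred (D ⊗ A)) (q : T.Pred (D ⊗ B)) :
    T.copair (orth p) (orth q) = orth (T.copair p q) :=
  EModHom.map_orth (T.copairHom D A B) (p, q)

theorem copair_smul {D A B : V} (r : E) (p : T.Pred (D ⊗ A)) (q : T.Pred (D ⊗ B)) :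
    T.copair (r • p) (r • q) = r • T.copair p q :=
  EModHom.map_smul (T.copairHom D A B) r (p, q)

theorem isTest_copair {D A B : V} {n : ℕ} {p : Fin (n + 1) → T.Pred (D ⊗ A)}
    {q : Fin (n + 1) → T.Pred (D ⊗ B)} (hp : IsTest p) (hq : IsTest q) :
    IsTest fun i => T.copair (p i) (q i) :=
  EModHom.map_isTest (T.copairHom D A B) (prod_sum _ hp hq)

theorem pull_copair {D D' A A' B B' : V} (d : D' ⟶ D) (a : A' ⟶ A) (b : B' ⟶ B)
    (p : T.Pred (D ⊗ A)) (q : T.Pred (D ⊗ B)) :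
    T.pull (d ⊗ₘ coprod.map a b) (T.copair p q) =
      T.copair (T.pull (d ⊗ₘ a) p) (T.pull (d ⊗ₘ b) q) := by
  have h₁ : D' ◁ coprod.inl ≫ (d ⊗ₘ coprod.map a b) = (d ⊗ₘ a) ≫ D ◁ coprod.inl := by
    simp only [← id_tensorHom, tensorHom_comp_tensorHom, coprod.inl_map, Category.id_comp,
      Category.comp_id]
  have h₂ : D' ◁ coprod.inr ≫ (d ⊗ₘ coprod.map a b) = (d ⊗ₘ b) ≫ D ◁ coprod.inr := by
    simp only [← id_tensorHom, tensorHom_comp_tensorHom, coprod.inr_map, Category.id_comp,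
      Category.comp_id]
  apply T.eq_copair <;> rw [← pull_comp]
  · rw [h₁, pull_comp, pull_inl_copair]
  · rw [h₂, pull_comp, pull_inr_copair]

theorem pull_le {A B : V} (f : A ⟶ B) {p q : T.Pred B} (h : p ≤ q) : T.pull f p ≤ T.pull f q :=
  EModHom.map_le (T.P.map f).unop h

theorem pull_ovee {A B : V} (f : A ⟶ B) {p q s : T.Pred B} (h : ovee p q = some s) :
    ovee (T.pull f p) (T.pull f q) = some (T.pull f s) :=
  EModHom.map_ovee (T.P.map f).unop _ _ _ h

theorem pull_zero {A B : V} (f : A ⟶ B) : T.pull f 0 = 0 := EModHom.map_zero (T.P.map f).unop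

theorem pull_one {A B : V} (f : A ⟶ B) : T.pull f 1 = 1 := EModHom.map_one (T.P.map f).unop

theorem pull_orth {A B : V} (f : A ⟶ B) (p : T.Pred B) : T.pull f (orth p) = orth (T.pull f p) :=
  EModHom.map_orth (T.P.map f).unop p

theorem pull_smul {A B : V} (f : A ⟶ B) (r : E) (p : T.Pred B) :
    T.pull f (r • p) = r • T.pull f p :=
  EModHom.map_smul (T.P.map f).unop r p

theorem pull_isTest {A B : V} (f : A ⟶ B) {n : ℕ} {r : Fin (n + 1) → T.Pred B} (h : IsTest r) :
    IsTest fun i => T.pull f (r i) :=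
  EModHom.map_isTest (T.P.map f).unop h

theorem scalar_smul_one (p : T.Pred (𝟙_ V)) : T.scalar p • (1 : T.Pred (𝟙_ V)) = p := by
  have h₁ : T.predUnitIso.inv.toFun (T.predUnitIso.hom.toFun p) = p :=
    congrFun (congrArg EModHom.toFun (T.predUnitIso.hom_inv_id)) p
  have h₂ := EModHom.map_smul T.predUnitIso.inv (T.scalar p) (1 : E)
  replace h₂ := (congrArg (T.predUnitIso.inv.toFun) (EffectMonoid.mul_top (T.scalar p))).symm.trans h₂
  refine Eq.trans ?_ (h₂.symm.trans h₁)
  exact congrArg (T.scalar p • ·) (EModHom.map_one T.predUnitIso.inv).symm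

theorem scalar_smul (r : E) (p : T.Pred (𝟙_ V)) : T.scalar (r • p) = r * T.scalar p :=
  EModHom.map_smul T.predUnitIso.hom r p

theorem scalar_one : T.scalar 1 = 1 := EModHom.map_one T.predUnitIso.hom

theorem scalar_ovee {p q s : T.Pred (𝟙_ V)} (h : ovee p q = some s) :
    ovee (T.scalar p) (T.scalar q) = some (T.scalar s) :=
  EModHom.map_ovee T.predUnitIso.hom _ _ _ h

theorem meas_congr {A : V} {n : ℕ} {r s : Fin (n + 1) → T.Pred A} (h : r = s) (hr : IsTest r)
    (hs : IsTest s) : T.meas r hr = T.meas s hs := by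
  subst h; rfl

end Triangle

end QPEL

namespace QPEL

open PartialCommMonoid QPEL.PSum EffectAlgebra

section SubstMaps

variable {V : Type u} [Category.{v} V] [MonoidalCategory V] [SymmetricCategory V]
  [HasBinaryCoproducts V] [IsMonoidalDistrib V] {E : Type w} [CommEffectMonoid E]
  (T : Triangle V E)

theorem Triangle.str₂_swap {Ξ P Q A B C : Scope} (h₁ : Split Ξ P C) (h₂ : Split P A B)
    (h₃ : Split Ξ Q B) (h₄ : Split Q A C) :
    T.str₂ h₁ ≫ T.str₂ h₂ ▷ Scope.obj V C ≫ swapRight _ _ _ =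
      T.str₂ h₃ ≫ T.str₂ h₄ ▷ Scope.obj V B := by
  have k₁ : Split Ξ A (C ++ B) := by grind
  have k₂ : Split (C ++ B) B C := by grind
  have k₃ : Split (C ++ B) C B := by grind
  rw [swapRight, reassoc_of% T.str₂_assoc h₁ h₂ k₁ k₂, ← MonoidalCategory.whiskerLeft_comp_assoc,
    T.str₂_braid k₂ k₃, ← reassoc_of% T.str₂_assoc h₃ h₄ k₁ k₃]
  simp

/-- `SubstMap T Q Ξ Γ h`: the arrow `h` distributes the declarations of `Ξ` over those of `Γ`, and
a declaration `x : A` of `Γ` is fed by an arrow `g` with `Q x Ξ' A g`, where `Ξ'` is its share. -/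
inductive SubstMap (Q : Key → (Ξ : Scope) → (A : Ty) → (Scope.obj V Ξ ⟶ A.obj V) → Prop) :
    (Ξ Γ : Scope) → (Scope.obj V Ξ ⟶ Scope.obj V Γ) → Prop
  | nil {Ξ : Scope} : Ξ.Nodup → SubstMap Q Ξ [] (T.bang (Scope.obj V Ξ))
  | cons {Ξ Ξ₁ Ξ₂ Γ : Scope} {x : Key} {A : Ty} {f : Scope.obj V Ξ₁ ⟶ Scope.obj V Γ}
      {g : Scope.obj V Ξ₂ ⟶ A.obj V} (h : Split Ξ Ξ₁ Ξ₂) :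
      SubstMap Q Ξ₁ Γ f → Q x Ξ₂ A g → SubstMap Q Ξ ((x, A) :: Γ) (T.str₂ h ≫ (f ⊗ₘ g))

variable {T} {Q : Key → (Ξ : Scope) → (A : Ty) → (Scope.obj V Ξ ⟶ A.obj V) → Prop}

namespace SubstMap

theorem of_eq {Ξ Γ : Scope} {f g} (h : SubstMap T Q Ξ Γ f) (he : f = g) : SubstMap T Q Ξ Γ g :=
  he ▸ h

theorem nodup {Ξ Γ : Scope} {f} (h : SubstMap T Q Ξ Γ f) : Ξ.Nodup := by
  cases h with
  | nil h => exact h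
  | cons h => exact h.1

theorem extract {Ξ Γ Γ' : Scope} {a : Key × Ty} {f e} (h : SubstMap T Q Ξ Γ f)
    (he : Extract V Γ a Γ' e) : ∃ Ξ₁ Ξ₂, ∃ (hs : Split Ξ Ξ₁ Ξ₂) (f' : _) (g : _),
      SubstMap T Q Ξ₁ Γ' f' ∧ Q a.1 Ξ₂ a.2 g ∧ f ≫ e = T.str₂ hs ≫ (f' ⊗ₘ g) := by
  induction he generalizing Ξ with
  | here =>
    cases h with
    | cons hs h hg => exact ⟨_, _, hs, _, _, h, hg, Category.comp_id _⟩
  | @there Γ Γ' a b e he ih =>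
    cases h with
    | @cons _ Ξ₁ Ξb _ x B f gb hs h hgb =>
      obtain ⟨Ξ₂, Ξa, hs', f', ga, hf', hga, hc⟩ := ih h
      have k₁ : Split Ξ (Ξb ++ Ξ₂) Ξa := by grind
      have k₂ : Split (Ξb ++ Ξ₂) Ξ₂ Ξb := by grind
      refine ⟨_, _, k₁, _, _, .cons k₂ hf' hgb, hga, ?_⟩
      rw [Category.assoc, ← tensorHom_id, tensorHom_comp_tensorHom_assoc, hc, Category.comp_id,
        ← Category.id_comp gb, ← tensorHom_comp_tensorHom_assoc, swapRight_naturality, tensorHom_id,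
        reassoc_of% T.str₂_swap hs hs' k₁ k₂, Category.id_comp, ← tensorHom_id,
        tensorHom_comp_tensorHom, Category.id_comp]

theorem comp_str {Ξ Γ Γ' : Scope} {f π} (h : SubstMap T Q Ξ Γ f) (hπ : Str T Γ Γ' π) :
    SubstMap T Q Ξ Γ' (f ≫ π) := by
  induction hπ generalizing Ξ with
  | nil => exact (SubstMap.nil h.nodup).of_eq (T.bang_unique _ _)
  | cons he _ ih =>
    obtain ⟨Ξ₁, Ξ₂, hs, f', g, hf', hg, hc⟩ := h.extract he
    refine (SubstMap.cons hs (ih hf') hg).of_eq ?_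
    rw [reassoc_of% hc, ← tensorHom_id, tensorHom_comp_tensorHom, Category.comp_id]

theorem append {Ξ Γ₁ Γ₂ : Scope} {f} (h : SubstMap T Q Ξ (Γ₂ ++ Γ₁) f) :
    ∃ Ξ₁ Ξ₂, ∃ (hs : Split Ξ Ξ₁ Ξ₂) (f₁ : _) (f₂ : _), SubstMap T Q Ξ₁ Γ₁ f₁ ∧
      SubstMap T Q Ξ₂ Γ₂ f₂ ∧ f ≫ (Scope.split V Γ₂ Γ₁).hom = T.str₂ hs ≫ (f₁ ⊗ₘ f₂) := by
  induction Γ₂ generalizing Ξ with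
  | nil =>
    have hΞ := h.nodup
    have hs : Split Ξ Ξ [] := by grind
    have hs' : Sub Ξ Ξ := by grind
    refine ⟨_, _, hs, f, _, h, .nil List.nodup_nil, ?_⟩
    rw [T.str₂_nil_right hs hs', T.str_self, T.bang_unique (T.bang (Scope.obj V [])) (𝟙 _)]
    simp [Scope.split]
  | cons a Γ₂ ih =>
    cases h with
    | @cons _ Ξ' Ξa _ x A f g hs h hg =>
      obtain ⟨Ξ₁, Ξ₂, hs', f₁, f₂, h₁, h₂, hc⟩ := ih h
      have k₁ : Split Ξ Ξ₁ (Ξa ++ Ξ₂) := by grind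
      have k₂ : Split (Ξa ++ Ξ₂) Ξ₂ Ξa := by grind
      refine ⟨_, _, k₁, _, _, h₁, .cons k₂ h₂ hg, ?_⟩
      change (T.str₂ hs ≫ (f ⊗ₘ g)) ≫ (Scope.split V Γ₂ Γ₁).hom ▷ A.obj V ≫ (α_ _ _ _).hom = _
      rw [Category.assoc, ← tensorHom_id, tensorHom_comp_tensorHom_assoc, hc, Category.comp_id,
        ← Category.id_comp g, ← tensorHom_comp_tensorHom_assoc, associator_naturality, tensorHom_id,
        reassoc_of% T.str₂_assoc hs hs' k₁ k₂, Category.id_comp, ← id_tensorHom,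
        tensorHom_comp_tensorHom, Category.id_comp]

theorem split {Ξ Γ A B : Scope} {f} (h : SubstMap T Q Ξ Γ f) (k : Split Γ A B) :
    ∃ Ξ₁ Ξ₂, ∃ (hs : Split Ξ Ξ₁ Ξ₂) (f₁ : _) (f₂ : _), SubstMap T Q Ξ₁ A f₁ ∧
      SubstMap T Q Ξ₂ B f₂ ∧ f ≫ T.str₂ k = T.str₂ hs ≫ (f₁ ⊗ₘ f₂) := by
  obtain ⟨Ξ₁, Ξ₂, hs, f₁, f₂, h₁, h₂, hc⟩ := (h.comp_str (T.str_spec k)).append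
  exact ⟨Ξ₁, Ξ₂, hs, f₁, f₂, h₁, h₂, (Category.assoc _ _ _).symm.trans hc⟩

theorem weaken {Ξ Ξ' Γ : Scope} {f} (h : SubstMap T Q Ξ Γ f) (k : Sub Ξ Ξ') :
    SubstMap T Q Ξ' Γ (T.str k ≫ f) := by
  cases h with
  | nil h => exact (SubstMap.nil k.1).of_eq (T.bang_unique _ _)
  | @cons _ Ξ₁ Ξ₂ _ _ _ _ _ hs h hg =>
    have k₁ : Split Ξ' Ξ₁ Ξ₂ := by grind
    refine (SubstMap.cons k₁ h hg).of_eq ?_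
    rw [← T.str_str₂ k hs k₁, Category.assoc]

theorem mono {Q' : Key → (Ξ : Scope) → (A : Ty) → (Scope.obj V Ξ ⟶ A.obj V) → Prop}
    (hQ : ∀ x Ξ A g, Q x Ξ A g → Q' x Ξ A g) {Ξ Γ : Scope} {f} (h : SubstMap T Q Ξ Γ f) :
    SubstMap T Q' Ξ Γ f := by
  induction h with
  | nil h => exact .nil h
  | cons hs _ hg ih => exact .cons hs ih (hQ _ _ _ _ hg)

theorem lift {Ξ Γ : Scope} {f} (h : SubstMap T Q Ξ Γ f) {x y : Key} {A B : Ty}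
    {s : B.obj V ⟶ A.obj V} (hy : (y, B) ∉ Ξ) (hQ : Q x [(y, B)] A ((λ_ _).hom ≫ s)) :
    SubstMap T Q ((y, B) :: Ξ) ((x, A) :: Γ) (f ⊗ₘ s) := by
  have := h.nodup
  have k : Split ((y, B) :: Ξ) Ξ [(y, B)] := by grind
  refine (SubstMap.cons k h hQ).of_eq ?_
  rw [← tensorHom_comp_whiskerLeft, tensorHom_def', Category.assoc,
    reassoc_of% T.str₂_single k, MonoidalCategory.tensorHom_def]

theorem refl {Γ : Scope} (hΓ : Γ.Nodup) (hQ : ∀ a ∈ Γ, Q a.1 [a] a.2 (λ_ _).hom) :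
    SubstMap T Q Γ Γ (𝟙 _) := by
  induction Γ with
  | nil => exact (SubstMap.nil hΓ).of_eq (T.bang_unique _ _)
  | cons a Γ ih =>
    have h := ih (List.nodup_cons.1 hΓ).2 fun b hb => hQ b (List.mem_cons_of_mem _ hb)
    exact (h.lift (x := a.1) (s := 𝟙 (a.2.obj V)) (List.nodup_cons.1 hΓ).1
      (by rw [Category.comp_id]; exact hQ a List.mem_cons_self)).of_eq (id_tensorHom_id _ _)

end SubstMap

end SubstMaps

end QPEL

namespace QPEL

open PartialCommMonoid EffectAlgebra

section Reindexing

variable {V : Type u} [Category.{v} V] [MonoidalCategory V] [SymmetricCategory V]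
  [HasBinaryCoproducts V] [IsMonoidalDistrib V] {E : Type w} [CommEffectMonoid E]
  {X X₁ X₂ Y Y₁ Y₂ A B C : V} {h : X ⟶ Y} {h₁ : X₁ ⟶ Y₁} {h₂ : X₂ ⟶ Y₂} {s : X ⟶ X₁ ⊗ X₂}
  {t : Y ⟶ Y₁ ⊗ Y₂}

theorem discard_tensorHom (f : X ⟶ 𝟙_ V) (g : Y ⟶ A) :
    (f ⊗ₘ g) ≫ (λ_ _).hom = (f ▷ Y ≫ (λ_ _).hom) ≫ g := by
  simp [MonoidalCategory.tensorHom_def]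

theorem reindex_pair (hc : h ≫ t = s ≫ (h₁ ⊗ₘ h₂)) (f : Y₁ ⟶ A) (g : Y₂ ⟶ B) :
    s ≫ ((h₁ ≫ f) ⊗ₘ (h₂ ≫ g)) = h ≫ t ≫ (f ⊗ₘ g) := by
  rw [← tensorHom_comp_tensorHom, reassoc_of% hc]

theorem reindex_whisker (hc : h ≫ t = s ≫ (h₁ ⊗ₘ h₂)) (f : Y₂ ⟶ A) :
    s ≫ X₁ ◁ (h₂ ≫ f) ≫ h₁ ▷ A = h ≫ t ≫ Y₁ ◁ f := by
  rw [reassoc_of% hc, MonoidalCategory.tensorHom_def', MonoidalCategory.whiskerLeft_comp,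
    Category.assoc, Category.assoc, whisker_exchange]

theorem reindex_letE (hc : h ≫ t = s ≫ (h₁ ⊗ₘ h₂)) (f : Y₂ ⟶ A ⊗ B) (g : (Y₁ ⊗ A) ⊗ B ⟶ C) :
    s ≫ X₁ ◁ (h₂ ≫ f) ≫ (α_ _ _ _).inv ≫ h₁ ▷ A ▷ B ≫ g =
      h ≫ t ≫ Y₁ ◁ f ≫ (α_ _ _ _).inv ≫ g := by
  rw [← reassoc_of% reindex_whisker hc f, associator_inv_naturality_left_assoc]

theorem whiskerRight_tensorDesc (h₁ : X₁ ⟶ Y₁) (g : Y₁ ⊗ A ⟶ C) (k : Y₁ ⊗ B ⟶ C) :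
    tensorDesc (h₁ ▷ A ≫ g) (h₁ ▷ B ≫ k) = h₁ ▷ (A ⨿ B) ≫ tensorDesc g k := by
  have := map_tensorDesc h₁ (𝟙 A) (𝟙 B) g k
  simpa only [coprod.map_id_id, tensorHom_id] using this.symm

theorem reindex_case (hc : h ≫ t = s ≫ (h₁ ⊗ₘ h₂)) (f : Y₂ ⟶ A ⨿ B) (g : Y₁ ⊗ A ⟶ C)
    (k : Y₁ ⊗ B ⟶ C) :
    s ≫ X₁ ◁ (h₂ ≫ f) ≫ tensorDesc (h₁ ▷ A ≫ g) (h₁ ▷ B ≫ k) =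
      h ≫ t ≫ Y₁ ◁ f ≫ tensorDesc g k := by
  rw [← reassoc_of% reindex_whisker hc f, whiskerRight_tensorDesc]

theorem Triangle.pull_whiskerRight_copair (T : Triangle V E) (h₁ : X₁ ⟶ Y₁) (p : T.Pred (Y₁ ⊗ A))
    (q : T.Pred (Y₁ ⊗ B)) :
    T.copair (T.pull (h₁ ▷ A) p) (T.pull (h₁ ▷ B) q) = T.pull (h₁ ▷ (A ⨿ B)) (T.copair p q) := by
  have := T.pull_copair h₁ (𝟙 A) (𝟙 B) p q
  simpa only [coprod.map_id_id, tensorHom_id] using this.symm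

theorem Triangle.reindex_copair (T : Triangle V E) (hc : h ≫ t = s ≫ (h₁ ⊗ₘ h₂))
    (f : Y₂ ⟶ A ⨿ B) (p : T.Pred (Y₁ ⊗ A)) (q : T.Pred (Y₁ ⊗ B)) :
    T.pull (s ≫ X₁ ◁ (h₂ ≫ f)) (T.copair (T.pull (h₁ ▷ A) p) (T.pull (h₁ ▷ B) q)) =
      T.pull h (T.pull (t ≫ Y₁ ◁ f) (T.copair p q)) := by
  rw [T.pull_whiskerRight_copair, ← T.pull_comp, ← T.pull_comp, Category.assoc,
    reindex_whisker hc f]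

theorem Triangle.reindex_measure (T : Triangle V E) (hc : h ≫ t = s ≫ (h₁ ⊗ₘ h₂)) {n : ℕ}
    {p : Fin (n + 1) → T.Pred Y₂} (hp : IsTest p) (hp' : IsTest fun i => T.pull h₂ (p i))
    (f : Fin (n + 1) → (Y₁ ⟶ C)) :
    s ≫ X₁ ◁ T.meas _ hp' ≫ copower.branch n (fun i => h₁ ≫ f i) =
      h ≫ t ≫ Y₁ ◁ T.meas p hp ≫ copower.branch n f := by
  rw [← T.meas_natural h₂ p hp hp', ← reassoc_of% reindex_whisker hc (T.meas p hp)]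
  have := map_branch h₁ f (𝟙 C)
  simp only [Category.comp_id] at this
  rw [this]

end Reindexing

section Denotations

variable {V : Type u} [Category.{v} V] [MonoidalCategory V] [SymmetricCategory V]
  [HasBinaryCoproducts V] [IsMonoidalDistrib V] {E : Type w} [CommEffectMonoid E]
  (T : Triangle V E)

/-- Values of expressions over the object `X`: arrows for terms, predicates for effects. -/
inductive Triangle.Sem (X : V) : Kind → Type (max v w)
  | tm (A : Ty) (f : X ⟶ A.obj V) : Triangle.Sem X .tm
  | eff (p : T.Pred X) : Triangle.Sem X .eff

variable {T} in
/-- Reindexing of values along an arrow. -/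
noncomputable def Triangle.Sem.pull {X Y : V} (k : Y ⟶ X) : {s : Kind} → T.Sem X s → T.Sem Y s
  | _, .tm A f => .tm A (k ≫ f)
  | _, .eff p => .eff (T.pull k p)

/-- `T.Den n Ξ e v`: in the scope `Ξ`, under `n` binders, the expression `e` has the value `v`. -/
inductive Triangle.Den : ℕ → (Ξ : Scope) → {s : Kind} → Expr s → T.Sem (Scope.obj V Ξ) s → Prop
  | fvar {n : ℕ} {Ξ : Scope} {x : ℕ} {A : Ty} (h : Sub [(.free x, A)] Ξ) :
      Den n Ξ (.fvar x) (.tm A (T.str h ≫ (λ_ (A.obj V)).hom))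
  | bvar {n : ℕ} {Ξ : Scope} {i : ℕ} {A : Ty} (hi : i < n) (h : Sub [(.level (n - 1 - i), A)] Ξ) :
      Den n Ξ (.bvar i) (.tm A (T.str h ≫ (λ_ (A.obj V)).hom))
  | pair {n : ℕ} {Ξ Γ Δ : Scope} {M N : Tm} {A B : Ty} {f : Scope.obj V Γ ⟶ A.obj V}
      {g : Scope.obj V Δ ⟶ B.obj V} (h : Split Ξ Γ Δ) :
      Den n Γ M (.tm A f) → Den n Δ N (.tm B g) →
      Den n Ξ (.pair M N) (.tm (.tensor A B) (T.str₂ h ≫ (f ⊗ₘ g)))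
  | letE {n : ℕ} {Ξ Δ Γ : Scope} {M N : Tm} {A B C : Ty}
      {f : Scope.obj V Γ ⟶ A.obj V ⊗ B.obj V}
      {g : (Scope.obj V Δ ⊗ A.obj V) ⊗ B.obj V ⟶ C.obj V} (h : Split Ξ Δ Γ) :
      Den n Γ M (.tm (.tensor A B) f) →
      Den (n + 2) ((.level (n + 1), B) :: (.level n, A) :: Δ) N (.tm C g) →
      Den n Ξ (.letE M N) (.tm C (T.str₂ h ≫ Scope.obj V Δ ◁ f ≫ (α_ _ _ _).inv ≫ g))
  | unit {n : ℕ} {Ξ : Scope} : Ξ.Nodup → Den n Ξ .unit (.tm .unit (T.bang (Scope.obj V Ξ)))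
  | inl {n : ℕ} {Ξ : Scope} {M : Tm} {A B : Ty} {f : Scope.obj V Ξ ⟶ A.obj V} :
      Den n Ξ M (.tm A f) →
      Den n Ξ (.inl M) (.tm (.sum A B) (f ≫ (coprod.inl : _ ⟶ A.obj V ⨿ B.obj V)))
  | inr {n : ℕ} {Ξ : Scope} {M : Tm} {A B : Ty} {f : Scope.obj V Ξ ⟶ B.obj V} :
      Den n Ξ M (.tm B f) →
      Den n Ξ (.inr M) (.tm (.sum A B) (f ≫ (coprod.inr : _ ⟶ A.obj V ⨿ B.obj V)))
  | caseT {n : ℕ} {Ξ Δ Γ : Scope} {M N P : Tm} {A B C : Ty}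
      {f : Scope.obj V Γ ⟶ A.obj V ⨿ B.obj V} {g : Scope.obj V Δ ⊗ A.obj V ⟶ C.obj V}
      {k : Scope.obj V Δ ⊗ B.obj V ⟶ C.obj V} (h : Split Ξ Δ Γ) :
      Den n Γ M (.tm (.sum A B) f) → Den (n + 1) ((.level n, A) :: Δ) N (.tm C g) →
      Den (n + 1) ((.level n, B) :: Δ) P (.tm C k) →
      Den n Ξ (.caseT M N P) (.tm C (T.str₂ h ≫ Scope.obj V Δ ◁ f ≫ tensorDesc g k))
  | measure {n : ℕ} {Ξ Δ Γ : Scope} {l : ℕ} {φ : Fin (l + 1) → Eff} {M : Fin (l + 1) → Tm}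
      {A : Ty} {p : Fin (l + 1) → T.Pred (Scope.obj V Γ)}
      {f : Fin (l + 1) → (Scope.obj V Δ ⟶ A.obj V)} (h : Split Ξ Δ Γ) :
      (∀ i, Den n Γ (φ i) (.eff (p i))) → (hp : IsTest p) →
      (∀ i, Den n Δ (M i) (.tm A (f i))) →
      Den n Ξ (.measure φ M)
        (.tm A (T.str₂ h ≫ Scope.obj V Δ ◁ T.meas p hp ≫ copower.branch l f))
  | zero {n : ℕ} {Ξ : Scope} : Ξ.Nodup → Den n Ξ .zero (.eff 0)
  | ovee {n : ℕ} {Ξ : Scope} {φ ψ : Eff} {p q s : T.Pred (Scope.obj V Ξ)} :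
      Den n Ξ φ (.eff p) → Den n Ξ ψ (.eff q) → PartialCommMonoid.ovee p q = some s →
      Den n Ξ (.ovee φ ψ) (.eff s)
  | orth {n : ℕ} {Ξ : Scope} {φ : Eff} {p : T.Pred (Scope.obj V Ξ)} :
      Den n Ξ φ (.eff p) → Den n Ξ (.orth φ) (.eff (EffectAlgebra.orth p))
  | mul {n : ℕ} {Ξ : Scope} {φ ψ : Eff} {p : T.Pred (𝟙_ V)} {q : T.Pred (Scope.obj V Ξ)} :
      Den n [] φ (.eff p) → Den n Ξ ψ (.eff q) → Den n Ξ (.mul φ ψ) (.eff (T.scalar p • q))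
  | caseE {n : ℕ} {Ξ Γ Δ : Scope} {M : Tm} {φ ψ : Eff} {A B : Ty}
      {f : Scope.obj V Δ ⟶ A.obj V ⨿ B.obj V} {p : T.Pred (Scope.obj V Γ ⊗ A.obj V)}
      {q : T.Pred (Scope.obj V Γ ⊗ B.obj V)} (h : Split Ξ Γ Δ) :
      Den n Δ M (.tm (.sum A B) f) → Den (n + 1) ((.level n, A) :: Γ) φ (.eff p) →
      Den (n + 1) ((.level n, B) :: Γ) ψ (.eff q) →
      Den n Ξ (.caseE M φ ψ) (.eff (T.pull (T.str₂ h ≫ Scope.obj V Γ ◁ f) (T.copair p q)))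

variable {T}

namespace Triangle

theorem Sem.pull_id {X : V} {s : Kind} (v : T.Sem X s) : v.pull (𝟙 X) = v := by
  cases v <;> simp [Sem.pull, T.pull_id]

theorem Sem.pull_pull {X Y Z : V} {s : Kind} (v : T.Sem X s) (k : Y ⟶ X) (l : Z ⟶ Y) :
    (v.pull k).pull l = v.pull (l ≫ k) := by
  cases v <;> simp [Sem.pull, T.pull_comp]

namespace Den

theorem of_eq {n : ℕ} {Ξ : Scope} {s : Kind} {e : Expr s} {v w : T.Sem (Scope.obj V Ξ) s}
    (h : T.Den n Ξ e v) (hv : v = w) : T.Den n Ξ e w := hv ▸ h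

theorem of_tm {n : ℕ} {Ξ : Scope} {e : Tm} {A : Ty} {f g : Scope.obj V Ξ ⟶ A.obj V}
    (h : T.Den n Ξ e (.tm A f)) (hf : f = g) : T.Den n Ξ e (.tm A g) := hf ▸ h

theorem of_eff {n : ℕ} {Ξ : Scope} {e : Eff} {p q : T.Pred (Scope.obj V Ξ)}
    (h : T.Den n Ξ e (.eff p)) (hp : p = q) : T.Den n Ξ e (.eff q) := hp ▸ h

theorem nodup {n : ℕ} {Ξ : Scope} {s : Kind} {e : Expr s} {v : T.Sem (Scope.obj V Ξ) s}
    (h : T.Den n Ξ e v) : Ξ.Nodup := by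
  induction h with
  | unit h => exact h
  | zero h => exact h
  | _ => first | assumption | grind

theorem weaken {n : ℕ} {Γ : Scope} {s : Kind} {e : Expr s} {v : T.Sem (Scope.obj V Γ) s}
    (h : T.Den n Γ e v) : ∀ {Ξ : Scope} (k : Sub Γ Ξ), T.Den n Ξ e (v.pull (T.str k)) := by
  induction h with
  | @fvar n Γ x A h =>
    intro Ξ k
    have h' : Sub [(.free x, A)] Ξ := by grind
    exact (Den.fvar h').of_tm (by rw [← T.str_comp k h h', Category.assoc])
  | @bvar n Γ i A hi h =>
    intro Ξ k
    have h' : Sub [(.level (n - 1 - i), A)] Ξ := by grind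
    exact (Den.bvar hi h').of_tm (by rw [← T.str_comp k h h', Category.assoc])
  | @pair n Ξ' Γ Δ _ _ _ _ _ _ h h₁ h₂ =>
    intro Ξ k
    have h' : Split Ξ Γ Δ := by grind
    exact (Den.pair h' h₁ h₂).of_tm (by rw [← T.str_str₂ k h h']; exact Category.assoc _ _ _)
  | @letE n Ξ' Γ Δ _ _ _ _ _ _ _ h h₁ h₂ =>
    intro Ξ k
    have h' : Split Ξ Γ Δ := by grind
    exact (Den.letE h' h₁ h₂).of_tm (by rw [← T.str_str₂ k h h', Category.assoc])
  | unit h => exact fun k => (Den.unit k.1).of_tm (T.bang_unique _ _)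
  | inl _ ih => exact fun k => (Den.inl (ih k)).of_tm (Category.assoc _ _ _)
  | inr _ ih => exact fun k => (Den.inr (ih k)).of_tm (Category.assoc _ _ _)
  | @caseT n Ξ' Γ Δ _ _ _ _ _ _ _ _ _ h h₁ h₂ h₃ =>
    intro Ξ k
    have h' : Split Ξ Γ Δ := by grind
    exact (Den.caseT h' h₁ h₂ h₃).of_tm (by rw [← T.str_str₂ k h h', Category.assoc])
  | @measure n Ξ' Γ Δ _ _ _ _ _ _ h h₁ hp h₂ =>
    intro Ξ k
    have h' : Split Ξ Γ Δ := by grind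
    exact (Den.measure h' h₁ hp h₂).of_tm (by rw [← T.str_str₂ k h h', Category.assoc])
  | zero h => exact fun k => (Den.zero k.1).of_eff (T.pull_zero _).symm
  | ovee _ _ hs ih₁ ih₂ => exact fun k => Den.ovee (ih₁ k) (ih₂ k) (T.pull_ovee _ hs)
  | orth _ ih => exact fun k => (Den.orth (ih k)).of_eff (T.pull_orth _ _).symm
  | mul h₁ _ _ ih₂ => exact fun k => (Den.mul h₁ (ih₂ k)).of_eff (T.pull_smul _ _ _).symm
  | @caseE n Ξ' Γ Δ _ _ _ _ _ _ _ _ h h₁ h₂ h₃ =>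
    intro Ξ k
    have h' : Split Ξ Γ Δ := by grind
    exact (Den.caseE h' h₁ h₂ h₃).of_eff (by rw [← T.str_str₂ k h h', Category.assoc, T.pull_comp])

end Den

end Triangle

/-- A variable as an expression under `n` binders. -/
def Key.var (n : ℕ) : Key → Tm
  | .free x => .fvar x
  | .level j => .bvar (n - 1 - j)

/-- The levels that a scope uses are less than `n`. -/
@[grind =]
def Scope.Bounded (n : ℕ) (Ξ : Scope) : Prop := ∀ j A, (Key.level j, A) ∈ Ξ → j < n

/-- Operations on expressions that act on variables only; the first argument counts the binders
that have been passed. -/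
structure Traversal (F : ℕ → (s : Kind) → Expr s → Expr s) : Prop where
  bvar : ∀ {d i}, i < d → F d _ (.bvar i) = .bvar i
  pair : ∀ d M N, F d _ (.pair M N) = .pair (F d _ M) (F d _ N)
  letE : ∀ d M N, F d _ (.letE M N) = .letE (F d _ M) (F (d + 2) _ N)
  unit : ∀ d, F d _ .unit = .unit
  inl : ∀ d M, F d _ (.inl M) = .inl (F d _ M)
  inr : ∀ d M, F d _ (.inr M) = .inr (F d _ M)
  caseT : ∀ d M N P, F d _ (.caseT M N P) = .caseT (F d _ M) (F (d + 1) _ N) (F (d + 1) _ P)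
  measure : ∀ d {n : ℕ} (φ : Fin (n + 1) → Eff) (M : Fin (n + 1) → Tm),
    F d _ (.measure φ M) = .measure (fun i => F d _ (φ i)) (fun i => F d _ (M i))
  zero : ∀ d, F d _ .zero = .zero
  ovee : ∀ d φ ψ, F d _ (.ovee φ ψ) = .ovee (F d _ φ) (F d _ ψ)
  orth : ∀ d φ, F d _ (.orth φ) = .orth (F d _ φ)
  mul : ∀ d φ ψ, F d _ (.mul φ ψ) = .mul (F d _ φ) (F d _ ψ)
  caseE : ∀ d M φ ψ, F d _ (.caseE M φ ψ) = .caseE (F d _ M) (F (d + 1) _ φ) (F (d + 1) _ ψ)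

namespace Traversal

theorem id : Traversal fun _ _ e => e := by
  constructor <;> intros <;> rfl

theorem comp {F G : ℕ → (s : Kind) → Expr s → Expr s} (hF : Traversal F) (hG : Traversal G) :
    Traversal fun d s e => G d s (F d s e) where
  bvar h := by rw [hF.bvar h, hG.bvar h]
  pair d M N := by rw [hF.pair, hG.pair]
  letE d M N := by rw [hF.letE, hG.letE]
  unit d := by rw [hF.unit, hG.unit]
  inl d M := by rw [hF.inl, hG.inl]
  inr d M := by rw [hF.inr, hG.inr]
  caseT d M N P := by rw [hF.caseT, hG.caseT]
  measure d n φ M := by rw [hF.measure, hG.measure]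
  zero d := by rw [hF.zero, hG.zero]
  ovee d φ ψ := by rw [hF.ovee, hG.ovee]
  orth d φ := by rw [hF.orth, hG.orth]
  mul d φ ψ := by rw [hF.mul, hG.mul]
  caseE d M φ ψ := by rw [hF.caseE, hG.caseE]

theorem close (x k : ℕ) : Traversal fun d _ e => Expr.close x (k + d) e := by
  constructor <;> intros <;> rfl

theorem subst (σ : ℕ → Tm) : Traversal fun _ _ e => Expr.subst σ e := by
  constructor <;> intros <;> rfl

variable (T) in
/-- The variable `x`, declared under `n` binders, is replaced by a term with value `g`. -/
def VarDen (F : ℕ → (s : Kind) → Expr s → Expr s) (n m d : ℕ) (x : Key) (Ξ : Scope) (A : Ty)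
    (g : Scope.obj V Ξ ⟶ A.obj V) : Prop :=
  ∀ d' ≥ d, T.Den (m + d') Ξ (F d' _ (x.var (n + d'))) (.tm A g)

variable {F : ℕ → (s : Kind) → Expr s → Expr s}

theorem VarDen.succ {n m d : ℕ} {x : Key} {Ξ : Scope} {A : Ty} {g : Scope.obj V Ξ ⟶ A.obj V}
    (h : VarDen T F n m d x Ξ A g) : VarDen T F n m (d + 1) x Ξ A g :=
  fun d' hd => h d' (Nat.le_of_succ_le hd)

theorem varDen_level (hF : Traversal F) (n m d : ℕ) (A : Ty) :
    VarDen T F n m (d + 1) (.level (n + d)) [(.level (m + d), A)] A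
      ((λ_ (A.obj V)).hom ≫ 𝟙 (A.obj V)) := by
  intro d' hd
  have hj : m + d' - 1 - (n + d' - 1 - (n + d)) = m + d := by omega
  have key : ∀ j, j = m + d → ∃ hk : Sub [(Key.level j, A)] [(.level (m + d), A)],
      T.str hk ≫ (λ_ (A.obj V)).hom = (λ_ (A.obj V)).hom ≫ 𝟙 (A.obj V) := by
    rintro _ rfl
    exact ⟨by grind, by rw [T.str_self, Category.id_comp, Category.comp_id]⟩
  obtain ⟨hk, hc⟩ := key _ hj
  rw [Key.var, hF.bvar (by omega)]
  exact (Triangle.Den.bvar (by omega) hk).of_tm hc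

theorem lift (hF : Traversal F) {n m d : ℕ} {Ξ Γ : Scope} {h : Scope.obj V Ξ ⟶ Scope.obj V Γ}
    (hh : SubstMap T (VarDen T F n m d) Ξ Γ h) (hΞ : Ξ.Bounded (m + d)) (A : Ty) :
    SubstMap T (VarDen T F n m (d + 1)) ((.level (m + d), A) :: Ξ) ((.level (n + d), A) :: Γ)
      (h ▷ A.obj V) :=
  ((hh.mono fun _ _ _ _ h => h.succ).lift (by grind) (hF.varDen_level n m d A)).of_eq
    (tensorHom_id _ _)

theorem den_var {n m d : ℕ} {Ξ Γ : Scope} {x : Key} {A : Ty}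
    {h : Scope.obj V Ξ ⟶ Scope.obj V Γ} (hh : SubstMap T (VarDen T F n m d) Ξ Γ h)
    (k : Sub [(x, A)] Γ) :
    T.Den (m + d) Ξ (F d _ (x.var (n + d))) (.tm A (h ≫ T.str k ≫ (λ_ (A.obj V)).hom)) := by
  have := hh.comp_str (T.str_spec k)
  rw [← Category.assoc]
  generalize h ≫ T.str k = h' at this
  cases this with
  | @cons _ Ξ₁ Ξ₂ _ _ _ f g hs h hg =>
    have k₂ : Sub Ξ₂ Ξ := by grind
    refine ((hg d le_rfl).weaken k₂).of_tm ?_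
    rw [← T.str₂_discard_left hs k₂ f, Category.assoc]
    exact (congrArg (T.str₂ hs ≫ ·) (discard_tensorHom f g)).symm.trans (Category.assoc _ _ _).symm

theorem den (hF : Traversal F) {n m N : ℕ} {s : Kind} {Γ : Scope} {e : Expr s}
    {v : T.Sem (Scope.obj V Γ) s} (hv : T.Den N Γ e v) :
    ∀ {d : ℕ} {Ξ : Scope} {h : Scope.obj V Ξ ⟶ Scope.obj V Γ}, N = n + d →
      SubstMap T (VarDen T F n m d) Ξ Γ h → Ξ.Bounded (m + d) →
      T.Den (m + d) Ξ (F d s e) (v.pull h) := by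
  induction hv with
  | @fvar N Γ x A k =>
    rintro d Ξ h rfl hh hΞ
    exact den_var hh k
  | @bvar N Γ i A hi k =>
    rintro d Ξ h rfl hh hΞ
    have := den_var hh k
    rwa [Key.var, show n + d - 1 - (n + d - 1 - i) = i by omega] at this
  | @pair n Γ Γ₁ Γ₂ _ _ _ _ f g k h₁ h₂ ih₁ ih₂ =>
    rintro d Ξ h rfl hh hΞ
    obtain ⟨Ξ₁, Ξ₂, hs, h₁, h₂, hh₁, hh₂, hc⟩ := hh.split k
    rw [hF.pair]
    refine (Triangle.Den.pair hs (ih₁ rfl hh₁ (by grind)) (ih₂ rfl hh₂ (by grind))).of_tm ?_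
    exact reindex_pair hc _ _
  | @letE n Γ Γ₁ Γ₂ _ _ A B _ f g k h₁ h₂ ih₁ ih₂ =>
    rintro d Ξ h rfl hh hΞ
    obtain ⟨Ξ₁, Ξ₂, hs, h₁, h₂, hh₁, hh₂, hc⟩ := hh.split k
    rw [hF.letE]
    have hb : Ξ₁.Bounded (m + d) := by grind
    have l₁ := hF.lift hh₁ hb
    have l₂ := hF.lift (l₁ A) (by grind) B
    exact (Triangle.Den.letE hs (ih₁ rfl hh₂ (by grind)) (ih₂ rfl l₂ (by grind))).of_tm
      (reindex_letE hc _ _)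
  | unit h =>
    rintro d Ξ h rfl hh hΞ
    rw [hF.unit]
    exact (Triangle.Den.unit hh.nodup).of_tm (T.bang_unique _ _)
  | inl _ ih =>
    rintro d Ξ h rfl hh hΞ
    rw [hF.inl]
    exact (Triangle.Den.inl (ih rfl hh hΞ)).of_tm (Category.assoc _ _ _)
  | inr _ ih =>
    rintro d Ξ h rfl hh hΞ
    rw [hF.inr]
    exact (Triangle.Den.inr (ih rfl hh hΞ)).of_tm (Category.assoc _ _ _)
  | @caseT n Γ Γ₁ Γ₂ _ _ _ _ _ _ f g g' k h₁ h₂ h₃ ih₁ ih₂ ih₃ =>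
    rintro d Ξ h rfl hh hΞ
    obtain ⟨Ξ₁, Ξ₂, hs, h₁, h₂, hh₁, hh₂, hc⟩ := hh.split k
    rw [hF.caseT]
    have l₁ := hF.lift hh₁ (by grind)
    refine (Triangle.Den.caseT hs (ih₁ rfl hh₂ (by grind)) (ih₂ rfl (l₁ _) (by grind))
      (ih₃ rfl (l₁ _) (by grind))).of_tm (reindex_case hc _ _ _)
  | @measure n Γ Γ₁ Γ₂ _ _ _ _ p f k h₁ hp h₂ ih₁ ih₂ =>
    rintro d Ξ h rfl hh hΞ
    obtain ⟨Ξ₁, Ξ₂, hs, h₁, h₂, hh₁, hh₂, hc⟩ := hh.split k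
    rw [hF.measure]
    refine (Triangle.Den.measure hs (fun i => ih₁ i rfl hh₂ (by grind)) (T.pull_isTest h₂ hp)
      (fun i => ih₂ i rfl hh₁ (by grind))).of_tm (T.reindex_measure hc hp _ _)
  | zero h =>
    rintro d Ξ h rfl hh hΞ
    rw [hF.zero]
    exact (Triangle.Den.zero hh.nodup).of_eff (T.pull_zero _).symm
  | ovee _ _ hs ih₁ ih₂ =>
    rintro d Ξ h rfl hh hΞ
    rw [hF.ovee]
    exact Triangle.Den.ovee (ih₁ rfl hh hΞ) (ih₂ rfl hh hΞ) (T.pull_ovee _ hs)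
  | orth _ ih =>
    rintro d Ξ h rfl hh hΞ
    rw [hF.orth]
    exact (Triangle.Den.orth (ih rfl hh hΞ)).of_eff (T.pull_orth _ _).symm
  | mul h₁ _ ih₁ ih₂ =>
    rintro d Ξ h rfl hh hΞ
    rw [hF.mul]
    have := ih₁ (Ξ := []) (h := 𝟙 _) rfl
      ((SubstMap.nil List.nodup_nil).of_eq (T.bang_unique _ _)) (by grind)
    rw [Triangle.Sem.pull_id] at this
    exact (Triangle.Den.mul this (ih₂ rfl hh hΞ)).of_eff (T.pull_smul _ _ _).symm
  | @caseE n Γ Γ₁ Γ₂ _ _ _ _ _ _ _ _ k h₁ h₂ h₃ ih₁ ih₂ ih₃ =>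
    rintro d Ξ h rfl hh hΞ
    obtain ⟨Ξ₁, Ξ₂, hs, h₁, h₂, hh₁, hh₂, hc⟩ := hh.split k
    rw [hF.caseE]
    have l₁ := hF.lift hh₁ (by grind)
    refine (Triangle.Den.caseE hs (ih₁ rfl hh₂ (by grind)) (ih₂ rfl (l₁ _) (by grind))
      (ih₃ rfl (l₁ _) (by grind))).of_eff (T.reindex_copair hc _ _ _)

end Traversal

end Denotations

end QPEL

namespace QPEL

open PartialCommMonoid EffectAlgebra

section Points

variable (V : Type u) [Category.{v} V] [MonoidalCategory V] [HasBinaryCoproducts V]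

/-- A closed point of the interpretation of a type. -/
noncomputable def Ty.pt : (A : Ty) → (𝟙_ V ⟶ A.obj V)
  | .tensor A B => (λ_ (𝟙_ V)).inv ≫ (A.pt ⊗ₘ B.pt)
  | .unit => 𝟙 _
  | .sum A B => A.pt ≫ (coprod.inl : A.obj V ⟶ A.obj V ⨿ B.obj V)

/-- A closed point of the interpretation of a scope. -/
noncomputable def Scope.pt : (Ξ : Scope) → (𝟙_ V ⟶ Ξ.obj V)
  | [] => 𝟙 _
  | a :: Ξ => (λ_ (𝟙_ V)).inv ≫ (Scope.pt Ξ ⊗ₘ a.2.pt V)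

end Points

section Strengthening

variable {V : Type u} [Category.{v} V] [MonoidalCategory V] [SymmetricCategory V]
  [HasBinaryCoproducts V] [IsMonoidalDistrib V] {E : Type w} [CommEffectMonoid E]
  {T : Triangle V E}

theorem discard_section {X Y : V} (p : 𝟙_ V ⟶ Y) (k : Y ⟶ 𝟙_ V) (h : p ≫ k = 𝟙 _) :
    ((ρ_ X).inv ≫ X ◁ p) ≫ X ◁ k ≫ (ρ_ X).hom = 𝟙 X := by
  rw [Category.assoc, ← MonoidalCategory.whiskerLeft_comp_assoc, h]
  simp

theorem Triangle.exists_section {Γ Ξ : Scope} (h : Sub Γ Ξ) : ∃ i, i ≫ T.str h = 𝟙 _ := by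
  classical
  let R := Ξ.filter (· ∉ Γ)
  have h₁ : Sub (R ++ Γ) Ξ := by grind
  have h₂ : Sub Ξ (R ++ Γ) := by grind
  have h₃ : Split (R ++ Γ) Γ R := by grind
  have h₄ : Sub Γ (R ++ Γ) := by grind
  have h₅ : Sub (R ++ Γ) (R ++ Γ) := by grind
  have hs : T.str₂ h₃ = (Scope.split V R Γ).hom := by
    change T.str h₅ ≫ _ = _
    rw [T.str_self, Category.id_comp]
  refine ⟨((ρ_ _).inv ≫ Scope.obj V Γ ◁ Scope.pt V R) ≫ (Scope.split V R Γ).inv ≫ T.str h₂, ?_⟩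
  simp only [Category.assoc]
  rw [T.str_comp h₂ h h₄,
    ← T.str₂_discard_right h₃ h₄ (T.bang _), hs, Iso.inv_hom_id_assoc]
  exact (Category.assoc _ _ _).symm.trans (discard_section _ _ (T.bang_unique _ _))

/-- `e` uses the variable `k`, where `n` binders have been passed. -/
@[grind =]
def Expr.Uses (k : Key) : ℕ → {s : Kind} → Expr s → Prop
  | n, _, bvar i => k = .level (n - 1 - i)
  | _, _, fvar y => k = .free y
  | n, _, pair M N => Uses k n M ∨ Uses k n N
  | n, _, letE M N => Uses k n M ∨ Uses k (n + 2) N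
  | _, _, unit => False
  | n, _, inl M => Uses k n M
  | n, _, inr M => Uses k n M
  | n, _, caseT M N P => Uses k n M ∨ Uses k (n + 1) N ∨ Uses k (n + 1) P
  | n, _, measure φ M => (∃ i, Uses k n (φ i)) ∨ ∃ i, Uses k n (M i)
  | _, _, zero => False
  | n, _, ovee φ ψ => Uses k n φ ∨ Uses k n ψ
  | n, _, orth φ => Uses k n φ
  | n, _, mul φ ψ => Uses k n φ ∨ Uses k n ψ
  | n, _, caseE M φ ψ => Uses k n M ∨ Uses k (n + 1) φ ∨ Uses k (n + 1) ψ

theorem Expr.uses_free_iff (x : ℕ) {s : Kind} (e : Expr s) :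
    ∀ n, e.Uses (.free x) n ↔ e.Occurs x := by
  induction e with
  | fvar y => intro n; simp [Uses, Occurs, eq_comm]
  | _ => intro n; simp_all [Uses, Occurs]

/-- No key is declared twice, and the levels are less than `n`. -/
@[grind =]
def Scope.WF (n : ℕ) (Ξ : Scope) : Prop :=
  Ξ.Nodup ∧ (∀ k A B, (k, A) ∈ Ξ → (k, B) ∈ Ξ → A = B) ∧ Ξ.Bounded n

theorem Scope.WF.sub {n : ℕ} {Ξ Γ : Scope} (h : Ξ.WF n) (k : Sub Γ Ξ) : Γ.WF n := by grind

theorem Scope.WF.cons {n : ℕ} {Ξ : Scope} (h : Ξ.WF n) (A : Ty) :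
    Scope.WF (n + 1) ((.level n, A) :: Ξ) := by grind

namespace Triangle.Den

theorem exists_of_uses {n : ℕ} {Γ : Scope} {s : Kind} {e : Expr s} {v : T.Sem (Scope.obj V Γ) s}
    (h : T.Den n Γ e v) {k : Key} (hk : ∀ j, k = .level j → j < n) (hu : e.Uses k n) :
    ∃ A, (k, A) ∈ Γ := by
  induction h with
  | mul h₁ h₂ ih₁ ih₂ =>
    rcases hu with hu | hu
    · obtain ⟨A, hA⟩ := ih₁ hk hu
      cases hA
    · exact ih₂ hk hu
  | _ => grind

theorem _root_.QPEL.Triangle.exists_split_restrict {Γ Γ' Γ₁ Γ₂ : Scope} (h : Split Γ Γ₁ Γ₂)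
    (k : Sub Γ' Γ) : ∃ Γ₁' Γ₂', ∃ (h' : Split Γ' Γ₁' Γ₂') (k₁ : Sub Γ₁' Γ₁) (k₂ : Sub Γ₂' Γ₂),
      T.str k ≫ T.str₂ h' = T.str₂ h ≫ (T.str k₁ ⊗ₘ T.str k₂) ∧
      (∀ a ∈ Γ₁, a ∈ Γ' → a ∈ Γ₁') ∧ ∀ a ∈ Γ₂, a ∈ Γ' → a ∈ Γ₂' := by
  classical
  have k₁ : Sub (Γ'.filter (· ∈ Γ₁)) Γ₁ := by grind
  have k₂ : Sub (Γ'.filter (· ∈ Γ₂)) Γ₂ := by grind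
  have h' : Split Γ' (Γ'.filter (· ∈ Γ₁)) (Γ'.filter (· ∈ Γ₂)) := by grind
  have h'' : Split Γ (Γ'.filter (· ∈ Γ₁)) (Γ'.filter (· ∈ Γ₂)) := by grind
  exact ⟨_, _, h', k₁, k₂, (T.str_str₂ k h' h'').trans (T.str₂_str h k₁ k₂ h'').symm, by grind,
    by grind⟩

theorem exists_tm {n : ℕ} {X : V} {Γ' : Scope} {k : X ⟶ Scope.obj V Γ'} {M : Tm} {A : Ty}
    {f : X ⟶ A.obj V} :
    (∃ v', T.Den n Γ' M v' ∧ Sem.tm A f = v'.pull k) ↔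
      ∃ f', T.Den n Γ' M (.tm A f') ∧ f = k ≫ f' := by
  constructor
  · rintro ⟨⟨_, f'⟩, h, h'⟩
    cases h'
    exact ⟨f', h, rfl⟩
  · rintro ⟨f', h, rfl⟩
    exact ⟨_, h, rfl⟩

theorem exists_eff {n : ℕ} {X : V} {Γ' : Scope} {k : X ⟶ Scope.obj V Γ'} {φ : Eff}
    {p : T.Pred X} :
    (∃ v', T.Den n Γ' φ v' ∧ Sem.eff p = v'.pull k) ↔
      ∃ p', T.Den n Γ' φ (.eff p') ∧ p = T.pull k p' := by
  constructor
  · rintro ⟨v', h, h'⟩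
    cases v' with | eff p' => ?_
    cases h'
    exact ⟨p', h, rfl⟩
  · rintro ⟨p', h, rfl⟩
    exact ⟨_, h, rfl⟩

theorem strengthen {n : ℕ} {Γ : Scope} {s : Kind} {e : Expr s} {v : T.Sem (Scope.obj V Γ) s}
    (h : T.Den n Γ e v) (hΓ : Γ.WF n) {Γ' : Scope} (k : Sub Γ' Γ)
    (hk : ∀ a ∈ Γ, e.Uses a.1 n → a ∈ Γ') : ∃ v', T.Den n Γ' e v' ∧ v = v'.pull (T.str k) := by
  classical
  induction h generalizing Γ' with
  | @fvar n Γ x A h =>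
    have h' : Sub [(.free x, A)] Γ' := by grind
    refine ⟨_, .fvar h', ?_⟩
    rw [← T.str_comp k h' h, Category.assoc]; rfl
  | @bvar n Γ i A hi h =>
    have h' : Sub [(.level (n - 1 - i), A)] Γ' := by grind
    refine ⟨_, .bvar hi h', ?_⟩
    rw [← T.str_comp k h' h, Category.assoc]; rfl
  | @pair n Γ Γ₁ Γ₂ M N A B f g h _ _ ih₁ ih₂ =>
    obtain ⟨Γ₁', Γ₂', h', k₁, k₂, hc, m₁, m₂⟩ := exists_split_restrict (T := T) h k
    obtain ⟨f', hf, rfl⟩ := exists_tm.1 (ih₁ (hΓ.sub (by grind)) k₁ (by grind))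
    obtain ⟨g', hg, rfl⟩ := exists_tm.1 (ih₂ (hΓ.sub (by grind)) k₂ (by grind))
    exact ⟨_, .pair h' hf hg, congrArg (Sem.tm _) (reindex_pair hc f' g')⟩
  | @letE n Γ Γ₁ Γ₂ M N A B C f g h _ h₂ ih₁ ih₂ =>
    obtain ⟨Γ₁', Γ₂', h', k₁, k₂, hc, m₁, m₂⟩ := exists_split_restrict (T := T) h k
    have w : Γ₁.WF n := hΓ.sub (by grind)
    have k₁' : Sub ((.level n, A) :: Γ₁') ((.level n, A) :: Γ₁) := by grind
    have k₁'' : Sub ((.level (n + 1), B) :: (.level n, A) :: Γ₁')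
      ((.level (n + 1), B) :: (.level n, A) :: Γ₁) := by grind
    obtain ⟨f', hf, rfl⟩ := exists_tm.1 (ih₁ (hΓ.sub (by grind)) k₂ (by grind))
    obtain ⟨g', hg, rfl⟩ := exists_tm.1 (ih₂ ((w.cons A).cons B) k₁'' (by grind))
    rw [T.str_cons k₁'' k₁', T.str_cons k₁' k₁]
    exact ⟨_, .letE h' hf hg, congrArg (Sem.tm _) (reindex_letE hc f' g')⟩
  | unit h => exact ⟨_, .unit k.2.1, congrArg (Sem.tm _) (T.bang_unique _ _)⟩
  | @inl n Γ M A B f _ ih =>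
    obtain ⟨f', hf, rfl⟩ := exists_tm.1 (ih hΓ k hk)
    exact ⟨_, .inl (B := B) hf, congrArg (Sem.tm (.sum A B)) (Category.assoc _ _ _)⟩
  | @inr n Γ M A B f _ ih =>
    obtain ⟨f', hf, rfl⟩ := exists_tm.1 (ih hΓ k hk)
    exact ⟨_, .inr (A := A) hf, congrArg (Sem.tm (.sum A B)) (Category.assoc _ _ _)⟩
  | @caseT n Γ Γ₁ Γ₂ M N P A B C f g l h _ _ _ ih₁ ih₂ ih₃ =>
    obtain ⟨Γ₁', Γ₂', h', k₁, k₂, hc, m₁, m₂⟩ := exists_split_restrict (T := T) h k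
    have w : Γ₁.WF n := hΓ.sub (by grind)
    have kA : Sub ((.level n, A) :: Γ₁') ((.level n, A) :: Γ₁) := by grind
    have kB : Sub ((.level n, B) :: Γ₁') ((.level n, B) :: Γ₁) := by grind
    obtain ⟨f', hf, rfl⟩ := exists_tm.1 (ih₁ (hΓ.sub (by grind)) k₂ (by grind))
    obtain ⟨g', hg, rfl⟩ := exists_tm.1 (ih₂ (w.cons A) kA (by grind))
    obtain ⟨l', hl, rfl⟩ := exists_tm.1 (ih₃ (w.cons B) kB (by grind))
    rw [T.str_cons kA k₁, T.str_cons kB k₁]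
    exact ⟨_, .caseT h' hf hg hl, congrArg (Sem.tm _) (reindex_case hc f' g' l')⟩
  | @measure n Γ Γ₁ Γ₂ l φ M A p f h _ hp _ ih₁ ih₂ =>
    obtain ⟨Γ₁', Γ₂', h', k₁, k₂, hc, m₁, m₂⟩ := exists_split_restrict (T := T) h k
    have w₁ : Γ₁.WF n := hΓ.sub (by grind)
    have w₂ : Γ₂.WF n := hΓ.sub (by grind)
    choose p' hp₁ hp' using fun i => exists_eff.1 (ih₁ i w₂ k₂ fun a ha hu =>
      m₂ a ha (hk a (by grind) (Or.inl ⟨i, hu⟩)))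
    choose f' hf hf' using fun i => exists_tm.1 (ih₂ i w₁ k₁ fun a ha hu =>
      m₁ a ha (hk a (by grind) (Or.inr ⟨i, hu⟩)))
    obtain rfl := funext hp'
    obtain rfl := funext hf'
    obtain ⟨i, hi⟩ := T.exists_section k₂
    have ht : IsTest p' := by
      simpa only [← T.pull_comp, hi, T.pull_id] using T.pull_isTest i hp
    exact ⟨_, .measure h' hp₁ ht hf, congrArg (Sem.tm _) (T.reindex_measure hc ht hp f')⟩
  | zero h => exact ⟨_, .zero k.2.1, congrArg Sem.eff (T.pull_zero _).symm⟩
  | ovee _ _ hs ih₁ ih₂ =>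
    obtain ⟨p, hp, rfl⟩ := exists_eff.1 (ih₁ hΓ k (by grind))
    obtain ⟨q, hq, rfl⟩ := exists_eff.1 (ih₂ hΓ k (by grind))
    obtain ⟨i, hi⟩ := T.exists_section k
    have ht := T.pull_ovee i hs
    simp only [← T.pull_comp, hi, T.pull_id] at ht
    refine ⟨_, .ovee hp hq ht, congrArg Sem.eff (Option.some.inj ?_)⟩
    rw [← hs, T.pull_ovee _ ht]
  | orth _ ih =>
    obtain ⟨p, hp, rfl⟩ := exists_eff.1 (ih hΓ k hk)
    exact ⟨_, .orth hp, congrArg Sem.eff (T.pull_orth _ _).symm⟩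
  | mul h₁ _ _ ih₂ =>
    obtain ⟨p, hp, rfl⟩ := exists_eff.1 (ih₂ hΓ k (by grind))
    exact ⟨_, .mul h₁ hp, congrArg Sem.eff (T.pull_smul _ _ _).symm⟩
  | @caseE n Γ Γ₁ Γ₂ M φ ψ A B f p q h _ _ _ ih₁ ih₂ ih₃ =>
    obtain ⟨Γ₁', Γ₂', h', k₁, k₂, hc, m₁, m₂⟩ := exists_split_restrict (T := T) h k
    have w : Γ₁.WF n := hΓ.sub (by grind)
    have kA : Sub ((.level n, A) :: Γ₁') ((.level n, A) :: Γ₁) := by grind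
    have kB : Sub ((.level n, B) :: Γ₁') ((.level n, B) :: Γ₁) := by grind
    obtain ⟨f', hf, rfl⟩ := exists_tm.1 (ih₁ (hΓ.sub (by grind)) k₂ (by grind))
    obtain ⟨p', hp, rfl⟩ := exists_eff.1 (ih₂ (w.cons A) kA (by grind))
    obtain ⟨q', hq, rfl⟩ := exists_eff.1 (ih₃ (w.cons B) kB (by grind))
    rw [T.str_cons kA k₁, T.str_cons kB k₁]
    exact ⟨_, .caseE h' hf hp hq, congrArg Sem.eff (T.reindex_copair hc f' p' q')⟩

end Triangle.Den

end Strengthening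

end QPEL

namespace QPEL

open PartialCommMonoid EffectAlgebra

/-- The type on whose structure `A` and `B` agree; parts in which they differ become the unit. -/
def Ty.meet : Ty → Ty → Ty
  | .tensor A B, .tensor A' B' => .tensor (A.meet A') (B.meet B')
  | .sum A B, .sum A' B' => .sum (A.meet A') (B.meet B')
  | .unit, .unit => .unit
  | .tensor _ _, .sum _ _ => .unit
  | .tensor _ _, .unit => .unit
  | .sum _ _, .tensor _ _ => .unit
  | .sum _ _, .unit => .unit
  | .unit, .tensor _ _ => .unit
  | .unit, .sum _ _ => .unit

section Meets

variable (V : Type u) [Category.{v} V] [MonoidalCategory V] [HasBinaryCoproducts V]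

/-- The arrow that fills the parts in which `A` and `B` differ with the closed points of `A`. -/
noncomputable def Ty.meetL : (A B : Ty) → ((A.meet B).obj V ⟶ A.obj V)
  | .tensor A B, .tensor A' B' => A.meetL A' ⊗ₘ B.meetL B'
  | .sum A B, .sum A' B' => (coprod.map (A.meetL A') (B.meetL B') :
      (A.meet A').obj V ⨿ (B.meet B').obj V ⟶ A.obj V ⨿ B.obj V)
  | .unit, .unit => 𝟙 _
  | .tensor A B, .sum _ _ => Ty.pt V (.tensor A B)
  | .tensor A B, .unit => Ty.pt V (.tensor A B)
  | .sum A B, .tensor _ _ => Ty.pt V (.sum A B)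
  | .sum A B, .unit => Ty.pt V (.sum A B)
  | .unit, .tensor _ _ => 𝟙 _
  | .unit, .sum _ _ => 𝟙 _

/-- The arrow that fills the parts in which `A` and `B` differ with the closed points of `B`. -/
noncomputable def Ty.meetR : (A B : Ty) → ((A.meet B).obj V ⟶ B.obj V)
  | .tensor A B, .tensor A' B' => A.meetR A' ⊗ₘ B.meetR B'
  | .sum A B, .sum A' B' => (coprod.map (A.meetR A') (B.meetR B') :
      (A.meet A').obj V ⨿ (B.meet B').obj V ⟶ A'.obj V ⨿ B'.obj V)
  | .unit, .unit => 𝟙 _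
  | .tensor _ _, .sum A B => Ty.pt V (.sum A B)
  | .tensor _ _, .unit => 𝟙 _
  | .sum _ _, .tensor A B => Ty.pt V (.tensor A B)
  | .sum _ _, .unit => 𝟙 _
  | .unit, .tensor A B => Ty.pt V (.tensor A B)
  | .unit, .sum A B => Ty.pt V (.sum A B)

theorem Ty.meetL_self (A : Ty) : A.meetL V A = A.meetR V A := by
  induction A with
  | tensor A B ihA ihB => exact congrArg₂ (· ⊗ₘ ·) ihA ihB
  | unit => rfl
  | sum A B ihA ihB => exact congrArg₂ coprod.map ihA ihB

/-- Arrows that fill some parts of a type with its closed points. -/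
inductive Ty.Fill : (A₀ A : Ty) → (A₀.obj V ⟶ A.obj V) → Prop
  | pt (A : Ty) : Fill .unit A (A.pt V)
  | tensor {A₀ A B₀ B : Ty} {s : A₀.obj V ⟶ A.obj V} {t : B₀.obj V ⟶ B.obj V} :
      Fill A₀ A s → Fill B₀ B t → Fill (.tensor A₀ B₀) (.tensor A B) (s ⊗ₘ t)
  | sum {A₀ A B₀ B : Ty} {s : A₀.obj V ⟶ A.obj V} {t : B₀.obj V ⟶ B.obj V} :
      Fill A₀ A s → Fill B₀ B t → Fill (.sum A₀ B₀) (.sum A B)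
        (coprod.map s t : A₀.obj V ⨿ B₀.obj V ⟶ A.obj V ⨿ B.obj V)

theorem Ty.fill_meetL (A B : Ty) : Ty.Fill V (A.meet B) A (A.meetL V B) := by
  induction A generalizing B with
  | tensor A A' ih ih' =>
    cases B with
    | tensor B B' => exact .tensor (ih B) (ih' B')
    | _ => exact .pt _
  | unit => cases B <;> exact .pt .unit
  | sum A A' ih ih' =>
    cases B with
    | sum B B' => exact .sum (ih B) (ih' B')
    | _ => exact .pt _

theorem Ty.fill_meetR (A B : Ty) : Ty.Fill V (A.meet B) B (A.meetR V B) := by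
  induction A generalizing B with
  | tensor A A' ih ih' =>
    cases B with
    | tensor B B' => exact .tensor (ih B) (ih' B')
    | sum => exact .pt _
    | unit => exact .pt _
  | unit => cases B <;> exact .pt _
  | sum A A' ih ih' =>
    cases B with
    | sum B B' => exact .sum (ih B) (ih' B')
    | tensor => exact .pt _
    | unit => exact .pt _

theorem Ty.fill_id (A : Ty) : Ty.Fill V A A (𝟙 _) := by
  induction A with
  | tensor A B ih ih' =>
    have := Ty.Fill.tensor ih ih'
    rwa [id_tensorHom_id] at this
  | unit => exact .pt .unit
  | sum A B ih ih' =>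
    have := Ty.Fill.sum ih ih'
    rwa [coprod.map_id_id] at this

theorem Ty.Fill.pt_comp {A₀ A : Ty} {s : A₀.obj V ⟶ A.obj V} (h : Ty.Fill V A₀ A s) :
    A₀.pt V ≫ s = A.pt V := by
  induction h with
  | pt A => exact Category.id_comp _
  | tensor _ _ ih ih' =>
    exact (Category.assoc _ _ _).trans (congrArg (_ ≫ ·)
      ((tensorHom_comp_tensorHom _ _ _ _).trans (congrArg₂ (· ⊗ₘ ·) ih ih')))
  | @sum A₀ A B₀ B s t _ _ ih ih' =>
    change (Ty.pt V A₀ ≫ coprod.inl) ≫ coprod.map s t = Ty.pt V A ≫ coprod.inl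
    rw [Category.assoc, coprod.inl_map, reassoc_of% ih]

theorem Ty.Fill.exists_meet {A₀ A B : Ty} {s : A₀.obj V ⟶ A.obj V} {t : A₀.obj V ⟶ B.obj V}
    (hs : Ty.Fill V A₀ A s) (ht : Ty.Fill V A₀ B t) :
    ∃ f, f ≫ A.meetL V B = s ∧ f ≫ A.meetR V B = t := by
  induction hs generalizing B with
  | pt A =>
    cases ht
    exact ⟨_, (fill_meetL V A B).pt_comp, (fill_meetR V A B).pt_comp⟩
  | tensor _ _ ih ih' =>
    cases ht with
    | tensor h h' =>
      obtain ⟨f, rfl, rfl⟩ := ih h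
      obtain ⟨g, rfl, rfl⟩ := ih' h'
      exact ⟨f ⊗ₘ g, tensorHom_comp_tensorHom _ _ _ _, tensorHom_comp_tensorHom _ _ _ _⟩
  | sum _ _ ih ih' =>
    cases ht with
    | sum h h' =>
      obtain ⟨f, rfl, rfl⟩ := ih h
      obtain ⟨g, rfl, rfl⟩ := ih' h'
      exact ⟨(coprod.map f g :), coprod.map_map _ _ _ _, coprod.map_map _ _ _ _⟩

end Meets

section Uniqueness

variable {V : Type u} [Category.{v} V] [MonoidalCategory V] [SymmetricCategory V]
  [HasBinaryCoproducts V] [IsMonoidalDistrib V] {E : Type w} [CommEffectMonoid E]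
  {T : Triangle V E}

/-- A variable fed by itself, declared with a type some parts of which are filled with points. -/
inductive FillVar : Key → (Ξ : Scope) → (A : Ty) → (Scope.obj V Ξ ⟶ A.obj V) → Prop
  | mk {x : Key} {A₀ A : Ty} {s : A₀.obj V ⟶ A.obj V} : Ty.Fill V A₀ A s →
      FillVar x [(x, A₀)] A ((λ_ _).hom ≫ s)

namespace SubstMap

theorem exists_mem_of_fill {Ξ Γ : Scope} {f} (h : SubstMap T FillVar Ξ Γ f) {x : Key} {A : Ty}
    (hx : (x, A) ∈ Γ) : ∃ A₀, (x, A₀) ∈ Ξ := by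
  induction h with
  | nil => cases hx
  | cons h _ hg ih =>
    cases hg
    grind

theorem fill_restrict {Ξ Γ : Scope} {f} (h : SubstMap T FillVar Ξ Γ f) {Ξ' : Scope} (k : Sub Ξ' Ξ)
    (hk : ∀ a ∈ Ξ, ∀ A, (a.1, A) ∈ Γ → a ∈ Ξ') :
    ∃ f', SubstMap T FillVar Ξ' Γ f' ∧ f = T.str k ≫ f' := by
  classical
  induction h generalizing Ξ' with
  | nil h => exact ⟨_, .nil k.2.1, T.bang_unique _ _⟩
  | @cons Ξ Ξ₁ _ _ x A f g h _ hg ih =>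
    cases hg with
    | @mk A₀ _ s hs =>
      have k₁ : Sub (Ξ'.filter (· ∈ Ξ₁)) Ξ₁ := by grind
      have k₂ : Sub [(x, A₀)] [(x, A₀)] := by grind
      have hm : (x, A₀) ∈ Ξ' := hk _ (by grind) A List.mem_cons_self
      have h' : Split Ξ' (Ξ'.filter (· ∈ Ξ₁)) [(x, A₀)] := by grind
      have h'' : Split Ξ (Ξ'.filter (· ∈ Ξ₁)) [(x, A₀)] := by grind
      have hc := (T.str_str₂ k h' h'').trans (T.str₂_str h k₁ k₂ h'').symm
      obtain ⟨f', hf', rfl⟩ := ih k₁ fun a ha B hB => List.mem_filter.2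
        ⟨hk a (by grind) B (List.mem_cons_of_mem _ hB), by simpa using ha⟩
      refine ⟨_, .cons h' hf' (.mk hs), ?_⟩
      rw [← reindex_pair hc, T.str_self, Category.id_comp]

theorem fill_split {Ξ Γ Γ₁ Γ₂ Ξ₁ Ξ₂ : Scope} {h} (hh : SubstMap T FillVar Ξ Γ h)
    (hΞ : ∀ x A B, (x, A) ∈ Ξ → (x, B) ∈ Ξ → A = B) (k : Split Γ Γ₁ Γ₂) (hs : Split Ξ Ξ₁ Ξ₂)
    (h₁ : ∀ x, (∃ A, (x, A) ∈ Γ₁) ↔ ∃ A, (x, A) ∈ Ξ₁)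
    (h₂ : ∀ x, (∃ A, (x, A) ∈ Γ₂) ↔ ∃ A, (x, A) ∈ Ξ₂) :
    ∃ f₁ f₂, SubstMap T FillVar Ξ₁ Γ₁ f₁ ∧ SubstMap T FillVar Ξ₂ Γ₂ f₂ ∧
      h ≫ T.str₂ k = T.str₂ hs ≫ (f₁ ⊗ₘ f₂) := by
  obtain ⟨Ξ₁', Ξ₂', hs', f₁, f₂, hf₁, hf₂, hc⟩ := hh.split k
  have k₁ : Sub Ξ₁ Ξ₁' := by
    refine ⟨by grind, by grind, fun ⟨x, A₀⟩ ha => ?_⟩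
    obtain ⟨A, hA⟩ := (h₁ x).2 ⟨_, ha⟩
    obtain ⟨A₁, hA₁⟩ := hf₁.exists_mem_of_fill hA
    grind
  have k₂ : Sub Ξ₂ Ξ₂' := by
    refine ⟨by grind, by grind, fun ⟨x, A₀⟩ ha => ?_⟩
    obtain ⟨A, hA⟩ := (h₂ x).2 ⟨_, ha⟩
    obtain ⟨A₁, hA₁⟩ := hf₂.exists_mem_of_fill hA
    grind
  obtain ⟨f₁', hf₁', rfl⟩ := hf₁.fill_restrict k₁ (by
    rintro ⟨x, A₀⟩ ha A hA
    obtain ⟨A₁, hA₁⟩ := (h₁ x).1 ⟨_, hA⟩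
    grind)
  obtain ⟨f₂', hf₂', rfl⟩ := hf₂.fill_restrict k₂ (by
    rintro ⟨x, A₀⟩ ha A hA
    obtain ⟨A₁, hA₁⟩ := (h₂ x).1 ⟨_, hA⟩
    grind)
  refine ⟨f₁', f₂', hf₁', hf₂', ?_⟩
  rw [hc, ← tensorHom_comp_tensorHom, reassoc_of% T.str₂_str hs' k₁ k₂ hs]

end SubstMap

open Classical in
/-- The declarations of the variables that satisfy `U`. -/
noncomputable def Scope.only (U : Key → Prop) (Ξ : Scope) : Scope := Ξ.filter fun a => U a.1

@[grind =]
theorem Scope.mem_only {U : Key → Prop} {Ξ : Scope} {a : Key × Ty} :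
    a ∈ Ξ.only U ↔ a ∈ Ξ ∧ U a.1 := by
  simp [Scope.only]

theorem Scope.only_nodup {U : Key → Prop} {Ξ : Scope} (h : Ξ.Nodup) : (Ξ.only U).Nodup :=
  h.filter _

theorem SubstMap.fill_only {n : ℕ} {Ξ Γ Γ₁ Γ₂ : Scope} {h} (hh : SubstMap T FillVar Ξ Γ h)
    (hΞ : Ξ.WF n) (hΓ : Γ.WF n) (k : Split Γ Γ₁ Γ₂) {U₁ U₂ : Key → Prop}
    (h₁ : ∀ x, (∀ j, x = .level j → j < n) → U₁ x → ∃ A, (x, A) ∈ Γ₁)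
    (h₂ : ∀ x, (∀ j, x = .level j → j < n) → U₂ x → ∃ A, (x, A) ∈ Γ₂) :
    ∃ (k₁ : Sub (Γ₁.only U₁) Γ₁) (k₂ : Sub (Γ₂.only U₂) Γ₂) (hs : Split Ξ (Ξ.only U₁) (Ξ.only U₂))
      (f₁ : _) (f₂ : _) (t : _), SubstMap T FillVar (Ξ.only U₁) (Γ₁.only U₁) f₁ ∧
      SubstMap T FillVar (Ξ.only U₂) (Γ₂.only U₂) f₂ ∧
      𝟙 _ ≫ t = (h ≫ T.str₂ k) ≫ (T.str k₁ ⊗ₘ T.str k₂) ∧ 𝟙 _ ≫ t = T.str₂ hs ≫ (f₁ ⊗ₘ f₂) := by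
  have n₁ : (Γ₁.only U₁).Nodup := Scope.only_nodup (by grind)
  have n₂ : (Γ₂.only U₂).Nodup := Scope.only_nodup (by grind)
  have m₁ : (Ξ.only U₁).Nodup := Scope.only_nodup (by grind)
  have m₂ : (Ξ.only U₂).Nodup := Scope.only_nodup (by grind)
  have k₁ : Sub (Γ₁.only U₁) Γ₁ := by grind
  have k₂ : Sub (Γ₂.only U₂) Γ₂ := by grind
  have key : ∀ x A, (x, A) ∈ Ξ → ∀ j, x = .level j → j < n := by grind
  have hs : Split Ξ (Ξ.only U₁) (Ξ.only U₂) := by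
    refine ⟨by grind, List.nodup_append.2 ⟨m₂, m₁, ?_⟩, by grind⟩
    rintro ⟨x, A⟩ ha _ hb rfl
    obtain ⟨A₁, hA₁⟩ := h₁ x (key x A (by grind)) (by grind)
    obtain ⟨A₂, hA₂⟩ := h₂ x (key x A (by grind)) (by grind)
    have : A₁ = A₂ := by grind
    grind
  have k' : Split Γ (Γ₁.only U₁) (Γ₂.only U₂) := by grind
  obtain ⟨f₁, f₂, hf₁, hf₂, hc⟩ := hh.fill_split hΞ.2.1 k' hs
    (fun x => ⟨fun ⟨A, hA⟩ => by
        obtain ⟨A₀, hA₀⟩ := hh.exists_mem_of_fill (x := x) (A := A) (by grind)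
        exact ⟨A₀, by grind⟩,
      fun ⟨A, hA⟩ => by
        obtain ⟨A₁, hA₁⟩ := h₁ x (key x A (by grind)) (by grind)
        exact ⟨A₁, by grind⟩⟩)
    (fun x => ⟨fun ⟨A, hA⟩ => by
        obtain ⟨A₀, hA₀⟩ := hh.exists_mem_of_fill (x := x) (A := A) (by grind)
        exact ⟨A₀, by grind⟩,
      fun ⟨A, hA⟩ => by
        obtain ⟨A₁, hA₁⟩ := h₂ x (key x A (by grind)) (by grind)
        exact ⟨A₁, by grind⟩⟩)
  refine ⟨k₁, k₂, hs, f₁, f₂, _, hf₁, hf₂, ?_, (Category.id_comp _).trans hc⟩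
  rw [Category.id_comp, Category.assoc, T.str₂_str k k₁ k₂ k']

end Uniqueness

end QPEL

namespace QPEL

open PartialCommMonoid EffectAlgebra

section Uniqueness

variable {V : Type u} [Category.{v} V] [MonoidalCategory V] [SymmetricCategory V]
  [HasBinaryCoproducts V] [IsMonoidalDistrib V] {E : Type w} [CommEffectMonoid E]
  {T : Triangle V E}

theorem comp₄_assoc {X₁ X₂ X₃ X₄ X₅ X₆ : V} (a : X₁ ⟶ X₂) (b : X₂ ⟶ X₃) (c : X₃ ⟶ X₄)
    (d : X₄ ⟶ X₅) (e : X₅ ⟶ X₆) : (a ≫ b ≫ c ≫ d) ≫ e = a ≫ b ≫ c ≫ d ≫ e := by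
  simp only [Category.assoc]

theorem comp₂_tensorDesc_comp {X₁ X₂ D A B C C' : V} (a : X₁ ⟶ X₂) (b : X₂ ⟶ D ⊗ (A ⨿ B))
    (g : D ⊗ A ⟶ C) (h : D ⊗ B ⟶ C) (k : C ⟶ C') :
    (a ≫ b ≫ tensorDesc g h) ≫ k = a ≫ b ≫ tensorDesc (g ≫ k) (h ≫ k) := by
  simp only [Category.assoc, tensorDesc_comp]

theorem whisker_letE {X₁ X Y₁ A₀ B₀ A B C : V} (f₁ : X₁ ⟶ Y₁) (f₀ : X ⟶ A₀ ⊗ B₀) (s : A₀ ⟶ A)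
    (t : B₀ ⟶ B) {f : X ⟶ A ⊗ B} (hf : f₀ ≫ (s ⊗ₘ t) = f) (g : (Y₁ ⊗ A) ⊗ B ⟶ C) :
    X₁ ◁ f₀ ≫ (α_ _ _ _).inv ≫ ((f₁ ⊗ₘ s) ⊗ₘ t) ≫ g =
      X₁ ◁ f ≫ (α_ _ _ _).inv ≫ f₁ ▷ A ▷ B ≫ g := by
  rw [← hf, MonoidalCategory.whiskerLeft_comp, Category.assoc, ← associator_inv_naturality_left_assoc,
    ← id_tensorHom _ (s ⊗ₘ t), ← tensorHom_id f₁ (A ⊗ B), tensorHom_comp_tensorHom_assoc,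
    Category.id_comp, Category.comp_id, associator_inv_naturality_assoc]

theorem whisker_case {X₁ X Y₁ A₀ B₀ A B C : V} (f₁ : X₁ ⟶ Y₁) (f₀ : X ⟶ A₀ ⨿ B₀) (s : A₀ ⟶ A)
    (t : B₀ ⟶ B) {f : X ⟶ A ⨿ B} (hf : f₀ ≫ coprod.map s t = f) (g : Y₁ ⊗ A ⟶ C) (l : Y₁ ⊗ B ⟶ C) :
    X₁ ◁ f₀ ≫ tensorDesc ((f₁ ⊗ₘ s) ≫ g) ((f₁ ⊗ₘ t) ≫ l) =
      X₁ ◁ f ≫ tensorDesc (f₁ ▷ A ≫ g) (f₁ ▷ B ≫ l) := by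
  rw [← hf, whiskerRight_tensorDesc, ← map_tensorDesc, MonoidalCategory.whiskerLeft_comp,
    MonoidalCategory.tensorHom_def', Category.assoc, Category.assoc]

theorem Triangle.pull_whisker_copair {X₁ X Y₁ A₀ B₀ A B : V} (f₁ : X₁ ⟶ Y₁) (f₀ : X ⟶ A₀ ⨿ B₀)
    (s : A₀ ⟶ A) (t : B₀ ⟶ B) {f : X ⟶ A ⨿ B} (hf : f₀ ≫ coprod.map s t = f) (p : T.Pred (Y₁ ⊗ A)) (q : T.Pred (Y₁ ⊗ B)) :
    T.pull (X₁ ◁ f₀) (T.copair (T.pull (f₁ ⊗ₘ s) p) (T.pull (f₁ ⊗ₘ t) q)) =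
      T.pull (X₁ ◁ f) (T.copair (T.pull (f₁ ▷ A) p) (T.pull (f₁ ▷ B) q)) := by
  rw [← hf, T.pull_whiskerRight_copair, ← T.pull_copair, MonoidalCategory.whiskerLeft_comp,
    MonoidalCategory.tensorHom_def', T.pull_comp, T.pull_comp]

theorem branch_comp {D X Y : V} {n : ℕ} (f : Fin (n + 1) → (D ⟶ X)) (k : X ⟶ Y) :
    copower.branch n f ≫ k = copower.branch n fun i => f i ≫ k := by
  simpa using map_branch (𝟙 D) f k

/-- `T.FillDen n Ξ e v`: up to filling parts of the types in `Ξ` with points, `e` has the value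
`v`. -/
def Triangle.FillDen (T : Triangle V E) (n : ℕ) (Ξ : Scope) {s : Kind} (e : Expr s)
    (v : T.Sem (Scope.obj V Ξ) s) : Prop :=
  Ξ.WF n ∧ ∃ Γ h v₀, SubstMap T FillVar Ξ Γ h ∧ Γ.WF n ∧ T.Den n Γ e v₀ ∧ v = v₀.pull h

namespace Triangle.FillDen

theorem var {Ξ Γ : Scope} {x : Key} {A : Ty} {h : Scope.obj V Ξ ⟶ Scope.obj V Γ}
    (hh : SubstMap T FillVar Ξ Γ h) (k : Sub [(x, A)] Γ) :
    ∃ (A₀ : Ty) (k₀ : Sub [(x, A₀)] Ξ) (s : _), Ty.Fill V A₀ A s ∧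
      h ≫ T.str k ≫ (λ_ (A.obj V)).hom = T.str k₀ ≫ (λ_ (A₀.obj V)).hom ≫ s := by
  have := hh.comp_str (T.str_spec k)
  rw [← Category.assoc]
  generalize h ≫ T.str k = h' at this
  cases this with
  | @cons _ Ξ₁ Ξ₂ _ _ _ f g hs h hg =>
    cases hg with
    | @mk A₀ _ s hs' =>
      have k₂ : Sub [(x, A₀)] Ξ := by grind
      refine ⟨A₀, k₂, s, hs', ?_⟩
      rw [← T.str₂_discard_left hs k₂ f, Category.assoc]
      refine (congrArg (T.str₂ hs ≫ ·) (discard_tensorHom f _)).trans ?_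
      simp

theorem fvar {n : ℕ} {Ξ : Scope} {x : ℕ} {v} (h : T.FillDen n Ξ (.fvar x) v) :
    ∃ (A₀ A : Ty) (k₀ : Sub [(.free x, A₀)] Ξ) (s : _), Ty.Fill V A₀ A s ∧
      v = .tm A (T.str k₀ ≫ (λ_ (A₀.obj V)).hom ≫ s) := by
  obtain ⟨hΞ, Γ, h, v₀, hh, hΓ, hd, rfl⟩ := h
  cases hd with
  | fvar k =>
    obtain ⟨A₀, k₀, s, hs, hc⟩ := var hh k
    exact ⟨A₀, _, k₀, s, hs, congrArg (Sem.tm _) hc⟩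

theorem bvar {n : ℕ} {Ξ : Scope} {i : ℕ} {v} (h : T.FillDen n Ξ (.bvar i) v) :
    ∃ (A₀ A : Ty) (k₀ : Sub [(.level (n - 1 - i), A₀)] Ξ) (s : _), Ty.Fill V A₀ A s ∧
      v = .tm A (T.str k₀ ≫ (λ_ (A₀.obj V)).hom ≫ s) := by
  obtain ⟨hΞ, Γ, h, v₀, hh, hΓ, hd, rfl⟩ := h
  cases hd with
  | bvar _ k =>
    obtain ⟨A₀, k₀, s, hs, hc⟩ := var hh k
    exact ⟨A₀, _, k₀, s, hs, congrArg (Sem.tm _) hc⟩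

theorem _root_.QPEL.Scope.WF.only {n : ℕ} {Ξ : Scope} (h : Ξ.WF n) (U : Key → Prop) :
    (Ξ.only U).WF n := by
  have := Scope.only_nodup (U := U) h.1
  grind

theorem pair {n : ℕ} {Ξ : Scope} {M N : Tm} {v} (h : T.FillDen n Ξ (.pair M N) v) :
    ∃ (A B : Ty) (k : Split Ξ (Ξ.only fun x => M.Uses x n) (Ξ.only fun x => N.Uses x n))
      (f : _) (g : _), T.FillDen n _ M (.tm A f) ∧ T.FillDen n _ N (.tm B g) ∧
      v = .tm (.tensor A B) (T.str₂ k ≫ (f ⊗ₘ g)) := by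
  obtain ⟨hΞ, Γ, h, v₀, hh, hΓ, hd, rfl⟩ := h
  cases hd with
  | @pair _ _ Γ₁ Γ₂ _ _ A B f g k h₁ h₂ =>
    obtain ⟨k₁, k₂, hs, f₁, f₂, t, hf₁, hf₂, e₁, e₂⟩ := hh.fill_only hΞ hΓ k
      (fun x => h₁.exists_of_uses) (fun x => h₂.exists_of_uses)
    obtain ⟨f', hf, rfl⟩ := Den.exists_tm.1 (h₁.strengthen (hΓ.sub (by grind)) k₁ (by grind))
    obtain ⟨g', hg, rfl⟩ := Den.exists_tm.1 (h₂.strengthen (hΓ.sub (by grind)) k₂ (by grind))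
    refine ⟨A, B, hs, _, _, ⟨hΞ.only _, _, _, _, hf₁, hΓ.sub (by grind), hf, rfl⟩,
      ⟨hΞ.only _, _, _, _, hf₂, hΓ.sub (by grind), hg, rfl⟩, congrArg (Sem.tm _) ?_⟩
    exact (Category.assoc _ _ _).symm.trans
      ((reindex_pair e₁ f' g').trans (reindex_pair e₂ f' g').symm)

theorem letE {n : ℕ} {Ξ : Scope} {M N : Tm} {v} (h : T.FillDen n Ξ (.letE M N) v) :
    ∃ (A B C : Ty) (k : Split Ξ (Ξ.only fun x => N.Uses x (n + 2)) (Ξ.only fun x => M.Uses x n))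
      (f : _ ⟶ A.obj V ⊗ B.obj V), T.FillDen n _ M (.tm (.tensor A B) f) ∧
      ∀ (A₀ B₀ : Ty) (s : _) (t : _), Ty.Fill V A₀ A s → Ty.Fill V B₀ B t → ∃ g,
      T.FillDen (n + 2) ((.level (n + 1), B₀) :: (.level n, A₀) ::
        Ξ.only fun x => N.Uses x (n + 2)) N (.tm C g) ∧
      ∀ f₀, f₀ ≫ (s ⊗ₘ t) = f → v = .tm C (T.str₂ k ≫ _ ◁ f₀ ≫ (α_ _ _ _).inv ≫ g) := by
  obtain ⟨hΞ, Γ, h, v₀, hh, hΓ, hd, rfl⟩ := h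
  cases hd with
  | @letE _ _ Γ₁ Γ₂ _ _ A B C f g k h₁ h₂ =>
    obtain ⟨k₁, k₂, hs, f₁, f₂, r, hf₁, hf₂, e₁, e₂⟩ := hh.fill_only
      (U₁ := fun x => N.Uses x (n + 2)) (U₂ := fun x => M.Uses x n) hΞ hΓ k
      (fun x hx hu => by
        obtain ⟨D, hD⟩ := h₂.exists_of_uses (fun j hj => (hx j hj).trans (by omega)) hu
        exact ⟨D, by grind⟩) (fun x => h₁.exists_of_uses)
    have wΓ := hΓ.sub (show Sub Γ₁ Γ by grind)
    have wΓ' := wΓ.sub k₁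
    have wΞ := hΞ.only fun x => N.Uses x (n + 2)
    have kA : Sub ((.level n, A) :: Γ₁.only fun x => N.Uses x (n + 2)) ((.level n, A) :: Γ₁) := by
      grind
    have kB : Sub ((.level (n + 1), B) :: (.level n, A) :: Γ₁.only fun x => N.Uses x (n + 2))
      ((.level (n + 1), B) :: (.level n, A) :: Γ₁) := by grind
    obtain ⟨f', hf, rfl⟩ := Den.exists_tm.1 (h₁.strengthen (hΓ.sub (by grind)) k₂ (by grind))
    obtain ⟨g', hg, rfl⟩ := Den.exists_tm.1 (h₂.strengthen ((wΓ.cons A).cons B) kB (by grind))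
    rw [T.str_cons kB kA, T.str_cons kA k₁]
    refine ⟨A, B, C, hs, _, ⟨hΞ.only _, _, _, _, hf₂, hΓ.sub (by grind), hf, rfl⟩, ?_⟩
    intro A₀ B₀ s t ks kt
    refine ⟨_, ⟨(wΞ.cons A₀).cons B₀, _, _, _, (hf₁.lift (by grind) (.mk ks)).lift (by grind)
      (.mk kt), (wΓ'.cons A).cons B, hg, rfl⟩, fun f₀ hf₀ => congrArg (Sem.tm _) ?_⟩
    refine (Category.assoc _ _ _).symm.trans
      ((reindex_letE e₁ f' g').trans ((reindex_letE e₂ f' g').symm.trans ?_))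
    exact congrArg (T.str₂ hs ≫ ·) (whisker_letE f₁ f₀ s t hf₀ g').symm

theorem inl {n : ℕ} {Ξ : Scope} {M : Tm} {v} (h : T.FillDen n Ξ (.inl M) v) :
    ∃ (A B : Ty) (f : _), T.FillDen n Ξ M (.tm A f) ∧
      v = .tm (.sum A B) (f ≫ (coprod.inl : _ ⟶ A.obj V ⨿ B.obj V)) := by
  obtain ⟨hΞ, Γ, h, v₀, hh, hΓ, hd, rfl⟩ := h
  cases hd with
  | inl h => exact ⟨_, _, _, ⟨hΞ, _, _, _, hh, hΓ, h, rfl⟩,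
      congrArg (Sem.tm _) (Category.assoc _ _ _).symm⟩

theorem inr {n : ℕ} {Ξ : Scope} {M : Tm} {v} (h : T.FillDen n Ξ (.inr M) v) :
    ∃ (A B : Ty) (f : _), T.FillDen n Ξ M (.tm B f) ∧
      v = .tm (.sum A B) (f ≫ (coprod.inr : _ ⟶ A.obj V ⨿ B.obj V)) := by
  obtain ⟨hΞ, Γ, h, v₀, hh, hΓ, hd, rfl⟩ := h
  cases hd with
  | inr h => exact ⟨_, _, _, ⟨hΞ, _, _, _, hh, hΓ, h, rfl⟩,
      congrArg (Sem.tm _) (Category.assoc _ _ _).symm⟩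

theorem caseT {n : ℕ} {Ξ : Scope} {M N P : Tm} {v} (h : T.FillDen n Ξ (.caseT M N P) v) :
    ∃ (A B C : Ty) (k : Split Ξ (Ξ.only fun x => N.Uses x (n + 1) ∨ P.Uses x (n + 1))
        (Ξ.only fun x => M.Uses x n))
      (f : _ ⟶ A.obj V ⨿ B.obj V), T.FillDen n _ M (.tm (.sum A B) f) ∧
      ∀ (A₀ B₀ : Ty) (s : _) (t : _), Ty.Fill V A₀ A s → Ty.Fill V B₀ B t → ∃ g l,
      T.FillDen (n + 1) ((.level n, A₀) :: Ξ.only fun x => N.Uses x (n + 1) ∨ P.Uses x (n + 1)) N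
        (.tm C g) ∧
      T.FillDen (n + 1) ((.level n, B₀) :: Ξ.only fun x => N.Uses x (n + 1) ∨ P.Uses x (n + 1)) P
        (.tm C l) ∧
      ∀ f₀, f₀ ≫ coprod.map s t = f → v = .tm C (T.str₂ k ≫ _ ◁ f₀ ≫ tensorDesc g l) := by
  obtain ⟨hΞ, Γ, h, v₀, hh, hΓ, hd, rfl⟩ := h
  cases hd with
  | @caseT _ _ Γ₁ Γ₂ _ _ _ A B C f g l k h₁ h₂ h₃ =>
    obtain ⟨k₁, k₂, hs, f₁, f₂, r, hf₁, hf₂, e₁, e₂⟩ := hh.fill_only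
      (U₁ := fun x => N.Uses x (n + 1) ∨ P.Uses x (n + 1)) (U₂ := fun x => M.Uses x n) hΞ hΓ k
      (fun x hx hu => by
        rcases hu with hu | hu
        · obtain ⟨D, hD⟩ := h₂.exists_of_uses (fun j hj => (hx j hj).trans (by omega)) hu
          exact ⟨D, by grind⟩
        · obtain ⟨D, hD⟩ := h₃.exists_of_uses (fun j hj => (hx j hj).trans (by omega)) hu
          exact ⟨D, by grind⟩) (fun x => h₁.exists_of_uses)
    have wΓ := hΓ.sub (show Sub Γ₁ Γ by grind)
    have wΓ' := wΓ.sub k₁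
    have wΞ := hΞ.only fun x => N.Uses x (n + 1) ∨ P.Uses x (n + 1)
    have kA : Sub ((.level n, A) :: Γ₁.only fun x => N.Uses x (n + 1) ∨ P.Uses x (n + 1))
      ((.level n, A) :: Γ₁) := by grind
    have kB : Sub ((.level n, B) :: Γ₁.only fun x => N.Uses x (n + 1) ∨ P.Uses x (n + 1))
      ((.level n, B) :: Γ₁) := by grind
    obtain ⟨f', hf, rfl⟩ := Den.exists_tm.1 (h₁.strengthen (hΓ.sub (by grind)) k₂ (by grind))
    obtain ⟨g', hg, rfl⟩ := Den.exists_tm.1 (h₂.strengthen (wΓ.cons A) kA (by grind))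
    obtain ⟨l', hl, rfl⟩ := Den.exists_tm.1 (h₃.strengthen (wΓ.cons B) kB (by grind))
    rw [T.str_cons kA k₁, T.str_cons kB k₁]
    refine ⟨A, B, C, hs, _, ⟨hΞ.only _, _, _, _, hf₂, hΓ.sub (by grind), hf, rfl⟩, ?_⟩
    intro A₀ B₀ s t ks kt
    refine ⟨_, _, ⟨wΞ.cons A₀, _, _, _, hf₁.lift (by grind) (.mk ks), wΓ'.cons A, hg, rfl⟩,
      ⟨wΞ.cons B₀, _, _, _, hf₁.lift (by grind) (.mk kt), wΓ'.cons B, hl, rfl⟩,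
      fun f₀ hf₀ => congrArg (Sem.tm _) ?_⟩
    refine (Category.assoc _ _ _).symm.trans
      ((reindex_case e₁ f' g' l').trans ((reindex_case e₂ f' g' l').symm.trans ?_))
    exact congrArg (T.str₂ hs ≫ ·) (whisker_case f₁ f₀ s t hf₀ g' l').symm

theorem measure {n : ℕ} {Ξ : Scope} {l : ℕ} {φ : Fin (l + 1) → Eff} {M : Fin (l + 1) → Tm} {v}
    (h : T.FillDen n Ξ (.measure φ M) v) :
    ∃ (A : Ty) (k : Split Ξ (Ξ.only fun x => ∃ i, (M i).Uses x n)
        (Ξ.only fun x => ∃ i, (φ i).Uses x n)) (p : Fin (l + 1) → T.Pred _)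
      (f : Fin (l + 1) → (_ ⟶ A.obj V)) (hp : IsTest p),
      (∀ i, T.FillDen n _ (φ i) (.eff (p i))) ∧ (∀ i, T.FillDen n _ (M i) (.tm A (f i))) ∧
      v = .tm A (T.str₂ k ≫ _ ◁ T.meas p hp ≫ copower.branch l f) := by
  obtain ⟨hΞ, Γ, h, v₀, hh, hΓ, hd, rfl⟩ := h
  cases hd with
  | @measure _ _ Γ₁ Γ₂ _ _ _ A p f k h₁ hp h₂ =>
    obtain ⟨k₁, k₂, hs, f₁, f₂, t, hf₁, hf₂, e₁, e₂⟩ := hh.fill_only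
      (U₁ := fun x => ∃ i, (M i).Uses x n) (U₂ := fun x => ∃ i, (φ i).Uses x n) hΞ hΓ k
      (fun x hx ⟨i, hu⟩ => (h₂ i).exists_of_uses hx hu)
      (fun x hx ⟨i, hu⟩ => (h₁ i).exists_of_uses hx hu)
    have w₁ : Γ₁.WF n := hΓ.sub (by grind)
    have w₂ : Γ₂.WF n := hΓ.sub (by grind)
    choose p' hp₁ hp' using fun i => Den.exists_eff.1 ((h₁ i).strengthen w₂ k₂ fun a ha hu =>
      Scope.mem_only.2 ⟨ha, i, hu⟩)
    choose f' hf hf' using fun i => Den.exists_tm.1 ((h₂ i).strengthen w₁ k₁ fun a ha hu =>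
      Scope.mem_only.2 ⟨ha, i, hu⟩)
    obtain rfl := funext hp'
    obtain rfl := funext hf'
    obtain ⟨i, hi⟩ := T.exists_section k₂
    have ht : IsTest p' := by
      simpa only [← T.pull_comp, hi, T.pull_id] using T.pull_isTest i hp
    refine ⟨A, hs, _, _, T.pull_isTest f₂ ht,
      fun i => ⟨hΞ.only _, _, _, _, hf₂, w₂.sub k₂, hp₁ i, rfl⟩,
      fun i => ⟨hΞ.only _, _, _, _, hf₁, w₁.sub k₁, hf i, rfl⟩, congrArg (Sem.tm _) ?_⟩
    exact (Category.assoc _ _ _).symm.trans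
      ((T.reindex_measure e₁ ht hp f').trans (T.reindex_measure e₂ ht _ f').symm)

theorem ovee {n : ℕ} {Ξ : Scope} {φ ψ : Eff} {v} (h : T.FillDen n Ξ (.ovee φ ψ) v) :
    ∃ p q s, T.FillDen n Ξ φ (.eff p) ∧ T.FillDen n Ξ ψ (.eff q) ∧
      PartialCommMonoid.ovee p q = some s ∧ v = .eff s := by
  obtain ⟨hΞ, Γ, h, v₀, hh, hΓ, hd, rfl⟩ := h
  cases hd with
  | ovee h₁ h₂ hs => exact ⟨_, _, _, ⟨hΞ, _, _, _, hh, hΓ, h₁, rfl⟩,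
      ⟨hΞ, _, _, _, hh, hΓ, h₂, rfl⟩, T.pull_ovee _ hs, rfl⟩

theorem orth {n : ℕ} {Ξ : Scope} {φ : Eff} {v} (h : T.FillDen n Ξ (.orth φ) v) :
    ∃ p, T.FillDen n Ξ φ (.eff p) ∧ v = .eff (EffectAlgebra.orth p) := by
  obtain ⟨hΞ, Γ, h, v₀, hh, hΓ, hd, rfl⟩ := h
  cases hd with
  | orth h => exact ⟨_, ⟨hΞ, _, _, _, hh, hΓ, h, rfl⟩, congrArg Sem.eff (T.pull_orth _ _)⟩

theorem mul {n : ℕ} {Ξ : Scope} {φ ψ : Eff} {v} (h : T.FillDen n Ξ (.mul φ ψ) v) :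
    ∃ (p : T.Pred (𝟙_ V)) (q : T.Pred (Scope.obj V Ξ)), T.FillDen n [] φ (.eff p) ∧
      T.FillDen n Ξ ψ (.eff q) ∧ v = .eff (T.scalar p • q) := by
  obtain ⟨hΞ, Γ, h, v₀, hh, hΓ, hd, rfl⟩ := h
  cases hd with
  | mul h₁ h₂ =>
    have w : Scope.WF n [] := by grind
    refine ⟨_, _, ⟨w, [], 𝟙 _, _, (SubstMap.nil List.nodup_nil).of_eq (T.bang_unique _ _), w, h₁,
      (Sem.pull_id _).symm⟩, ⟨hΞ, _, _, _, hh, hΓ, h₂, rfl⟩, congrArg Sem.eff (T.pull_smul _ _ _)⟩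

theorem caseE {n : ℕ} {Ξ : Scope} {M : Tm} {φ ψ : Eff} {v} (h : T.FillDen n Ξ (.caseE M φ ψ) v) :
    ∃ (A B : Ty) (k : Split Ξ (Ξ.only fun x => φ.Uses x (n + 1) ∨ ψ.Uses x (n + 1))
        (Ξ.only fun x => M.Uses x n))
      (f : _ ⟶ A.obj V ⨿ B.obj V), T.FillDen n _ M (.tm (.sum A B) f) ∧
      ∀ (A₀ B₀ : Ty) (s : _) (t : _), Ty.Fill V A₀ A s → Ty.Fill V B₀ B t →
      ∃ (p : T.Pred (_ ⊗ A₀.obj V)) (q : T.Pred (_ ⊗ B₀.obj V)),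
      T.FillDen (n + 1) ((.level n, A₀) :: Ξ.only fun x => φ.Uses x (n + 1) ∨ ψ.Uses x (n + 1)) φ
        (.eff p) ∧
      T.FillDen (n + 1) ((.level n, B₀) :: Ξ.only fun x => φ.Uses x (n + 1) ∨ ψ.Uses x (n + 1)) ψ
        (.eff q) ∧
      ∀ f₀, f₀ ≫ coprod.map s t = f → v = .eff (T.pull (T.str₂ k ≫ _ ◁ f₀) (T.copair p q)) := by
  obtain ⟨hΞ, Γ, h, v₀, hh, hΓ, hd, rfl⟩ := h
  cases hd with
  | @caseE _ _ Γ₁ Γ₂ _ _ _ A B f p q k h₁ h₂ h₃ =>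
    obtain ⟨k₁, k₂, hs, f₁, f₂, r, hf₁, hf₂, e₁, e₂⟩ := hh.fill_only
      (U₁ := fun x => φ.Uses x (n + 1) ∨ ψ.Uses x (n + 1)) (U₂ := fun x => M.Uses x n) hΞ hΓ k
      (fun x hx hu => by
        rcases hu with hu | hu
        · obtain ⟨D, hD⟩ := h₂.exists_of_uses (fun j hj => (hx j hj).trans (by omega)) hu
          exact ⟨D, by grind⟩
        · obtain ⟨D, hD⟩ := h₃.exists_of_uses (fun j hj => (hx j hj).trans (by omega)) hu
          exact ⟨D, by grind⟩) (fun x => h₁.exists_of_uses)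
    have wΓ := hΓ.sub (show Sub Γ₁ Γ by grind)
    have wΓ' := wΓ.sub k₁
    have wΞ := hΞ.only fun x => φ.Uses x (n + 1) ∨ ψ.Uses x (n + 1)
    have kA : Sub ((.level n, A) :: Γ₁.only fun x => φ.Uses x (n + 1) ∨ ψ.Uses x (n + 1))
      ((.level n, A) :: Γ₁) := by grind
    have kB : Sub ((.level n, B) :: Γ₁.only fun x => φ.Uses x (n + 1) ∨ ψ.Uses x (n + 1))
      ((.level n, B) :: Γ₁) := by grind
    obtain ⟨f', hf, rfl⟩ := Den.exists_tm.1 (h₁.strengthen (hΓ.sub (by grind)) k₂ (by grind))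
    obtain ⟨p', hp, rfl⟩ := Den.exists_eff.1 (h₂.strengthen (wΓ.cons A) kA (by grind))
    obtain ⟨q', hq, rfl⟩ := Den.exists_eff.1 (h₃.strengthen (wΓ.cons B) kB (by grind))
    rw [T.str_cons kA k₁, T.str_cons kB k₁]
    refine ⟨A, B, hs, _, ⟨hΞ.only _, _, _, _, hf₂, hΓ.sub (by grind), hf, rfl⟩, ?_⟩
    intro A₀ B₀ s t ks kt
    refine ⟨_, _, ⟨wΞ.cons A₀, _, _, _, hf₁.lift (by grind) (.mk ks), wΓ'.cons A, hp, rfl⟩,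
      ⟨wΞ.cons B₀, _, _, _, hf₁.lift (by grind) (.mk kt), wΓ'.cons B, hq, rfl⟩,
      fun f₀ hf₀ => congrArg Sem.eff ?_⟩
    refine (T.pull_comp _ _ _).symm.trans ((congrArg (T.pull · _) (Category.assoc _ _ _).symm).trans
      ((T.reindex_copair e₁ f' p' q').trans ((T.reindex_copair e₂ f' p' q').symm.trans ?_)))
    rw [T.pull_comp, T.pull_comp (T.str₂ hs)]
    exact congrArg (T.pull (T.str₂ hs)) (T.pull_whisker_copair f₁ f₀ s t hf₀ p' q').symm

theorem pull_zero {n : ℕ} {Ξ : Scope} {v} (h : T.FillDen n Ξ .zero v) : v = .eff 0 := by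
  obtain ⟨hΞ, Γ, h, v₀, hh, hΓ, hd, rfl⟩ := h
  cases hd with
  | zero => exact congrArg Sem.eff (T.pull_zero _)

theorem unit {n : ℕ} {Ξ : Scope} {v} (h : T.FillDen n Ξ .unit v) :
    v = .tm .unit (T.bang (Scope.obj V Ξ)) := by
  obtain ⟨hΞ, Γ, h, v₀, hh, hΓ, hd, rfl⟩ := h
  cases hd with
  | unit => exact congrArg (Sem.tm .unit) (T.bang_unique _ _)

end Triangle.FillDen

namespace Triangle

/-- Two values agree up to parts of their types in which they are filled with closed points. -/
def Sem.Agree {X : V} : {s : Kind} → T.Sem X s → T.Sem X s → Prop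
  | _, .tm A f, .tm B g => ∃ k, k ≫ A.meetL V B = f ∧ k ≫ A.meetR V B = g
  | _, .eff p, .eff q => p = q

theorem FillDen.agree {s : Kind} {e : Expr s} : ∀ {n : ℕ} {Ξ : Scope}
    {v w : T.Sem (Scope.obj V Ξ) s}, T.FillDen n Ξ e v → T.FillDen n Ξ e w → v.Agree w := by
  induction e with
  | bvar i =>
    intro n Ξ v w hv hw
    obtain ⟨A₀, A, k, s, hs, rfl⟩ := hv.bvar
    obtain ⟨B₀, B, l, t, ht, rfl⟩ := hw.bvar
    obtain rfl : A₀ = B₀ := by have := hv.1; grind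
    obtain ⟨f, rfl, rfl⟩ := hs.exists_meet V ht
    exact ⟨T.str k ≫ (λ_ _).hom ≫ f, by simp, by simp⟩
  | fvar x =>
    intro n Ξ v w hv hw
    obtain ⟨A₀, A, k, s, hs, rfl⟩ := hv.fvar
    obtain ⟨B₀, B, l, t, ht, rfl⟩ := hw.fvar
    obtain rfl : A₀ = B₀ := by have := hv.1; grind
    obtain ⟨f, rfl, rfl⟩ := hs.exists_meet V ht
    exact ⟨T.str k ≫ (λ_ _).hom ≫ f, by simp, by simp⟩
  | pair M N ih₁ ih₂ =>
    intro n Ξ v w hv hw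
    obtain ⟨A, B, k, f, g, hf, hg, rfl⟩ := hv.pair
    obtain ⟨A', B', _, f', g', hf', hg', rfl⟩ := hw.pair
    obtain ⟨f₀, rfl, rfl⟩ := ih₁ hf hf'
    obtain ⟨g₀, rfl, rfl⟩ := ih₂ hg hg'
    exact ⟨T.str₂ k ≫ (f₀ ⊗ₘ g₀), (Category.assoc _ _ _).trans (congrArg (T.str₂ k ≫ ·)
      (tensorHom_comp_tensorHom _ _ _ _)), (Category.assoc _ _ _).trans (congrArg (T.str₂ k ≫ ·)
      (tensorHom_comp_tensorHom _ _ _ _))⟩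
  | letE M N ih₁ ih₂ =>
    intro n Ξ v w hv hw
    obtain ⟨A, B, C, k, f, hf, hN⟩ := hv.letE
    obtain ⟨A', B', C', _, f', hf', hN'⟩ := hw.letE
    obtain ⟨f₀, h₁, h₂⟩ := ih₁ hf hf'
    obtain ⟨g, hg, e₁⟩ := hN _ _ _ _ (A.fill_meetL V A') (B.fill_meetL V B')
    obtain ⟨g', hg', e₂⟩ := hN' _ _ _ _ (A.fill_meetR V A') (B.fill_meetR V B')
    rw [e₁ f₀ h₁, e₂ f₀ h₂]
    obtain ⟨g₀, rfl, rfl⟩ := ih₂ hg hg'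
    exact ⟨T.str₂ k ≫ _ ◁ f₀ ≫ (α_ _ _ _).inv ≫ g₀, comp₄_assoc _ _ _ _ _, comp₄_assoc _ _ _ _ _⟩
  | unit =>
    intro n Ξ v w hv hw
    rw [hv.unit, hw.unit]
    exact ⟨T.bang _, T.bang_unique _ _, T.bang_unique _ _⟩
  | inl M ih =>
    intro n Ξ v w hv hw
    obtain ⟨A, B, f, hf, rfl⟩ := hv.inl
    obtain ⟨A', B', f', hf', rfl⟩ := hw.inl
    obtain ⟨f₀, rfl, rfl⟩ := ih hf hf'
    refine ⟨f₀ ≫ (coprod.inl : _ ⟶ (A.meet A').obj V ⨿ (B.meet B').obj V), ?_, ?_⟩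
    · exact (Category.assoc _ _ _).trans ((congrArg (f₀ ≫ ·) (coprod.inl_map _ _)).trans
        (Category.assoc _ _ _).symm)
    · exact (Category.assoc _ _ _).trans ((congrArg (f₀ ≫ ·) (coprod.inl_map _ _)).trans
        (Category.assoc _ _ _).symm)
  | inr M ih =>
    intro n Ξ v w hv hw
    obtain ⟨A, B, f, hf, rfl⟩ := hv.inr
    obtain ⟨A', B', f', hf', rfl⟩ := hw.inr
    obtain ⟨f₀, rfl, rfl⟩ := ih hf hf'
    refine ⟨f₀ ≫ (coprod.inr : _ ⟶ (A.meet A').obj V ⨿ (B.meet B').obj V), ?_, ?_⟩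
    · exact (Category.assoc _ _ _).trans ((congrArg (f₀ ≫ ·) (coprod.inr_map _ _)).trans
        (Category.assoc _ _ _).symm)
    · exact (Category.assoc _ _ _).trans ((congrArg (f₀ ≫ ·) (coprod.inr_map _ _)).trans
        (Category.assoc _ _ _).symm)
  | caseT M N P ih₁ ih₂ ih₃ =>
    intro n Ξ v w hv hw
    obtain ⟨A, B, C, k, f, hf, hN⟩ := hv.caseT
    obtain ⟨A', B', C', _, f', hf', hN'⟩ := hw.caseT
    obtain ⟨f₀, h₁, h₂⟩ := ih₁ hf hf'
    obtain ⟨g, l, hg, hl, e₁⟩ := hN _ _ _ _ (A.fill_meetL V A') (B.fill_meetL V B')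
    obtain ⟨g', l', hg', hl', e₂⟩ := hN' _ _ _ _ (A.fill_meetR V A') (B.fill_meetR V B')
    rw [e₁ f₀ h₁, e₂ f₀ h₂]
    obtain ⟨g₀, rfl, rfl⟩ := ih₂ hg hg'
    obtain ⟨l₀, rfl, rfl⟩ := ih₃ hl hl'
    exact ⟨T.str₂ k ≫ _ ◁ f₀ ≫ tensorDesc g₀ l₀,
      comp₂_tensorDesc_comp _ _ _ _ _, comp₂_tensorDesc_comp _ _ _ _ _⟩
  | measure φ M ih₁ ih₂ =>
    intro n Ξ v w hv hw
    obtain ⟨A, k, p, f, hp, hφ, hM, rfl⟩ := hv.measure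
    obtain ⟨A', _, p', f', hp', hφ', hM', rfl⟩ := hw.measure
    obtain rfl : p = p' := funext fun i => ih₁ i (hφ i) (hφ' i)
    choose f₀ h₁ h₂ using fun i => ih₂ i (hM i) (hM' i)
    obtain rfl := funext h₁
    obtain rfl := funext h₂
    exact ⟨T.str₂ k ≫ _ ◁ T.meas p hp ≫ copower.branch _ f₀,
      by simp only [Category.assoc, branch_comp], by simp only [Category.assoc, branch_comp]⟩
  | zero =>
    intro n Ξ v w hv hw
    rw [hv.pull_zero, hw.pull_zero]
    rfl
  | ovee φ ψ ih₁ ih₂ =>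
    intro n Ξ v w hv hw
    obtain ⟨p, q, s, hp, hq, hs, rfl⟩ := hv.ovee
    obtain ⟨p', q', s', hp', hq', hs', rfl⟩ := hw.ovee
    obtain rfl : p = p' := ih₁ hp hp'
    obtain rfl : q = q' := ih₂ hq hq'
    exact Option.some.inj (hs.symm.trans hs')
  | orth φ ih =>
    intro n Ξ v w hv hw
    obtain ⟨p, hp, rfl⟩ := hv.orth
    obtain ⟨p', hp', rfl⟩ := hw.orth
    exact congrArg EffectAlgebra.orth (ih hp hp')
  | mul φ ψ ih₁ ih₂ =>
    intro n Ξ v w hv hw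
    obtain ⟨p, q, hp, hq, rfl⟩ := hv.mul
    obtain ⟨p', q', hp', hq', rfl⟩ := hw.mul
    obtain rfl : p = p' := ih₁ hp hp'
    obtain rfl : q = q' := ih₂ hq hq'
    rfl
  | caseE M φ ψ ih₁ ih₂ ih₃ =>
    intro n Ξ v w hv hw
    obtain ⟨A, B, k, f, hf, hN⟩ := hv.caseE
    obtain ⟨A', B', _, f', hf', hN'⟩ := hw.caseE
    obtain ⟨f₀, h₁, h₂⟩ := ih₁ hf hf'
    obtain ⟨p, q, hp, hq, e₁⟩ := hN _ _ _ _ (A.fill_meetL V A') (B.fill_meetL V B')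
    obtain ⟨p', q', hp', hq', e₂⟩ := hN' _ _ _ _ (A.fill_meetR V A') (B.fill_meetR V B')
    rw [e₁ f₀ h₁, e₂ f₀ h₂]
    obtain rfl : p = p' := ih₂ hp hp'
    obtain rfl : q = q' := ih₃ hq hq'
    rfl

theorem Den.fillDen {n : ℕ} {Ξ : Scope} {s : Kind} {e : Expr s} {v : T.Sem (Scope.obj V Ξ) s}
    (h : T.Den n Ξ e v) (hΞ : Ξ.WF n) : T.FillDen n Ξ e v :=
  ⟨hΞ, Ξ, 𝟙 _, v, .refl hΞ.1 fun a _ => by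
    rw [← Category.comp_id (λ_ _).hom]
    exact .mk (a.2.fill_id V), hΞ, h, (Sem.pull_id v).symm⟩

theorem Den.unique_tm {n : ℕ} {Ξ : Scope} {M : Tm} {A : Ty} {f g : Scope.obj V Ξ ⟶ A.obj V}
    (hΞ : Ξ.WF n) (hf : T.Den n Ξ M (.tm A f)) (hg : T.Den n Ξ M (.tm A g)) : f = g := by
  obtain ⟨k, rfl, rfl⟩ := (hf.fillDen hΞ).agree (hg.fillDen hΞ)
  rw [Ty.meetL_self]

theorem Den.unique_eff {n : ℕ} {Ξ : Scope} {φ : Eff} {p q : T.Pred (Scope.obj V Ξ)}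
    (hΞ : Ξ.WF n) (hp : T.Den n Ξ φ (.eff p)) (hq : T.Den n Ξ φ (.eff q)) : p = q :=
  (hp.fillDen hΞ).agree (hq.fillDen hΞ)

end Triangle

end Uniqueness

end QPEL

namespace QPEL

open PartialCommMonoid EffectAlgebra

/-- The scope of a context. -/
def Ctx.toScope : Ctx → Scope
  | .nil => []
  | .ext Γ x A => (.free x, A) :: Γ.toScope

theorem Ctx.toScope_append (Γ Δ : Ctx) : (Γ ++ Δ).toScope = Δ.toScope ++ Γ.toScope := by
  induction Δ with
  | nil => rfl
  | ext Δ x A ih => exact congrArg ((Key.free x, A) :: ·) ih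

theorem Ctx.mem_names {Γ : Ctx} {x : ℕ} : x ∈ Γ.names ↔ ∃ A, (Key.free x, A) ∈ Γ.toScope := by
  induction Γ with
  | nil => simp [Ctx.names, Ctx.toScope]
  | ext Γ y B ih =>
    simp only [Ctx.names, Ctx.toScope, List.mem_cons, ih, Prod.mk.injEq, Key.free.injEq]
    constructor
    · rintro (rfl | ⟨A, h⟩)
      · exact ⟨B, .inl ⟨rfl, rfl⟩⟩
      · exact ⟨A, .inr h⟩
    · rintro ⟨A, ⟨rfl, rfl⟩ | h⟩
      · exact .inl rfl
      · exact .inr ⟨A, h⟩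

theorem Ctx.Valid.toScope {Γ : Ctx} (h : Γ.Valid) : Γ.toScope.WF 0 := by
  induction Γ with
  | nil => grind [Ctx.toScope]
  | ext Γ x A ih =>
    have h' := List.nodup_cons.1 h
    have := ih h'.2
    have hx : ∀ B, (Key.free x, B) ∉ Γ.toScope := fun B hB => h'.1 (Ctx.mem_names.2 ⟨B, hB⟩)
    simp only [Ctx.toScope]
    grind

theorem Scope.WF.free {Ξ : Scope} (h : Ξ.WF 0) {a : Key × Ty} (ha : a ∈ Ξ) :
    ∃ x A, a = (.free x, A) := by
  obtain ⟨_ | j, A⟩ := a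
  · exact ⟨_, _, rfl⟩
  · exact absurd (h.2.2 j A ha) (Nat.not_lt_zero j)

section Operations

variable {V : Type u} [Category.{v} V] [MonoidalCategory V] [SymmetricCategory V]
  [HasBinaryCoproducts V] [IsMonoidalDistrib V] {E : Type w} [CommEffectMonoid E]
  {T : Triangle V E}

namespace Traversal

variable {F : ℕ → (s : Kind) → Expr s → Expr s}

theorem varDen_free {n m d z : ℕ} (A : Ty) (hz : ∀ d, F d _ (.fvar z) = .fvar z) :
    VarDen T F n m d (.free z) [(.free z, A)] A (λ_ _).hom := by
  intro d' _
  have h : Sub [(Key.free z, A)] [(.free z, A)] := by grind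
  rw [Key.var, hz]
  exact (Triangle.Den.fvar h).of_tm (by rw [T.str_self, Category.id_comp])

theorem varDen_bound {n m d j x : ℕ} (A : Ty) (hj : j < m)
    (hx : ∀ d, F d _ (.fvar x) = .bvar (m + d - 1 - j)) :
    VarDen T F n m d (.free x) [(.level j, A)] A (λ_ _).hom := by
  intro d' _
  have key : ∀ i, i = j → ∃ hk : Sub [(Key.level i, A)] [(.level j, A)],
      T.str hk ≫ (λ_ (A.obj V)).hom = (λ_ (A.obj V)).hom := by
    rintro _ rfl
    exact ⟨by grind, by rw [T.str_self, Category.id_comp]⟩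
  obtain ⟨hk, hc⟩ := key (m + d' - 1 - (m + d' - 1 - j)) (by omega)
  rw [Key.var, hx]
  exact (Triangle.Den.bvar (by omega) hk).of_tm hc

theorem substMap_refl {Δ : Scope} (hΔ : Δ.WF 0) (n m d : ℕ)
    (h : ∀ x A, (Key.free x, A) ∈ Δ → ∀ d, F d _ (.fvar x) = .fvar x) :
    SubstMap T (VarDen T F n m d) Δ Δ (𝟙 _) := by
  refine .refl hΔ.1 fun a ha => ?_
  obtain ⟨x, A, rfl⟩ := hΔ.free ha
  exact varDen_free A (h x A ha)

end Traversal

namespace Triangle.Den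

theorem raise {Γ : Scope} {s : Kind} {e : Expr s} {v : T.Sem (Scope.obj V Γ) s} (hΓ : Γ.WF 0)
    (h : T.Den 0 Γ e v) (n : ℕ) : T.Den n Γ e v := by
  have := Traversal.id.den (n := 0) (m := n) (d := 0) h rfl
    (Traversal.substMap_refl hΓ _ _ _ fun _ _ _ _ => rfl) (by grind)
  rwa [Sem.pull_id] at this

theorem close {Δ : Scope} {x : ℕ} {A : Ty} {s : Kind} {e : Expr s}
    {v : T.Sem (Scope.obj V Δ ⊗ A.obj V) s} (hΔ : Scope.WF 0 ((.free x, A) :: Δ))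
    (h : T.Den 0 ((.free x, A) :: Δ) e v) : T.Den 1 ((.level 0, A) :: Δ) (e.close x 0) v := by
  have l := (Traversal.substMap_refl (T := T) (Δ := Δ) (F := fun d s e => Expr.close x (0 + d) e)
    (hΔ.sub (by grind)) 0 1 0 fun z C hz d => by
      have h₁ : z ≠ x := by rintro rfl; grind
      simp [Expr.close, h₁]).lift (x := .free x) (y := .level 0) (A := A) (B := A)
        (s := 𝟙 _) (by grind)
      ((Category.comp_id (λ_ (A.obj V)).hom).symm ▸ Traversal.varDen_bound A (by omega)
        fun d => by simp [Expr.close])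
  have := (Traversal.close x 0).den (n := 0) (m := 1) (d := 0) h rfl
    (l.of_eq (id_tensorHom_id _ _)) (by grind)
  exact this.of_eq (Sem.pull_id v)

theorem close₂ {Δ : Scope} {x y : ℕ} {A B : Ty} {s : Kind} {e : Expr s}
    {v : T.Sem ((Scope.obj V Δ ⊗ A.obj V) ⊗ B.obj V) s}
    (hΔ : Scope.WF 0 ((.free y, B) :: (.free x, A) :: Δ))
    (h : T.Den 0 ((.free y, B) :: (.free x, A) :: Δ) e v) :
    T.Den 2 ((.level 1, B) :: (.level 0, A) :: Δ) ((e.close x 1).close y 0) v := by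
  have hyx : y ≠ x := by
    rintro rfl
    have := hΔ.2.1 (.free y) A B (by simp) (by simp)
    grind
  have hF := (Traversal.close x 1).comp (Traversal.close y 0)
  have l₁ := (Traversal.substMap_refl (T := T) (Δ := Δ)
    (F := fun d s e => Expr.close y (0 + d) (Expr.close x (1 + d) e))
    (hΔ.sub (by grind)) 0 2 0 fun z C hz d => by
      have h₁ : z ≠ x := by rintro rfl; grind
      have h₂ : z ≠ y := by rintro rfl; grind
      simp [Expr.close, h₁, h₂]).lift (x := .free x) (y := .level 0) (A := A) (B := A)
        (s := 𝟙 _) (by grind)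
      ((Category.comp_id (λ_ (A.obj V)).hom).symm ▸ Traversal.varDen_bound A (by omega)
        fun d => by simp [Expr.close])
  have l₂ := l₁.lift (x := .free y) (y := .level 1) (A := B) (B := B) (s := 𝟙 _) (by grind)
      ((Category.comp_id (λ_ (B.obj V)).hom).symm ▸ Traversal.varDen_bound B (by omega)
        fun d => by simp [Expr.close, hyx])
  have := hF.den (n := 0) (m := 2) (d := 0) h rfl
    (l₂.of_eq ((congrArg (· ⊗ₘ 𝟙 (B.obj V)) (id_tensorHom_id (Scope.obj V Δ) (A.obj V))).trans
      (id_tensorHom_id _ _))) (by grind)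
  exact this.of_eq (Sem.pull_id v)

theorem subst₁ {Ξ Δ Γ : Scope} {x : ℕ} {A : Ty} {s : Kind} {e : Expr s} {M : Tm}
    {v : T.Sem (Scope.obj V Δ ⊗ A.obj V) s} {f : Scope.obj V Γ ⟶ A.obj V}
    (hΔ : Scope.WF 0 ((.free x, A) :: Δ)) (hΞ : Ξ.WF 0) (k : Split Ξ Δ Γ)
    (h : T.Den 0 ((.free x, A) :: Δ) e v) (hM : T.Den 0 Γ M (.tm A f)) :
    T.Den 0 Ξ (Expr.subst1 M x e) (v.pull (T.str₂ k ≫ Scope.obj V Δ ◁ f)) := by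
  have := (Traversal.subst (Function.update Expr.fvar x M)).den (n := 0) (m := 0) (d := 0) h rfl
    (.cons k (Traversal.substMap_refl (hΔ.sub (by grind)) _ _ _ fun y B hy d => by
        have : y ≠ x := by rintro rfl; grind
        exact Function.update_of_ne this _ _)
      (fun d _ => by
        have := hM.raise (hΞ.sub (by grind)) (0 + d)
        simpa [Expr.subst, Key.var] using this)) (by grind)
  exact this.of_eq (by rw [id_tensorHom])

theorem subst₂ {Ξ Ξ' Δ Γ Γ' : Scope} {x y : ℕ} {A B : Ty} {s : Kind} {e : Expr s} {M N : Tm}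
    {v : T.Sem ((Scope.obj V Δ ⊗ A.obj V) ⊗ B.obj V) s} {f : Scope.obj V Γ ⟶ A.obj V}
    {g : Scope.obj V Γ' ⟶ B.obj V}
    (hΔ : Scope.WF 0 ((.free y, B) :: (.free x, A) :: Δ)) (hΞ : Ξ.WF 0) (k : Split Ξ Ξ' Γ')
    (k' : Split Ξ' Δ Γ)
    (h : T.Den 0 ((.free y, B) :: (.free x, A) :: Δ) e v) (hM : T.Den 0 Γ M (.tm A f))
    (hN : T.Den 0 Γ' N (.tm B g)) :
    T.Den 0 Ξ (Expr.subst2 M x N y e)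
      (v.pull (T.str₂ k ≫ ((T.str₂ k' ≫ Scope.obj V Δ ◁ f) ⊗ₘ g))) := by
  have hyx : x ≠ y := by
    rintro rfl
    have := hΔ.2.1 (.free x) A B (by simp) (by simp)
    grind
  have := (Traversal.subst (Function.update (Function.update Expr.fvar x M) y N)).den
    (n := 0) (m := 0) (d := 0) h rfl
    (.cons k (.cons k' (Traversal.substMap_refl (hΔ.sub (by grind)) _ _ _ fun z C hz d => by
        have h₁ : z ≠ x := by rintro rfl; grind
        have h₂ : z ≠ y := by rintro rfl; grind
        simp [Expr.subst, h₁, h₂])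
      (fun d _ => by
        have := hM.raise ((hΞ.sub (Γ := Ξ') (by grind)).sub (by grind)) (0 + d)
        simpa [Expr.subst, Key.var, hyx] using this))
      (fun d _ => by
        have := hN.raise (hΞ.sub (by grind)) (0 + d)
        simpa [Expr.subst, Key.var] using this)) (by grind)
  exact this.of_eq (by rw [id_tensorHom])

theorem letIn {Ξ Δ Γ : Scope} {x y : ℕ} {M N : Tm} {A B C : Ty}
    {f : Scope.obj V Γ ⟶ A.obj V ⊗ B.obj V} {g : (Scope.obj V Δ ⊗ A.obj V) ⊗ B.obj V ⟶ C.obj V}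
    (k : Split Ξ Δ Γ) (hΔ : Scope.WF 0 ((.free y, B) :: (.free x, A) :: Δ))
    (hM : T.Den 0 Γ M (.tm (.tensor A B) f))
    (hN : T.Den 0 ((.free y, B) :: (.free x, A) :: Δ) N (.tm C g)) :
    T.Den 0 Ξ (.letIn x y M N) (.tm C (T.str₂ k ≫ Scope.obj V Δ ◁ f ≫ (α_ _ _ _).inv ≫ g)) :=
  .letE k hM (hN.close₂ hΔ)

theorem caseOf {Ξ Δ Γ : Scope} {x y : ℕ} {M N P : Tm} {A B C : Ty}
    {f : Scope.obj V Γ ⟶ A.obj V ⨿ B.obj V} {g : Scope.obj V Δ ⊗ A.obj V ⟶ C.obj V}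
    {l : Scope.obj V Δ ⊗ B.obj V ⟶ C.obj V} (k : Split Ξ Δ Γ)
    (hx : Scope.WF 0 ((.free x, A) :: Δ)) (hy : Scope.WF 0 ((.free y, B) :: Δ))
    (hM : T.Den 0 Γ M (.tm (.sum A B) f)) (hN : T.Den 0 ((.free x, A) :: Δ) N (.tm C g))
    (hP : T.Den 0 ((.free y, B) :: Δ) P (.tm C l)) :
    T.Den 0 Ξ (.caseOf M x N y P) (.tm C (T.str₂ k ≫ Scope.obj V Δ ◁ f ≫ tensorDesc g l)) :=
  .caseT k hM (hN.close hx) (hP.close hy)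

theorem caseEff {Ξ Γ Δ : Scope} {x y : ℕ} {M : Tm} {φ ψ : Eff} {A B : Ty}
    {f : Scope.obj V Δ ⟶ A.obj V ⨿ B.obj V} {p : T.Pred (Scope.obj V Γ ⊗ A.obj V)}
    {q : T.Pred (Scope.obj V Γ ⊗ B.obj V)} (k : Split Ξ Γ Δ)
    (hx : Scope.WF 0 ((.free x, A) :: Γ)) (hy : Scope.WF 0 ((.free y, B) :: Γ))
    (hM : T.Den 0 Δ M (.tm (.sum A B) f)) (hφ : T.Den 0 ((.free x, A) :: Γ) φ (.eff p))
    (hψ : T.Den 0 ((.free y, B) :: Γ) ψ (.eff q)) :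
    T.Den 0 Ξ (.caseEff M x φ y ψ)
      (.eff (T.pull (T.str₂ k ≫ Scope.obj V Γ ◁ f) (T.copair p q))) :=
  .caseE k hM (hφ.close hx) (hψ.close hy)

end Triangle.Den

end Operations

end QPEL

namespace QPEL

open PartialCommMonoid EffectAlgebra

section Soundness

variable {V : Type u} [Category.{v} V] [MonoidalCategory V] [SymmetricCategory V]
  [HasBinaryCoproducts V] [IsMonoidalDistrib V] {E : Type w} [CommEffectMonoid E]
  {T : Triangle V E}

/-! ## Truth of judgements -/

theorem whisker_letE_letE {X G Y Z A B W : V} (s : X ⟶ Y ⊗ Z) (f : G ⟶ A ⊗ B)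
    (g : (Z ⊗ A) ⊗ B ⟶ W) :
    X ◁ f ≫ (α_ X A B).inv ≫ (s ▷ A ≫ (α_ Y Z A).hom) ▷ B ≫ (α_ Y (Z ⊗ A) B).hom ≫ Y ◁ g =
      s ▷ G ≫ (α_ Y Z G).hom ≫ Y ◁ (Z ◁ f ≫ (α_ Z A B).inv ≫ g) := by
  have h : (α_ X A B).inv ≫ (s ▷ A ≫ (α_ Y Z A).hom) ▷ B ≫ (α_ Y (Z ⊗ A) B).hom =
      s ▷ (A ⊗ B) ≫ (α_ Y Z (A ⊗ B)).hom ≫ Y ◁ (α_ Z A B).inv := by monoidal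
  rw [reassoc_of% h, ← MonoidalCategory.whiskerLeft_comp, whisker_exchange_assoc]
  simp

theorem whisker_tensorDesc_assoc {X G Y Z A B C W : V} (s : X ⟶ Y ⊗ Z) (f : G ⟶ A ⨿ B)
    (g : Z ⊗ A ⟶ C) (h : Z ⊗ B ⟶ C) (k : Y ⊗ C ⟶ W) :
    X ◁ f ≫ tensorDesc ((s ▷ A ≫ (α_ Y Z A).hom) ≫ Y ◁ g ≫ k)
        ((s ▷ B ≫ (α_ Y Z B).hom) ≫ Y ◁ h ≫ k) =
      s ▷ G ≫ (α_ Y Z G).hom ≫ Y ◁ (Z ◁ f ≫ tensorDesc g h) ≫ k := by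
  have key : tensorDesc ((s ▷ A ≫ (α_ Y Z A).hom) ≫ Y ◁ g ≫ k)
        ((s ▷ B ≫ (α_ Y Z B).hom) ≫ Y ◁ h ≫ k) =
      s ▷ (A ⨿ B) ≫ (α_ Y Z (A ⨿ B)).hom ≫ Y ◁ tensorDesc g h ≫ k := by
    apply tensor_coprod_hom_ext
    · rw [inl_tensorDesc, whisker_exchange_assoc, associator_naturality_right_assoc,
        ← MonoidalCategory.whiskerLeft_comp_assoc, inl_tensorDesc, Category.assoc]
    · rw [inr_tensorDesc, whisker_exchange_assoc, associator_naturality_right_assoc,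
        ← MonoidalCategory.whiskerLeft_comp_assoc, inr_tensorDesc, Category.assoc]
  rw [key, whisker_exchange_assoc]
  simp

theorem tensorDesc_leftUnitor (A B : V) :
    tensorDesc ((λ_ A).hom ≫ (coprod.inl : A ⟶ A ⨿ B)) ((λ_ B).hom ≫ coprod.inr) =
      (λ_ (A ⨿ B)).hom := by
  apply tensor_coprod_hom_ext
  · rw [inl_tensorDesc, leftUnitor_naturality]
  · rw [inr_tensorDesc, leftUnitor_naturality]

theorem whisker_inl_tensorDesc {X G A B C : V} (f : G ⟶ A) (g : X ⊗ A ⟶ C) (h : X ⊗ B ⟶ C) :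
    X ◁ (f ≫ coprod.inl) ≫ tensorDesc g h = X ◁ f ≫ g := by
  rw [MonoidalCategory.whiskerLeft_comp, Category.assoc, inl_tensorDesc]

theorem whisker_inr_tensorDesc {X G A B C : V} (f : G ⟶ B) (g : X ⊗ A ⟶ C) (h : X ⊗ B ⟶ C) :
    X ◁ (f ≫ coprod.inr) ≫ tensorDesc g h = X ◁ f ≫ h := by
  rw [MonoidalCategory.whiskerLeft_comp, Category.assoc, inr_tensorDesc]

theorem comp_whiskerLeft_tensorHom {X Y Z D A B : V} (s : X ⟶ Y ⊗ Z) (f : Z ⟶ A) (g : D ⟶ B) :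
    ((s ≫ Y ◁ f) ⊗ₘ g) = s ▷ D ≫ (α_ Y Z D).hom ≫ Y ◁ (f ⊗ₘ g) ≫ (α_ Y A B).inv := by
  rw [MonoidalCategory.tensorHom_def, MonoidalCategory.tensorHom_def]
  monoidal

theorem tensorHom_braiding {X Y A B : V} (f : X ⟶ A) (g : Y ⟶ B) :
    (β_ Y X).hom ≫ (f ⊗ₘ g) = Y ◁ f ≫ g ▷ A ≫ (β_ B A).hom := by
  rw [← BraidedCategory.braiding_naturality, ← MonoidalCategory.tensorHom_def'_assoc]

namespace Triangle

variable (T) in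
theorem meas_copair {D A B : V} {n : ℕ} {p : Fin (n + 1) → T.Pred (D ⊗ A)}
    {q : Fin (n + 1) → T.Pred (D ⊗ B)} (hp : IsTest p) (hq : IsTest q) :
    T.meas (fun i => T.copair (p i) (q i)) (T.isTest_copair hp hq) =
      tensorDesc (T.meas p hp) (T.meas q hq) := by
  apply tensor_coprod_hom_ext
  · rw [inl_tensorDesc, T.meas_natural _ _ _ (T.pull_isTest _ (T.isTest_copair hp hq))]
    exact T.meas_congr (funext fun i => T.pull_inl_copair _ _) _ _
  · rw [inr_tensorDesc, T.meas_natural _ _ _ (T.pull_isTest _ (T.isTest_copair hp hq))]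
    exact T.meas_congr (funext fun i => T.pull_inr_copair _ _) _ _

/-- The truth of a judgement over a scope. -/
def Sound (T : Triangle V E) (Ξ : Scope) : Jdg → Prop
  | .tm M A => ∃ f, T.Den 0 Ξ M (.tm A f)
  | .eq M N A => ∃ f, T.Den 0 Ξ M (.tm A f) ∧ T.Den 0 Ξ N (.tm A f)
  | .eff φ => ∃ p, T.Den 0 Ξ φ (.eff p)
  | .le φ ψ => ∃ p q, T.Den 0 Ξ φ (.eff p) ∧ T.Den 0 Ξ ψ (.eff q) ∧ p ≤ q

theorem Den.one {Ξ : Scope} (hΞ : Ξ.Nodup) {n : ℕ} : T.Den n Ξ Expr.one (.eff 1) := .orth (.zero hΞ)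

theorem Den.zero_inv {n : ℕ} {Ξ : Scope} {p : T.Pred (Scope.obj V Ξ)}
    (h : T.Den n Ξ .zero (.eff p)) : p = 0 := by
  cases h; rfl

theorem Den.orth_inv {n : ℕ} {Ξ : Scope} {φ : Eff} {p : T.Pred (Scope.obj V Ξ)}
    (h : T.Den n Ξ (.orth φ) (.eff p)) : ∃ q, T.Den n Ξ φ (.eff q) ∧ p = EffectAlgebra.orth q := by
  cases h with
  | orth h => exact ⟨_, h, rfl⟩

theorem Den.ovee_inv {n : ℕ} {Ξ : Scope} {φ ψ : Eff} {s : T.Pred (Scope.obj V Ξ)}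
    (h : T.Den n Ξ (.ovee φ ψ) (.eff s)) :
    ∃ p q, T.Den n Ξ φ (.eff p) ∧ T.Den n Ξ ψ (.eff q) ∧ PSum.of p + PSum.of q = PSum.of s := by
  cases h with
  | ovee h h' hs => exact ⟨_, _, h, h', hs⟩

theorem Den.one_inv {n : ℕ} {Ξ : Scope} {p : T.Pred (Scope.obj V Ξ)}
    (h : T.Den n Ξ Expr.one (.eff p)) : p = 1 := by
  obtain ⟨q, hq, rfl⟩ := Den.orth_inv h
  rw [hq.zero_inv]; rfl

theorem Den.bigOvee_inv {n : ℕ} {Ξ : Scope} : ∀ {l : ℕ} {φ : Fin (l + 1) → Eff}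
    {s : T.Pred (Scope.obj V Ξ)}, T.Den n Ξ (Expr.bigOvee φ) (.eff s) →
    ∃ p : Fin (l + 1) → T.Pred (Scope.obj V Ξ), (∀ i, T.Den n Ξ (φ i) (.eff (p i))) ∧
      ∑ i, PSum.of (p i) = PSum.of s
  | 0, φ, s, h => ⟨fun _ => s, fun i => by rw [Fin.fin_one_eq_zero i]; exact h, by simp⟩
  | l + 1, φ, s, h => by
    obtain ⟨a, b, ha, hb, hs⟩ := Den.ovee_inv h
    obtain ⟨p, hp, hps⟩ := Den.bigOvee_inv ha
    refine ⟨Fin.snoc (α := fun _ => T.Pred (Scope.obj V Ξ)) p b, fun i => ?_, ?_⟩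
    · refine Fin.lastCases ?_ (fun i => ?_) i
      · rw [Fin.snoc_last]; exact hb
      · rw [Fin.snoc_castSucc]; exact hp i
    · rw [Fin.sum_univ_castSucc]
      simp only [Fin.snoc_castSucc, Fin.snoc_last]
      rw [hps, hs]

namespace Sound

variable {Ξ Γ Δ Θ : Scope}

theorem exists_test {l : ℕ} {φ : Fin (l + 1) → Eff} (h : T.Sound Γ (.le Expr.one (Expr.bigOvee φ))) :
    ∃ p : Fin (l + 1) → T.Pred (Scope.obj V Γ), (∀ i, T.Den 0 Γ (φ i) (.eff (p i))) ∧
      IsTest p := by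
  obtain ⟨a, b, ha, hb, hab⟩ := h
  obtain ⟨p, hp, hs⟩ := Den.bigOvee_inv hb
  rw [ha.one_inv] at hab
  exact ⟨p, hp, hs.trans (congrArg PSum.of (eq_one_of_one_le hab))⟩

theorem of_perp {φ ψ : Eff} (h : T.Sound Γ (.perp φ ψ)) :
    ∃ p q s, T.Den 0 Γ φ (.eff p) ∧ T.Den 0 Γ ψ (.eff q) ∧ PSum.of p + PSum.of q = PSum.of s := by
  obtain ⟨p, q, hp, hq, hpq⟩ := h
  obtain ⟨q, hq', rfl⟩ := hq.orth_inv
  obtain ⟨s, hs⟩ := perp_iff.1 hpq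
  exact ⟨p, q, s, hp, hq', hs⟩

theorem perp {φ ψ : Eff} {p q s : T.Pred (Scope.obj V Γ)} (hp : T.Den 0 Γ φ (.eff p))
    (hq : T.Den 0 Γ ψ (.eff q)) (h : PSum.of p + PSum.of q = PSum.of s) :
    T.Sound Γ (.perp φ ψ) :=
  ⟨p, _, hp, .orth hq, perp_iff.2 ⟨s, h⟩⟩

theorem of_le (hΓ : Γ.WF 0) {φ ψ : Eff} {p q : T.Pred (Scope.obj V Γ)}
    (h : T.Sound Γ (.le φ ψ)) (hp : T.Den 0 Γ φ (.eff p)) (hq : T.Den 0 Γ ψ (.eff q)) : p ≤ q := by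
  obtain ⟨p', q', hp', hq', h⟩ := h
  rwa [hp.unique_eff hΓ hp', hq.unique_eff hΓ hq']

theorem equiv {φ ψ : Eff} {p : T.Pred (Scope.obj V Γ)} (hp : T.Den 0 Γ φ (.eff p))
    (hq : T.Den 0 Γ ψ (.eff p)) {J : Jdg} (hJ : J ∈ Jdg.equiv φ ψ) : T.Sound Γ J := by
  rcases hJ with rfl | rfl
  · exact ⟨p, p, hp, hq, EffectAlgebra.le_refl p⟩
  · exact ⟨p, p, hq, hp, EffectAlgebra.le_refl p⟩

theorem weaken {J : Jdg} (h : T.Sound Γ J) (k : Sub Γ Ξ) : T.Sound Ξ J := by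
  cases J with
  | tm M A =>
    obtain ⟨f, h⟩ := h
    exact ⟨_, h.weaken k⟩
  | eq M N A =>
    obtain ⟨f, h, h'⟩ := h
    exact ⟨_, h.weaken k, h'.weaken k⟩
  | eff φ =>
    obtain ⟨f, h⟩ := h
    exact ⟨_, h.weaken k⟩
  | le φ ψ =>
    obtain ⟨p, q, h, h', hpq⟩ := h
    exact ⟨_, _, h.weaken k, h'.weaken k, T.pull_le _ hpq⟩

/-! ### Terms -/

theorem measure_eq (hΓ : Γ.WF 0) (k : Split Ξ Δ Γ) {l : ℕ} {φ ψ : Fin (l + 1) → Eff}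
    {M N : Fin (l + 1) → Tm} {A : Ty} (h : T.Sound Γ (.le Expr.one (Expr.bigOvee φ)))
    (h₁ : ∀ i, T.Sound Γ (.le (φ i) (ψ i))) (h₂ : ∀ i, T.Sound Γ (.le (ψ i) (φ i)))
    (h₃ : ∀ i, T.Sound Δ (.eq (M i) (N i) A)) : T.Sound Ξ (.eq (.measure φ M) (.measure ψ N) A) := by
  obtain ⟨p, hp, ht⟩ := h.exists_test
  choose f hM hN using h₃
  refine ⟨_, .measure k hp ht hM, .measure k (fun i => ?_) ht hN⟩
  obtain ⟨a, b, ha, hb, -⟩ := h₁ i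
  rwa [EffectAlgebra.le_antisymm ((h₁ i).of_le hΓ (hp i) hb) ((h₂ i).of_le hΓ hb (hp i))]

theorem beta_tensor {x y : ℕ} {M N P : Tm} {A B C : Ty} (hΞ : Ξ.WF 0)
    (k : Sub (Θ ++ (Δ ++ Γ)) Ξ) (hΘ : Scope.WF 0 ((.free y, B) :: (.free x, A) :: Θ))
    (hM : T.Sound Γ (.tm M A)) (hN : T.Sound Δ (.tm N B))
    (hP : T.Sound ((.free y, B) :: (.free x, A) :: Θ) (.tm P C)) :
    T.Sound Ξ (.eq (.letIn x y (.pair M N) P) (.subst2 M x N y P) C) := by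
  obtain ⟨f, hM⟩ := hM
  obtain ⟨g, hN⟩ := hN
  obtain ⟨h, hP⟩ := hP
  have k₁ : Split Ξ (Γ ++ Θ) Δ := by grind
  have k₂ : Split (Γ ++ Θ) Θ Γ := by grind
  have k₃ : Split Ξ Θ (Δ ++ Γ) := by grind
  have k₄ : Split (Δ ++ Γ) Γ Δ := by grind
  refine ⟨_, .letIn k₃ hΘ (.pair k₄ hM hN) hP,
    (hP.subst₂ hΘ hΞ k₁ k₂ hM hN).of_tm ?_⟩
  have e := T.str₂_assoc k₁ k₂ k₃ k₄
  have e' : T.str₂ k₁ ≫ ((T.str₂ k₂ ≫ Scope.obj V Θ ◁ f) ⊗ₘ g) = T.str₂ k₃ ≫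
      Scope.obj V Θ ◁ (T.str₂ k₄ ≫ (f ⊗ₘ g)) ≫ (α_ _ _ _).inv := by
    rw [MonoidalCategory.whiskerLeft_comp, Category.assoc, ← reassoc_of% e,
      comp_whiskerLeft_tensorHom]
  rw [e']
  simp only [Category.assoc]
  rfl

theorem beta_inl {x y : ℕ} {M N P : Tm} {A B C : Ty} (hΞ : Ξ.WF 0) (k : Split Ξ Δ Γ)
    (hx : Scope.WF 0 ((.free x, A) :: Δ)) (hy : Scope.WF 0 ((.free y, B) :: Δ))
    (hM : T.Sound Γ (.tm M A)) (hN : T.Sound ((.free x, A) :: Δ) (.tm N C))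
    (hP : T.Sound ((.free y, B) :: Δ) (.tm P C)) :
    T.Sound Ξ (.eq (.caseOf (.inl M) x N y P) (.subst1 M x N) C) := by
  obtain ⟨f, hM⟩ := hM
  obtain ⟨g, hN⟩ := hN
  obtain ⟨h, hP⟩ := hP
  refine ⟨_, .caseOf k hx hy (.inl hM) hN hP, (hN.subst₁ hx hΞ k hM).of_tm ?_⟩
  exact (Category.assoc _ _ _).trans
    (congrArg (T.str₂ k ≫ ·) (whisker_inl_tensorDesc f g h).symm)

theorem beta_inr {x y : ℕ} {M N P : Tm} {A B C : Ty} (hΞ : Ξ.WF 0) (k : Split Ξ Δ Γ)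
    (hx : Scope.WF 0 ((.free x, A) :: Δ)) (hy : Scope.WF 0 ((.free y, B) :: Δ))
    (hM : T.Sound Γ (.tm M B)) (hN : T.Sound ((.free x, A) :: Δ) (.tm N C))
    (hP : T.Sound ((.free y, B) :: Δ) (.tm P C)) :
    T.Sound Ξ (.eq (.caseOf (.inr M) x N y P) (.subst1 M y P) C) := by
  obtain ⟨f, hM⟩ := hM
  obtain ⟨g, hN⟩ := hN
  obtain ⟨h, hP⟩ := hP
  refine ⟨_, .caseOf k hx hy (.inr hM) hN hP, (hP.subst₁ hy hΞ k hM).of_tm ?_⟩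
  exact (Category.assoc _ _ _).trans
    (congrArg (T.str₂ k ≫ ·) (whisker_inr_tensorDesc f g h).symm)

theorem _root_.QPEL.eta_tensor_hom {X A B : V} (f : X ⟶ A ⊗ B) :
    𝟙_ V ◁ f ≫ (α_ _ _ _).inv ≫ ((ρ_ (𝟙_ V ⊗ A)).inv ▷ B ≫ (α_ _ _ _).hom) ≫
      ((λ_ A).hom ⊗ₘ (λ_ B).hom) = (λ_ X).hom ≫ f := by
  have h : (α_ (𝟙_ V) A B).inv ≫ ((ρ_ (𝟙_ V ⊗ A)).inv ▷ B ≫ (α_ _ _ _).hom) ≫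
      ((λ_ A).hom ⊗ₘ (λ_ B).hom) = (λ_ _).hom := by monoidal
  rw [h]
  simp

theorem eta_tensor {x y : ℕ} {M : Tm} {A B : Ty} (hΓ : Γ.WF 0) (hxy : x ≠ y)
    (hM : T.Sound Γ (.tm M (.tensor A B))) :
    T.Sound Γ (.eq M (.letIn x y M (.pair (.fvar x) (.fvar y))) (.tensor A B)) := by
  obtain ⟨f, hM⟩ := hM
  have k : Split Γ [] Γ := by grind
  have k₁ : Split [(.free y, B), (.free x, A)] [(.free x, A)] [(.free y, B)] := by grind
  have k₂ : Split [(.free x, A)] [(.free x, A)] [] := by grind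
  have hx : Sub [(.free x, A)] [(.free x, A)] := by grind
  have hy : Sub [(.free y, B)] [(.free y, B)] := by grind
  have hΓ' : Sub Γ Γ := by grind
  refine ⟨f, hM, (Den.letIn k (by grind) hM (.pair k₁ (.fvar hx) (.fvar hy))).of_tm ?_⟩
  rw [T.str₂_cons_right k₁ k₂, T.str₂_nil_right k₂ hx, T.str_self, T.str_self, Category.id_comp,
    Category.id_comp, Category.id_comp]
  refine (congrArg (T.str₂ k ≫ ·) (eta_tensor_hom f)).trans ?_
  exact (Category.assoc _ _ _).symm.trans (by
    erw [T.str₂_nil_left k hΓ', T.str_self, Category.id_comp])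

theorem eta_unit {M : Tm} (hM : T.Sound Γ (.tm M .unit)) : T.Sound Γ (.eq M .unit .unit) := by
  obtain ⟨f, hM⟩ := hM
  exact ⟨f, hM, (Den.unit hM.nodup).of_tm (T.bang_unique _ _)⟩

theorem eta_sum {x y : ℕ} {M : Tm} {A B : Ty} (hΓ : Γ.WF 0) (hM : T.Sound Γ (.tm M (.sum A B))) :
    T.Sound Γ (.eq M (.caseOf M x (.inl (.fvar x)) y (.inr (.fvar y))) (.sum A B)) := by
  obtain ⟨f, hM⟩ := hM
  have k : Split Γ [] Γ := by grind
  have hx : Sub [(.free x, A)] [(.free x, A)] := by grind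
  have hy : Sub [(.free y, B)] [(.free y, B)] := by grind
  have hΓ' : Sub Γ Γ := by grind
  refine ⟨f, hM, (Den.caseOf k (by grind) (by grind) hM (.inl (.fvar hx)) (.inr (.fvar hy))).of_tm ?_⟩
  rw [T.str_self, T.str_self, Category.id_comp, Category.id_comp]
  refine (congrArg (fun t => T.str₂ k ≫ 𝟙_ V ◁ f ≫ t) (tensorDesc_leftUnitor _ _)).trans ?_
  refine (congrArg (T.str₂ k ≫ ·) (leftUnitor_naturality f)).trans ?_
  exact (Category.assoc _ _ _).symm.trans (by
    erw [T.str₂_nil_left k hΓ', T.str_self, Category.id_comp])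

end Sound

end Triangle

end Soundness

end QPEL

namespace QPEL

open PartialCommMonoid EffectAlgebra

section Soundness

variable {V : Type u} [Category.{v} V] [MonoidalCategory V] [SymmetricCategory V]
  [HasBinaryCoproducts V] [IsMonoidalDistrib V] {E : Type w} [CommEffectMonoid E]
  {T : Triangle V E}

namespace Triangle

/-- Pairing, with the second component first. -/
theorem Den.pair_braid {n : ℕ} {Ξ Γ Δ : Scope} {M N : Tm} {A B : Ty} {f : Scope.obj V Γ ⟶ A.obj V}
    {g : Scope.obj V Δ ⟶ B.obj V} (h : Split Ξ Δ Γ) (hM : T.Den n Γ M (.tm A f))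
    (hN : T.Den n Δ N (.tm B g)) :
    T.Den n Ξ (.pair M N)
      (.tm (.tensor A B) (T.str₂ h ≫ Scope.obj V Δ ◁ f ≫ g ▷ A.obj V ≫ (β_ _ _).hom)) := by
  have h' : Split Ξ Γ Δ := by grind
  refine (Den.pair h' hM hN).of_tm ?_
  rw [← T.str₂_braid h h']
  exact (Category.assoc _ _ _).trans (congrArg (T.str₂ h ≫ ·) (tensorHom_braiding f g))

theorem letE_str₂ {Ξ Γ Δ Θ P R : Scope} {a b : Key × Ty} (k₁ : Split Ξ P Γ)
    (k₂ : Split (b :: a :: P) Θ (b :: a :: Δ)) (k₃ : Split P Θ Δ) (k₄ : Split Ξ Θ R)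
    (k₅ : Split R Δ Γ) (f : Scope.obj V Γ ⟶ a.2.obj V ⊗ b.2.obj V) {W : V}
    {C : V} (g : (Scope.obj V Δ ⊗ a.2.obj V) ⊗ b.2.obj V ⟶ W) (h : Scope.obj V Θ ⊗ W ⟶ C) :
    T.str₂ k₁ ≫ Scope.obj V P ◁ f ≫ (α_ _ _ _).inv ≫ T.str₂ k₂ ≫ Scope.obj V Θ ◁ g ≫ h =
      T.str₂ k₄ ≫ Scope.obj V Θ ◁ (T.str₂ k₅ ≫ Scope.obj V Δ ◁ f ≫ (α_ _ _ _).inv ≫ g) ≫ h := by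
  have k₆ : Split (a :: P) Θ (a :: Δ) := by grind
  have e : T.str₂ k₁ ≫ Scope.obj V P ◁ f ≫ (α_ _ _ _).inv ≫ T.str₂ k₂ ≫ Scope.obj V Θ ◁ g =
      T.str₂ k₄ ≫ Scope.obj V Θ ◁ (T.str₂ k₅ ≫ Scope.obj V Δ ◁ f ≫ (α_ _ _ _).inv ≫ g) := by
    rw [T.str₂_cons_right k₂ k₆, T.str₂_cons_right k₆ k₃, MonoidalCategory.whiskerLeft_comp,
      ← reassoc_of% T.str₂_assoc k₁ k₃ k₄ k₅, ← whisker_letE_letE, Category.assoc]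
  simpa only [Category.assoc] using congrArg (· ≫ h) e

theorem caseT_str₂ {Ξ Γ Δ Θ P R : Scope} {a b : Key × Ty} (k₁ : Split Ξ P Γ)
    (k₂ : Split (a :: P) Θ (a :: Δ)) (k₂' : Split (b :: P) Θ (b :: Δ)) (k₄ : Split Ξ Θ R)
    (k₅ : Split R Δ Γ) (f : Scope.obj V Γ ⟶ a.2.obj V ⨿ b.2.obj V) {W C : V}
    (g : Scope.obj V Δ ⊗ a.2.obj V ⟶ W) (h : Scope.obj V Δ ⊗ b.2.obj V ⟶ W)
    (k : Scope.obj V Θ ⊗ W ⟶ C) :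
    T.str₂ k₁ ≫ Scope.obj V P ◁ f ≫ tensorDesc (T.str₂ k₂ ≫ Scope.obj V Θ ◁ g ≫ k)
        (T.str₂ k₂' ≫ Scope.obj V Θ ◁ h ≫ k) =
      T.str₂ k₄ ≫ Scope.obj V Θ ◁ (T.str₂ k₅ ≫ Scope.obj V Δ ◁ f ≫ tensorDesc g h) ≫ k := by
  have k₃ : Split P Θ Δ := by grind
  rw [T.str₂_cons_right k₂ k₃, T.str₂_cons_right k₂' k₃, whisker_tensorDesc_assoc,
    reassoc_of% T.str₂_assoc k₁ k₃ k₄ k₅, MonoidalCategory.whiskerLeft_comp _ (T.str₂ k₅),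
    Category.assoc]

namespace Sound

variable {Ξ Γ Δ Θ : Scope}

theorem let_commute {x y t u : ℕ} {M N P : Tm} {A B C D F : Ty}
    (hΞ : Scope.WF 0 ((.free y, B) :: (.free x, A) :: Ξ)) (k : Sub (Θ ++ (Δ ++ Γ)) Ξ)
    (hΘ : Scope.WF 0 ((.free u, D) :: (.free t, C) :: Θ))
    (hM : T.Sound Γ (.tm M (.tensor A B)))
    (hN : T.Sound ((.free y, B) :: (.free x, A) :: Δ) (.tm N (.tensor C D)))
    (hP : T.Sound ((.free u, D) :: (.free t, C) :: Θ) (.tm P F)) :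
    T.Sound Ξ (.eq (.letIn x y M (.letIn t u N P)) (.letIn t u (.letIn x y M N) P) F) := by
  obtain ⟨f, hM⟩ := hM
  obtain ⟨g, hN⟩ := hN
  obtain ⟨h, hP⟩ := hP
  have k₁ : Split Ξ (Θ ++ Δ) Γ := by grind
  have k₂ : Split ((.free y, B) :: (.free x, A) :: (Θ ++ Δ)) Θ
    ((.free y, B) :: (.free x, A) :: Δ) := by grind
  have k₃ : Split (Θ ++ Δ) Θ Δ := by grind
  have k₄ : Split Ξ Θ (Δ ++ Γ) := by grind
  have k₅ : Split (Δ ++ Γ) Δ Γ := by grind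
  refine ⟨_, .letIn k₁ (hΞ.sub (by grind)) hM (.letIn k₂ hΘ hN hP),
    (Den.letIn k₄ hΘ (.letIn k₅ (hΞ.sub (by grind)) hM hN) hP).of_tm ?_⟩
  exact (letE_str₂ (T := T) k₁ k₂ k₃ k₄ k₅ f g _).symm

theorem let_case {x y z t : ℕ} {M N P Q : Tm} {A B C D F : Ty}
    (hx : Scope.WF 0 ((.free x, A) :: Ξ)) (hy : Scope.WF 0 ((.free y, B) :: Ξ))
    (k : Sub (Θ ++ (Δ ++ Γ)) Ξ) (hΘ : Scope.WF 0 ((.free t, D) :: (.free z, C) :: Θ))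
    (hM : T.Sound Γ (.tm M (.sum A B))) (hN : T.Sound ((.free x, A) :: Δ) (.tm N (.tensor C D)))
    (hP : T.Sound ((.free y, B) :: Δ) (.tm P (.tensor C D)))
    (hQ : T.Sound ((.free t, D) :: (.free z, C) :: Θ) (.tm Q F)) :
    T.Sound Ξ (.eq (.letIn z t (.caseOf M x N y P) Q)
      (.caseOf M x (.letIn z t N Q) y (.letIn z t P Q)) F) := by
  obtain ⟨f, hM⟩ := hM
  obtain ⟨g, hN⟩ := hN
  obtain ⟨h, hP⟩ := hP
  obtain ⟨q, hQ⟩ := hQ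
  have k₁ : Split Ξ (Θ ++ Δ) Γ := by grind
  have k₂ : Split ((.free x, A) :: (Θ ++ Δ)) Θ ((.free x, A) :: Δ) := by grind
  have k₂' : Split ((.free y, B) :: (Θ ++ Δ)) Θ ((.free y, B) :: Δ) := by grind
  have k₄ : Split Ξ Θ (Δ ++ Γ) := by grind
  have k₅ : Split (Δ ++ Γ) Δ Γ := by grind
  refine ⟨_, .letIn k₄ hΘ (.caseOf k₅ (hx.sub (by grind)) (hy.sub (by grind)) hM hN hP) hQ,
    (Den.caseOf k₁ (hx.sub (by grind)) (hy.sub (by grind)) hM (.letIn k₂ hΘ hN hQ)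
      (.letIn k₂' hΘ hP hQ)).of_tm ?_⟩
  exact caseT_str₂ (T := T) k₁ k₂ k₂' k₄ k₅ f g h _

theorem case_commute {x y z t : ℕ} {M N P Q R : Tm} {A B C D F : Ty}
    (hx : Scope.WF 0 ((.free x, A) :: Ξ)) (hy : Scope.WF 0 ((.free y, B) :: Ξ))
    (k : Sub (Θ ++ (Δ ++ Γ)) Ξ) (hz : Scope.WF 0 ((.free z, C) :: Θ))
    (ht : Scope.WF 0 ((.free t, D) :: Θ))
    (hM : T.Sound Γ (.tm M (.sum A B))) (hN : T.Sound ((.free x, A) :: Δ) (.tm N (.sum C D)))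
    (hP : T.Sound ((.free y, B) :: Δ) (.tm P (.sum C D)))
    (hQ : T.Sound ((.free z, C) :: Θ) (.tm Q F)) (hR : T.Sound ((.free t, D) :: Θ) (.tm R F)) :
    T.Sound Ξ (.eq (.caseOf M x (.caseOf N z Q t R) y (.caseOf P z Q t R))
      (.caseOf (.caseOf M x N y P) z Q t R) F) := by
  obtain ⟨f, hM⟩ := hM
  obtain ⟨g, hN⟩ := hN
  obtain ⟨h, hP⟩ := hP
  obtain ⟨q, hQ⟩ := hQ
  obtain ⟨r, hR⟩ := hR
  have k₁ : Split Ξ (Θ ++ Δ) Γ := by grind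
  have k₂ : Split ((.free x, A) :: (Θ ++ Δ)) Θ ((.free x, A) :: Δ) := by grind
  have k₂' : Split ((.free y, B) :: (Θ ++ Δ)) Θ ((.free y, B) :: Δ) := by grind
  have k₄ : Split Ξ Θ (Δ ++ Γ) := by grind
  have k₅ : Split (Δ ++ Γ) Δ Γ := by grind
  refine ⟨_, .caseOf k₁ (hx.sub (by grind)) (hy.sub (by grind)) hM (.caseOf k₂ hz ht hN hQ hR)
      (.caseOf k₂' hz ht hP hQ hR),
    (Den.caseOf k₄ hz ht (.caseOf k₅ (hx.sub (by grind)) (hy.sub (by grind)) hM hN hP)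
      hQ hR).of_tm ?_⟩
  exact (caseT_str₂ (T := T) k₁ k₂ k₂' k₄ k₅ f g h _).symm

theorem let_tensor {x y : ℕ} {M N P : Tm} {A B C D : Ty}
    (hΞ : Scope.WF 0 ((.free y, B) :: (.free x, A) :: Ξ)) (k : Sub (Θ ++ (Δ ++ Γ)) Ξ)
    (hM : T.Sound Γ (.tm M (.tensor A B)))
    (hN : T.Sound ((.free y, B) :: (.free x, A) :: Δ) (.tm N C)) (hP : T.Sound Θ (.tm P D)) :
    T.Sound Ξ (.eq (.pair (.letIn x y M N) P) (.letIn x y M (.pair N P)) (.tensor C D)) := by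
  obtain ⟨f, hM⟩ := hM
  obtain ⟨g, hN⟩ := hN
  obtain ⟨h, hP⟩ := hP
  have k₁ : Split Ξ (Θ ++ Δ) Γ := by grind
  have k₂ : Split ((.free y, B) :: (.free x, A) :: (Θ ++ Δ)) Θ
    ((.free y, B) :: (.free x, A) :: Δ) := by grind
  have k₃ : Split (Θ ++ Δ) Θ Δ := by grind
  have k₄ : Split Ξ Θ (Δ ++ Γ) := by grind
  have k₅ : Split (Δ ++ Γ) Δ Γ := by grind
  refine ⟨_, .pair_braid k₄ (.letIn k₅ (hΞ.sub (by grind)) hM hN) hP,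
    (Den.letIn k₁ (hΞ.sub (by grind)) hM (.pair_braid k₂ hN hP)).of_tm ?_⟩
  exact letE_str₂ (T := T) k₁ k₂ k₃ k₄ k₅ f g _

theorem case_tensor {a b : ℕ} {Q M N P : Tm} {A B C D : Ty}
    (ha : Scope.WF 0 ((.free a, A) :: Ξ)) (hb : Scope.WF 0 ((.free b, B) :: Ξ))
    (k : Sub (Θ ++ (Δ ++ Γ)) Ξ)
    (hQ : T.Sound Γ (.tm Q (.sum A B))) (hM : T.Sound ((.free a, A) :: Δ) (.tm M C))
    (hN : T.Sound ((.free b, B) :: Δ) (.tm N C)) (hP : T.Sound Θ (.tm P D)) :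
    T.Sound Ξ (.eq (.pair (.caseOf Q a M b N) P) (.caseOf Q a (.pair M P) b (.pair N P))
      (.tensor C D)) := by
  obtain ⟨f, hQ⟩ := hQ
  obtain ⟨g, hM⟩ := hM
  obtain ⟨h, hN⟩ := hN
  obtain ⟨p, hP⟩ := hP
  have k₁ : Split Ξ (Θ ++ Δ) Γ := by grind
  have k₂ : Split ((.free a, A) :: (Θ ++ Δ)) Θ ((.free a, A) :: Δ) := by grind
  have k₂' : Split ((.free b, B) :: (Θ ++ Δ)) Θ ((.free b, B) :: Δ) := by grind
  have k₄ : Split Ξ Θ (Δ ++ Γ) := by grind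
  have k₅ : Split (Δ ++ Γ) Δ Γ := by grind
  refine ⟨_, .pair_braid k₄ (.caseOf k₅ (ha.sub (by grind)) (hb.sub (by grind)) hQ hM hN) hP,
    (Den.caseOf k₁ (ha.sub (by grind)) (hb.sub (by grind)) hQ (.pair_braid k₂ hM hP)
      (.pair_braid k₂' hN hP)).of_tm ?_⟩
  exact caseT_str₂ (T := T) k₁ k₂ k₂' k₄ k₅ f g h _

/-! ### Measurements -/

theorem measure_perm (k : Split Ξ Δ Γ) {l : ℕ} {φ : Fin (l + 1) → Eff}
    {M : Fin (l + 1) → Tm} {A : Ty} (p : Equiv.Perm (Fin (l + 1)))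
    (h : T.Sound Γ (.le Expr.one (Expr.bigOvee φ))) (hM : ∀ i, T.Sound Δ (.tm (M i) A)) :
    T.Sound Ξ (.eq (.measure φ M) (.measure (fun i => φ (p i)) fun i => M (p i)) A) := by
  obtain ⟨r, hr, ht⟩ := h.exists_test
  choose f hM using hM
  refine ⟨_, .measure k hr ht hM,
    (Den.measure k (fun i => hr (p i)) (ht.perm p) fun i => hM (p i)).of_tm ?_⟩
  rw [T.meas_perm r p ht (ht.perm p), MonoidalCategory.whiskerLeft_comp, Category.assoc,
    desc_branch]
  simp only [Equiv.apply_symm_apply]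

theorem measure_zero (k : Split Ξ Δ Γ) {l : ℕ} {φ : Fin (l + 1) → Eff}
    {M : Fin (l + 1) → Tm} {N : Tm} {A : Ty}
    (h : T.Sound Γ (.le Expr.one (Expr.bigOvee φ))) (hM : ∀ i, T.Sound Δ (.tm (M i) A))
    (hN : T.Sound Δ (.tm N A)) :
    T.Sound Ξ (.eq (.measure (Expr.snoc φ .zero) (Expr.snoc M N)) (.measure φ M) A) := by
  obtain ⟨r, hr, ht⟩ := h.exists_test
  choose f hM using hM
  obtain ⟨g, hN⟩ := hN
  refine ⟨_, (Den.measure k (p := Fin.snoc (α := fun _ => T.Pred (Scope.obj V Γ)) r 0)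
    (f := Fin.snoc (α := fun _ => Scope.obj V Δ ⟶ A.obj V) f g)
    (fun i => ?_) ht.snoc_zero fun i => ?_).of_tm ?_, .measure k hr ht hM⟩
  · refine Fin.lastCases ?_ (fun i => ?_) i
    · rw [Expr.snoc, Fin.snoc_last, Fin.snoc_last]; exact .zero (by grind)
    · rw [Expr.snoc, Fin.snoc_castSucc, Fin.snoc_castSucc]; exact hr i
  · refine Fin.lastCases ?_ (fun i => ?_) i
    · rw [Expr.snoc, Fin.snoc_last, Fin.snoc_last]; exact hN
    · rw [Expr.snoc, Fin.snoc_castSucc, Fin.snoc_castSucc]; exact hM i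
  · rw [T.meas_zero r ht ht.snoc_zero]
    refine congrArg (T.str₂ k ≫ ·) ((whisker_inl_tensorDesc (T.meas r ht) _ _).trans ?_)
    refine congrArg (fun t => Scope.obj V Δ ◁ T.meas r ht ≫ copower.branch l t) (funext fun i => ?_)
    rw [Fin.snoc_castSucc]

theorem measure_one {M : Tm} {A : Ty} (hM : T.Sound Γ (.tm M A)) :
    T.Sound Γ (.eq (.measure (n := 0) (fun _ => Expr.one) fun _ => M) M A) := by
  obtain ⟨f, hM⟩ := hM
  have := hM.nodup
  have k : Split Γ Γ [] := by grind
  have hΓ : Sub Γ Γ := by grind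
  have ht : IsTest fun _ : Fin 1 => (1 : T.Pred (Scope.obj V [])) :=
    Fin.sum_univ_one _
  refine ⟨f, (Den.measure k (fun _ => .one List.nodup_nil) ht fun _ => hM).of_tm ?_, hM⟩
  have := congrArg (· ≫ f) (T.str₂_discard_right k hΓ (T.meas _ ht))
  simp only [Category.assoc, T.str_self, Category.id_comp] at this
  exact this

theorem measure_plus (k : Split Ξ Δ Γ) {l : ℕ} {φ ψ : Eff} {χ : Fin l → Eff} {M : Tm}
    {P : Fin l → Tm} {A : Ty}
    (h : T.Sound Γ (.le Expr.one (Expr.bigOvee (Expr.cons φ (Expr.cons ψ χ)))))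
    (hM : T.Sound Δ (.tm M A)) (hP : ∀ i, T.Sound Δ (.tm (P i) A)) :
    T.Sound Ξ (.eq (.measure (Expr.cons (.ovee φ ψ) χ) (Expr.cons M P))
      (.measure (Expr.cons φ (Expr.cons ψ χ)) (Expr.cons M (Expr.cons M P))) A) := by
  obtain ⟨r, hr, ht⟩ := h.exists_test
  obtain ⟨f, hM⟩ := hM
  choose g hP using hP
  obtain ⟨a, b, r, rfl⟩ : ∃ a b r', r = Fin.cons (α := fun _ => T.Pred (Scope.obj V Γ)) a
      (Fin.cons (α := fun _ => T.Pred (Scope.obj V Γ)) b r') :=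
    ⟨r 0, r 1, fun i => r i.succ.succ, by
      funext i
      refine Fin.cases rfl (fun i => Fin.cases rfl (fun i => rfl) i) i⟩
  obtain ⟨s, hs⟩ : ∃ s, PSum.of a + PSum.of b = PSum.of s := by
    have := ht
    unfold IsTest at this
    rw [Fin.sum_univ_succ, Fin.sum_univ_succ, ← add_assoc] at this
    exact exists_of_left this
  have ht' := (isTest_cons_iff hs).2 ht
  have ha : T.Den 0 Γ φ (.eff a) := hr 0
  have hb : T.Den 0 Γ ψ (.eff b) := hr 1
  have hc : ∀ i, T.Den 0 Γ (χ i) (.eff (r i)) := fun i => hr i.succ.succ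
  have hM' : ∀ i, T.Den 0 Δ (Expr.cons M P i)
      (.tm A (Fin.cons (α := fun _ => Scope.obj V Δ ⟶ A.obj V) f g i)) :=
    fun i => Fin.cases hM hP i
  refine ⟨_, .measure k (fun i => ?_) ht' hM',
    (Den.measure k hr ht (f := Fin.cons (α := fun _ => Scope.obj V Δ ⟶ A.obj V) f
      (Fin.cons (α := fun _ => Scope.obj V Δ ⟶ A.obj V) f g))
        fun i => Fin.cases hM hM' i).of_tm ?_⟩
  · exact Fin.cases (.ovee ha hb hs) hc i
  · rw [T.meas_ovee a b s r hs ht' ht, MonoidalCategory.whiskerLeft_comp, Category.assoc]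
    have e : Fin.cons (α := fun _ => 𝟙_ V ⟶ copower V l) (copower.ι V l 0) (copower.ι V l) =
        fun i => copower.ι V l (Fin.cons (α := fun _ => Fin (l + 1)) 0 id i) :=
      funext fun i => Fin.cases rfl (fun _ => rfl) i
    rw [e, desc_branch]
    refine congrArg (fun t => T.str₂ k ≫ Scope.obj V Δ ◁ T.meas _ ht ≫ copower.branch (l + 1) t)
      (funext fun i => Fin.cases rfl (fun _ => rfl) i)

theorem measure_case {l : ℕ} {x y : ℕ} {φ ψ : Fin (l + 1) → Eff} {M : Tm}
    {N : Fin (l + 1) → Tm} {A B C : Ty}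
    (hx : Scope.WF 0 ((.free x, A) :: Ξ)) (hy : Scope.WF 0 ((.free y, B) :: Ξ))
    (k : Sub (Θ ++ (Δ ++ Γ)) Ξ)
    (hφ : T.Sound ((.free x, A) :: Γ) (.le Expr.one (Expr.bigOvee φ)))
    (hψ : T.Sound ((.free y, B) :: Γ) (.le Expr.one (Expr.bigOvee ψ)))
    (hM : T.Sound Δ (.tm M (.sum A B))) (hN : ∀ i, T.Sound Θ (.tm (N i) C)) :
    T.Sound Ξ (.eq (.measure (fun i => .caseEff M x (φ i) y (ψ i)) N)
      (.caseOf M x (.measure φ N) y (.measure ψ N)) C) := by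
  obtain ⟨p, hp, hpt⟩ := hφ.exists_test
  obtain ⟨q, hq, hqt⟩ := hψ.exists_test
  obtain ⟨f, hM⟩ := hM
  choose g hN using hN
  have k₁ : Split Ξ (Θ ++ Γ) Δ := by grind
  have k₂ : Split ((.free x, A) :: (Θ ++ Γ)) Θ ((.free x, A) :: Γ) := by grind
  have k₂' : Split ((.free y, B) :: (Θ ++ Γ)) Θ ((.free y, B) :: Γ) := by grind
  have k₄ : Split Ξ Θ (Δ ++ Γ) := by grind
  have k₅ : Split (Δ ++ Γ) Γ Δ := by grind
  have ht := T.pull_isTest (T.str₂ k₅ ≫ Scope.obj V Γ ◁ f) (T.isTest_copair hpt hqt)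
  refine ⟨_, .measure k₄ (fun i => .caseEff k₅ (hx.sub (by grind)) (hy.sub (by grind)) hM (hp i)
      (hq i)) ht hN,
    (Den.caseOf k₁ (hx.sub (by grind)) (hy.sub (by grind)) hM (.measure k₂ hp hpt hN)
      (.measure k₂' hq hqt hN)).of_tm ?_⟩
  have e := ((T.meas_natural (T.str₂ k₅ ≫ Scope.obj V Γ ◁ f) _ (T.isTest_copair hpt hqt) ht).symm.trans
    (congrArg ((T.str₂ k₅ ≫ Scope.obj V Γ ◁ f) ≫ ·) (T.meas_copair hpt hqt))).trans
    (Category.assoc _ _ _)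
  refine Eq.trans ?_ (congrArg (fun t => T.str₂ k₄ ≫ Scope.obj V Θ ◁ t ≫ copower.branch l g) e).symm
  exact caseT_str₂ (T := T) k₁ k₂ k₂' k₄ k₅ f _ _ _

end Sound

end Triangle

end Soundness

end QPEL

namespace QPEL

open PartialCommMonoid EffectAlgebra

section Soundness

variable {V : Type u} [Category.{v} V] [MonoidalCategory V] [SymmetricCategory V]
  [HasBinaryCoproducts V] [IsMonoidalDistrib V] {E : Type w} [CommEffectMonoid E]
  {T : Triangle V E}

/-! ### Effects -/

namespace Triangle

theorem str_tail {Ξ : Scope} {a : Key × Ty} (h : Sub Ξ (a :: Ξ)) :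
    T.str h = Scope.obj V Ξ ◁ T.bang (a.2.obj V) ≫ (ρ_ _).hom := by
  have k : Split (a :: Ξ) Ξ [a] := by grind
  rw [← T.str₂_discard_right k h ((λ_ _).hom ≫ T.bang _), MonoidalCategory.whiskerLeft_comp,
    Category.assoc, reassoc_of% T.str₂_single k]

namespace Sound

variable {Ξ Γ Δ Θ : Scope}

theorem ovee_mono {φ ψ χ : Eff} (hΓ : Γ.WF 0) (h : T.Sound Γ (.le φ ψ))
    (h' : T.Sound Γ (.le ψ (.orth χ))) : T.Sound Γ (.le (.ovee φ χ) (.ovee ψ χ)) := by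
  obtain ⟨q, r, s, hq, hr, hs⟩ := h'.of_perp
  obtain ⟨p, q', hp, hq', hpq⟩ := h
  rw [hq'.unique_eff hΓ hq] at hpq
  obtain ⟨t, ht, hts⟩ := add_mono_left hpq hs
  exact ⟨t, s, .ovee hp hr ht, .ovee hq hr hs, hts⟩

theorem ovee_comm {φ ψ : Eff} (h : T.Sound Γ (.perp φ ψ)) :
    T.Sound Γ (.le (.ovee φ ψ) (.ovee ψ φ)) := by
  obtain ⟨p, q, s, hp, hq, hs⟩ := h.of_perp
  exact ⟨s, s, .ovee hp hq hs, .ovee hq hp ((add_comm _ _).trans hs), EffectAlgebra.le_refl s⟩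

theorem exists_assoc {φ ψ χ : Eff} (h : T.Sound Γ (.perp (.ovee φ ψ) χ)) :
    ∃ p q r s t v, T.Den 0 Γ φ (.eff p) ∧ T.Den 0 Γ ψ (.eff q) ∧ T.Den 0 Γ χ (.eff r) ∧
      PSum.of p + PSum.of q = PSum.of s ∧ PSum.of s + PSum.of r = PSum.of v ∧
      PSum.of q + PSum.of r = PSum.of t ∧ PSum.of p + PSum.of t = PSum.of v := by
  obtain ⟨s, r, v, hs, hr, hv⟩ := h.of_perp
  obtain ⟨p, q, hp, hq, hpq⟩ := hs.ovee_inv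
  have hv' := hv
  rw [← hpq, add_assoc] at hv'
  obtain ⟨t, ht⟩ := exists_of_left ((add_comm _ _).trans hv')
  rw [ht] at hv'
  exact ⟨p, q, r, s, t, v, hp, hq, hr, hpq, hv, ht, hv'⟩

theorem perp_rotate {φ ψ χ : Eff} (h : T.Sound Γ (.perp (.ovee φ ψ) χ)) :
    T.Sound Γ (.perp (.ovee ψ χ) φ) := by
  obtain ⟨p, q, r, s, t, v, hp, hq, hr, -, -, ht, hv⟩ := exists_assoc h
  exact perp (.ovee hq hr ht) hp ((add_comm _ _).trans hv)

theorem ovee_assoc {φ ψ χ : Eff} (h : T.Sound Γ (.perp (.ovee φ ψ) χ)) :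
    T.Sound Γ (.le (.ovee φ (.ovee ψ χ)) (.ovee (.ovee φ ψ) χ)) := by
  obtain ⟨p, q, r, s, t, v, hp, hq, hr, hs, hv, ht, hv'⟩ := exists_assoc h
  exact ⟨v, v, .ovee hp (.ovee hq hr ht) hv', .ovee (.ovee hp hq hs) hr hv,
    EffectAlgebra.le_refl v⟩

theorem ovee_zero {φ : Eff} (h : T.Sound Γ (.eff φ)) : T.Sound Γ (.le (.ovee φ .zero) φ) := by
  obtain ⟨p, hp⟩ := h
  exact ⟨p, p, .ovee hp (.zero hp.nodup) (PartialCommMonoid.ovee_zero p), hp,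
    EffectAlgebra.le_refl p⟩

theorem ortho₁ {φ ψ : Eff} (h : T.Sound Γ (.le Expr.one (.ovee φ ψ))) :
    T.Sound Γ (.le (.orth ψ) φ) := by
  obtain ⟨o, s, ho, hs, hos⟩ := h
  obtain ⟨p, q, hp, hq, hpq⟩ := hs.ovee_inv
  rw [ho.one_inv] at hos
  rw [eq_one_of_one_le hos, add_comm] at hpq
  refine ⟨_, p, .orth hq, hp, ?_⟩
  rw [eq_orth hpq]
  exact EffectAlgebra.le_refl _

theorem ortho₂ {φ : Eff} (h : T.Sound Γ (.eff φ)) :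
    T.Sound Γ (.le Expr.one (.ovee φ (.orth φ))) := by
  obtain ⟨p, hp⟩ := h
  exact ⟨1, 1, .one hp.nodup, .ovee hp (.orth hp) (of_add_orth p), EffectAlgebra.le_refl _⟩

theorem dist_left_perp {φ ψ χ : Eff} (h : T.Sound [] (.perp φ ψ)) (h' : T.Sound Γ (.eff χ)) :
    T.Sound Γ (.perp (.mul φ χ) (.mul ψ χ)) := by
  obtain ⟨p, q, s, hp, hq, hs⟩ := h.of_perp
  obtain ⟨r, hr⟩ := h'
  exact perp (.mul hp hr) (.mul hq hr) (EffectModule.ovee_smul _ _ _ _ (T.scalar_ovee hs))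

theorem dist_left {φ ψ χ : Eff} {J : Jdg} (h : T.Sound [] (.perp φ ψ)) (h' : T.Sound Γ (.eff χ))
    (hJ : J ∈ Jdg.equiv (.mul (.ovee φ ψ) χ) (.ovee (.mul φ χ) (.mul ψ χ))) : T.Sound Γ J := by
  obtain ⟨p, q, s, hp, hq, hs⟩ := h.of_perp
  obtain ⟨r, hr⟩ := h'
  exact equiv (.mul (.ovee hp hq hs) hr)
    (.ovee (.mul hp hr) (.mul hq hr) (EffectModule.ovee_smul _ _ _ _ (T.scalar_ovee hs))) hJ

theorem dist_right_perp {φ ψ χ : Eff} (h : T.Sound [] (.eff φ)) (h' : T.Sound Γ (.perp ψ χ)) :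
    T.Sound Γ (.perp (.mul φ ψ) (.mul φ χ)) := by
  obtain ⟨p, q, s, hp, hq, hs⟩ := h'.of_perp
  obtain ⟨r, hr⟩ := h
  exact perp (.mul hr hp) (.mul hr hq) (EffectModule.smul_ovee _ _ _ _ hs)

theorem dist_right {φ ψ χ : Eff} {J : Jdg} (h : T.Sound [] (.eff φ)) (h' : T.Sound Γ (.perp ψ χ))
    (hJ : J ∈ Jdg.equiv (.mul φ (.ovee ψ χ)) (.ovee (.mul φ ψ) (.mul φ χ))) : T.Sound Γ J := by
  obtain ⟨p, q, s, hp, hq, hs⟩ := h'.of_perp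
  obtain ⟨r, hr⟩ := h
  exact equiv (.mul hr (.ovee hp hq hs)) (.ovee (.mul hr hp) (.mul hr hq)
    (EffectModule.smul_ovee _ _ _ _ hs)) hJ

theorem unit_left {φ : Eff} {J : Jdg} (h : T.Sound Γ (.eff φ)) (hJ : J ∈ Jdg.equiv (.mul .one φ) φ) :
    T.Sound Γ J := by
  obtain ⟨p, hp⟩ := h
  exact equiv (.mul (.one List.nodup_nil) hp)
    (hp.of_eff (by erw [T.scalar_one, EffectModule.one_smul'])) hJ

theorem unit_right {φ : Eff} {J : Jdg} (hΓ : Γ.WF 0) (h : T.Sound [] (.eff φ))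
    (hJ : J ∈ Jdg.equiv (.mul φ .one) φ) : T.Sound Γ J := by
  obtain ⟨p, hp⟩ := h
  have k : Sub [] Γ := by grind
  refine equiv (.mul hp (.one hΓ.1)) ((hp.weaken k).of_eff ?_) hJ
  refine (congrArg (T.pull (T.str k)) (T.scalar_smul_one p)).symm.trans ?_
  rw [T.pull_smul, T.pull_one]

theorem mul_assoc {φ ψ χ : Eff} {J : Jdg} (h₁ : T.Sound [] (.eff φ)) (h₂ : T.Sound [] (.eff ψ))
    (h₃ : T.Sound Γ (.eff χ)) (hJ : J ∈ Jdg.equiv (.mul φ (.mul ψ χ)) (.mul (.mul φ ψ) χ)) :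
    T.Sound Γ J := by
  obtain ⟨p, hp⟩ := h₁
  obtain ⟨q, hq⟩ := h₂
  obtain ⟨r, hr⟩ := h₃
  refine equiv (.mul hp (.mul hq hr)) ((Den.mul (.mul hp hq) hr).of_eff ?_) hJ
  rw [← EffectModule.mul_smul']
  exact congrArg (· • r) (T.scalar_smul _ _)

theorem mul_comm {φ ψ : Eff} {J : Jdg} (h₁ : T.Sound [] (.eff φ)) (h₂ : T.Sound [] (.eff ψ))
    (hJ : J ∈ Jdg.equiv (.mul φ ψ) (.mul ψ φ)) : T.Sound [] J := by
  obtain ⟨p, hp⟩ := h₁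
  obtain ⟨q, hq⟩ := h₂
  refine equiv (.mul hp hq) ((Den.mul hq hp).of_eff ?_) hJ
  have key : ∀ p q : T.Pred (𝟙_ V), T.scalar p • q = (T.scalar p * T.scalar q) • 1 := fun p q => by
    rw [EffectModule.mul_smul', T.scalar_smul_one]
  refine (key q p).trans (Eq.trans ?_ (key p q).symm)
  rw [CommEffectMonoid.mul_comm']

variable {x y : ℕ} {A B : Ty} {M : Tm} {φ ψ φ' ψ' χ : Eff} {J : Jdg}

theorem case_cong {N : Tm} (k : Split Ξ Γ Δ)
    (hx : Scope.WF 0 ((.free x, A) :: Γ)) (hy : Scope.WF 0 ((.free y, B) :: Γ))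
    (hφ : T.Sound ((.free x, A) :: Γ) (.eff φ)) (hψ : T.Sound ((.free y, B) :: Γ) (.eff ψ))
    (h : T.Sound Δ (.eq M N (.sum A B)))
    (hJ : J ∈ Jdg.equiv (.caseEff M x φ y ψ) (.caseEff N x φ y ψ)) : T.Sound Ξ J := by
  obtain ⟨p, hp⟩ := hφ
  obtain ⟨q, hq⟩ := hψ
  obtain ⟨f, hM, hN⟩ := h
  exact equiv (.caseEff k hx hy hM hp hq) (.caseEff k hx hy hN hp hq) hJ

theorem case_mono (k : Split Ξ Γ Δ)
    (hx : Scope.WF 0 ((.free x, A) :: Γ)) (hy : Scope.WF 0 ((.free y, B) :: Γ))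
    (hφ : T.Sound ((.free x, A) :: Γ) (.le φ φ')) (hψ : T.Sound ((.free y, B) :: Γ) (.le ψ ψ'))
    (h : T.Sound Δ (.tm M (.sum A B))) :
    T.Sound Ξ (.le (.caseEff M x φ y ψ) (.caseEff M x φ' y ψ')) := by
  obtain ⟨p, p', hp, hp', hpp⟩ := hφ
  obtain ⟨q, q', hq, hq', hqq⟩ := hψ
  obtain ⟨f, hM⟩ := h
  exact ⟨_, _, .caseEff k hx hy hM hp hq, .caseEff k hx hy hM hp' hq',
    T.pull_le _ (T.copair_le hpp hqq)⟩

theorem beta_inl_eff (hΞ : Ξ.WF 0) (k : Split Ξ Γ Δ)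
    (hx : Scope.WF 0 ((.free x, A) :: Γ)) (hy : Scope.WF 0 ((.free y, B) :: Γ))
    (hφ : T.Sound ((.free x, A) :: Γ) (.eff φ)) (hψ : T.Sound ((.free y, B) :: Γ) (.eff ψ))
    (h : T.Sound Δ (.tm M A))
    (hJ : J ∈ Jdg.equiv (.caseEff (.inl M) x φ y ψ) (.subst1 M x φ)) : T.Sound Ξ J := by
  obtain ⟨p, hp⟩ := hφ
  obtain ⟨q, hq⟩ := hψ
  obtain ⟨f, hM⟩ := h
  refine equiv (.caseEff k hx hy (.inl hM) hp hq) ((hp.subst₁ hx hΞ k hM).of_eff ?_) hJ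
  refine (congrArg _ (T.pull_inl_copair p q).symm).trans ((T.pull_comp _ _ _).symm.trans ?_)
  refine congrArg (fun t => T.pull t (T.copair p q)) ((Category.assoc _ _ _).trans ?_)
  exact congrArg (T.str₂ k ≫ ·) (MonoidalCategory.whiskerLeft_comp _ _ _).symm

theorem beta_inr_eff (hΞ : Ξ.WF 0) (k : Split Ξ Γ Δ)
    (hx : Scope.WF 0 ((.free x, A) :: Γ)) (hy : Scope.WF 0 ((.free y, B) :: Γ))
    (hφ : T.Sound ((.free x, A) :: Γ) (.eff φ)) (hψ : T.Sound ((.free y, B) :: Γ) (.eff ψ))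
    (h : T.Sound Δ (.tm M B))
    (hJ : J ∈ Jdg.equiv (.caseEff (.inr M) x φ y ψ) (.subst1 M y ψ)) : T.Sound Ξ J := by
  obtain ⟨p, hp⟩ := hφ
  obtain ⟨q, hq⟩ := hψ
  obtain ⟨f, hM⟩ := h
  refine equiv (.caseEff k hx hy (.inr hM) hp hq) ((hq.subst₁ hy hΞ k hM).of_eff ?_) hJ
  refine (congrArg _ (T.pull_inr_copair p q).symm).trans ((T.pull_comp _ _ _).symm.trans ?_)
  refine congrArg (fun t => T.pull t (T.copair p q)) ((Category.assoc _ _ _).trans ?_)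
  exact congrArg (T.str₂ k ≫ ·) (MonoidalCategory.whiskerLeft_comp _ _ _).symm

theorem eta_sum_eff {z : ℕ}
    (hx : Scope.WF 0 ((.free x, A) :: (.free z, .sum A B) :: Γ))
    (hy : Scope.WF 0 ((.free y, B) :: (.free z, .sum A B) :: Γ))
    (h : T.Sound ((.free z, .sum A B) :: Γ) (.eff φ))
    (hJ : J ∈ Jdg.equiv φ (.caseEff (.fvar z) x (.subst1 (.inl (.fvar x)) z φ)
      y (.subst1 (.inr (.fvar y)) z φ))) : T.Sound ((.free z, .sum A B) :: Γ) J := by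
  obtain ⟨p, hp⟩ := h
  have k : Split ((.free z, .sum A B) :: Γ) Γ [(.free z, .sum A B)] := by grind
  have kx : Split ((.free x, A) :: Γ) Γ [(.free x, A)] := by grind
  have ky : Split ((.free y, B) :: Γ) Γ [(.free y, B)] := by grind
  have hz : Scope.WF 0 ((.free z, .sum A B) :: Γ) := hx.sub (by grind)
  have hx' : Scope.WF 0 ((.free x, A) :: Γ) := hx.sub (by grind)
  have hy' : Scope.WF 0 ((.free y, B) :: Γ) := hy.sub (by grind)
  have sx : Sub [(.free x, A)] [(.free x, A)] := by grind
  have sy : Sub [(.free y, B)] [(.free y, B)] := by grind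
  have sz : Sub [(.free z, Ty.sum A B)] [(.free z, .sum A B)] := by grind
  have hl := (hp.subst₁ hz hx' kx (.inl (.fvar sx))).of_eff
    (q := T.pull (Scope.obj V Γ ◁ (coprod.inl : _ ⟶ A.obj V ⨿ B.obj V)) p) (by
      rw [T.str_self, Category.id_comp]
      refine congrArg (T.pull · p) ?_
      refine (congrArg (T.str₂ kx ≫ ·) (MonoidalCategory.whiskerLeft_comp _ _ _)).trans ?_
      exact (reassoc_of% T.str₂_single kx) _)
  have hr := (hp.subst₁ hz hy' ky (.inr (.fvar sy))).of_eff
    (q := T.pull (Scope.obj V Γ ◁ (coprod.inr : _ ⟶ A.obj V ⨿ B.obj V)) p) (by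
      rw [T.str_self, Category.id_comp]
      refine congrArg (T.pull · p) ?_
      refine (congrArg (T.str₂ ky ≫ ·) (MonoidalCategory.whiskerLeft_comp _ _ _)).trans ?_
      exact (reassoc_of% T.str₂_single ky) _)
  refine equiv hp ((Den.caseEff k hx' hy' (.fvar sz) hl hr).of_eff ?_) hJ
  rw [T.str_self, Category.id_comp]
  refine (congrArg _ (T.copair_pull (A := A.obj V) (B := B.obj V) p)).trans ?_
  exact (congrArg (T.pull · p) (T.str₂_single k)).trans (T.pull_id p)

theorem case_ovee (k : Split Ξ Γ Δ)
    (hx : Scope.WF 0 ((.free x, A) :: Γ)) (hy : Scope.WF 0 ((.free y, B) :: Γ))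
    (hφ : T.Sound ((.free x, A) :: Γ) (.perp φ φ')) (hψ : T.Sound ((.free y, B) :: Γ) (.perp ψ ψ'))
    (h : T.Sound Δ (.tm M (.sum A B)))
    (hJ : J ∈ Jdg.equiv (.caseEff M x (.ovee φ φ') y (.ovee ψ ψ'))
      (.ovee (.caseEff M x φ y ψ) (.caseEff M x φ' y ψ'))) : T.Sound Ξ J := by
  obtain ⟨p, p', s, hp, hp', hs⟩ := hφ.of_perp
  obtain ⟨q, q', t, hq, hq', ht⟩ := hψ.of_perp
  obtain ⟨f, hM⟩ := h
  exact equiv (.caseEff k hx hy hM (.ovee hp hp' hs) (.ovee hq hq' ht))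
    (.ovee (.caseEff k hx hy hM hp hq) (.caseEff k hx hy hM hp' hq')
      (T.pull_ovee _ (T.ovee_copair hs ht))) hJ

theorem case_orth (k : Split Ξ Γ Δ)
    (hx : Scope.WF 0 ((.free x, A) :: Γ)) (hy : Scope.WF 0 ((.free y, B) :: Γ))
    (hφ : T.Sound ((.free x, A) :: Γ) (.eff φ)) (hψ : T.Sound ((.free y, B) :: Γ) (.eff ψ))
    (h : T.Sound Δ (.tm M (.sum A B)))
    (hJ : J ∈ Jdg.equiv (.caseEff M x (.orth φ) y (.orth ψ)) (.orth (.caseEff M x φ y ψ))) :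
    T.Sound Ξ J := by
  obtain ⟨p, hp⟩ := hφ
  obtain ⟨q, hq⟩ := hψ
  obtain ⟨f, hM⟩ := h
  exact equiv (.caseEff k hx hy hM (.orth hp) (.orth hq))
    ((Den.orth (.caseEff k hx hy hM hp hq)).of_eff
      ((T.pull_orth _ _).symm.trans (congrArg _ (T.copair_orth p q).symm))) hJ

theorem case_mul (k : Split Ξ Γ Δ)
    (hx : Scope.WF 0 ((.free x, A) :: Γ)) (hy : Scope.WF 0 ((.free y, B) :: Γ))
    (hφ : T.Sound ((.free x, A) :: Γ) (.eff φ)) (hψ : T.Sound ((.free y, B) :: Γ) (.eff ψ))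
    (h : T.Sound Δ (.tm M (.sum A B))) (hχ : T.Sound [] (.eff χ))
    (hJ : J ∈ Jdg.equiv (.caseEff M x (.mul χ φ) y (.mul χ ψ)) (.mul χ (.caseEff M x φ y ψ))) :
    T.Sound Ξ J := by
  obtain ⟨p, hp⟩ := hφ
  obtain ⟨q, hq⟩ := hψ
  obtain ⟨f, hM⟩ := h
  obtain ⟨r, hr⟩ := hχ
  exact equiv (.caseEff k hx hy hM (.mul hr hp) (.mul hr hq))
    ((Den.mul hr (.caseEff k hx hy hM hp hq)).of_eff
      ((T.pull_smul _ _ _).symm.trans (congrArg _ (T.copair_smul _ p q).symm))) hJ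

theorem exists_tail {a : Key × Ty} {x : ℕ} (ha : a.1 = .free x) (hΓ : Scope.WF 0 (a :: Γ))
    (hχ : ¬ Expr.Occurs x χ) {r : T.Pred (Scope.obj V (a :: Γ))} (h : T.Den 0 (a :: Γ) χ (.eff r)) :
    ∃ c, T.Den 0 Γ χ (.eff c) ∧ r = T.pull (Scope.obj V Γ ◁ T.bang (a.2.obj V) ≫ (ρ_ _).hom) c := by
  have k : Sub Γ (a :: Γ) := by grind
  obtain ⟨v, hv, he⟩ := h.strengthen hΓ k fun b hb hu => by
    rcases List.mem_cons.1 hb with rfl | hb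
    · rw [ha, Expr.uses_free_iff] at hu
      exact absurd hu hχ
    · exact hb
  cases v with
  | eff c =>
    refine ⟨c, hv, ?_⟩
    rw [← str_tail k]
    exact Sem.eff.inj he

theorem case_le (hΞ : Ξ.WF 0) (k : Split Ξ Δ Γ)
    (hx : Scope.WF 0 ((.free x, A) :: Δ)) (hy : Scope.WF 0 ((.free y, B) :: Δ))
    (hxχ : ¬ Expr.Occurs x χ) (hyχ : ¬ Expr.Occurs y χ) (h : T.Sound Γ (.tm M (.sum A B)))
    (hφ : T.Sound ((.free x, A) :: Δ) (.le φ χ)) (hψ : T.Sound ((.free y, B) :: Δ) (.le ψ χ)) :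
    T.Sound Ξ (.le (.caseEff M x φ y ψ) χ) := by
  obtain ⟨f, hM⟩ := h
  obtain ⟨p, r, hp, hr, hpr⟩ := hφ
  obtain ⟨q, r', hq, hr', hqr⟩ := hψ
  obtain ⟨c, hc, rfl⟩ := exists_tail rfl hx hxχ hr
  obtain ⟨c', hc', rfl⟩ := exists_tail rfl hy hyχ hr'
  obtain rfl := hc.unique_eff (hΞ.sub (by grind)) hc'
  have k' : Sub Δ Ξ := by grind
  refine ⟨_, _, .caseEff k hx hy hM hp hq, hc.weaken k', ?_⟩
  have key : T.pull (Scope.obj V Δ ◁ T.bang (A.obj V ⨿ B.obj V) ≫ (ρ_ _).hom) c =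
      T.copair (T.pull (Scope.obj V Δ ◁ T.bang (A.obj V) ≫ (ρ_ _).hom) c)
        (T.pull (Scope.obj V Δ ◁ T.bang (B.obj V) ≫ (ρ_ _).hom) c) := by
    apply T.eq_copair <;> rw [← T.pull_comp, ← MonoidalCategory.whiskerLeft_comp_assoc] <;>
      rw [T.bang_unique (_ ≫ T.bang _)]
  refine EffectAlgebra.le_trans (T.pull_le _ (T.copair_le hpr hqr)) ?_
  rw [← key, ← T.pull_comp, ← T.str₂_discard_right k k' (f ≫ T.bang _),
    MonoidalCategory.whiskerLeft_comp]
  simp only [Category.assoc]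
  exact EffectAlgebra.le_refl _

end Sound

end Triangle

end Soundness

end QPEL

namespace QPEL

section Soundness

variable {V : Type u} [Category.{v} V] [MonoidalCategory V] [SymmetricCategory V]
  [HasBinaryCoproducts V] [IsMonoidalDistrib V] {E : Type w} [CommEffectMonoid E]
  {T : Triangle V E}

theorem Ctx.exch_sub {Γ Δ : Ctx} {x y : ℕ} {A B : Ty} (h : ((Γ.ext x A).ext y B ++ Δ).Valid) :
    ((Γ.ext y B).ext x A ++ Δ).Valid ∧
      Sub ((Γ.ext x A).ext y B ++ Δ).toScope ((Γ.ext y B).ext x A ++ Δ).toScope := by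
  have hp : ((Γ.ext y B).ext x A ++ Δ).names.Perm ((Γ.ext x A).ext y B ++ Δ).names := by
    induction Δ with
    | nil => exact List.Perm.swap _ _ _
    | ext Δ z C ih => exact (ih (List.nodup_cons.1 h).2).cons z
  have h' : ((Γ.ext y B).ext x A ++ Δ).Valid := hp.nodup_iff.2 h
  refine ⟨h', h'.toScope.1, h.toScope.1, ?_⟩
  simp only [Ctx.toScope_append, Ctx.toScope]
  intro a ha
  grind

theorem Ctx.split_append {Γ Δ : Ctx} (h : (Γ ++ Δ).Valid) :
    Split (Γ ++ Δ).toScope Δ.toScope Γ.toScope ∧ Split (Γ ++ Δ).toScope Γ.toScope Δ.toScope := by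
  have := h.toScope.1
  rw [Ctx.toScope_append] at this ⊢
  grind

theorem Ctx.sub_append₃ {Γ Δ Θ : Ctx} (h : (Γ ++ Δ ++ Θ).Valid) :
    Sub (Θ.toScope ++ (Δ.toScope ++ Γ.toScope)) (Γ ++ Δ ++ Θ).toScope := by
  have := h.toScope.1
  rw [Ctx.toScope_append, Ctx.toScope_append] at this ⊢
  grind

theorem Ctx.Has.sub_toScope {Γ : Ctx} {x : ℕ} {A : Ty} (h : Γ.Has x A) (hΓ : Γ.toScope.Nodup) :
    Sub [(.free x, A)] Γ.toScope := by
  have : (Key.free x, A) ∈ Γ.toScope := by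
    clear hΓ
    induction h with
    | here => exact List.mem_cons_self
    | there _ ih => exact List.mem_cons_of_mem _ ih
  grind

theorem Ctx.Valid.tail {Γ : Ctx} {x : ℕ} {A : Ty} (h : (Γ.ext x A).Valid) : Γ.Valid :=
  (List.nodup_cons.1 h).2

variable (T) in
/-- Derivable judgements are true. -/
theorem Derives.sound {Γ : Ctx} {J : Jdg} (h : Derives Γ J) : Γ.Valid ∧ T.Sound Γ.toScope J := by
  have nilv : Ctx.nil.Valid := List.nodup_nil
  induction h with
  | exch _ ih =>
    have h := Ctx.exch_sub ih.1
    exact ⟨h.1, ih.2.weaken h.2⟩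
  | var hΓ h => exact ⟨hΓ, _, .fvar (h.sub_toScope hΓ.toScope.1)⟩
  | pair hv _ _ ih₁ ih₂ =>
    obtain ⟨-, f, hf⟩ := ih₁
    obtain ⟨-, g, hg⟩ := ih₂
    exact ⟨hv, _, .pair (Ctx.split_append hv).2 hf hg⟩
  | letIn hv _ _ ih₁ ih₂ =>
    obtain ⟨-, f, hf⟩ := ih₁
    obtain ⟨h₂, g, hg⟩ := ih₂
    exact ⟨hv, _, .letIn (Ctx.split_append hv).1 h₂.toScope hf hg⟩
  | unit hv => exact ⟨hv, _, .unit hv.toScope.1⟩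
  | inl _ ih =>
    obtain ⟨hv, f, hf⟩ := ih
    exact ⟨hv, _, .inl hf⟩
  | inr _ ih =>
    obtain ⟨hv, f, hf⟩ := ih
    exact ⟨hv, _, .inr hf⟩
  | caseOf hv _ _ _ ih₁ ih₂ ih₃ =>
    obtain ⟨-, f, hf⟩ := ih₁
    obtain ⟨h₂, g, hg⟩ := ih₂
    obtain ⟨h₃, k, hk⟩ := ih₃
    exact ⟨hv, _, .caseOf (Ctx.split_append hv).1 h₂.toScope h₃.toScope hf hg hk⟩
  | measure hv _ _ ih₁ ih₂ =>
    obtain ⟨p, hp, ht⟩ := ih₁.2.exists_test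
    choose f hf using fun i => (ih₂ i).2
    exact ⟨hv, _, .measure (Ctx.split_append hv).1 hp ht hf⟩
  | refl _ ih =>
    obtain ⟨hv, f, hf⟩ := ih
    exact ⟨hv, f, hf, hf⟩
  | symm _ ih =>
    obtain ⟨hv, f, hf, hg⟩ := ih
    exact ⟨hv, f, hg, hf⟩
  | trans _ _ ih₁ ih₂ =>
    obtain ⟨hv, f, hf, hg⟩ := ih₁
    obtain ⟨-, f', hf', hg'⟩ := ih₂
    obtain rfl := hg.unique_tm hv.toScope hf'
    exact ⟨hv, f, hf, hg'⟩
  | pair_eq hv _ _ ih₁ ih₂ =>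
    obtain ⟨-, f, hf, hf'⟩ := ih₁
    obtain ⟨-, g, hg, hg'⟩ := ih₂
    exact ⟨hv, _, .pair (Ctx.split_append hv).2 hf hg, .pair (Ctx.split_append hv).2 hf' hg'⟩
  | let_eq hv _ _ ih₁ ih₂ =>
    obtain ⟨-, f, hf, hf'⟩ := ih₁
    obtain ⟨h₂, g, hg, hg'⟩ := ih₂
    have k := (Ctx.split_append hv).1
    exact ⟨hv, _, .letIn k h₂.toScope hf hg, .letIn k h₂.toScope hf' hg'⟩
  | inl_eq _ ih =>
    obtain ⟨hv, f, hf, hg⟩ := ih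
    exact ⟨hv, _, .inl hf, .inl hg⟩
  | inr_eq _ ih =>
    obtain ⟨hv, f, hf, hg⟩ := ih
    exact ⟨hv, _, .inr hf, .inr hg⟩
  | case_eq hv _ _ _ ih₁ ih₂ ih₃ =>
    obtain ⟨-, f, hf, hf'⟩ := ih₁
    obtain ⟨h₂, g, hg, hg'⟩ := ih₂
    obtain ⟨h₃, k, hk, hk'⟩ := ih₃
    have k := (Ctx.split_append hv).1
    exact ⟨hv, _, .caseOf k h₂.toScope h₃.toScope hf hg hk,
      .caseOf k h₂.toScope h₃.toScope hf' hg' hk'⟩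
  | measure_eq hv _ _ _ _ ih₁ ih₂ ih₃ ih₄ =>
    exact ⟨hv, .measure_eq ih₁.1.toScope (Ctx.split_append hv).1 ih₁.2 (fun i => (ih₂ i).2)
      (fun i => (ih₃ i).2) fun i => (ih₄ i).2⟩
  | beta_tensor hv _ _ _ ih₁ ih₂ ih₃ =>
    exact ⟨hv, .beta_tensor hv.toScope (Ctx.sub_append₃ hv) ih₃.1.toScope ih₁.2 ih₂.2 ih₃.2⟩
  | beta_inl hv _ _ _ ih₁ ih₂ ih₃ =>
    exact ⟨hv, .beta_inl hv.toScope (Ctx.split_append hv).1 ih₂.1.toScope ih₃.1.toScope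
      ih₁.2 ih₂.2 ih₃.2⟩
  | beta_inr hv _ _ _ ih₁ ih₂ ih₃ =>
    exact ⟨hv, .beta_inr hv.toScope (Ctx.split_append hv).1 ih₂.1.toScope ih₃.1.toScope
      ih₁.2 ih₂.2 ih₃.2⟩
  | eta_tensor hxy _ ih => exact ⟨ih.1, .eta_tensor ih.1.toScope hxy ih.2⟩
  | eta_unit _ ih => exact ⟨ih.1, .eta_unit ih.2⟩
  | eta_sum _ ih => exact ⟨ih.1, .eta_sum ih.1.toScope ih.2⟩
  | let_commute hv _ _ _ ih₁ ih₂ ih₃ =>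
    exact ⟨hv.tail.tail, .let_commute hv.toScope (Ctx.sub_append₃ hv.tail.tail) ih₃.1.toScope
      ih₁.2 ih₂.2 ih₃.2⟩
  | let_case hx hy _ _ _ _ ih₁ ih₂ ih₃ ih₄ =>
    exact ⟨hx.tail, .let_case hx.toScope hy.toScope (Ctx.sub_append₃ hx.tail) ih₄.1.toScope
      ih₁.2 ih₂.2 ih₃.2 ih₄.2⟩
  | let_tensor hv _ _ _ ih₁ ih₂ ih₃ =>
    exact ⟨hv.tail.tail, .let_tensor hv.toScope (Ctx.sub_append₃ hv.tail.tail) ih₁.2 ih₂.2 ih₃.2⟩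
  | case_commute hx hy _ _ _ _ _ ih₁ ih₂ ih₃ ih₄ ih₅ =>
    exact ⟨hx.tail, .case_commute hx.toScope hy.toScope (Ctx.sub_append₃ hx.tail) ih₄.1.toScope
      ih₅.1.toScope ih₁.2 ih₂.2 ih₃.2 ih₄.2 ih₅.2⟩
  | case_tensor hx hy _ _ _ _ ih₁ ih₂ ih₃ ih₄ =>
    exact ⟨hx.tail, .case_tensor hx.toScope hy.toScope (Ctx.sub_append₃ hx.tail)
      ih₁.2 ih₂.2 ih₃.2 ih₄.2⟩
  | measure_perm p hv _ _ ih₁ ih₂ =>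
    exact ⟨hv, .measure_perm (Ctx.split_append hv).1 p ih₁.2 fun i => (ih₂ i).2⟩
  | measure_zero hv _ _ _ ih₁ ih₂ ih₃ =>
    exact ⟨hv, .measure_zero (Ctx.split_append hv).1 ih₁.2 (fun i => (ih₂ i).2) ih₃.2⟩
  | measure_one _ ih => exact ⟨ih.1, .measure_one ih.2⟩
  | measure_plus hv _ _ _ ih₁ ih₂ ih₃ =>
    exact ⟨hv, .measure_plus (Ctx.split_append hv).1 ih₁.2 ih₂.2 fun i => (ih₃ i).2⟩
  | measure_case hx hy _ _ _ _ ih₁ ih₂ ih₃ ih₄ =>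
    exact ⟨hx.tail, .measure_case hx.toScope hy.toScope (Ctx.sub_append₃ hx.tail) ih₁.2 ih₂.2
      ih₃.2 fun i => (ih₄ i).2⟩
  | zero hv => exact ⟨hv, _, .zero hv.toScope.1⟩
  | orth _ ih =>
    obtain ⟨hv, p, hp⟩ := ih
    exact ⟨hv, _, .orth hp⟩
  | ovee _ ih =>
    obtain ⟨p, q, s, hp, hq, hs⟩ := ih.2.of_perp
    exact ⟨ih.1, s, .ovee hp hq hs⟩
  | mul _ _ ih₁ ih₂ =>
    obtain ⟨-, p, hp⟩ := ih₁
    obtain ⟨hv, q, hq⟩ := ih₂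
    exact ⟨hv, _, .mul hp hq⟩
  | caseEff hv _ _ _ ih₁ ih₂ ih₃ =>
    obtain ⟨h₁, p, hp⟩ := ih₁
    obtain ⟨h₂, q, hq⟩ := ih₂
    obtain ⟨-, f, hf⟩ := ih₃
    exact ⟨hv, _, .caseEff (Ctx.split_append hv).2 h₁.toScope h₂.toScope hf hp hq⟩
  | le_refl _ ih =>
    obtain ⟨hv, p, hp⟩ := ih
    exact ⟨hv, p, p, hp, hp, EffectAlgebra.le_refl p⟩
  | le_trans _ _ ih₁ ih₂ =>
    obtain ⟨hv, p, q, hp, hq, h⟩ := ih₁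
    obtain ⟨-, q', r, hq', hr, h'⟩ := ih₂
    obtain rfl := hq.unique_eff hv.toScope hq'
    exact ⟨hv, p, r, hp, hr, EffectAlgebra.le_trans h h'⟩
  | zero_le _ ih =>
    obtain ⟨hv, p, hp⟩ := ih
    exact ⟨hv, 0, p, .zero hp.nodup, hp, EffectAlgebra.zero_le p⟩
  | orth_antitone _ ih =>
    obtain ⟨hv, p, q, hp, hq, h⟩ := ih
    exact ⟨hv, _, _, .orth hq, .orth hp, EffectAlgebra.orth_le_orth h⟩
  | orth_orth _ ih =>
    obtain ⟨hv, p, hp⟩ := ih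
    exact ⟨hv, p, p, hp, (Triangle.Den.orth (.orth hp)).of_eff (EffectAlgebra.orth_orth p),
      EffectAlgebra.le_refl p⟩
  | le_ovee _ ih =>
    obtain ⟨p, q, s, hp, hq, hs⟩ := ih.2.of_perp
    exact ⟨ih.1, p, s, hp, .ovee hp hq hs, q, hs⟩
  | ovee_mono _ _ ih₁ ih₂ => exact ⟨ih₁.1, .ovee_mono ih₁.1.toScope ih₁.2 ih₂.2⟩
  | ovee_comm _ ih => exact ⟨ih.1, .ovee_comm ih.2⟩
  | perp_rotate _ ih => exact ⟨ih.1, .perp_rotate ih.2⟩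
  | ovee_assoc _ ih => exact ⟨ih.1, .ovee_assoc ih.2⟩
  | ovee_zero _ ih => exact ⟨ih.1, .ovee_zero ih.2⟩
  | ortho₁ _ ih => exact ⟨ih.1, .ortho₁ ih.2⟩
  | ortho₂ _ ih => exact ⟨ih.1, .ortho₂ ih.2⟩
  | dist_left_perp _ _ ih₁ ih₂ => exact ⟨ih₂.1, .dist_left_perp ih₁.2 ih₂.2⟩
  | dist_left _ _ hJ ih₁ ih₂ => exact ⟨ih₂.1, .dist_left ih₁.2 ih₂.2 hJ⟩
  | dist_right_perp _ _ ih₁ ih₂ => exact ⟨ih₂.1, .dist_right_perp ih₁.2 ih₂.2⟩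
  | dist_right _ _ hJ ih₁ ih₂ => exact ⟨ih₂.1, .dist_right ih₁.2 ih₂.2 hJ⟩
  | unit_left _ hJ ih => exact ⟨ih.1, .unit_left ih.2 hJ⟩
  | unit_right hv _ hJ ih => exact ⟨hv, .unit_right hv.toScope ih.2 hJ⟩
  | assoc _ _ _ hJ ih₁ ih₂ ih₃ => exact ⟨ih₃.1, .mul_assoc ih₁.2 ih₂.2 ih₃.2 hJ⟩
  | comm _ _ hJ ih₁ ih₂ => exact ⟨ih₁.1, .mul_comm ih₁.2 ih₂.2 hJ⟩
  | case_cong hv _ _ _ hJ ih₁ ih₂ ih₃ =>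
    exact ⟨hv, .case_cong (Ctx.split_append hv).2 ih₁.1.toScope ih₂.1.toScope ih₁.2 ih₂.2 ih₃.2 hJ⟩
  | case_mono hv _ _ _ ih₁ ih₂ ih₃ =>
    exact ⟨hv, .case_mono (Ctx.split_append hv).2 ih₁.1.toScope ih₂.1.toScope ih₁.2 ih₂.2 ih₃.2⟩
  | beta_inl_eff hv _ _ _ hJ ih₁ ih₂ ih₃ =>
    exact ⟨hv, .beta_inl_eff hv.toScope (Ctx.split_append hv).2 ih₁.1.toScope ih₂.1.toScope
      ih₁.2 ih₂.2 ih₃.2 hJ⟩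
  | beta_inr_eff hv _ _ _ hJ ih₁ ih₂ ih₃ =>
    exact ⟨hv, .beta_inr_eff hv.toScope (Ctx.split_append hv).2 ih₁.1.toScope ih₂.1.toScope
      ih₁.2 ih₂.2 ih₃.2 hJ⟩
  | eta_sum_eff hx hy _ hJ ih =>
    exact ⟨hx.tail, .eta_sum_eff hx.toScope hy.toScope ih.2 hJ⟩
  | case_ovee hv _ _ _ hJ ih₁ ih₂ ih₃ =>
    exact ⟨hv, .case_ovee (Ctx.split_append hv).2 ih₁.1.toScope ih₂.1.toScope ih₁.2 ih₂.2 ih₃.2 hJ⟩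
  | case_orth hv _ _ _ hJ ih₁ ih₂ ih₃ =>
    exact ⟨hv, .case_orth (Ctx.split_append hv).2 ih₁.1.toScope ih₂.1.toScope ih₁.2 ih₂.2 ih₃.2 hJ⟩
  | case_le hv hx hy _ _ _ ih₁ ih₂ ih₃ =>
    exact ⟨hv, .case_le hv.toScope (Ctx.split_append hv).1 ih₂.1.toScope ih₃.1.toScope hx hy
      ih₁.2 ih₂.2 ih₃.2⟩
  | case_mul hv _ _ _ _ hJ ih₁ ih₂ ih₃ ih₄ =>
    exact ⟨hv, .case_mul (Ctx.split_append hv).2 ih₁.1.toScope ih₂.1.toScope ih₁.2 ih₂.2 ih₃.2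
      ih₄.2 hJ⟩

end Soundness

end QPEL

namespace QPEL

/-! ## Comparison with the interpretation over contexts -/

section Comparison

variable {V : Type u} [Category.{v} V] [MonoidalCategory V] [SymmetricCategory V]
  [HasBinaryCoproducts V] [IsMonoidalDistrib V] {E : Type w} [CommEffectMonoid E]
  {T : Triangle V E}

variable (V) in
/-- The interpretations of a context and of its scope are isomorphic. -/
noncomputable def Ctx.objIso : (Γ : Ctx) → (Γ.obj V ≅ Scope.obj V Γ.toScope)
  | .nil => Iso.refl _
  | .ext Γ _ A => whiskerRightIso Γ.objIso (A.obj V)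

theorem Ctx.objIso_split {Γ Δ : Ctx} (k : Split (Γ ++ Δ).toScope Γ.toScope Δ.toScope) :
    (Ctx.objIso V (Γ ++ Δ)).hom ≫ T.str₂ k =
      (Ctx.split V Γ Δ).hom ≫ ((Ctx.objIso V Γ).hom ⊗ₘ (Ctx.objIso V Δ).hom) := by
  induction Δ with
  | nil =>
    have h : Sub Γ.toScope Γ.toScope := k
    have hk : T.str₂ k = (ρ_ (Scope.obj V Γ.toScope)).inv :=
      (T.str₂_nil_right k h).trans
        ((congrArg (· ≫ (ρ_ (Scope.obj V Γ.toScope)).inv) (T.str_self h)).trans (Category.id_comp _))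
    have e : ∀ {X Y : V} (f : X ⟶ Y), f ≫ (ρ_ Y).inv = (ρ_ X).inv ≫ (f ⊗ₘ 𝟙 (𝟙_ V)) := fun f => by
      rw [tensorHom_id, rightUnitor_inv_naturality]
    exact (congrArg ((Ctx.objIso V Γ).hom ≫ ·) hk).trans (e _)
  | ext Δ x A ih =>
    have k' : Split (Γ ++ Δ).toScope Γ.toScope Δ.toScope := by
      have : ((Key.free x, A) :: (Γ ++ Δ).toScope).Nodup := k.1
      have hk : Sub (((Key.free x, A) :: Δ.toScope) ++ Γ.toScope)
        ((Key.free x, A) :: (Γ ++ Δ).toScope) := k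
      have := Ctx.toScope_append Γ Δ
      grind
    have e : ∀ {X Y X₁ Y₁ X₂ Y₂ : V} {h : X ⟶ Y} {t : Y ⟶ Y₁ ⊗ Y₂} {s : X ⟶ X₁ ⊗ X₂}
        {h₁ : X₁ ⟶ Y₁} {h₂ : X₂ ⟶ Y₂} (_ : h ≫ t = s ≫ (h₁ ⊗ₘ h₂)) (A : V),
        h ▷ A ≫ t ▷ A ≫ (α_ _ _ _).hom = (s ▷ A ≫ (α_ _ _ _).hom) ≫ (h₁ ⊗ₘ h₂ ▷ A) := by
      intro X Y X₁ Y₁ X₂ Y₂ h t s h₁ h₂ hc A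
      rw [← comp_whiskerRight_assoc, hc, comp_whiskerRight_assoc, Category.assoc,
        ← tensorHom_id (h₁ ⊗ₘ h₂), associator_naturality, tensorHom_id]
    refine (congrArg ((Ctx.objIso V (Γ ++ Δ)).hom ▷ A.obj V ≫ ·)
      (T.str₂_cons_right k k')).trans ?_
    exact e (ih k') (A.obj V)

theorem Triangle.str_swap {Γ : Scope} {a b : Key × Ty} (k : Sub (b :: a :: Γ) (a :: b :: Γ)) :
    T.str k = swapRight _ _ _ := by
  rw [← (Str.cons (.there .here) (Str.refl (T := T) (a :: Γ))).eq k]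
  simp

theorem Ctx.objIso_swap {Γ Δ : Ctx} {x y : ℕ} {A B : Ty}
    (k : Sub ((Γ.ext x A).ext y B ++ Δ).toScope ((Γ.ext y B).ext x A ++ Δ).toScope) :
    (Ctx.swap V Γ x y A B Δ).hom ≫ (Ctx.objIso V ((Γ.ext x A).ext y B ++ Δ)).hom =
      (Ctx.objIso V ((Γ.ext y B).ext x A ++ Δ)).hom ≫ T.str k := by
  induction Δ with
  | nil =>
    have e : ∀ {X Y : V} (f : X ⟶ Y) (A B : V),
        ((α_ X B A).hom ≫ X ◁ (β_ B A).hom ≫ (α_ X A B).inv) ≫ f ▷ A ▷ B =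
          f ▷ B ▷ A ≫ swapRight Y B A := fun f A B =>
      (swapRight_whisker_left f B A).symm
    have hk : T.str k = swapRight _ _ _ := T.str_swap (a := (.free x, A)) (b := (.free y, B)) k
    rw [hk]
    exact e (Ctx.objIso V Γ).hom (A.obj V) (B.obj V)
  | ext Δ z C ih =>
    have k' : Sub ((Γ.ext x A).ext y B ++ Δ).toScope ((Γ.ext y B).ext x A ++ Δ).toScope := by
      have h₁ : ((Key.free z, C) :: ((Γ.ext x A).ext y B ++ Δ).toScope).Nodup := k.2.1
      have h₂ : ((Key.free z, C) :: ((Γ.ext y B).ext x A ++ Δ).toScope).Nodup := k.1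
      have hk : ((Key.free z, C) :: ((Γ.ext x A).ext y B ++ Δ).toScope) ⊆
        ((Key.free z, C) :: ((Γ.ext y B).ext x A ++ Δ).toScope) := k.2.2
      grind
    refine Eq.trans ?_ (congrArg ((Ctx.objIso V ((Γ.ext y B).ext x A ++ Δ)).hom ▷ C.obj V ≫ ·)
      (T.str_cons k k')).symm
    exact (comp_whiskerRight _ _ _).symm.trans
      ((congrArg (· ▷ C.obj V) (ih k')).trans (comp_whiskerRight _ _ _))

theorem Ctx.objIso_proj {Γ : Ctx} {x : ℕ} {A : Ty} (h : Γ.Has x A)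
    (k : Sub [(.free x, A)] Γ.toScope) :
    T.proj h = (Ctx.objIso V Γ).hom ≫ T.str k ≫ (λ_ (A.obj V)).hom := by
  induction h with
  | @here Γ x A =>
    have k' : Sub [] Γ.toScope := by
      have hk : ((Key.free x, A) :: Γ.toScope).Nodup := k.1
      grind
    have : T.str k = T.str k' ▷ A.obj V := T.str_cons k k'
    rw [this, T.str_nil]
    refine Eq.trans ?_ (Category.assoc _ _ _)
    refine congrArg (· ≫ (λ_ (A.obj V)).hom) ?_
    refine Eq.trans ?_ (comp_whiskerRight _ _ _)
    exact congrArg (· ▷ A.obj V) (T.bang_unique _ _)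
  | @there Γ x y A B h ih =>
    have hk : ((Key.free y, B) :: Γ.toScope).Nodup := k.1
    have k₁ : Sub Γ.toScope ((Key.free y, B) :: Γ.toScope) := by grind
    have k₂ := h.sub_toScope (List.nodup_cons.1 hk).2
    have e := T.str_comp k₁ k₂ k
    rw [T.str_tail] at e
    have aux : ∀ {X Y Z : V} (f : X ⟶ Y) (b : B.obj V ⟶ 𝟙_ V) (g : Y ⟶ Z),
        X ◁ b ≫ (ρ_ X).hom ≫ f ≫ g = f ▷ B.obj V ≫ ((Y ◁ b ≫ (ρ_ Y).hom) ≫ g) := by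
      intro X Y Z f b g
      rw [Category.assoc, ← whisker_exchange_assoc, rightUnitor_naturality_assoc]
    refine (congrArg (fun t => Γ.obj V ◁ T.bang (B.obj V) ≫ (ρ_ _).hom ≫ t) (ih k₂)).trans ?_
    refine (aux _ _ _).trans ?_
    refine congrArg ((Ctx.objIso V Γ).hom ▷ B.obj V ≫ ·) ?_
    refine (Category.assoc _ _ _).symm.trans ?_
    exact congrArg (· ≫ (λ_ (A.obj V)).hom) e

theorem Ctx.objIso_split_braid {Γ Δ : Ctx} (h : (Γ ++ Δ).Valid) :
    (Ctx.objIso V (Γ ++ Δ)).hom ≫ T.str₂ (Ctx.split_append h).1 =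
      ((Ctx.split V Γ Δ).hom ≫ (β_ _ _).hom) ≫
        ((Ctx.objIso V Δ).hom ⊗ₘ (Ctx.objIso V Γ).hom) := by
  rw [← T.str₂_braid (Ctx.split_append h).2, reassoc_of% Ctx.objIso_split, Category.assoc,
    BraidedCategory.braiding_naturality]

end Comparison

end QPEL

namespace QPEL

theorem whiskerRight_braiding_assoc {V : Type u} [Category.{v} V] [MonoidalCategory V]
    [SymmetricCategory V] {X Y Z D W : V} (s : X ⟶ Y ⊗ D)
    (f : Y ⟶ Z) (k : D ⊗ Z ⟶ W) :
    s ≫ f ▷ D ≫ (β_ Z D).hom ≫ k = (s ≫ (β_ Y D).hom) ≫ D ◁ f ≫ k := by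
  rw [BraidedCategory.braiding_naturality_left_assoc, Category.assoc]

section FromContexts

variable {V : Type u} [Category.{v} V] [MonoidalCategory V] [SymmetricCategory V]
  [HasBinaryCoproducts V] [IsMonoidalDistrib V] {E : Type w} [CommEffectMonoid E]
  {T : Triangle V E}

variable (T) in
/-- In the context `Γ`, the expression `e` has the value that corresponds to `v`. -/
def Triangle.CtxDen (Γ : Ctx) {s : Kind} (e : Expr s) (v : T.Sem (Γ.obj V) s) : Prop :=
  Γ.Valid ∧ ∃ w, T.Den 0 Γ.toScope e w ∧ v = w.pull (Ctx.objIso V Γ).hom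

namespace Triangle.CtxDen

theorem tm {Γ : Ctx} {M : Tm} {A : Ty} {f : Γ.obj V ⟶ A.obj V} :
    T.CtxDen Γ M (.tm A f) ↔
      Γ.Valid ∧ ∃ g, T.Den 0 Γ.toScope M (.tm A g) ∧ f = (Ctx.objIso V Γ).hom ≫ g :=
  and_congr_right fun _ => Den.exists_tm

theorem eff {Γ : Ctx} {φ : Eff} {p : T.Pred (Γ.obj V)} :
    T.CtxDen Γ φ (.eff p) ↔
      Γ.Valid ∧ ∃ q, T.Den 0 Γ.toScope φ (.eff q) ∧ p = T.pull (Ctx.objIso V Γ).hom q :=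
  and_congr_right fun _ => Den.exists_eff

theorem exch {Γ Δ : Ctx} {x y : ℕ} {A B : Ty} {s : Kind} {e : Expr s}
    {v : T.Sem (((Γ.ext x A).ext y B ++ Δ).obj V) s}
    (h : T.CtxDen ((Γ.ext x A).ext y B ++ Δ) e v) :
    T.CtxDen ((Γ.ext y B).ext x A ++ Δ) e (v.pull (Ctx.swap V Γ x y A B Δ).hom) := by
  obtain ⟨hv, w, hw, rfl⟩ := h
  obtain ⟨hv', k⟩ := Ctx.exch_sub hv
  exact ⟨hv', _, hw.weaken k, by rw [Sem.pull_pull, Sem.pull_pull, Ctx.objIso_swap (T := T) k]⟩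

theorem pair {Γ Δ : Ctx} {M N : Tm} {A B : Ty} {f : Γ.obj V ⟶ A.obj V} {g : Δ.obj V ⟶ B.obj V}
    (hv : (Γ ++ Δ).Valid) (hM : T.CtxDen Γ M (.tm A f)) (hN : T.CtxDen Δ N (.tm B g)) :
    T.CtxDen (Γ ++ Δ) (.pair M N) (.tm (.tensor A B) ((Ctx.split V Γ Δ).hom ≫ (f ⊗ₘ g))) := by
  obtain ⟨-, f', hf, rfl⟩ := tm.1 hM
  obtain ⟨-, g', hg, rfl⟩ := tm.1 hN
  have k := (Ctx.split_append hv).2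
  exact tm.2 ⟨hv, _, .pair k hf hg, reindex_pair (Ctx.objIso_split k) f' g'⟩

theorem letIn {Γ Δ : Ctx} {x y : ℕ} {M N : Tm} {A B C : Ty} {f : Γ.obj V ⟶ A.obj V ⊗ B.obj V}
    {g : (Δ.obj V ⊗ A.obj V) ⊗ B.obj V ⟶ C.obj V}
    (hv : (Γ ++ Δ).Valid) (hM : T.CtxDen Γ M (.tm (.tensor A B) f))
    (hN : T.CtxDen ((Δ.ext x A).ext y B) N (.tm C g)) :
    T.CtxDen (Γ ++ Δ) (.letIn x y M N) (.tm C
      ((Ctx.split V Γ Δ).hom ≫ f ▷ Δ.obj V ≫ (β_ (A.obj V ⊗ B.obj V) (Δ.obj V)).hom ≫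
        (α_ (Δ.obj V) (A.obj V) (B.obj V)).inv ≫ g)) := by
  obtain ⟨-, f', hf, rfl⟩ := tm.1 hM
  obtain ⟨h₂, g', hg, rfl⟩ := tm.1 hN
  have k := (Ctx.split_append hv).1
  refine tm.2 ⟨hv, _, .letIn k h₂.toScope hf hg, ?_⟩
  refine (whiskerRight_braiding_assoc _ _ _).trans ?_
  exact reindex_letE (Ctx.objIso_split_braid hv) f' g'

theorem caseOf {Γ Δ : Ctx} {x y : ℕ} {M N P : Tm} {A B C : Ty} {f : Γ.obj V ⟶ A.obj V ⨿ B.obj V}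
    {g : Δ.obj V ⊗ A.obj V ⟶ C.obj V} {h : Δ.obj V ⊗ B.obj V ⟶ C.obj V}
    (hv : (Γ ++ Δ).Valid) (hM : T.CtxDen Γ M (.tm (.sum A B) f))
    (hN : T.CtxDen (Δ.ext x A) N (.tm C g)) (hP : T.CtxDen (Δ.ext y B) P (.tm C h)) :
    T.CtxDen (Γ ++ Δ) (.caseOf M x N y P) (.tm C
      ((Ctx.split V Γ Δ).hom ≫ f ▷ Δ.obj V ≫ (β_ (A.obj V ⨿ B.obj V) (Δ.obj V)).hom ≫
        (leftDistrib (Δ.obj V) (A.obj V) (B.obj V)).inv ≫ coprod.desc g h)) := by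
  obtain ⟨-, f', hf, rfl⟩ := tm.1 hM
  obtain ⟨h₂, g', hg, rfl⟩ := tm.1 hN
  obtain ⟨h₃, k', hk, rfl⟩ := tm.1 hP
  have k := (Ctx.split_append hv).1
  refine tm.2 ⟨hv, _, .caseOf k h₂.toScope h₃.toScope hf hg hk, ?_⟩
  refine (whiskerRight_braiding_assoc _ _ _).trans ?_
  exact reindex_case (Ctx.objIso_split_braid hv) f' g' k'

theorem measure {Γ Δ : Ctx} {n : ℕ} {φ : Fin (n + 1) → Eff} {M : Fin (n + 1) → Tm} {A : Ty}
    {p : Fin (n + 1) → T.Pred (Γ.obj V)} {f : Fin (n + 1) → (Δ.obj V ⟶ A.obj V)}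
    (hv : (Γ ++ Δ).Valid) (hφ : ∀ i, T.CtxDen Γ (φ i) (.eff (p i))) (hp : IsTest p)
    (hM : ∀ i, T.CtxDen Δ (M i) (.tm A (f i))) :
    T.CtxDen (Γ ++ Δ) (.measure φ M) (.tm A
      ((Ctx.split V Γ Δ).hom ≫ T.meas p hp ▷ Δ.obj V ≫ (β_ (copower V n) (Δ.obj V)).hom ≫
        copower.branch n f)) := by
  choose p' hp' he using fun i => (eff.1 (hφ i)).2
  choose f' hf' hf using fun i => (tm.1 (hM i)).2
  obtain rfl := funext he
  obtain rfl := funext hf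
  have k := (Ctx.split_append hv).1
  have ht : IsTest p' := by
    have := T.pull_isTest (Ctx.objIso V Γ).inv hp
    simpa only [← T.pull_comp, Iso.inv_hom_id, T.pull_id] using this
  refine tm.2 ⟨hv, _, .measure k hp' ht hf', ?_⟩
  refine (whiskerRight_braiding_assoc _ _ _).trans ?_
  exact T.reindex_measure (Ctx.objIso_split_braid hv) ht hp f'

theorem caseEff {Γ Δ : Ctx} {x y : ℕ} {φ ψ : Eff} {M : Tm} {A B : Ty}
    {p : T.Pred (Γ.obj V ⊗ A.obj V)} {q : T.Pred (Γ.obj V ⊗ B.obj V)}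
    {f : Δ.obj V ⟶ A.obj V ⨿ B.obj V} (hv : (Γ ++ Δ).Valid)
    (hφ : T.CtxDen (Γ.ext x A) φ (.eff p)) (hψ : T.CtxDen (Γ.ext y B) ψ (.eff q))
    (hM : T.CtxDen Δ M (.tm (.sum A B) f)) :
    T.CtxDen (Γ ++ Δ) (.caseEff M x φ y ψ)
      (.eff (T.pull ((Ctx.split V Γ Δ).hom ≫ Γ.obj V ◁ f) (T.copair p q))) := by
  obtain ⟨-, f', hf, rfl⟩ := tm.1 hM
  obtain ⟨h₂, p', hp, rfl⟩ := eff.1 hφ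
  obtain ⟨h₃, q', hq, rfl⟩ := eff.1 hψ
  have k := (Ctx.split_append hv).2
  refine eff.2 ⟨hv, _, .caseEff k h₂.toScope h₃.toScope hf hp hq, ?_⟩
  exact T.reindex_copair (Ctx.objIso_split k) f' p' q'

theorem ovee {Γ : Ctx} {φ ψ : Eff} {p q r : T.Pred (Γ.obj V)} (hφ : T.CtxDen Γ φ (.eff p))
    (hψ : T.CtxDen Γ ψ (.eff q)) (hr : PartialCommMonoid.ovee p q = some r) :
    T.CtxDen Γ (.ovee φ ψ) (.eff r) := by
  obtain ⟨hv, p', hp, rfl⟩ := eff.1 hφ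
  obtain ⟨-, q', hq, rfl⟩ := eff.1 hψ
  refine eff.2 ⟨hv, T.pull (Ctx.objIso V Γ).inv r, .ovee hp hq ?_, ?_⟩
  · have := T.pull_ovee (Ctx.objIso V Γ).inv hr
    simpa only [← T.pull_comp, Iso.inv_hom_id, T.pull_id] using this
  · rw [← T.pull_comp, Iso.hom_inv_id, T.pull_id]

theorem mul {Γ : Ctx} {φ ψ : Eff} {p : T.Pred (𝟙_ V)} {q : T.Pred (Γ.obj V)}
    (hφ : T.CtxDen .nil φ (.eff p)) (hψ : T.CtxDen Γ ψ (.eff q)) :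
    T.CtxDen Γ (.mul φ ψ) (.eff (T.scalar p • q)) := by
  obtain ⟨-, p', hp, e⟩ := eff.1 hφ
  obtain ⟨hv, q', hq, rfl⟩ := eff.1 hψ
  obtain rfl : p = p' := e.trans (T.pull_id p')
  exact eff.2 ⟨hv, _, .mul hp hq, (T.pull_smul _ _ _).symm⟩

end Triangle.CtxDen

mutual

theorem Triangle.TmDen.ctxDen {Γ : Ctx} {M : Tm} {A : Ty} {f : Γ.obj V ⟶ A.obj V} :
    T.TmDen Γ M A f → T.CtxDen Γ M (.tm A f)
  | .exch h => h.ctxDen.exch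
  | .var hΓ h => Triangle.CtxDen.tm.2 ⟨hΓ, _, .fvar (h.sub_toScope hΓ.toScope.1),
      Ctx.objIso_proj h _⟩
  | .pair hv h₁ h₂ => .pair hv h₁.ctxDen h₂.ctxDen
  | .letIn hv h₁ h₂ => .letIn hv h₁.ctxDen h₂.ctxDen
  | .unit hv => Triangle.CtxDen.tm.2 ⟨hv, _, .unit hv.toScope.1, T.bang_unique _ _⟩
  | .inl h =>
    have ⟨hv, _, hf, e⟩ := Triangle.CtxDen.tm.1 h.ctxDen
    Triangle.CtxDen.tm.2 ⟨hv, _, .inl hf, e ▸ Category.assoc _ _ _⟩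
  | .inr h =>
    have ⟨hv, _, hf, e⟩ := Triangle.CtxDen.tm.1 h.ctxDen
    Triangle.CtxDen.tm.2 ⟨hv, _, .inr hf, e ▸ Category.assoc _ _ _⟩
  | .caseOf hv h₁ h₂ h₃ => .caseOf hv h₁.ctxDen h₂.ctxDen h₃.ctxDen
  | .measure hv h₁ hp h₂ => .measure hv (fun i => (h₁ i).ctxDen) hp fun i => (h₂ i).ctxDen

theorem Triangle.EffDen.ctxDen {Γ : Ctx} {φ : Eff} {p : T.Pred (Γ.obj V)} :
    T.EffDen Γ φ p → T.CtxDen Γ φ (.eff p)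
  | .exch h => h.ctxDen.exch
  | .zero hv => Triangle.CtxDen.eff.2 ⟨hv, _, .zero hv.toScope.1, (T.pull_zero _).symm⟩
  | .orth h =>
    have ⟨hv, _, hf, e⟩ := Triangle.CtxDen.eff.1 h.ctxDen
    Triangle.CtxDen.eff.2 ⟨hv, _, .orth hf, e ▸ (T.pull_orth _ _).symm⟩
  | .ovee h₁ h₂ hs => .ovee h₁.ctxDen h₂.ctxDen hs
  | .mul h₁ h₂ => .mul h₁.ctxDen h₂.ctxDen
  | .caseEff hv h₁ h₂ h₃ hp hq => T.eq_copair hp hq ▸ .caseEff hv h₁.ctxDen h₂.ctxDen h₃.ctxDen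

end

end FromContexts

end QPEL

namespace QPEL

namespace Expr

/-- Names for the dangling indices of an expression, read under one further binder. -/
def push (x : ℕ) (f : ℕ → ℕ) : ℕ → ℕ
  | 0 => x
  | i + 1 => f i

/-- Turn the bound variables whose index at the top level is `i + d` into free variables `f i`. -/
def opn (f : ℕ → ℕ) : ℕ → {s : Kind} → Expr s → Expr s
  | d, _, bvar i => if i < d then bvar i else fvar (f (i - d))
  | _, _, fvar y => fvar y
  | d, _, pair M N => pair (opn f d M) (opn f d N)
  | d, _, letE M N => letE (opn f d M) (opn f (d + 2) N)
  | _, _, unit => unit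
  | d, _, inl M => inl (opn f d M)
  | d, _, inr M => inr (opn f d M)
  | d, _, caseT M N P => caseT (opn f d M) (opn f (d + 1) N) (opn f (d + 1) P)
  | d, _, measure φ M => measure (fun i => opn f d (φ i)) (fun i => opn f d (M i))
  | _, _, zero => zero
  | d, _, ovee φ ψ => ovee (opn f d φ) (opn f d ψ)
  | d, _, orth φ => orth (opn f d φ)
  | d, _, mul φ ψ => mul (opn f d φ) (opn f d ψ)
  | d, _, caseE M φ ψ => caseE (opn f d M) (opn f (d + 1) φ) (opn f (d + 1) ψ)

theorem close_opn {x : ℕ} {f : ℕ → ℕ} (hf : ∀ i, f i ≠ x) {s : Kind} {e : Expr s}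
    (he : ¬ e.Occurs x) (d : ℕ) : close x d (opn (push x f) d e) = opn f (d + 1) e := by
  induction e generalizing d with
  | bvar i =>
    rcases lt_trichotomy i d with h | rfl | h
    · simp [opn, close, h, Nat.lt_succ_of_lt h]
    · simp [opn, close, push]
    · obtain ⟨j, rfl⟩ : ∃ j, i = d + 1 + j := ⟨i - (d + 1), by omega⟩
      have h₁ : ¬ d + 1 + j < d := by omega
      simp [opn, close, push, hf, h₁, show d + 1 + j - d = j + 1 by omega]
      exact h
  | _ => simp_all [opn, close, Occurs]

theorem close_close {x y : ℕ} (h : x ≠ y) {s : Kind} (e : Expr s) (k l : ℕ) :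
    close y k (close x l e) = close x l (close y k e) := by
  induction e generalizing k l with
  | fvar z => grind [close]
  | _ => simp_all [close]

theorem exists_fresh {s : Kind} (e : Expr s) : ∃ k, ∀ x ≥ k, ¬ e.Occurs x := by
  induction e with
  | fvar y => exact ⟨y + 1, fun x hx h => by simp only [Occurs] at h; omega⟩
  | measure φ M ih₁ ih₂ =>
    choose k hk using ih₁
    choose l hl using ih₂
    refine ⟨Finset.univ.sup k ⊔ Finset.univ.sup l, fun x hx => ?_⟩
    rintro (⟨i, h⟩ | ⟨i, h⟩)
    · exact hk i x ((Finset.le_sup (Finset.mem_univ i)).trans (le_sup_left.trans hx)) h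
    · exact hl i x ((Finset.le_sup (Finset.mem_univ i)).trans (le_sup_right.trans hx)) h
  | bvar | unit | zero => exact ⟨0, fun _ _ h => h⟩
  | inl _ ih | inr _ ih | orth _ ih => exact ih
  | pair _ _ ih₁ ih₂ | letE _ _ ih₁ ih₂ | ovee _ _ ih₁ ih₂ | mul _ _ ih₁ ih₂ =>
    obtain ⟨k, hk⟩ := ih₁
    obtain ⟨l, hl⟩ := ih₂
    exact ⟨k ⊔ l, fun x hx h => h.elim (hk x (le_sup_left.trans hx)) (hl x (le_sup_right.trans hx))⟩
  | caseT _ _ _ ih₁ ih₂ ih₃ | caseE _ _ _ ih₁ ih₂ ih₃ =>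
    obtain ⟨k, hk⟩ := ih₁
    obtain ⟨l, hl⟩ := ih₂
    obtain ⟨m, hm⟩ := ih₃
    refine ⟨k ⊔ l ⊔ m, fun x hx h => ?_⟩
    simp only [ge_iff_le, sup_le_iff] at hx
    exact h.elim (hk x hx.1.1) (·.elim (hl x hx.1.2) (hm x hx.2))

end Expr

theorem Traversal.opn (f : ℕ → ℕ) : Traversal fun d _ e => Expr.opn f d e where
  bvar h := by simp [Expr.opn, h]
  pair _ _ _ := rfl
  letE _ _ _ := rfl
  unit _ := rfl
  inl _ _ := rfl
  inr _ _ := rfl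
  caseT _ _ _ _ := rfl
  measure _ _ _ _ := rfl
  zero _ := rfl
  ovee _ _ _ := rfl
  orth _ _ := rfl
  mul _ _ _ := rfl
  caseE _ _ _ _ := rfl

/-- Declarations under `n` binders, with names for the bound variables. -/
def Key.opn (f : ℕ → ℕ) (n : ℕ) : Key × Ty → Key × Ty
  | (.free x, A) => (.free x, A)
  | (.level j, A) => (.free (f (n - 1 - j)), A)

/-! ### Contexts up to exchange -/

namespace Ctx

/-- Contexts that differ by exchange. -/
inductive Perm : Ctx → Ctx → Prop
  | refl (Γ : Ctx) : Perm Γ Γ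
  | ext {Γ Γ' : Ctx} (x : ℕ) (A : Ty) : Perm Γ Γ' → Perm (Γ.ext x A) (Γ'.ext x A)
  | swap (Γ : Ctx) (x y : ℕ) (A B : Ty) : Perm ((Γ.ext x A).ext y B) ((Γ.ext y B).ext x A)
  | trans {Γ Γ' Γ'' : Ctx} : Perm Γ Γ' → Perm Γ' Γ'' → Perm Γ Γ''

theorem append_assoc (Γ Δ Θ : Ctx) : Γ ++ Δ ++ Θ = Γ ++ (Δ ++ Θ) := by
  induction Θ with
  | nil => rfl
  | ext Θ x A ih => exact congrArg (Ctx.ext · x A) ih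

theorem Perm.names {Γ Γ' : Ctx} (h : Perm Γ Γ') : Γ.names.Perm Γ'.names := by
  induction h with
  | refl => exact .refl _
  | ext x A _ ih => exact ih.cons x
  | swap Γ x y A B => exact .swap _ _ _
  | trans _ _ ih₁ ih₂ => exact ih₁.trans ih₂

theorem Perm.induction {Q : Ctx → Prop}
    (hQ : ∀ {Γ Δ : Ctx} {x y : ℕ} {A B : Ty}, Q ((Γ.ext x A).ext y B ++ Δ) →
      Q ((Γ.ext y B).ext x A ++ Δ))
    {Γ Γ' : Ctx} (h : Perm Γ Γ') (Δ : Ctx) : Q (Γ ++ Δ) → Q (Γ' ++ Δ) := by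
  induction h generalizing Δ with
  | refl => exact id
  | @ext Γ Γ' x A _ ih =>
    have := ih (Ctx.nil.ext x A ++ Δ)
    rwa [← append_assoc, ← append_assoc] at this
  | swap Γ x y A B => exact hQ
  | trans _ _ ih₁ ih₂ => exact ih₂ Δ ∘ ih₁ Δ

theorem perm_ext_append (Γ Δ : Ctx) (x : ℕ) (A : Ty) :
    Perm (Γ.ext x A ++ Δ) ((Γ ++ Δ).ext x A) := by
  induction Δ with
  | nil => exact .refl _
  | ext Δ y B ih => exact (ih.ext y B).trans (.swap _ _ _ _ _)

theorem exists_perm_append (Γ : Ctx) (P : Key × Ty → Prop) :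
    ∃ Γ₁ Γ₂, Perm (Γ₁ ++ Γ₂) Γ ∧ (∀ a ∈ Γ.toScope, ¬ P a → a ∈ Γ₁.toScope) ∧
      ∀ a ∈ Γ.toScope, P a → a ∈ Γ₂.toScope := by
  induction Γ with
  | nil => exact ⟨.nil, .nil, .refl _, fun _ h _ => h, fun _ h _ => h⟩
  | ext Γ x A ih =>
    obtain ⟨Γ₁, Γ₂, h, h₁, h₂⟩ := ih
    by_cases hP : P (.free x, A)
    · refine ⟨Γ₁, Γ₂.ext x A, h.ext x A, ?_, ?_⟩ <;> grind [toScope]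
    · refine ⟨Γ₁.ext x A, Γ₂, (perm_ext_append _ _ _ _).trans (h.ext x A), ?_, ?_⟩ <;>
        grind [toScope]

theorem exists_split {Γ : Ctx} (hΓ : Γ.Valid) {Ξ A B : Scope} (h : Split Ξ A B)
    {r : Key × Ty → Key × Ty} (k : Sub (Ξ.map r) Γ.toScope) :
    ∃ Γ₁ Γ₂, (Γ₁ ++ Γ₂).Valid ∧ Perm (Γ₁ ++ Γ₂) Γ ∧ Sub (A.map r) Γ₁.toScope ∧
      Sub (B.map r) Γ₂.toScope := by
  obtain ⟨Γ₁, Γ₂, hp, h₁, h₂⟩ := Γ.exists_perm_append (· ∈ B.map r)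
  have hv : (Γ₁ ++ Γ₂).Valid := hp.names.nodup_iff.2 hΓ
  have hs := Ctx.split_append hv
  have hr := List.inj_on_of_nodup_map k.2.1
  refine ⟨Γ₁, Γ₂, hv, hp, ⟨by grind, .map_on ?_ (by grind), ?_⟩, ⟨by grind, .map_on ?_ (by grind), ?_⟩⟩
  · exact fun a ha b hb => hr (by grind) (by grind)
  · intro a ha
    obtain ⟨b, hb, rfl⟩ := List.mem_map.1 ha
    refine h₁ _ (k.2.2 (List.mem_map_of_mem (by grind))) fun hc => ?_
    obtain ⟨c, hc, e⟩ := List.mem_map.1 hc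
    have : c = b := hr (by grind) (by grind) e
    grind
  · exact fun a ha b hb => hr (by grind) (by grind)
  · intro a ha
    obtain ⟨b, hb, rfl⟩ := List.mem_map.1 ha
    exact h₂ _ (k.2.2 (List.mem_map_of_mem (by grind))) ha

theorem exists_fresh (Γ : Ctx) : ∃ k, ∀ x ≥ k, x ∉ Γ.names :=
  ⟨Γ.names.sum + 1, fun x hx h => by
    have := List.le_sum_of_mem h
    omega⟩

end Ctx

end QPEL

namespace QPEL

section Existence

variable {V : Type u} [Category.{v} V] [MonoidalCategory V] [SymmetricCategory V]
  [HasBinaryCoproducts V] [IsMonoidalDistrib V] {E : Type w} [CommEffectMonoid E]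
  {T : Triangle V E}

variable (T) in
theorem Traversal.exists_substMap_opn {f : ℕ → ℕ} {n : ℕ} {Ξ : Scope} (hΞ : Ξ.Bounded n)
    (h : (Ξ.map (Key.opn f n)).Nodup) :
    ∃ k, SubstMap T (VarDen T (fun d _ e => Expr.opn f d e) n 0 0) (Ξ.map (Key.opn f n)) Ξ k := by
  induction Ξ with
  | nil => exact ⟨_, .nil List.nodup_nil⟩
  | cons a Ξ ih =>
    obtain ⟨k, hk⟩ := ih (by grind) (List.nodup_cons.1 h).2
    obtain ⟨x | j, A⟩ := a
    · exact ⟨_, hk.lift (y := .free x) (B := A) (List.nodup_cons.1 h).1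
        ((Category.comp_id (λ_ (A.obj V)).hom).symm ▸ varDen_free A fun _ => rfl)⟩
    · refine ⟨_, hk.lift (y := .free (f (n - 1 - j))) (B := A) (s := 𝟙 _) (List.nodup_cons.1 h).1
        ((Category.comp_id (λ_ (A.obj V)).hom).symm ▸ fun d _ => ?_)⟩
      have hj : j < n := hΞ j A List.mem_cons_self
      have h₁ : ¬ n + d - 1 - j < d := by omega
      have h₂ : n + d - 1 - j - d = n - 1 - j := by omega
      have hs : Sub [(Key.free (f (n - 1 - j)), A)] [(.free (f (n - 1 - j)), A)] := by grind
      simp only [Key.var, Expr.opn, h₁, h₂, if_false]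
      exact (Triangle.Den.fvar hs).of_tm (by rw [T.str_self, Category.id_comp])

variable (T) in
theorem Triangle.exists_den_opn {f : ℕ → ℕ} {n : ℕ} {Ξ Θ : Scope} (hΞ : Ξ.Bounded n)
    (hΘ : Θ.WF 0) (h : Sub (Ξ.map (Key.opn f n)) Θ) :
    ∃ k : Scope.obj V Θ ⟶ Scope.obj V Ξ, ∀ {s : Kind} {e : Expr s} {v : T.Sem (Scope.obj V Ξ) s},
      T.Den n Ξ e v → T.Den 0 Θ (e.opn f 0) (v.pull k) := by
  obtain ⟨k, hk⟩ := Traversal.exists_substMap_opn T hΞ h.2.1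
  exact ⟨_, fun he => (Traversal.opn f).den (n := n) (m := 0) (d := 0) he rfl (hk.weaken h)
    hΘ.2.2⟩

theorem Triangle.EffDen.opn_eq {f : ℕ → ℕ} {n : ℕ} {Ξ : Scope} {Γ : Ctx} (hΞ : Ξ.Bounded n)
    (hΓ : Γ.Valid) (h : Sub (Ξ.map (Key.opn f n)) Γ.toScope) :
    ∃ k : Γ.obj V ⟶ Scope.obj V Ξ, ∀ {φ : Eff} {p : T.Pred (Scope.obj V Ξ)} {q : T.Pred (Γ.obj V)},
      T.EffDen Γ (φ.opn f 0) q → T.Den n Ξ φ (.eff p) → q = T.pull k p := by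
  obtain ⟨k, hk⟩ := T.exists_den_opn hΞ hΓ.toScope h
  refine ⟨(Ctx.objIso V Γ).hom ≫ k, fun hq hp => ?_⟩
  obtain ⟨-, q', hq', rfl⟩ := CtxDen.eff.1 hq.ctxDen
  rw [T.pull_comp, hq'.unique_eff hΓ.toScope (hk hp)]

theorem Triangle.Den.opn_self {f : ℕ → ℕ} {n : ℕ} {Ξ : Scope} {s : Kind} {e : Expr s}
    {v : T.Sem (Scope.obj V Ξ) s} (h : T.Den n Ξ e v) : e.opn f n = e := by
  induction h with
  | bvar hi _ => simp [Expr.opn, hi]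
  | _ => simp_all [Expr.opn]

variable (T) in
/-- The expression `e` is interpreted in the context `Γ`; terms have the type of the value `v`. -/
def Triangle.Interpretable (Γ : Ctx) {X : V} : {s : Kind} → Expr s → T.Sem X s → Prop
  | _, M, .tm A _ => ∃ g, T.TmDen Γ M A g
  | _, φ, .eff _ => ∃ q, T.EffDen Γ φ q

theorem Triangle.Interpretable.perm {Γ Γ' : Ctx} (h : Ctx.Perm Γ Γ') {X : V} {s : Kind}
    {e : Expr s} {v : T.Sem X s} : T.Interpretable Γ e v → T.Interpretable Γ' e v := by
  refine h.induction (Q := fun Γ => T.Interpretable Γ e v) (fun h => ?_) .nil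
  cases v with
  | tm A f =>
    obtain ⟨g, hg⟩ := h
    exact ⟨_, hg.exch⟩
  | eff p =>
    obtain ⟨q, hq⟩ := h
    exact ⟨_, hq.exch⟩

theorem Scope.map_opn_push {n : ℕ} {Ξ : Scope} (hΞ : Ξ.Bounded n) (f : ℕ → ℕ) (x : ℕ) :
    Ξ.map (Key.opn (Expr.push x f) (n + 1)) = Ξ.map (Key.opn f n) := by
  refine List.map_congr_left fun a ha => ?_
  obtain ⟨x | j, A⟩ := a
  · rfl
  · have hj : j < n := hΞ j A ha
    simp only [Key.opn, show n + 1 - 1 - j = (n - 1 - j) + 1 by omega, Expr.push]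

theorem Scope.sub_opn_push {n : ℕ} {Ξ : Scope} (hΞ : Ξ.Bounded n) {f : ℕ → ℕ} {x : ℕ} {Γ : Ctx}
    (hx : x ∉ Γ.names) (h : Sub (Ξ.map (Key.opn f n)) Γ.toScope) (A : Ty) :
    Sub (List.map (Key.opn (Expr.push x f) (n + 1)) ((.level n, A) :: Ξ)) (Γ.ext x A).toScope := by
  have hA : (Key.free x, A) ∉ Γ.toScope := fun hA => hx (Ctx.mem_names.2 ⟨A, hA⟩)
  rw [List.map_cons, Scope.map_opn_push hΞ]
  simp only [Key.opn, Nat.add_sub_cancel, Nat.sub_self, Expr.push, Ctx.toScope]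
  grind

theorem Ctx.exists_name (Γ : Ctx) {f : ℕ → ℕ} (hf : ∃ l, ∀ i, f i < l) {s : Kind} (e : Expr s) :
    ∃ x, x ∉ Γ.names ∧ (∀ i, f i ≠ x) ∧ ¬ e.Occurs x ∧ ∃ l, ∀ i, Expr.push x f i < l := by
  obtain ⟨k, hk⟩ := Γ.exists_fresh
  obtain ⟨l, hl⟩ := hf
  obtain ⟨m, hm⟩ := e.exists_fresh
  refine ⟨k + l + m, hk _ (by omega), fun i h => ?_, hm _ (by omega), k + l + m + 1, fun i => ?_⟩
  · have := hl i
    omega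
  · cases i with
    | zero => exact Nat.lt_succ_self _
    | succ i =>
      have := hl i
      simp only [Expr.push]
      omega

theorem Ctx.Valid.left {Γ Δ : Ctx} (h : (Γ ++ Δ).Valid) : Γ.Valid := by
  induction Δ with
  | nil => exact h
  | ext Δ x A ih => exact ih h.tail

theorem Ctx.Valid.right {Γ Δ : Ctx} (h : (Γ ++ Δ).Valid) : Δ.Valid := by
  induction Δ with
  | nil => exact List.nodup_nil
  | ext Δ x A ih =>
    refine List.nodup_cons.2 ⟨fun hx => (List.nodup_cons.1 h).1 ?_, ih h.tail⟩
    obtain ⟨B, hB⟩ := Ctx.mem_names.1 hx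
    exact Ctx.mem_names.2 ⟨B, Ctx.toScope_append Γ Δ ▸ List.mem_append_left _ hB⟩

theorem Ctx.sub_map_opn {Γ : Ctx} (hΓ : Γ.Valid) {f : ℕ → ℕ} {n : ℕ} :
    Sub (Γ.toScope.map (Key.opn f n)) Γ.toScope := by
  have h : Γ.toScope.map (Key.opn f n) = Γ.toScope := by
    clear hΓ
    induction Γ with
    | nil => rfl
    | ext Γ x A ih => exact congrArg ((Key.free x, A) :: ·) ih
  have := hΓ.toScope.1
  rw [h]
  grind

/-- An expression that has a value is interpreted in contexts. -/
theorem Triangle.Den.interpretable {n : ℕ} {Ξ : Scope} {s : Kind} {e : Expr s}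
    {v : T.Sem (Scope.obj V Ξ) s} (h : T.Den n Ξ e v) : ∀ {f : ℕ → ℕ} {Γ : Ctx},
      (∃ l, ∀ i, f i < l) → Ξ.Bounded n → Γ.Valid → Sub (Ξ.map (Key.opn f n)) Γ.toScope →
      T.Interpretable Γ (e.opn f 0) v := by
  have hext : ∀ {Γ : Ctx} {x : ℕ} (A : Ty), Γ.Valid → x ∉ Γ.names → (Γ.ext x A).Valid :=
    fun _ h hx => List.nodup_cons.2 ⟨hx, h⟩
  have hhas : ∀ {Γ : Ctx} {x : ℕ} {A : Ty}, (Key.free x, A) ∈ Γ.toScope → Nonempty (Γ.Has x A) := by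
    intro Γ x A h
    induction Γ with
    | nil => cases h
    | ext Γ y B ih =>
      rcases List.mem_cons.1 h with h | h
      · cases h
        exact ⟨.here⟩
      · exact (ih h).map .there
  induction h with
  | @fvar n Ξ x A k =>
    intro f Γ hf hΞ hΓ hs
    obtain ⟨h⟩ := hhas (hs.2.2 (List.mem_map_of_mem (k.2.2 List.mem_cons_self)))
    exact ⟨_, .var hΓ h⟩
  | @bvar n Ξ i A hi k =>
    intro f Γ hf hΞ hΓ hs
    obtain ⟨h⟩ := hhas (hs.2.2 (List.mem_map_of_mem (k.2.2 List.mem_cons_self)))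
    rw [show n - 1 - (n - 1 - i) = i by omega] at h
    exact ⟨_, .var hΓ h⟩
  | @pair n Ξ Ξ₁ Ξ₂ _ _ _ _ _ _ k h₁ h₂ ih₁ ih₂ =>
    intro f Γ hf hΞ hΓ hs
    obtain ⟨Γ₁, Γ₂, hv, hp, hs₁, hs₂⟩ := Ctx.exists_split hΓ k hs
    have := Ctx.split_append hv
    obtain ⟨g₁, hg₁⟩ := ih₁ hf (by grind) (Ctx.Valid.left hv) hs₁
    obtain ⟨g₂, hg₂⟩ := ih₂ hf (by grind) (Ctx.Valid.right hv) hs₂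
    exact Interpretable.perm hp ⟨_, .pair hv hg₁ hg₂⟩
  | @letE n Ξ Δ Γ' M N A B C _ _ k h₁ h₂ ih₁ ih₂ =>
    intro f Γ hf hΞ hΓ hs
    obtain ⟨Γ₁, Γ₂, hv, hp, hs₁, hs₂⟩ := Ctx.exists_split hΓ (A := Γ') (B := Δ) (by grind) hs
    obtain ⟨g₁, hg₁⟩ := ih₁ hf (by grind) (Ctx.Valid.left hv) hs₁
    have hΔ : Δ.Bounded n := by grind
    have hv₂ := Ctx.Valid.right hv
    obtain ⟨x, hx, hfx, hNx, hf'⟩ := Γ₂.exists_name hf N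
    obtain ⟨y, hy, hfy, hNy, hf''⟩ := (Γ₂.ext x A).exists_name hf' N
    obtain ⟨g₂, hg₂⟩ := ih₂ hf'' (by grind) (hext B (hext A hv₂ hx) hy)
      (Scope.sub_opn_push (by grind) hy (Scope.sub_opn_push hΔ hx hs₂ A) B)
    have := TmDen.letIn hv hg₁ hg₂
    have hxy : x ≠ y := hfy 0
    rw [Expr.letIn, Expr.close_close hxy, Expr.close_opn hfy hNy, Expr.close_opn hfx hNx] at this
    exact Interpretable.perm hp ⟨_, this⟩
  | unit h => exact fun _ _ hΓ _ => ⟨_, .unit hΓ⟩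
  | inl _ ih =>
    intro f Γ hf hΞ hΓ hs
    obtain ⟨g, hg⟩ := ih hf hΞ hΓ hs
    exact ⟨_, .inl hg⟩
  | inr _ ih =>
    intro f Γ hf hΞ hΓ hs
    obtain ⟨g, hg⟩ := ih hf hΞ hΓ hs
    exact ⟨_, .inr hg⟩
  | @caseT n Ξ Δ Γ' M N P A B C _ _ _ k h₁ h₂ h₃ ih₁ ih₂ ih₃ =>
    intro f Γ hf hΞ hΓ hs
    obtain ⟨Γ₁, Γ₂, hv, hp, hs₁, hs₂⟩ := Ctx.exists_split hΓ (A := Γ') (B := Δ) (by grind) hs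
    obtain ⟨g₁, hg₁⟩ := ih₁ hf (by grind) (Ctx.Valid.left hv) hs₁
    have hΔ : Δ.Bounded n := by grind
    have hv₂ := Ctx.Valid.right hv
    obtain ⟨x, hx, hfx, hNx, hf'⟩ := Γ₂.exists_name hf N
    obtain ⟨y, hy, hfy, hPy, hf''⟩ := Γ₂.exists_name hf P
    obtain ⟨g₂, hg₂⟩ := ih₂ hf' (by grind) (hext A hv₂ hx) (Scope.sub_opn_push hΔ hx hs₂ A)
    obtain ⟨g₃, hg₃⟩ := ih₃ hf'' (by grind) (hext B hv₂ hy) (Scope.sub_opn_push hΔ hy hs₂ B)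
    have := TmDen.caseOf hv hg₁ hg₂ hg₃
    rw [Expr.caseOf, Expr.close_opn hfx hNx, Expr.close_opn hfy hPy] at this
    exact Interpretable.perm hp ⟨_, this⟩
  | @measure n Ξ Δ Γ' l φ M A p _ k h₁ ht h₂ ih₁ ih₂ =>
    intro f Γ hf hΞ hΓ hs
    obtain ⟨Γ₁, Γ₂, hv, hp, hs₁, hs₂⟩ := Ctx.exists_split hΓ (A := Γ') (B := Δ) (by grind) hs
    choose q hq using fun i => ih₁ i hf (by grind) (Ctx.Valid.left hv) hs₁
    choose g hg using fun i => ih₂ i hf (by grind) (Ctx.Valid.right hv) hs₂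
    obtain ⟨κ, hκ⟩ := EffDen.opn_eq (T := T) (by grind) (Ctx.Valid.left hv) hs₁
    obtain rfl : q = fun i => T.pull κ (p i) := funext fun i => hκ (hq i) (h₁ i)
    exact Interpretable.perm hp ⟨_, .measure hv hq (T.pull_isTest κ ht) hg⟩
  | zero h => exact fun _ _ hΓ _ => ⟨_, .zero hΓ⟩
  | ovee h₁ h₂ ho ih₁ ih₂ =>
    intro f Γ hf hΞ hΓ hs
    obtain ⟨q₁, hq₁⟩ := ih₁ hf hΞ hΓ hs
    obtain ⟨q₂, hq₂⟩ := ih₂ hf hΞ hΓ hs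
    obtain ⟨κ, hκ⟩ := EffDen.opn_eq (T := T) hΞ hΓ hs
    obtain rfl := hκ hq₁ h₁
    obtain rfl := hκ hq₂ h₂
    exact ⟨_, .ovee hq₁ hq₂ (T.pull_ovee κ ho)⟩
  | orth _ ih =>
    intro f Γ hf hΞ hΓ hs
    obtain ⟨q, hq⟩ := ih hf hΞ hΓ hs
    exact ⟨_, .orth hq⟩
  | mul _ _ ih₁ ih₂ =>
    intro f Γ hf hΞ hΓ hs
    obtain ⟨q₁, hq₁⟩ := ih₁ (Γ := .nil) hf (by grind) List.nodup_nil (by simp [Ctx.toScope]; grind)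
    obtain ⟨q₂, hq₂⟩ := ih₂ hf hΞ hΓ hs
    exact ⟨_, .mul hq₁ hq₂⟩
  | @caseE n Ξ Γ' Δ M φ ψ A B _ _ _ k h₁ h₂ h₃ ih₁ ih₂ ih₃ =>
    intro f Γ hf hΞ hΓ hs
    obtain ⟨Γ₁, Γ₂, hv, hp, hs₁, hs₂⟩ := Ctx.exists_split hΓ k hs
    obtain ⟨g₁, hg₁⟩ := ih₁ hf (by grind) (Ctx.Valid.right hv) hs₂
    have hΔ : Γ'.Bounded n := by grind
    have hv₁ := Ctx.Valid.left hv
    obtain ⟨x, hx, hfx, hφx, hf'⟩ := Γ₁.exists_name hf φ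
    obtain ⟨y, hy, hfy, hψy, hf''⟩ := Γ₁.exists_name hf ψ
    obtain ⟨p, hp'⟩ := ih₂ hf' (by grind) (hext A hv₁ hx) (Scope.sub_opn_push hΔ hx hs₁ A)
    obtain ⟨q, hq⟩ := ih₃ hf'' (by grind) (hext B hv₁ hy) (Scope.sub_opn_push hΔ hy hs₁ B)
    have := EffDen.caseEff hv hp' hq hg₁ (T.pull_inl_copair p q) (T.pull_inr_copair p q)
    rw [Expr.caseEff, Expr.close_opn hfx hφx, Expr.close_opn hfy hψy] at this
    exact Interpretable.perm hp ⟨_, this⟩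

theorem Triangle.Den.tmInterp {Γ : Ctx} (hΓ : Γ.Valid) {M : Tm} {A : Ty}
    {f : Scope.obj V Γ.toScope ⟶ A.obj V} (h : T.Den 0 Γ.toScope M (.tm A f)) :
    T.TmInterp Γ M A ((Ctx.objIso V Γ).hom ≫ f) := by
  have hu : ∀ g, T.TmDen Γ M A g → g = (Ctx.objIso V Γ).hom ≫ f := fun g hg => by
    obtain ⟨-, f', hf', rfl⟩ := CtxDen.tm.1 hg.ctxDen
    rw [hf'.unique_tm hΓ.toScope h]
  obtain ⟨g, hg⟩ : T.Interpretable Γ (M.opn (fun _ => 0) 0) (Sem.tm A f) :=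
    h.interpretable ⟨1, fun _ => Nat.zero_lt_one⟩ hΓ.toScope.2.2 hΓ (Ctx.sub_map_opn hΓ)
  rw [h.opn_self] at hg
  exact fun g' => ⟨hu g', fun e => e ▸ hu g hg ▸ hg⟩

theorem Triangle.Den.effInterp {Γ : Ctx} (hΓ : Γ.Valid) {φ : Eff}
    {p : T.Pred (Scope.obj V Γ.toScope)} (h : T.Den 0 Γ.toScope φ (.eff p)) :
    T.EffInterp Γ φ (T.pull (Ctx.objIso V Γ).hom p) := by
  have hu : ∀ q, T.EffDen Γ φ q → q = T.pull (Ctx.objIso V Γ).hom p := fun q hq => by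
    obtain ⟨-, p', hp', rfl⟩ := CtxDen.eff.1 hq.ctxDen
    rw [hp'.unique_eff hΓ.toScope h]
  obtain ⟨q, hq⟩ : T.Interpretable Γ (φ.opn (fun _ => 0) 0) (Sem.eff p) :=
    h.interpretable ⟨1, fun _ => Nat.zero_lt_one⟩ hΓ.toScope.2.2 hΓ (Ctx.sub_map_opn hΓ)
  rw [h.opn_self] at hq
  exact fun q' => ⟨hu q', fun e => e ▸ hu q hq ▸ hq⟩

end Existence

end QPEL

theorem mainTheorem1 {V : Type u} [Category.{v} V] [MonoidalCategory V] [SymmetricCategory V]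
    [HasBinaryCoproducts V] [IsMonoidalDistrib V] {E : Type w} [QPEL.CommEffectMonoid E]
    (T : QPEL.Triangle V E) (Γ : QPEL.Ctx) :
    (∀ (M : QPEL.Tm) (A : QPEL.Ty), QPEL.Derives Γ (.tm M A) → ∃ f, T.TmInterp Γ M A f) ∧
    (∀ φ : QPEL.Eff, QPEL.Derives Γ (.eff φ) → ∃ p, T.EffInterp Γ φ p) ∧
    (∀ (M N : QPEL.Tm) (A : QPEL.Ty), QPEL.Derives Γ (.eq M N A) →
      ∃ f g, T.TmInterp Γ M A f ∧ T.TmInterp Γ N A g ∧ f = g) ∧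
    (∀ φ ψ : QPEL.Eff, QPEL.Derives Γ (.le φ ψ) →
      ∃ p q, T.EffInterp Γ φ p ∧ T.EffInterp Γ ψ q ∧ p ≤ q) := by
  refine ⟨fun M A h => ?_, fun φ h => ?_, fun M N A h => ?_, fun φ ψ h => ?_⟩
  · obtain ⟨hΓ, f, hf⟩ := h.sound T
    exact ⟨_, hf.tmInterp hΓ⟩
  · obtain ⟨hΓ, p, hp⟩ := h.sound T
    exact ⟨_, hp.effInterp hΓ⟩
  · obtain ⟨hΓ, f, hf, hg⟩ := h.sound T
    exact ⟨_, _, hf.tmInterp hΓ, hg.tmInterp hΓ, rfl⟩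
  · obtain ⟨hΓ, p, q, hp, hq, hpq⟩ := h.sound T
    exact ⟨_, _, hp.effInterp hΓ, hq.effInterp hΓ, T.pull_le _ hpq⟩
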